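/- **Setting.** Let $Z$ be a smooth $4k$-dimensional spin$^c$ manifold ($k\ge 0$) with Riemannian metric, let $\xi$ be the Hermitian line bundle associated to its spin$^c$ structure, $\xi_{\mathbb R}$ the underlying real plane bundle and $\xi_{\mathbb C}=\xi_{\mathbb R}\otimes\mathbb C$, and let $V$ be a Euclidean spin vector bundle on $Z$ of rank $16l$ ($l\ge 0$), with complex spinor bundle $\Delta(V)$ (of rank $2^{8l}$) and $V_{\mathbb C}=V\otimes\mathbb C$. Fix metric connections on $TZ$ (for instance the Levi-Civita connection), $\xi$ (unitary) and $V$. All characteristic forms are the Chern–Weil forms of these connections: for curvature $R$, $$\mathrm{ch}=\mathrm{tr}\exp\Big(\tfrac{\sqrt{-1}}{2\pi}R\Big),\qquad \widehat A(TZ)=\det{}^{1/2}\!\left(\frac{\frac{\sqrt{-1}}{4\pi}R}{\sinh\frac{\sqrt{-1}}{4\pi}R}\right),\qquad p_1=-\tfrac1{8\pi^2}\mathrm{tr}\,R^2,\qquad c=c_1(\xi)=\tfrac{\sqrt{-1}}{2\pi}R^{\xi}.$$ For a complex vector bundle $E$ put $\wedge_t(E)=\sum_i t^i\wedge^iE$,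 $S_t(E)=\sum_i t^iS^iE$, and $\widetilde E=E-\mathbb C^{\mathrm{rk}E}$, where $S_t$ and $\wedge_t$ are extended to virtual bundles by $S_t(E-F)=S_t(E)\otimes\wedge_{-t}(F)$ and $\wedge_t(E-F)=\wedge_t(E)\otimes S_{-t}(F)$. With $q=e^{2\pi\sqrt{-1}\tau}$, $\tau$ in the upper half plane $\mathbf H$, $q^{1/2}=e^{\pi\sqrt{-1}\tau}$, let $$\Theta(T_{\mathbb C}Z,\xi_{\mathbb C})=\bigotimes_{n\ge1}S_{q^n}(\widetilde{T_{\mathbb C}Z})\otimes\bigotimes_{m\ge1}\wedge_{q^m}(\widetilde{\xi_{\mathbb C}})\otimes\bigotimes_{r\ge1}\wedge_{q^{r-1/2}}(\widetilde{\xi_{\mathbb C}})\otimes\bigotimes_{s\ge1}\wedge_{-q^{s-1/2}}(\widetilde{\xi_{\mathbb C}})$$ and let $Q(Z,\xi,V,\tau)$ be the component of degree $4k$ $$\Big\{\widehat A(TZ)\,e^{c/2}\,\mathrm{ch}(\Theta(T_{\mathbb C}Z,\xi_{\mathbb C}))\prod_{n\ge1}(1-q^n)^{8l}\Big[q^l\,\mathrm{ch}\Big(\Delta(V)\otimes\bigotimes_{m\ge1}\wedge_{q^m}(V_{\mathbb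 C})\Big)+\mathrm{ch}\Big(\bigotimes_{r\ge1}\wedge_{-q^{r-1/2}}(V_{\mathbb C})\Big)+\mathrm{ch}\Big(\bigotimes_{s\ge1}\wedge_{q^{s-1/2}}(V_{\mathbb C})\Big)\Big]\Big\}^{(4k)},$$ a power series in $q^{1/2}$ whose coefficients are $4k$-forms. **Lemma 2.2.** The series $Q(Z,\xi,V,\tau)$ converges at every point of $Z$ for every $\tau\in\mathbf H$. Suppose that $-p_1(Z)+3p_1(\xi_{\mathbb R})+p_1(V)=0$. Then $Q(Z,\xi,V,\tau)$ is a modular form over $SL_2(\mathbb Z)$ of weight $4l+2k$ (with trivial character, and holomorphic at the cusp). Precisely: 1. if $-p_1(Z)+3p_1(\xi_{\mathbb R})+p_1(V)=0$ as a differential form, then for all $x\in Z$ and $v_1,\dots,v_{4k}\in T_xZ$ the function $\tau\mapsto Q(Z,\xi,V,\tau)_x(v_1,\dots,v_{4k})$ is such a modular form; 2. if $-p_1(Z)+3p_1(\xi_{\mathbb R})+p_1(V)=0$ in de Rham cohomology, i.e. this form is exact, then the de Rham class of $Q(Z,\xi,V,\tau)$ is such a modular form, i.e. there are finitely many modular forms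 $f_i$ over $SL_2(\mathbb Z)$ of weight $4l+2k$ and smooth complex $4k$-forms $\eta_i$ on $Z$ such that $Q(Z,\xi,V,\tau)-\sum_i f_i(\tau)\,\eta_i$ is exact for every $\tau\in\mathbf H$. -/

import Mathlib

open scoped Manifold ContDiff Bundle MatrixGroups

namespace CharForm

noncomputable section

/-! ## Complex differential forms at a point and on a manifold -/

/-- The model space `ℝⁿ` of the manifold; every tangent space is (by Mathlib's definition of
`TangentSpace`) a copy of it. -/
abbrev Euc (n : ℕ) : Type := EuclideanSpace ℝ (Fin n)

/-- Complex valued covectors on `ℝⁿ`, i.e. `T*⊗ℂ`. -/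
abbrev CCovec (n : ℕ) : Type := Euc n →ₗ[ℝ] ℂ

/-- The algebra `Λ^{even}(T*⊗ℂ)` of complex valued forms of even degree at a point. -/
def EvenForms (n : ℕ) : Type :=
  CliffordAlgebra.even (0 : QuadraticForm ℂ (CCovec n))

instance (n : ℕ) : Ring (EvenForms n) :=
  inferInstanceAs (Ring (CliffordAlgebra.even (0 : QuadraticForm ℂ (CCovec n))))

instance (n : ℕ) : Algebra ℂ (EvenForms n) :=
  inferInstanceAs (Algebra ℂ (CliffordAlgebra.even (0 : QuadraticForm ℂ (CCovec n))))

/-- Forgetting that a form has even degree. -/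
def EvenForms.val {n : ℕ} : EvenForms n →ₐ[ℂ] ExteriorAlgebra ℂ (CCovec n) :=
  (CliffordAlgebra.even (0 : QuadraticForm ℂ (CCovec n))).val

/-- The exterior product of two covectors. -/
def wedge₂ {n : ℕ} (α β : CCovec n) : EvenForms n :=
  (CliffordAlgebra.even.ι (0 : QuadraticForm ℂ (CCovec n))).bilin α β

lemma ext_ι_swap {n : ℕ} (α β : CCovec n) :
    ExteriorAlgebra.ι ℂ α * ExteriorAlgebra.ι ℂ β =
      -(ExteriorAlgebra.ι ℂ β * ExteriorAlgebra.ι ℂ α) :=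
  eq_neg_of_add_eq_zero_left (ExteriorAlgebra.ι_add_mul_swap α β)

lemma ext_pair_comm {n : ℕ} (α β : CCovec n) (y : ExteriorAlgebra ℂ (CCovec n)) :
    (ExteriorAlgebra.ι ℂ α * ExteriorAlgebra.ι ℂ β) * y =
      y * (ExteriorAlgebra.ι ℂ α * ExteriorAlgebra.ι ℂ β) := by
  induction y using ExteriorAlgebra.induction with
  | algebraMap r => exact (Algebra.commutes r _).symm
  | ι γ =>
    calc ExteriorAlgebra.ι ℂ α * ExteriorAlgebra.ι ℂ β * ExteriorAlgebra.ι ℂ γ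
        = ExteriorAlgebra.ι ℂ α * (ExteriorAlgebra.ι ℂ β * ExteriorAlgebra.ι ℂ γ) := mul_assoc _ _ _
      _ = -((ExteriorAlgebra.ι ℂ α * ExteriorAlgebra.ι ℂ γ) * ExteriorAlgebra.ι ℂ β) := by
          rw [ext_ι_swap β γ, mul_neg, mul_assoc]
      _ = ExteriorAlgebra.ι ℂ γ * (ExteriorAlgebra.ι ℂ α * ExteriorAlgebra.ι ℂ β) := by
          rw [ext_ι_swap α γ, neg_mul, neg_neg, mul_assoc]
  | mul a b ha hb => rw [← mul_assoc, ha, mul_assoc, hb, mul_assoc]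
  | add a b ha hb => rw [mul_add, add_mul, ha, hb]

lemma even_mul_comm {n : ℕ} (x : ExteriorAlgebra ℂ (CCovec n))
    (hx : x ∈ CliffordAlgebra.evenOdd (0 : QuadraticForm ℂ (CCovec n)) 0)
    (y : ExteriorAlgebra ℂ (CCovec n)) : x * y = y * x := by
  induction x, hx using CliffordAlgebra.even_induction with
  | algebraMap r => exact Algebra.commutes r _
  | add a b ha hb iha ihb => rw [add_mul, mul_add, iha, ihb]
  | ι_mul_ι_mul α β a ha iha =>
    have h := ext_pair_comm α β y
    change (ExteriorAlgebra.ι ℂ α * ExteriorAlgebra.ι ℂ β * a) * y =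
      y * (ExteriorAlgebra.ι ℂ α * ExteriorAlgebra.ι ℂ β * a)
    rw [mul_assoc, iha, ← mul_assoc, h, mul_assoc]

/-- Forms of even degree commute. -/
instance (n : ℕ) : CommRing (EvenForms n) :=
  { (inferInstance : Ring (EvenForms n)) with
    mul_comm := fun a b => Subtype.ext (even_mul_comm a.1 a.2 b.1) }

/-- The value `a^{(p)}(v₁, …, v_p)` of the degree `p` component of a form `a` on tangent vectors;
`(α₁ ∧ ⋯ ∧ α_p)(v₁, …, v_p) = det (αᵢ(vⱼ))`. -/
def evalForm {n : ℕ} (p : ℕ) (v : Fin p → Euc n) (a : EvenForms n) : ℂ :=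
  ExteriorAlgebra.liftAlternating (R := ℂ) (M := CCovec n) (N := ℂ)
    (Pi.single p ((Matrix.detRowAlternating (n := Fin p) (R := ℂ)).compLinearMap
      (LinearMap.pi fun j => (LinearMap.applyₗ' ℂ (v j) : CCovec n →ₗ[ℂ] ℂ))))
    a.val

/-- The coordinate covector `dx^i`. -/
def dx {n : ℕ} (i : Fin n) : CCovec n where
  toFun v := (v i : ℂ)
  map_add' v w := by simp
  map_smul' r v := by simp

/-- The two-form `∑_{i<j} β(∂ᵢ, ∂ⱼ) dx^i ∧ dx^j` with the given values on basis vectors. -/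
def twoForm {n : ℕ} (β : Euc n → Euc n → ℂ) : EvenForms n :=
  ∑ i : Fin n, ∑ j : Fin n, if i < j then
    β (EuclideanSpace.single i 1) (EuclideanSpace.single j 1) • wedge₂ (dx i) (dx j) else 0

section Manifold

variable {n : ℕ} {Z : Type*} [TopologicalSpace Z] [ChartedSpace (Euc n) Z]

/-- The expression of a complex valued `p`-form in the chart around `x₀`. -/
def inChart {p : ℕ} (η : ∀ x : Z, TangentSpace (𝓡 n) x [⋀^Fin p]→L[ℝ] ℂ) (x₀ : Z) (y : Euc n) :
    Euc n [⋀^Fin p]→L[ℝ] ℂ :=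
  (η ((extChartAt (𝓡 n) x₀).symm y)).compContinuousLinearMap
    (mfderiv 𝓘(ℝ, Euc n) (𝓡 n) (extChartAt (𝓡 n) x₀).symm y)

/-- Smoothness of a complex valued `p`-form: it is smooth in every chart. -/
def IsSmoothForm {p : ℕ} (η : ∀ x : Z, TangentSpace (𝓡 n) x [⋀^Fin p]→L[ℝ] ℂ) : Prop :=
  ∀ x₀ : Z, ContDiffOn ℝ ∞ (inChart η x₀) (extChartAt (𝓡 n) x₀).target

/-- The exterior derivative of a form on a manifold, computed at `x` in the chart around `x`. -/
def extD {p : ℕ} (η : ∀ x : Z, TangentSpace (𝓡 n) x [⋀^Fin p]→L[ℝ] ℂ) (x : Z) :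
    TangentSpace (𝓡 n) x [⋀^Fin (p + 1)]→L[ℝ] ℂ :=
  (extDeriv (inChart η x) (extChartAt (𝓡 n) x x)).compContinuousLinearMap
    (mfderiv (𝓡 n) 𝓘(ℝ, Euc n) (extChartAt (𝓡 n) x) x)

/-- A field `β` of functions of `p` tangent vectors is an exact `p`-form, i.e. zero if `p = 0`, and
the exterior derivative of a smooth `(p-1)`-form otherwise. -/
def IsExact : (p : ℕ) → (∀ x : Z, (Fin p → TangentSpace (𝓡 n) x) → ℂ) → Prop
  | 0, β => ∀ x v, β x v = 0
  | p + 1, β => ∃ η : ∀ x : Z, TangentSpace (𝓡 n) x [⋀^Fin p]→L[ℝ] ℂ,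
      IsSmoothForm η ∧ ∀ x v, β x v = extD η x v

end Manifold

/-! ## Chern–Weil theory at a point

`A` is the algebra of even forms at a point. The curvature of a rank `r` bundle with connection, in a
frame at that point, is an `r × r` matrix `Ω` of two-forms, and `F = (√-1 / 2π) Ω`. -/

section ChernWeil

/-- The exponential of a nilpotent element. -/
def nilExp {R : Type*} [Ring R] [Module ℂ R] (a : R) : R :=
  ∑ j ∈ Finset.range (nilpotencyClass a), ((j.factorial : ℂ)⁻¹) • a ^ j

/-- `sinh(a)/a = ∑ a^{2j}/(2j+1)!` for a nilpotent element. -/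
def nilSinhc {R : Type*} [Ring R] [Module ℂ R] (a : R) : R :=
  ∑ j ∈ Finset.range (nilpotencyClass a), (((2 * j + 1).factorial : ℂ)⁻¹) • a ^ (2 * j)

/-- The power `a^r = ∑ⱼ binom(r, j) (a - 1)^j` of a unipotent element, for a rational exponent. -/
def unipPow {R : Type*} [Ring R] [Module ℂ R] (r : ℚ) (a : R) : R :=
  ∑ j ∈ Finset.range (nilpotencyClass (a - 1)), ((Ring.choose r j : ℚ) : ℂ) • (a - 1) ^ j

variable {A : Type*} [CommRing A] [Algebra ℂ A]

/-- The first Pontryagin form `p₁(E, ∇) = -(1/8π²) tr Ω² = ½ tr F²` of a real bundle. -/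
def pontryagin {r : ℕ} (F : Matrix (Fin r) (Fin r) A) : A :=
  (1 / 2 : ℂ) • (F * F).trace

/-- The form `Â(E, ∇) = det^{1/2} ((√-1/4π) Ω / sinh ((√-1/4π) Ω))`. -/
def aHat {r : ℕ} (F : Matrix (Fin r) (Fin r) A) : A :=
  unipPow (-1 / 2) (nilSinhc ((1 / 2 : ℂ) • F)).det

/-- The Chern character form of the exterior power `⋀ᵏ E`, where `g = exp F`: the trace of the
operator which `g` induces on `⋀ᵏ`. -/
def chExt {r : ℕ} (g : Matrix (Fin r) (Fin r) A) (k : ℕ) : A :=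
  LinearMap.trace A _ (exteriorPower.map k (Matrix.toLin' g))

/-- The Chern character form of the symmetric power `Sᵏ E`, where `g = exp F`: the trace of the
operator which `g` induces on `Sᵏ`, i.e. of the substitution `Xⱼ ↦ ∑ᵢ gᵢⱼ Xᵢ` on homogeneous
polynomials of degree `k`, computed in the basis of monomials. -/
def chSym {r : ℕ} (g : Matrix (Fin r) (Fin r) A) (k : ℕ) : A :=
  ∑ α ∈ Finset.finsuppAntidiag (Finset.univ : Finset (Fin r)) k,
    MvPolynomial.coeff α
      (∏ j : Fin r, (∑ i : Fin r, MvPolynomial.C (g i j) * MvPolynomial.X i) ^ α j)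

/-- The series `∑ₖ aₖ tᵏ` with `t = ε z^d` (`d ≥ 1`); here and below `z = q^{1/2}`. -/
def atPow (ε : ℤ) (d : ℕ) (a : ℕ → A) : PowerSeries A :=
  PowerSeries.mk fun m => if d ∣ m then (ε : A) ^ (m / d) * a (m / d) else 0

/-- `ch(⋀_t E) = ∑ tᵏ ch(⋀ᵏ E)` with `t = ε z^d`. -/
def chLam {r : ℕ} (ε : ℤ) (d : ℕ) (g : Matrix (Fin r) (Fin r) A) : PowerSeries A :=
  atPow ε d (chExt g)

/-- `ch(S_t E) = ∑ tᵏ ch(Sᵏ E)` with `t = ε z^d`. -/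
def chS {r : ℕ} (ε : ℤ) (d : ℕ) (g : Matrix (Fin r) (Fin r) A) : PowerSeries A :=
  atPow ε d (chSym g)

/-- `ch(S_t(E - ℂʳ)) = ch(S_t E) ch(⋀_{-t} ℂʳ)` with `r = rk E` and `t = ε z^d`. -/
def chSRed {r : ℕ} (ε : ℤ) (d : ℕ) (g : Matrix (Fin r) (Fin r) A) : PowerSeries A :=
  chS ε d g * chLam (-ε) d (1 : Matrix (Fin r) (Fin r) A)

/-- `ch(⋀_t(E - ℂʳ)) = ch(⋀_t E) ch(S_{-t} ℂʳ)` with `r = rk E` and `t = ε z^d`. -/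
def chLamRed {r : ℕ} (ε : ℤ) (d : ℕ) (g : Matrix (Fin r) (Fin r) A) : PowerSeries A :=
  chLam ε d g * chS (-ε) d (1 : Matrix (Fin r) (Fin r) A)

/-- The infinite product `∏_{n ≥ 0} P n` of power series with `P n ≡ 1 mod z^{n+1}`: the coefficient
of `zʲ` is that of any partial product with more than `j` factors. -/
def infProd (P : ℕ → PowerSeries A) : PowerSeries A :=
  PowerSeries.mk fun j => PowerSeries.coeff j (∏ n ∈ Finset.range (j + 1), P n)

/-- `ch(Θ(T_ℂZ, ξ_ℂ))`, where `Θ(T_ℂZ, ξ_ℂ)` is the tensor product of the `S_{qⁿ}(T_ℂZ - ℂ^{dim Z})`,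
`⋀_{q^m}(ξ_ℂ - ℂ²)`, `⋀_{q^{r-1/2}}(ξ_ℂ - ℂ²)` and `⋀_{-q^{s-1/2}}(ξ_ℂ - ℂ²)` over all
`n, m, r, s ≥ 1`; `gT` and `gξ` are the exponentials of the `F`s of `TZ` and `ξ_ℝ`. -/
def chTheta {d : ℕ} (gT : Matrix (Fin d) (Fin d) A) (gξ : Matrix (Fin 2) (Fin 2) A) :
    PowerSeries A :=
  infProd (fun n => chSRed 1 (2 * (n + 1)) gT) *
  infProd (fun m => chLamRed 1 (2 * (m + 1)) gξ) *
  infProd (fun r => chLamRed 1 (2 * r + 1) gξ) *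
  infProd (fun s => chLamRed (-1) (2 * s + 1) gξ)

/-- `(∏_{n ≥ 1} (1 - qⁿ))^e`. -/
def eulerPow (e : ℕ) : PowerSeries A :=
  infProd (fun n => 1 - PowerSeries.X ^ (2 * (n + 1))) ^ e

/-- The action of the basis vectors of `ℝ^{2m}` on the `2^m`-dimensional complex spinor module: the
vectors `e_{2j}` (`b = false`) and `e_{2j+1}` (`b = true`), `j < m`, act by
`Z ⊗ ⋯ ⊗ Z ⊗ X ⊗ 1 ⊗ ⋯ ⊗ 1` and `Z ⊗ ⋯ ⊗ Z ⊗ Y ⊗ 1 ⊗ ⋯ ⊗ 1`, with `X, Y, Z` the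
Pauli matrices and `X`, `Y` in position `j`. -/
def gamma (m : ℕ) (j : Fin m) (b : Bool) : Matrix (Fin m → Bool) (Fin m → Bool) ℂ :=
  Matrix.of fun s t =>
    if t = Function.update s j (!s j) then
      (∏ i ∈ Finset.univ.filter (· < j), if s i then (-1 : ℂ) else 1) *
        (if b then (if s j then Complex.I else -Complex.I) else 1)
    else 0

/-- The Clifford action of the `a`-th vector of the standard basis of `ℝ^{16l}`. -/
def clif (l : ℕ) (a : Fin (16 * l)) : Matrix (Fin (8 * l) → Bool) (Fin (8 * l) → Bool) ℂ :=
  gamma (8 * l) ⟨a.1 / 2, by omega⟩ (a.1 % 2 == 1)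

/-- The Chern character form `tr exp((√-1/2π) Ω^Δ)` of the spinor bundle `Δ(V)` with the connection
induced by that of `V`, whose curvature is `Ω^Δ = ¼ ∑ Ω_{ab} c(e_a) c(e_b)` (for `c(e_a)² = 1`). -/
def chSpinor {l : ℕ} (F : Matrix (Fin (16 * l)) (Fin (16 * l)) A) : A :=
  (nilExp (∑ a, ∑ b, ((1 / 4 : ℂ) • F a b) •
    (clif l a * clif l b).map (algebraMap ℂ A))).trace

/-- `q^l ch(Δ(V) ⊗ ⨂ ⋀_{q^m}(V_ℂ)) + ch(⨂ ⋀_{-q^{r-1/2}}(V_ℂ)) + ch(⨂ ⋀_{q^{s-1/2}}(V_ℂ))`. -/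
def chTwist {l : ℕ} (F : Matrix (Fin (16 * l)) (Fin (16 * l)) A) : PowerSeries A :=
  PowerSeries.X ^ (2 * l) * (PowerSeries.C (chSpinor F) *
    infProd (fun m => chLam 1 (2 * (m + 1)) (nilExp F))) +
  infProd (fun r => chLam (-1) (2 * r + 1) (nilExp F)) +
  infProd (fun s => chLam 1 (2 * s + 1) (nilExp F))

/-- The form `Â(TZ) exp(c/2) ch(Θ(T_ℂZ, ξ_ℂ)) (∏(1 - qⁿ))^{8l} [⋯]` as a series in `z = q^{1/2}`. -/
def qSeries {d l : ℕ} (FT : Matrix (Fin d) (Fin d) A) (Fξ : Matrix (Fin 2) (Fin 2) A) (c : A)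
    (FV : Matrix (Fin (16 * l)) (Fin (16 * l)) A) : PowerSeries A :=
  PowerSeries.C (aHat FT * nilExp ((1 / 2 : ℂ) • c)) *
    chTheta (nilExp FT) (nilExp Fξ) * eulerPow (8 * l) * chTwist FV

end ChernWeil

/-! ## Bundles, connections, spin structures -/

section Bundles

variable {n : ℕ} {Z : Type*} [TopologicalSpace Z] [ChartedSpace (Euc n) Z]

/-- A smooth Riemannian metric is in particular of class `C¹`. -/
instance [IsManifold (𝓡 n) ∞ Z] [Bundle.RiemannianBundle (fun x : Z => TangentSpace (𝓡 n) x)]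
    [h : IsContMDiffRiemannianBundle (𝓡 n) ∞ (Euc n) (fun x : Z => TangentSpace (𝓡 n) x)] :
    IsContMDiffRiemannianBundle (𝓡 n) 1 (Euc n) (fun x : Z => TangentSpace (𝓡 n) x) :=
  IsContMDiffRiemannianBundle.of_le (n := ∞) (by norm_cast)

/-- The curvature `R(u, w)σ = ∇_u ∇_W σ - ∇_w ∇_U σ - ∇_{[U, W]} σ` of a connection at `x`, where the
vectors `u, w` and `s` at `x` are extended to `U`, `W`, `σ`. -/
def curvature {F : Type*} [NormedAddCommGroup F] [NormedSpace ℝ F]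
    {V : Z → Type*} [TopologicalSpace (Bundle.TotalSpace F V)]
    [∀ x, AddCommGroup (V x)] [∀ x, Module ℝ (V x)] [∀ x, TopologicalSpace (V x)]
    [∀ x, IsTopologicalAddGroup (V x)] [∀ x, ContinuousSMul ℝ (V x)] [FiberBundle F V]
    [IsManifold (𝓡 n) ∞ Z]
    (cov : CovariantDerivative (𝓡 n) F V) (x : Z) (u w : TangentSpace (𝓡 n) x) (s : V x) : V x :=
  let U : ∀ y : Z, TangentSpace (𝓡 n) y := FiberBundle.extend (Euc n) u
  let W : ∀ y : Z, TangentSpace (𝓡 n) y := FiberBundle.extend (Euc n) w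
  let σ : ∀ y : Z, V y := FiberBundle.extend F s
  cov (fun y => cov σ y (W y)) x u - cov (fun y => cov σ y (U y)) x w -
    cov σ x (VectorField.mlieBracket (𝓡 n) U W x)

/-- The matrix `F = (√-1/2π) Ω` of two-forms at `x`, where `Ω_{ab}(u, w) = ⟨e_a, R(u, w) e_b⟩` is the
curvature in the orthonormal basis `e` of the fibre at `x`. -/
def curvMatrix {F : Type*} [NormedAddCommGroup F] [NormedSpace ℝ F]
    {V : Z → Type*} [TopologicalSpace (Bundle.TotalSpace F V)]
    [∀ x, NormedAddCommGroup (V x)] [∀ x, InnerProductSpace ℝ (V x)] [FiberBundle F V]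
    [IsManifold (𝓡 n) ∞ Z]
    (cov : CovariantDerivative (𝓡 n) F V) (x : Z) {r : ℕ} (e : Fin r → V x) :
    Matrix (Fin r) (Fin r) (EvenForms n) :=
  Matrix.of fun a b => (Complex.I / (2 * Real.pi)) •
    twoForm fun u w => ((inner ℝ (e a) (curvature cov x u w (e b)) : ℝ) : ℂ)

/-- The quadratic form `∑ vᵢ²` on `ℝʳ`. Then `spinGroup (stdQ r)` is `Spin(r)`. -/
def stdQ (r : ℕ) : QuadraticForm ℝ (Fin r → ℝ) :=
  QuadraticMap.weightedSumSquares ℝ fun _ : Fin r => (1 : ℝ)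

/-- The element `s` of `Spin(r)` lies over the matrix `g` of `SO(r)`: `s e_b s⁻¹ = ∑ₐ g_{ab} e_a`. -/
def LiesOver {r : ℕ} (s : spinGroup (stdQ r)) (g : Matrix (Fin r) (Fin r) ℝ) : Prop :=
  ∀ b : Fin r, (s : CliffordAlgebra (stdQ r)) * CliffordAlgebra.ι (stdQ r) (Pi.single b 1) *
    star (s : CliffordAlgebra (stdQ r)) = CliffordAlgebra.ι (stdQ r) (fun a => g a b)

/-- Continuity on `U` of a map to `Spin(r)` (which lies in the finite dimensional vector space
`CliffordAlgebra (stdQ r)`). -/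
def SpinContinuousOn {r : ℕ} (s : Z → spinGroup (stdQ r)) (U : Set Z) : Prop :=
  ∀ ℓ : Module.Dual ℝ (CliffordAlgebra (stdQ r)),
    ContinuousOn (fun x => ℓ (s x : CliffordAlgebra (stdQ r))) U

/-- `e` is a smooth orthonormal frame, over the set `U`, of the Euclidean bundle `V` of rank `r`. -/
structure IsOrthonormalFrameOn (F : Type*) [NormedAddCommGroup F] [NormedSpace ℝ F]
    {V : Z → Type*} [TopologicalSpace (Bundle.TotalSpace F V)]
    [∀ x, NormedAddCommGroup (V x)] [∀ x, InnerProductSpace ℝ (V x)] [FiberBundle F V]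
    {r : ℕ} (e : Fin r → ∀ x, V x) (U : Set Z) : Prop where
  smooth : ∀ a, ContMDiffOn (𝓡 n) ((𝓡 n).prod 𝓘(ℝ, F)) ∞
    (fun x => Bundle.TotalSpace.mk' F x (e a x)) U
  orthonormal : ∀ x ∈ U, Orthonormal ℝ (fun a => e a x)

/-- A spin structure on a Euclidean bundle `V` of rank `r`: smooth orthonormal frames `e i` over an
open cover, and lifts to `Spin(r)`, satisfying the cocycle condition, of the transition functions. -/
structure SpinStructure {n : ℕ} {Z : Type*} [TopologicalSpace Z] [ChartedSpace (Euc n) Z]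
    (r : ℕ) (V : Z → Type*)
    [TopologicalSpace (Bundle.TotalSpace (Euc r) V)]
    [∀ x, NormedAddCommGroup (V x)] [∀ x, InnerProductSpace ℝ (V x)] [FiberBundle (Euc r) V] where
  /-- the index set of the cover -/
  ι : Type*
  /-- the open sets of the cover -/
  U : ι → Set Z
  isOpen : ∀ i, IsOpen (U i)
  cover : ∀ x, ∃ i, x ∈ U i
  /-- the local frames -/
  e : ι → Fin r → ∀ x, V x
  frame : ∀ i, IsOrthonormalFrameOn (n := n) (Euc r) (e i) (U i)
  /-- the lifts of the transition functions -/
  lift : ι → ι → Z → spinGroup (stdQ r)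
  lift_continuous : ∀ i j, SpinContinuousOn (lift i j) (U i ∩ U j)
  lift_over : ∀ i j, ∀ x ∈ U i ∩ U j,
    LiesOver (lift i j x) (Matrix.of fun a b => inner ℝ (e i a x) (e j b x))
  cocycle : ∀ i j k, ∀ x ∈ U i ∩ U j ∩ U k, lift i j x * lift j k x = lift i k x

/-- The metric and the complex structure of the real plane bundle underlying a complex line bundle
make it a smooth Hermitian line bundle. -/
structure IsHermitianLine {n : ℕ} {Z : Type*} [TopologicalSpace Z] [ChartedSpace (Euc n) Z]
    (ξ : Z → Type*) [TopologicalSpace (Bundle.TotalSpace ℂ ξ)]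
    [∀ x, NormedAddCommGroup (ξ x)] [∀ x, InnerProductSpace ℝ (ξ x)] [∀ x, Module ℂ (ξ x)]
    [FiberBundle ℂ ξ] : Prop where
  inner_I : ∀ (x : Z) (v w : ξ x), inner ℝ (Complex.I • v) (Complex.I • w) = (inner ℝ v w : ℝ)
  smooth_I : ∀ (σ : ∀ x, ξ x) (U : Set Z), IsOpen U →
    ContMDiffOn (𝓡 n) ((𝓡 n).prod 𝓘(ℝ, ℂ)) ∞ (fun x => Bundle.TotalSpace.mk' ℂ x (σ x)) U →
    ContMDiffOn (𝓡 n) ((𝓡 n).prod 𝓘(ℝ, ℂ)) ∞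
      (fun x => Bundle.TotalSpace.mk' ℂ x (Complex.I • σ x)) U

/-- The connection on a complex line bundle is complex linear, `∇(√-1 σ) = √-1 ∇σ`. -/
def IsComplexConnection {ξ : Z → Type*} [TopologicalSpace (Bundle.TotalSpace ℂ ξ)]
    [∀ x, NormedAddCommGroup (ξ x)] [∀ x, InnerProductSpace ℝ (ξ x)] [∀ x, Module ℂ (ξ x)]
    [FiberBundle ℂ ξ] (cov : CovariantDerivative (𝓡 n) ℂ ξ) : Prop :=
  ∀ (σ : ∀ x, ξ x) (x : Z),
    MDifferentiableAt (𝓡 n) ((𝓡 n).prod 𝓘(ℝ, ℂ)) (fun y => Bundle.TotalSpace.mk' ℂ y (σ y)) x →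
    ∀ u : TangentSpace (𝓡 n) x,
      cov (fun y => Complex.I • σ y) x u = Complex.I • cov σ x u

/-- A spin^c structure on the Riemannian manifold `Z` with associated Hermitian line bundle `ξ`:
smooth orthonormal frames `e i` of `TZ` and unit sections `f i` of `ξ` over an open cover, and lifts
`[lift i j, phase i j]` to `Spin^c(n) = (Spin(n) × U(1)) / {±1}`, satisfying the cocycle condition in
that group, of the transition functions of `(TZ, ξ)`; here `[s, λ] ∈ Spin^c(n)` lies over
`(Ad s, λ²) ∈ SO(n) × U(1)`. -/
structure SpinCStructure {n : ℕ} (Z : Type*) [TopologicalSpace Z] [ChartedSpace (Euc n) Z]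
    [IsManifold (𝓡 n) ∞ Z]
    [Bundle.RiemannianBundle (fun x : Z => TangentSpace (𝓡 n) x)]
    (ξ : Z → Type*) [TopologicalSpace (Bundle.TotalSpace ℂ ξ)]
    [∀ x, NormedAddCommGroup (ξ x)] [∀ x, InnerProductSpace ℝ (ξ x)] [∀ x, Module ℂ (ξ x)]
    [FiberBundle ℂ ξ] where
  /-- the index set of the cover -/
  ι : Type*
  /-- the open sets of the cover -/
  U : ι → Set Z
  isOpen : ∀ i, IsOpen (U i)
  cover : ∀ x, ∃ i, x ∈ U i
  /-- the local frames of the tangent bundle -/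
  e : ι → Fin n → ∀ x : Z, TangentSpace (𝓡 n) x
  frame : ∀ i, IsOrthonormalFrameOn (n := n) (Euc n) (e i) (U i)
  /-- the local sections of the line bundle -/
  f : ι → ∀ x, ξ x
  f_smooth : ∀ i, ContMDiffOn (𝓡 n) ((𝓡 n).prod 𝓘(ℝ, ℂ)) ∞
    (fun x => Bundle.TotalSpace.mk' ℂ x (f i x)) (U i)
  f_norm : ∀ i, ∀ x ∈ U i, ‖f i x‖ = 1
  /-- the spin part of the lifts -/
  lift : ι → ι → Z → spinGroup (stdQ n)
  /-- the phase of the lifts -/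
  phase : ι → ι → Z → Circle
  lift_continuous : ∀ i j, SpinContinuousOn (lift i j) (U i ∩ U j)
  phase_continuous : ∀ i j, ContinuousOn (phase i j) (U i ∩ U j)
  lift_over : ∀ i j, ∀ x ∈ U i ∩ U j,
    LiesOver (lift i j x) (Matrix.of fun a b => inner ℝ (e i a x) (e j b x))
  phase_over : ∀ i j, ∀ x ∈ U i ∩ U j, f j x = ((phase i j x : ℂ) ^ 2) • f i x
  cocycle : ∀ i j k, ∀ x ∈ U i ∩ U j ∩ U k,
    ((lift i j x * lift j k x : spinGroup (stdQ n)) : CliffordAlgebra (stdQ n)) = lift i k x ∧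
        (phase i j x * phase j k x : ℂ) = phase i k x ∨
      ((lift i j x * lift j k x : spinGroup (stdQ n)) : CliffordAlgebra (stdQ n)) = -lift i k x ∧
        (phase i j x * phase j k x : ℂ) = -phase i k x

/-! ## The form `Q(Z, ξ, V, τ)` -/

variable [IsManifold (𝓡 n) ∞ Z]
  [Bundle.RiemannianBundle (fun x : Z => TangentSpace (𝓡 n) x)]
  {ξ : Z → Type*} [TopologicalSpace (Bundle.TotalSpace ℂ ξ)]
  [∀ x, NormedAddCommGroup (ξ x)] [∀ x, InnerProductSpace ℝ (ξ x)] [∀ x, Module ℂ (ξ x)]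
  [FiberBundle ℂ ξ]
  {l : ℕ} {V : Z → Type*} [TopologicalSpace (Bundle.TotalSpace (Euc (16 * l)) V)]
  [∀ x, NormedAddCommGroup (V x)] [∀ x, InnerProductSpace ℝ (V x)]
  [FiberBundle (Euc (16 * l)) V]
  (covT : CovariantDerivative (𝓡 n) (Euc n) (fun x : Z => TangentSpace (𝓡 n) x))
  (covξ : CovariantDerivative (𝓡 n) ℂ ξ)
  (covV : CovariantDerivative (𝓡 n) (Euc (16 * l)) V)
  (sc : SpinCStructure (n := n) Z ξ) (sp : SpinStructure (n := n) (16 * l) V)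

/-- `F = (√-1/2π) Ω` for the tangent bundle, in a local frame of the spin^c structure. -/
def tangentF (x : Z) : Matrix (Fin n) (Fin n) (EvenForms n) :=
  curvMatrix covT x fun a => sc.e (sc.cover x).choose a x

/-- `F = (√-1/2π) Ω` for the real plane bundle `ξ_ℝ`, in the frame `f, √-1 f`. -/
def planeF (x : Z) : Matrix (Fin 2) (Fin 2) (EvenForms n) :=
  curvMatrix covξ x ![sc.f (sc.cover x).choose x, Complex.I • sc.f (sc.cover x).choose x]

/-- The first Chern form `c = (√-1/2π) R^ξ` of the complex line bundle `ξ`, where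
`R^ξ = ⟨f, R f⟩ + √-1 ⟨√-1 f, R f⟩` is the complex valued curvature form. -/
def chernForm (x : Z) : EvenForms n :=
  planeF covξ sc x 0 0 + Complex.I • planeF covξ sc x 1 0

/-- `F = (√-1/2π) Ω` for `V`, in a local frame of the spin structure. -/
def spinF (x : Z) : Matrix (Fin (16 * l)) (Fin (16 * l)) (EvenForms n) :=
  curvMatrix covV x fun a => sp.e (sp.cover x).choose a x

/-- The form `-p₁(Z) + 3 p₁(ξ_ℝ) + p₁(V)` at `x`. -/
def anomaly (x : Z) : EvenForms n :=
  -pontryagin (tangentF covT sc x) + 3 * pontryagin (planeF covξ sc x) +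
    pontryagin (spinF covV sp x)

/-- The term of index `j` of the expansion of `Q(Z, ξ, V, τ)` in powers of `q^{1/2} = e^{πiτ}`,
evaluated on the tangent vectors `v₁, …, v_n` at `x` (`n = dim Z`). -/
def qTerm (τ : UpperHalfPlane) (x : Z) (v : Fin n → TangentSpace (𝓡 n) x) (j : ℕ) : ℂ :=
  evalForm n v (PowerSeries.coeff j
    (qSeries (tangentF covT sc x) (planeF covξ sc x) (chernForm covξ sc x) (spinF covV sp x))) *
    Complex.exp (Real.pi * Complex.I * τ) ^ j

/-- The form `Q(Z, ξ, V, τ)` of degree `n = dim Z`, as a function of `n` tangent vectors at `x`. -/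
def Q (τ : UpperHalfPlane) (x : Z) (v : Fin n → TangentSpace (𝓡 n) x) : ℂ :=
  ∑' j : ℕ, qTerm covT covξ covV sc sp τ x v j

end Bundles

end

end CharForm

/-!
Fix a point of `Z`. The even forms there are a commutative algebra in which forms of positive
degree are nilpotent, the curvature matrices have entries in it, and `Q` is a power series in
`x = q^{1/2}` with coefficients polynomial in these matrices. Over this algebra every
characteristic series in `Q` is an explicit scalar series times the exponential of a sum
`∑ tr F^{2j} · (power series in x)`. For exterior and symmetric powers this is Newton's identities
(`eulerD_chExt`, `eulerD_chSym`), for the `Â`-form it is `det_evNil`, and for the spinor bundle,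
whose curvature is determined by that of `V` through the Clifford relations, it is `chSpinor_eq`.
The series in the exponents are Eisenstein series of weight `2j`, for `TZ` at `τ`, and for `ξ` and
`V` at `τ`, `2τ`, `τ/2` and `(τ+1)/2`, in the combinations in which they occur as the Taylor
coefficients of logarithms of theta functions.

The factor `e^{c/2} = cosh(c/2) + sinh(c/2)` plays a double role: `cosh(c/2)` supplies exactly the
missing constant term of the exponent belonging to `ξ`, and the summand with `sinh(c/2)` lives in
degrees congruent to `2` modulo `4`, so it does not contribute to degree `4k`
(`evalForm_coeff_qSeries`). What remains is a sum of three exponentials (`qSeries_eq`), whose scalar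
prefactors are, up to constants, powers of `η(2τ)²/η(τ)`, `η(τ/2)²/η(τ)` and
`η((τ+1)/2)²/η(τ)`. The group `SL₂(ℤ)` permutes the three prefactors (`isTriple_thetaFac`) and
permutes the exponents in the same way (`isTriple_thetaMod`), up to the automorphy factor of weight
`2j` on the coefficient of `tr F^{2j}`. The only failure of modularity is that of `G₂`, and `G₂`
enters with the coefficient `-p₁(TZ) + 3p₁(ξ) + p₁(V)` times a constant. Where this form vanishes,
every coefficient of the resulting expansion in products of traces is modular of level one
(`isLevelOne_modCoef`, `IsLevelOne.exists_modularForm`), and counting form degrees gives the weight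
`4l + 2k` (`weight_eq`).

If the form is only exact, the same expansion holds up to terms that contain it as a factor. By the
Bianchi identity all the traces are closed (`dMat_curvForm`, `smoothClosed_trace`), so those terms
are exact (`isExact_mul`), and the remaining finite sum is the required combination of modular forms
and smooth forms.

Convergence holds because in each form degree only finitely many products of traces occur, and each
of them is multiplied by a power series that converges on the unit disc. For the infinite products
that define `Q`, this is a bound in weighted `ℓ¹`-norms (`isConv_wProd`).
-/

open scoped Topology

set_option linter.unusedSectionVars false
set_option synthInstance.maxHeartbeats 200000

namespace CharForm

/-! ### Exponentials of nilpotent elements and derivations -/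

section Nil

variable {R : Type*} [Ring R] [Algebra ℂ R]

/-- The value `∑_{j < N} f_j a^j` of a power series `f` at an element `a` with `a ^ N = 0`. -/
noncomputable def evNil (N : ℕ) (a : R) (f : PowerSeries ℂ) : R :=
  ∑ j ∈ Finset.range N, PowerSeries.coeff j f • a ^ j

lemma sum_range_of_pow_eq_zero (c : ℕ → ℂ) {a : R} {m N : ℕ} (hm : a ^ m = 0) (hN : a ^ N = 0) :
    ∑ j ∈ Finset.range m, c j • a ^ j = ∑ j ∈ Finset.range N, c j • a ^ j := by
  wlog h : m ≤ N generalizing m N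
  · exact (this hN hm (le_of_not_ge h)).symm
  refine Finset.sum_subset (Finset.range_subset_range.2 h) fun j _ hj => ?_
  rw [pow_eq_zero_of_le (by simpa using hj) hm, smul_zero]

lemma nilExp_eq_sum {a : R} {N : ℕ} (hN : a ^ N = 0) :
    nilExp a = ∑ j ∈ Finset.range N, ((j.factorial : ℂ)⁻¹) • a ^ j :=
  sum_range_of_pow_eq_zero _ (pow_nilpotencyClass ⟨N, hN⟩) hN

lemma nilExp_eq_evNil {a : R} {N : ℕ} (hN : a ^ N = 0) :
    nilExp a = evNil N a (PowerSeries.exp ℂ) := by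
  rw [nilExp_eq_sum hN, evNil]
  simp [PowerSeries.coeff_exp]

lemma evNil_eq_aeval (N : ℕ) (a : R) (f : PowerSeries ℂ) :
    evNil N a f = Polynomial.aeval a (PowerSeries.trunc N f) := by
  rw [evNil, Polynomial.aeval_def, PowerSeries.eval₂_trunc_eq_sum_range]
  simp [Algebra.smul_def]

/-- Truncating a polynomial beyond the order of nilpotency of `a` does not change its value at `a`.
-/
lemma aeval_trunc {a : R} {N : ℕ} (hN : a ^ N = 0) (p : Polynomial ℂ) :
    Polynomial.aeval a (PowerSeries.trunc N (p : PowerSeries ℂ)) = Polynomial.aeval a p := by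
  have h : Polynomial.X ^ N ∣ p - PowerSeries.trunc N (p : PowerSeries ℂ) := by
    rw [Polynomial.X_pow_dvd_iff]
    intro d hd
    rw [Polynomial.coeff_sub, PowerSeries.coeff_trunc, if_pos hd, Polynomial.coeff_coe, sub_self]
  obtain ⟨r, hr⟩ := h
  have := congrArg (Polynomial.aeval a) hr
  rw [map_sub, map_mul, map_pow, Polynomial.aeval_X, hN, zero_mul, sub_eq_zero] at this
  exact this.symm

lemma evNil_mul {a : R} {N : ℕ} (hN : a ^ N = 0) (f g : PowerSeries ℂ) :
    evNil N a (f * g) = evNil N a f * evNil N a g := by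
  simp only [evNil_eq_aeval]
  rw [← map_mul, ← aeval_trunc hN (_ * _), Polynomial.coe_mul, PowerSeries.trunc_trunc_mul_trunc]

lemma evNil_add (N : ℕ) (a : R) (f g : PowerSeries ℂ) :
    evNil N a (f + g) = evNil N a f + evNil N a g := by
  simp [evNil, add_smul, Finset.sum_add_distrib]

lemma evNil_one {a : R} {N : ℕ} (hN : a ^ N = 0) : evNil N a 1 = 1 := by
  rw [evNil_eq_aeval, ← Polynomial.coe_one, aeval_trunc hN, map_one]

lemma evNil_X {a : R} {N : ℕ} (hN : a ^ N = 0) : evNil N a PowerSeries.X = a := by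
  rw [evNil_eq_aeval, ← Polynomial.coe_X, aeval_trunc hN, Polynomial.aeval_X]

lemma evNil_congr {a : R} {N M : ℕ} (hN : a ^ N = 0) (hM : a ^ M = 0) (f : PowerSeries ℂ) :
    evNil N a f = evNil M a f := sum_range_of_pow_eq_zero _ hN hM

lemma map_evNil {S : Type*} [Ring S] [Algebra ℂ S] (φ : R →ₐ[ℂ] S) (N : ℕ) (a : R)
    (f : PowerSeries ℂ) : φ (evNil N a f) = evNil N (φ a) f := by
  simp [evNil, map_sum, map_smul]

lemma map_nilExp {S : Type*} [Ring S] [Algebra ℂ S] (φ : R →ₐ[ℂ] S) {a : R} (ha : IsNilpotent a) :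
    φ (nilExp a) = nilExp (φ a) := by
  obtain ⟨N, hN⟩ := ha
  rw [nilExp_eq_evNil hN, map_evNil, nilExp_eq_evNil (N := N)]
  rw [← map_pow, hN, map_zero]

lemma nilExp_add {a b : R} (h : Commute a b) (ha : IsNilpotent a) (hb : IsNilpotent b) :
    nilExp (a + b) = nilExp a * nilExp b := by
  let _ : Module ℚ R := Module.compHom R (algebraMap ℚ ℂ)
  have key : ∀ x : R, IsNilpotent x → nilExp x = IsNilpotent.exp x := by
    intro x hx
    rw [IsNilpotent.exp, nilExp]
    refine Finset.sum_congr rfl fun j _ => ?_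
    have : ((j.factorial : ℚ)⁻¹ : ℚ) • x ^ j = (algebraMap ℚ ℂ ((j.factorial : ℚ)⁻¹)) • x ^ j := rfl
    rw [this]
    simp
  rw [key _ ha, key _ hb, key _ (h.isNilpotent_add ha hb), IsNilpotent.exp_add_of_commute h ha hb]

lemma nilExp_zero : nilExp (0 : R) = 1 := by
  rw [nilExp_eq_sum (N := 1) (by simp)]; simp

lemma nilExp_nsmul {a : R} (ha : IsNilpotent a) (k : ℕ) : nilExp (k • a) = nilExp a ^ k := by
  induction k with
  | zero => simp [nilExp_zero]
  | succ k ih =>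
    have hk : IsNilpotent (k • a) := by
      rw [nsmul_eq_mul]; exact (Nat.cast_commute k a).isNilpotent_mul_left ha
    rw [succ_nsmul, nilExp_add ((Commute.refl a).smul_left k) hk ha, ih, pow_succ]

lemma nilExp_sum {S : Type*} [CommRing S] [Algebra ℂ S] {ι : Type*} (s : Finset ι) (a : ι → S)
    (ha : ∀ i ∈ s, IsNilpotent (a i)) : nilExp (∑ i ∈ s, a i) = ∏ i ∈ s, nilExp (a i) := by
  classical
  induction s using Finset.induction_on with
  | empty => simp [nilExp_zero]
  | insert i s hi ih =>
    rw [Finset.sum_insert hi, Finset.prod_insert hi, nilExp_add (Commute.all _ _)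
      (ha i (Finset.mem_insert_self _ _))
      (isNilpotent_sum fun j hj => ha j (Finset.mem_insert_of_mem hj)),
      ih fun j hj => ha j (Finset.mem_insert_of_mem hj)]

end Nil

section Derivations

variable {B : Type*} [CommRing B] [Algebra ℂ B] (D : Derivation ℂ B B)

/-- The chain rule; the coefficients `1/j!` are constants for a derivation over `ℂ`. -/
lemma derivation_nilExp {a : B} (ha : IsNilpotent a) : D (nilExp a) = D a * nilExp a := by
  obtain ⟨N, hN⟩ := ha
  have hN' : a ^ (N + 1) = 0 := by rw [pow_succ, hN, zero_mul]
  conv_lhs => rw [nilExp_eq_sum hN']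
  rw [nilExp_eq_sum hN, map_sum, Finset.sum_range_succ', Finset.mul_sum]
  simp only [D.map_smul, D.leibniz_pow, pow_zero, D.map_one_eq_zero, smul_zero, add_zero]
  refine Finset.sum_congr rfl fun j _ => ?_
  have hj : ((j + 1 : ℕ) : ℂ) ≠ 0 := Nat.cast_ne_zero.2 j.succ_ne_zero
  rw [Nat.add_sub_cancel, Nat.factorial_succ, Nat.cast_mul, mul_inv, ← Nat.cast_smul_eq_nsmul ℂ,
    smul_smul, mul_right_comm, inv_mul_cancel₀ hj, one_mul, smul_eq_mul, mul_comm, mul_smul_comm,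
    mul_comm]

lemma derivation_prod {ι : Type*} [DecidableEq ι] (s : Finset ι) (f : ι → B) :
    D (∏ i ∈ s, f i) = ∑ i ∈ s, D (f i) * ∏ j ∈ s.erase i, f j := by
  induction s using Finset.induction_on with
  | empty => simp
  | insert i s hi ih =>
    rw [Finset.prod_insert hi, D.leibniz, ih, Finset.sum_insert hi, Finset.erase_insert hi,
      smul_eq_mul, smul_eq_mul, Finset.mul_sum, add_comm, mul_comm]
    congr 1
    refine Finset.sum_congr rfl fun j hj => ?_
    have hij : j ≠ i := fun h => hi (h ▸ hj)
    rw [Finset.erase_insert_of_ne hij.symm, Finset.prod_insert (by simp [hi])]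
    ring

/-- Jacobi's formula for a derivation of the coefficient ring. -/
lemma derivation_det {ι : Type*} [DecidableEq ι] [Fintype ι] (M : Matrix ι ι B) :
    D M.det = (M.adjugate * M.map D).trace := by
  have h1 : ∀ i, (M.adjugate * M.map D) i i = (M.updateCol i fun k => D (M k i)).det := by
    intro i
    rw [← Matrix.cramer_apply, Matrix.cramer_eq_adjugate_mulVec]
    rfl
  simp only [Matrix.trace, Matrix.diag, h1]
  simp only [Matrix.det_apply, map_sum, Finset.sum_comm (s := Finset.univ (α := ι))]
  refine Finset.sum_congr rfl fun σ _ => ?_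
  rw [← Finset.smul_sum, Units.smul_def, Units.smul_def, map_zsmul, derivation_prod]
  congr 1
  refine Finset.sum_congr rfl fun i _ => ?_
  rw [← Finset.mul_prod_erase _ _ (Finset.mem_univ i), Matrix.updateCol_self]
  congr 1
  refine Finset.prod_congr rfl fun j hj => ?_
  rw [Matrix.updateCol_ne (Finset.ne_of_mem_erase hj)]

end Derivations

section Euler

variable (A : Type*) [CommRing A] [Algebra ℂ A]

/-- The Euler derivation `X d/dX` of the ring of power series. -/
noncomputable def eulerD : Derivation ℂ (PowerSeries A) (PowerSeries A) :=
  ((PowerSeries.X : PowerSeries A) • PowerSeries.derivative A).restrictScalars ℂ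

/-- The Euler derivation `X d/dX` of the ring of polynomials. -/
noncomputable def eulerP : Derivation ℂ (Polynomial A) (Polynomial A) :=
  ((Polynomial.X : Polynomial A) • (Polynomial.derivative' : Derivation A _ _)).restrictScalars ℂ

variable {A}

lemma coeff_eulerD (f : PowerSeries A) (m : ℕ) :
    PowerSeries.coeff m (eulerD A f) = (m : A) * PowerSeries.coeff m f := by
  change PowerSeries.coeff m (PowerSeries.X * PowerSeries.derivative A f) = _
  cases m with
  | zero => simp
  | succ m => rw [PowerSeries.coeff_succ_X_mul, PowerSeries.coeff_derivative]; push_cast; ring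

lemma coe_eulerP (f : Polynomial A) :
    ((eulerP A f : Polynomial A) : PowerSeries A) = eulerD A (f : PowerSeries A) := by
  change ((Polynomial.X * Polynomial.derivative f : Polynomial A) : PowerSeries A) =
    PowerSeries.X * PowerSeries.derivative A f
  rw [PowerSeries.derivative_coe, Polynomial.coe_mul, Polynomial.coe_X]

lemma natCast_mul_cancel {m : ℕ} (hm : m ≠ 0) {a b : A} (h : (m : A) * a = m * b) : a = b := by
  have hm' : (m : ℂ) ≠ 0 := by exact_mod_cast hm
  have : ∀ x : A, (m : ℂ)⁻¹ • ((m : A) * x) = x := by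
    intro x
    rw [← nsmul_eq_mul, ← Nat.cast_smul_eq_nsmul ℂ, smul_smul, inv_mul_cancel₀ hm', one_smul]
  rw [← this a, h, this b]

/-- A solution of `X Y' = h Y` with `h(0) = 0` is determined by its constant term. -/
lemma eulerD_unique {Y Y' h : PowerSeries A} (hY : eulerD A Y = h * Y) (hY' : eulerD A Y' = h * Y')
    (h0 : PowerSeries.coeff 0 h = 0) (hc : PowerSeries.coeff 0 Y = PowerSeries.coeff 0 Y') :
    Y = Y' := by
  ext m
  induction m using Nat.strong_induction_on with
  | _ m ih =>
    rcases eq_or_ne m 0 with rfl | hm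
    · exact hc
    refine natCast_mul_cancel hm ?_
    rw [← coeff_eulerD, ← coeff_eulerD, hY, hY', PowerSeries.coeff_mul, PowerSeries.coeff_mul]
    refine Finset.sum_congr rfl fun p hp => ?_
    have hp := Finset.HasAntidiagonal.mem_antidiagonal.1 hp
    rcases eq_or_ne p.1 0 with h' | h'
    · rw [h', h0, zero_mul, zero_mul]
    · rw [ih _ (by omega)]

lemma eulerP_unique {Y Y' h : Polynomial A} (hY : eulerP A Y = h * Y) (hY' : eulerP A Y' = h * Y')
    (h0 : h.coeff 0 = 0) (hc : Y.coeff 0 = Y'.coeff 0) : Y = Y' := by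
  refine Polynomial.coe_injective A (eulerD_unique (h := (h : PowerSeries A)) ?_ ?_ ?_ ?_)
  · rw [← coe_eulerP, hY, Polynomial.coe_mul]
  · rw [← coe_eulerP, hY', Polynomial.coe_mul]
  · rw [Polynomial.coeff_coe, h0]
  · rw [Polynomial.coeff_coe, Polynomial.coeff_coe, hc]

end Euler

/-! ### Newton's identities for exterior and symmetric powers -/

section Exterior

variable {A : Type*} [CommRing A] {r : ℕ}

lemma ofFinEmbEquiv_symm_eq {k : ℕ} (s : Set.powersetCard (Fin r) k) (i : Fin k) :
    Set.powersetCard.ofFinEmbEquiv.symm s i = (s.val.orderIsoOfFin s.prop i : Fin r) := by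
  rw [Set.powersetCard.ofFinEmbEquiv_symm_apply]
  rfl

/-- The trace on `⋀ᵏ` is the sum of the principal minors of size `k`. -/
lemma chExt_eq_coeff (g : Matrix (Fin r) (Fin r) A) (k : ℕ) :
    chExt g k = (Matrix.det (1 + (Polynomial.X : Polynomial A) • g.map Polynomial.C)).coeff k := by
  rw [Matrix.coeff_det_one_add_X_smul_eq_sum_minors, chExt,
    LinearMap.trace_eq_matrix_trace A ((Pi.basisFun A (Fin r)).exteriorPower k), Matrix.trace]
  rw [← Finset.sum_coe_sort (Finset.univ.powersetCard k)]
  refine Fintype.sum_equiv (Equiv.subtypeEquivRight fun s => ?_) _ _ fun s => ?_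
  · rw [Finset.mem_powersetCard_univ]; exact Set.powersetCard.mem_iff
  rw [Matrix.diag_apply, LinearMap.toMatrix_apply, exteriorPower.basis_repr_apply,
    exteriorPower.basis_apply, exteriorPower.ιMulti_family, exteriorPower.map_apply_ιMulti,
    exteriorPower.ιMultiDual_apply_ιMulti, ← Matrix.det_transpose]
  refine Eq.trans ?_ (Matrix.det_submatrix_equiv_self (s.val.orderIsoOfFin s.prop).toEquiv _)
  refine congrArg Matrix.det ?_
  ext i j
  simp only [Matrix.transpose_apply, Matrix.of_apply, Function.comp_apply, ofFinEmbEquiv_symm_eq,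
    Module.Basis.coord_apply, Pi.basisFun_repr, Pi.basisFun_apply,
    Matrix.toLin'_apply, Matrix.mulVec_single_one, Matrix.col_apply]
  rfl

end Exterior

section ExteriorNewton

variable {A : Type*} [CommRing A] [Algebra ℂ A] {r : ℕ}

/-- The power series `∑_{i ≥ 1} a_i X^i`. -/
noncomputable def posSeries (a : ℕ → A) : PowerSeries A :=
  PowerSeries.mk fun i => if i = 0 then 0 else a i

lemma coeff_posSeries (a : ℕ → A) (i : ℕ) :
    PowerSeries.coeff i (posSeries a) = if i = 0 then 0 else a i := by
  rw [posSeries, PowerSeries.coeff_mk]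

/-- Newton's identity for the exterior powers: `X d/dX` of `∑ ch(⋀ᵏ) Xᵏ = det (1 + X g)` is `∑
(-1)^{i-1} tr(gⁱ) Xⁱ` times that series. -/
lemma eulerD_chExt (g : Matrix (Fin r) (Fin r) A) :
    eulerD A (PowerSeries.mk (chExt g)) =
      posSeries (fun i => (-1) ^ (i - 1) * (g ^ i).trace) * PowerSeries.mk (chExt g) := by
  set M : Matrix (Fin r) (Fin r) (PowerSeries A) :=
    1 + (PowerSeries.X : PowerSeries A) • g.map (PowerSeries.C (R := A)) with hM
  -- the generating series of the traces on `⋀ᵏ` is `det (1 + X g)`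
  have hE : PowerSeries.mk (chExt g) = M.det := by
    have : M = (1 + (Polynomial.X : Polynomial A) • g.map Polynomial.C).map
        (Polynomial.coeToPowerSeries.ringHom (R := A)) := by
      refine Matrix.ext fun a b => ?_
      rw [hM, Matrix.map_apply, Matrix.add_apply, Matrix.add_apply, map_add]
      congr 1
      · rcases eq_or_ne a b with rfl | hab
        · simp
        · simp [hab]
      · simp only [Matrix.smul_apply, Matrix.map_apply, smul_eq_mul, map_mul,
          Polynomial.coeToPowerSeries.ringHom_apply, Polynomial.coe_X, Polynomial.coe_C]
    rw [this, ← RingHom.mapMatrix_apply, ← RingHom.map_det]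
    ext k
    rw [PowerSeries.coeff_mk, Polynomial.coeToPowerSeries.ringHom_apply, Polynomial.coeff_coe,
      chExt_eq_coeff]
  -- the Neumann series of `(1 + X g)⁻¹`
  set W : Matrix (Fin r) (Fin r) (PowerSeries A) :=
    Matrix.of fun a b => PowerSeries.mk fun i => (-1) ^ i * (g ^ i) a b with hW
  have hMW : M * W = 1 := by
    ext a b i
    rw [hM, add_mul, one_mul, Matrix.smul_mul, Matrix.add_apply, Matrix.smul_apply, smul_eq_mul,
      map_add]
    cases i with
    | zero =>
      rcases eq_or_ne a b with rfl | hab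
      · simp [hW]
      · simp [hW, hab]
    | succ i =>
      rw [PowerSeries.coeff_succ_X_mul, Matrix.mul_apply, map_sum, hW]
      simp only [Matrix.of_apply, PowerSeries.coeff_mk, Matrix.map_apply, PowerSeries.coeff_C_mul]
      rw [pow_succ' g, Matrix.mul_apply, Finset.mul_sum, ← Finset.sum_add_distrib,
        Finset.sum_eq_zero fun c _ => by ring]
      by_cases hab : a = b <;> simp [hab, Matrix.one_apply, PowerSeries.coeff_one]
  -- hence `adj M = det M • M⁻¹`, to be used in the formula for the derivative of `det M`
  have hadj : M.adjugate = M.det • W := by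
    calc M.adjugate = M.adjugate * (M * W) := by rw [hMW, mul_one]
      _ = M.det • W := by rw [← mul_assoc, Matrix.adjugate_mul, Matrix.smul_mul, one_mul]
  have hD : M.map (eulerD A) = (PowerSeries.X : PowerSeries A) • g.map (PowerSeries.C (R := A)) := by
    ext a b i
    rw [Matrix.map_apply, coeff_eulerD, hM, Matrix.add_apply, Matrix.smul_apply, smul_eq_mul,
      map_add, Matrix.map_apply]
    rcases i with _ | _ | i
    · simp
    · by_cases hab : a = b <;> simp [Matrix.one_apply, hab, PowerSeries.coeff_one]
    · rw [PowerSeries.coeff_succ_X_mul]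
      by_cases hab : a = b <;> simp [Matrix.one_apply, hab, PowerSeries.coeff_one]
  rw [hE, derivation_det, hadj, hD, Matrix.smul_mul, Matrix.trace_smul, smul_eq_mul, mul_comm]
  congr 1
  ext i
  rw [Matrix.mul_smul, Matrix.trace_smul, smul_eq_mul, coeff_posSeries]
  cases i with
  | zero => simp
  | succ i =>
    rw [PowerSeries.coeff_succ_X_mul, if_neg i.succ_ne_zero, Nat.add_sub_cancel, pow_succ g,
      Matrix.trace, Matrix.trace, map_sum, Finset.mul_sum]
    refine Finset.sum_congr rfl fun a _ => ?_
    rw [Matrix.diag_apply, Matrix.diag_apply, Matrix.mul_apply, Matrix.mul_apply, map_sum,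
      Finset.mul_sum]
    refine Finset.sum_congr rfl fun b _ => ?_
    rw [hW, Matrix.of_apply, Matrix.map_apply, PowerSeries.coeff_mul_C, PowerSeries.coeff_mk,
      mul_assoc]

lemma coeff_zero_chExt (g : Matrix (Fin r) (Fin r) A) : chExt g 0 = 1 := by
  rw [chExt_eq_coeff, Polynomial.coeff_zero_eq_eval_zero, eval_det_add_X_smul,
    Matrix.det_one, Polynomial.eval_one]

end ExteriorNewton

section Symmetric

open MvPolynomial

variable {A : Type*} [CommRing A] {r : ℕ}

/-- The trace of a linear endomorphism of the polynomial ring on homogeneous polynomials of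
degree `k`. -/
noncomputable def trDeg (k : ℕ) (φ : MvPolynomial (Fin r) A →ₗ[A] MvPolynomial (Fin r) A) : A :=
  ∑ α ∈ Finset.finsuppAntidiag (Finset.univ : Finset (Fin r)) k, coeff α (φ (monomial α 1))

/-- The algebra homomorphism `Xⱼ ↦ ∑ᵢ gᵢⱼ Xᵢ` of the polynomial ring, which in degree `k` is the
action of `g` on the symmetric power `Sᵏ`. -/
noncomputable def subst (g : Matrix (Fin r) (Fin r) A) :
    MvPolynomial (Fin r) A →ₐ[A] MvPolynomial (Fin r) A :=
  aeval fun j => ∑ i, C (g i j) * X i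

lemma chSym_eq_trDeg (g : Matrix (Fin r) (Fin r) A) (k : ℕ) :
    chSym g k = trDeg k (subst g).toLinearMap := by
  refine Finset.sum_congr rfl fun α _ => ?_
  rw [AlgHom.toLinearMap_apply, subst, aeval_monomial, map_one, one_mul,
    Finsupp.prod_fintype _ _ fun i => pow_zero _]

lemma trDeg_add (k : ℕ) (φ ψ : MvPolynomial (Fin r) A →ₗ[A] MvPolynomial (Fin r) A) :
    trDeg k (φ + ψ) = trDeg k φ + trDeg k ψ := by
  simp [trDeg, Finset.sum_add_distrib]

lemma trDeg_smul (k : ℕ) (c : A) (φ : MvPolynomial (Fin r) A →ₗ[A] MvPolynomial (Fin r) A) :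
    trDeg k (c • φ) = c * trDeg k φ := by
  simp [trDeg, Finset.mul_sum]

lemma trDeg_sum {ι : Type*} (s : Finset ι) (k : ℕ)
    (φ : ι → MvPolynomial (Fin r) A →ₗ[A] MvPolynomial (Fin r) A) :
    trDeg k (∑ i ∈ s, φ i) = ∑ i ∈ s, trDeg k (φ i) := by
  simp only [trDeg, LinearMap.sum_apply, coeff_sum]
  exact Finset.sum_comm

/-- Multiplication by `X_i`. -/
noncomputable def mulX (i : Fin r) : MvPolynomial (Fin r) A →ₗ[A] MvPolynomial (Fin r) A :=
  LinearMap.mulLeft A (X i)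

lemma sum_finsuppAntidiag {k : ℕ} {α : Fin r →₀ ℕ}
    (h : α ∈ Finset.finsuppAntidiag (Finset.univ : Finset (Fin r)) k) : ∑ i, α i = k :=
  (Finset.mem_finsuppAntidiag.1 h).1

/-- Cyclicity of the trace, for multiplication by a variable. -/
lemma trDeg_mulX_comp (k : ℕ) (i : Fin r)
    (ψ : MvPolynomial (Fin r) A →ₗ[A] MvPolynomial (Fin r) A) :
    trDeg (k + 1) (mulX i ∘ₗ ψ) = trDeg k (ψ ∘ₗ mulX i) := by
  classical
  simp only [trDeg, mulX, LinearMap.comp_apply, LinearMap.mulLeft_apply, coeff_X_mul']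
  rw [← Finset.sum_filter]
  symm
  refine Finset.sum_bij (fun β _ => β + Finsupp.single i 1) ?_ ?_ ?_ ?_
  · intro β hβ
    rw [Finset.mem_filter, Finset.mem_finsuppAntidiag]
    refine ⟨⟨?_, Finset.subset_univ _⟩, by simp⟩
    have := sum_finsuppAntidiag hβ
    change ∑ j, (β + (Finsupp.single i 1 : Fin r →₀ ℕ)) j = k + 1
    simp only [Finsupp.add_apply, Finset.sum_add_distrib, this]
    simp [Finsupp.single_apply]
  · intro β _ γ _ h
    exact add_right_cancel h
  · intro α hα
    rw [Finset.mem_filter] at hα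
    have hi : Finsupp.single i 1 ≤ α := by
      rw [Finsupp.single_le_iff]
      exact Nat.one_le_iff_ne_zero.2 (Finsupp.mem_support_iff.1 hα.2)
    refine ⟨α - Finsupp.single i 1, ?_, tsub_add_cancel_of_le hi⟩
    rw [Finset.mem_finsuppAntidiag]
    refine ⟨?_, Finset.subset_univ _⟩
    have h1 := sum_finsuppAntidiag hα.1
    have h2 : ∑ j, α j = ∑ j, ((α - (Finsupp.single i 1 : Fin r →₀ ℕ)) j + Finsupp.single i 1 j) := by
      conv_lhs => rw [← tsub_add_cancel_of_le hi]
      rfl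
    rw [Finset.sum_add_distrib, h1] at h2
    have h3 : ∑ j, (Finsupp.single i 1 : Fin r →₀ ℕ) j = 1 := by simp [Finsupp.single_apply]
    change ∑ j, (α - (Finsupp.single i 1 : Fin r →₀ ℕ)) j = k
    omega
  · intro β _
    rw [add_tsub_cancel_right, X, monomial_mul, one_mul, add_comm]

lemma trDeg_zero_mulX_comp (i : Fin r)
    (ψ : MvPolynomial (Fin r) A →ₗ[A] MvPolynomial (Fin r) A) :
    trDeg 0 (mulX i ∘ₗ ψ) = 0 := by
  classical
  refine Finset.sum_eq_zero fun α hα => ?_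
  have h := sum_finsuppAntidiag hα
  rw [LinearMap.comp_apply, mulX, LinearMap.mulLeft_apply, coeff_X_mul', if_neg]
  rw [Finsupp.mem_support_iff, not_not]
  exact (Finset.sum_eq_zero_iff.1 h) i (Finset.mem_univ i)

/-- The matrix of the traces, on homogeneous polynomials of degree `k`, of the operators `X_i ∂_j
T`, where `T` is the substitution given by `g`. The sum of the diagonal entries is `k` times the
trace of `T`, by Euler's identity. -/
noncomputable def symAux (g : Matrix (Fin r) (Fin r) A) (k : ℕ) : Matrix (Fin r) (Fin r) A :=
  Matrix.of fun i j =>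
    trDeg k (mulX i ∘ₗ (pderiv j : Derivation A _ _).toLinearMap ∘ₗ (subst g).toLinearMap)

/-- A recursion: by cyclicity of the trace, `X_i` can be moved to the right of `T`, and then past
`T` and `∂_j` to the left again, which costs the matrix `gᵀ` and a commutator. -/
lemma symAux_succ (g : Matrix (Fin r) (Fin r) A) (k : ℕ) :
    symAux g (k + 1) = g.transpose * (chSym g k • 1 + symAux g k) := by
  ext i j
  rw [symAux, Matrix.of_apply, trDeg_mulX_comp]
  have : ((pderiv j : Derivation A (MvPolynomial (Fin r) A) _).toLinearMap ∘ₗ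
      (subst g).toLinearMap) ∘ₗ mulX i = ∑ a, g a i • ((if a = j then (1 : A) else 0) •
        (subst g).toLinearMap + mulX a ∘ₗ (pderiv j : Derivation A _ _).toLinearMap ∘ₗ
          (subst g).toLinearMap) := by
    ext1 p
    refine LinearMap.ext fun q => ?_
    simp only [LinearMap.comp_apply, mulX, LinearMap.mulLeft_apply, LinearMap.sum_apply,
      LinearMap.smul_apply, LinearMap.add_apply, AlgHom.toLinearMap_apply]
    rw [map_mul, subst, aeval_X, Finset.sum_mul]
    change pderiv j _ = _
    rw [map_sum]
    refine Finset.sum_congr rfl fun a _ => ?_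
    rw [mul_assoc, ← smul_eq_C_mul, (pderiv j).map_smul, (pderiv j).leibniz, pderiv_X]
    congr 1
    rw [add_comm]
    congr 1
    by_cases ha : a = j
    · subst ha; simp
    · simp [ha]
  rw [this, trDeg_sum, Matrix.mul_apply]
  refine Finset.sum_congr rfl fun a _ => ?_
  rw [trDeg_smul, trDeg_add, trDeg_smul, Matrix.transpose_apply, Matrix.add_apply,
    Matrix.smul_apply, Matrix.one_apply, chSym_eq_trDeg, smul_eq_mul, mul_comm (trDeg k _)]
  rfl

lemma symAux_eq_sum (g : Matrix (Fin r) (Fin r) A) (k : ℕ) :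
    symAux g k = ∑ i ∈ Finset.range k, chSym g (k - 1 - i) • (g.transpose ^ (i + 1)) := by
  induction k with
  | zero =>
    ext i j
    rw [symAux, Matrix.of_apply, trDeg_zero_mulX_comp]
    simp
  | succ k ih =>
    rw [symAux_succ, ih, Finset.sum_range_succ', mul_add, Finset.mul_sum, add_comm]
    congr 1
    · refine Finset.sum_congr rfl fun i _ => ?_
      rw [Matrix.mul_smul, ← pow_succ']
      congr 2
      omega
    · simp

/-- Newton's identity for the symmetric powers: `k h_k = ∑ h_{k-1-i} tr g^{i+1}`. -/
lemma natCast_mul_chSym (g : Matrix (Fin r) (Fin r) A) (k : ℕ) :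
    (k : A) * chSym g k = ∑ i ∈ Finset.range k, chSym g (k - 1 - i) * (g ^ (i + 1)).trace := by
  classical
  -- Euler's identity: `∑ X_i ∂_i` multiplies a homogeneous polynomial by its degree
  have h1 : (k : A) * chSym g k = (symAux g k).trace := by
    rw [Matrix.trace, chSym_eq_trDeg]
    simp only [Matrix.diag_apply, symAux, Matrix.of_apply]
    rw [← trDeg_sum, trDeg, trDeg, Finset.mul_sum]
    refine Finset.sum_congr rfl fun α hα => ?_
    rw [LinearMap.sum_apply, coeff_sum]
    have : ∀ i : Fin r, ∀ p : MvPolynomial (Fin r) A,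
        coeff α (X i * pderiv i p) = α i * coeff α p := by
      intro i p
      rw [coeff_X_mul']
      split_ifs with h
      · have hi : Finsupp.single i 1 ≤ α := by
          rw [Finsupp.single_le_iff]
          exact Nat.one_le_iff_ne_zero.2 (Finsupp.mem_support_iff.1 h)
        rw [coeff_pderiv, tsub_add_cancel_of_le hi, mul_comm]
        congr 1
        have h1 : 1 ≤ α i := Nat.one_le_iff_ne_zero.2 (Finsupp.mem_support_iff.1 h)
        rw [Finsupp.tsub_apply, Finsupp.single_eq_same, Nat.cast_sub h1]
        simp
      · rw [Finsupp.notMem_support_iff.1 h]; simp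
    have h2 : ∀ i : Fin r, coeff α ((mulX i ∘ₗ (pderiv i : Derivation A _ _).toLinearMap ∘ₗ
        (subst g).toLinearMap) (monomial α 1)) = α i * coeff α (subst g (monomial α 1)) :=
      fun i => this i _
    simp only [h2]
    rw [← Finset.sum_mul, ← Nat.cast_sum, sum_finsuppAntidiag hα]
    rfl
  rw [h1, symAux_eq_sum, Matrix.trace_sum]
  refine Finset.sum_congr rfl fun i _ => ?_
  rw [Matrix.trace_smul, smul_eq_mul, ← Matrix.transpose_pow, Matrix.trace_transpose]

lemma coeff_zero_chSym (g : Matrix (Fin r) (Fin r) A) : chSym g 0 = 1 := by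
  simp [chSym]

variable [Algebra ℂ A]

/-- Newton's identity for the symmetric powers, for the generating series. -/
lemma eulerD_chSym (g : Matrix (Fin r) (Fin r) A) :
    eulerD A (PowerSeries.mk (chSym g)) =
      posSeries (fun i => (g ^ i).trace) * PowerSeries.mk (chSym g) := by
  ext k
  rw [coeff_eulerD, PowerSeries.coeff_mk, natCast_mul_chSym, PowerSeries.coeff_mul,
    Finset.Nat.sum_antidiagonal_eq_sum_range_succ_mk, Finset.sum_range_succ', coeff_posSeries,
    if_pos rfl, zero_mul, add_zero]
  refine Finset.sum_congr rfl fun i _ => ?_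
  rw [coeff_posSeries, if_neg i.succ_ne_zero, PowerSeries.coeff_mk, mul_comm]
  congr 2
  omega

end Symmetric

/-! ### Power series with coefficients in an algebra -/

section Series

variable {A : Type*} [CommRing A] [Algebra ℂ A]

variable (A) in
/-- Complex power series as power series with coefficients in `A`. -/
noncomputable def lft : PowerSeries ℂ →ₐ[ℂ] PowerSeries A :=
  PowerSeries.mapAlgHom (Algebra.ofId ℂ A)

lemma coeff_lft (f : PowerSeries ℂ) (m : ℕ) :
    PowerSeries.coeff m (lft A f) = algebraMap ℂ A (PowerSeries.coeff m f) :=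
  PowerSeries.coeff_map _ _ _

/-- The substitution `X ↦ ε X^d`. -/
noncomputable def twist (A : Type*) [CommRing A] [Algebra ℂ A] (ε : ℤ) (d : ℕ) (hd : d ≠ 0) :
    PowerSeries A →ₐ[ℂ] PowerSeries A :=
  ((PowerSeries.expand d hd).comp (PowerSeries.rescaleAlgHom (ε : A))).restrictScalars ℂ

lemma rescaleAlgHom_eq (a : A) (f : PowerSeries A) :
    PowerSeries.rescaleAlgHom a f = PowerSeries.rescale a f :=
  DFunLike.congr_fun (PowerSeries.coe_rescaleAlgHom a) f

lemma coeff_twist (ε : ℤ) (d : ℕ) (hd : d ≠ 0) (f : PowerSeries A) (m : ℕ) :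
    PowerSeries.coeff m (twist A ε d hd f) =
      if d ∣ m then (ε : A) ^ (m / d) * PowerSeries.coeff (m / d) f else 0 := by
  change PowerSeries.coeff m (PowerSeries.expand d hd (PowerSeries.rescaleAlgHom (ε : A) f)) = _
  rw [rescaleAlgHom_eq]
  split_ifs with h
  · obtain ⟨m, rfl⟩ := h
    rw [PowerSeries.coeff_expand_mul, PowerSeries.coeff_rescale,
      Nat.mul_div_cancel_left _ (Nat.pos_of_ne_zero hd)]
  · rw [PowerSeries.coeff_expand_of_not_dvd _ _ _ h]

lemma atPow_eq_twist (ε : ℤ) (d : ℕ) (hd : d ≠ 0) (a : ℕ → A) :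
    atPow ε d a = twist A ε d hd (PowerSeries.mk a) := by
  ext m
  rw [coeff_twist, atPow, PowerSeries.coeff_mk, PowerSeries.coeff_mk]

lemma lft_twist (ε : ℤ) (d : ℕ) (hd : d ≠ 0) (f : PowerSeries ℂ) :
    lft A (twist ℂ ε d hd f) = twist A ε d hd (lft A f) := by
  ext m
  rw [coeff_lft, coeff_twist, coeff_twist, coeff_lft]
  split_ifs <;> simp

lemma twist_C (ε : ℤ) (d : ℕ) (hd : d ≠ 0) (a : A) :
    twist A ε d hd (PowerSeries.C a) = PowerSeries.C a := by
  ext m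
  rw [coeff_twist, PowerSeries.coeff_C, PowerSeries.coeff_C]
  rcases eq_or_ne m 0 with rfl | hm
  · simp
  rw [if_neg hm]
  split_ifs with h h'
  · exact absurd h' (Nat.div_pos (Nat.le_of_dvd (Nat.pos_of_ne_zero hm) h)
      (Nat.pos_of_ne_zero hd)).ne'
  · rw [mul_zero]
  · rfl

lemma twist_X (ε : ℤ) (d : ℕ) (hd : d ≠ 0) :
    twist A ε d hd PowerSeries.X = (ε : PowerSeries A) * PowerSeries.X ^ d := by
  change PowerSeries.expand d hd (PowerSeries.rescaleAlgHom (ε : A) PowerSeries.X) = _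
  rw [rescaleAlgHom_eq, PowerSeries.rescale_X, map_mul, PowerSeries.expand_C, PowerSeries.expand_X, map_intCast]

lemma twist_twist (ε ε' : ℤ) (d d' : ℕ) (hd : d ≠ 0) (hd' : d' ≠ 0) (f : PowerSeries A) :
    twist A ε d hd (twist A ε' d' hd' f) =
      twist A (ε' * ε ^ d') (d * d') (Nat.mul_ne_zero hd hd') f := by
  ext m
  rw [coeff_twist, coeff_twist, coeff_twist]
  by_cases h : d ∣ m
  · obtain ⟨k, rfl⟩ := h
    rw [if_pos (dvd_mul_right _ _), Nat.mul_div_cancel_left _ (Nat.pos_of_ne_zero hd)]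
    by_cases h' : d' ∣ k
    · obtain ⟨l, rfl⟩ := h'
      rw [if_pos (dvd_mul_right _ _), if_pos (mul_dvd_mul_left _ (dvd_mul_right _ _)), ← mul_assoc,
        ← mul_assoc, Nat.mul_div_cancel_left _ (Nat.pos_of_ne_zero hd'),
        Nat.mul_div_cancel_left _ (Nat.pos_of_ne_zero (Nat.mul_ne_zero hd hd'))]
      push_cast
      ring
    · rw [if_neg h', if_neg, mul_zero]
      exact fun h => h' ((Nat.mul_dvd_mul_iff_left (Nat.pos_of_ne_zero hd)).1 h)
  · rw [if_neg h, if_neg fun h' => h ((dvd_mul_right _ _).trans h')]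

lemma twist_congr {ε ε' : ℤ} {d d' : ℕ} (hd : d ≠ 0) (hd' : d' ≠ 0) (h : ε = ε') (h' : d = d')
    (f : PowerSeries A) : twist A ε d hd f = twist A ε' d' hd' f := by
  subst h h'; rfl

lemma twist_dvd {ε : ℤ} {d : ℕ} (hd : d ≠ 0) {N : ℕ} {f : PowerSeries A}
    (h : PowerSeries.X ^ N ∣ f) : PowerSeries.X ^ (d * N) ∣ twist A ε d hd f := by
  obtain ⟨g, rfl⟩ := h
  rw [map_mul, map_pow, twist_X, mul_pow, ← pow_mul]
  exact Dvd.intro_left ((ε : PowerSeries A) ^ N * twist A ε d hd g) (by ring)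

lemma eulerD_C_mul_lft (a : A) (f : PowerSeries ℂ) :
    eulerD A (PowerSeries.C a * lft A f) = PowerSeries.C a * lft A (eulerD ℂ f) := by
  ext m
  rw [coeff_eulerD, PowerSeries.coeff_C_mul, PowerSeries.coeff_C_mul, coeff_lft, coeff_lft,
    coeff_eulerD, map_mul, map_natCast]
  ring

/-- The exponential of `∑ᵢ yᵢ eᵢ(X)`, for nilpotent `yᵢ` in the coefficient algebra and complex
power series `eᵢ`. -/
noncomputable def cexp {ι : Type*} [Fintype ι] (y : ι → A) (e : ι → PowerSeries ℂ) :
    PowerSeries A :=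
  nilExp (∑ i, PowerSeries.C (y i) * lft A (e i))

section

variable {ι : Type*} [Fintype ι] {y : ι → A}

lemma isNilpotent_C_mul {a : A} (ha : IsNilpotent a) (f : PowerSeries A) :
    IsNilpotent (PowerSeries.C a * f) :=
  (Commute.all _ _).isNilpotent_mul_right (ha.map (PowerSeries.C (R := A)))

lemma isNilpotent_expSum (hy : ∀ i, IsNilpotent (y i)) (e : ι → PowerSeries ℂ) :
    IsNilpotent (∑ i, PowerSeries.C (y i) * lft A (e i)) :=
  isNilpotent_sum fun i _ => isNilpotent_C_mul (hy i) _

lemma cexp_add (hy : ∀ i, IsNilpotent (y i)) (e e' : ι → PowerSeries ℂ) :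
    cexp y (e + e') = cexp y e * cexp y e' := by
  rw [cexp, cexp, cexp, ← nilExp_add (Commute.all _ _) (isNilpotent_expSum hy e)
    (isNilpotent_expSum hy e'), ← Finset.sum_add_distrib]
  simp [mul_add]

lemma cexp_zero (y : ι → A) : cexp y 0 = 1 := by
  simp [cexp, nilExp_zero]

lemma cexp_sum (hy : ∀ i, IsNilpotent (y i)) (e : ℕ → ι → PowerSeries ℂ) (N : ℕ) :
    cexp y (∑ n ∈ Finset.range N, e n) = ∏ n ∈ Finset.range N, cexp y (e n) := by
  induction N with
  | zero => simp [cexp_zero]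
  | succ N ih => rw [Finset.sum_range_succ, Finset.prod_range_succ, cexp_add hy, ih]

lemma twist_cexp (hy : ∀ i, IsNilpotent (y i)) (e : ι → PowerSeries ℂ) (ε : ℤ) (d : ℕ)
    (hd : d ≠ 0) : twist A ε d hd (cexp y e) = cexp y fun i => twist ℂ ε d hd (e i) := by
  rw [cexp, cexp, map_nilExp _ (isNilpotent_expSum hy e), map_sum]
  simp only [map_mul, twist_C, lft_twist]

lemma nilExp_sub_dvd {a b c : A} (ha : IsNilpotent a) (hb : IsNilpotent b) (h : c ∣ a - b) :
    c ∣ nilExp a - nilExp b := by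
  obtain ⟨N, hN⟩ := ha
  obtain ⟨M, hM⟩ := hb
  rw [nilExp_eq_sum (pow_eq_zero_of_le (le_max_left N M) hN),
    nilExp_eq_sum (pow_eq_zero_of_le (le_max_right N M) hM), ← Finset.sum_sub_distrib]
  refine Finset.dvd_sum fun j _ => ?_
  rw [← smul_sub, Algebra.smul_def]
  exact ((h.trans (sub_dvd_pow_sub_pow a b j)).mul_left _)

lemma lft_dvd {N : ℕ} {f : PowerSeries ℂ} (h : PowerSeries.X ^ N ∣ f) :
    (PowerSeries.X : PowerSeries A) ^ N ∣ lft A f := by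
  have := map_dvd (lft A) h
  rwa [map_pow, show lft A PowerSeries.X = PowerSeries.X from PowerSeries.map_X _] at this

lemma cexp_sub_dvd (hy : ∀ i, IsNilpotent (y i)) {e e' : ι → PowerSeries ℂ} {N : ℕ}
    (h : ∀ i, PowerSeries.X ^ N ∣ e i - e' i) :
    PowerSeries.X ^ N ∣ cexp y e - cexp y e' := by
  refine nilExp_sub_dvd (isNilpotent_expSum hy e) (isNilpotent_expSum hy e') ?_
  rw [← Finset.sum_sub_distrib]
  refine Finset.dvd_sum fun i _ => ?_
  rw [← mul_sub, ← map_sub]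
  exact (lft_dvd (h i)).mul_left _

lemma infProd_eq {P : ℕ → PowerSeries A} {G : PowerSeries A}
    (h : ∀ N, PowerSeries.X ^ N ∣ G - ∏ n ∈ Finset.range N, P n) : infProd P = G := by
  ext j
  have := PowerSeries.X_pow_dvd_iff.1 (h (j + 1)) j j.lt_succ_self
  rw [map_sub, sub_eq_zero] at this
  rw [infProd, PowerSeries.coeff_mk, this]

lemma infProd_sub_dvd {P : ℕ → PowerSeries A} (hP : ∀ n, PowerSeries.X ^ (n + 1) ∣ P n - 1)
    (N : ℕ) : PowerSeries.X ^ N ∣ infProd P - ∏ n ∈ Finset.range N, P n := by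
  have key : ∀ j M, j + 1 ≤ M → PowerSeries.coeff j (∏ n ∈ Finset.range M, P n) =
      PowerSeries.coeff j (∏ n ∈ Finset.range (j + 1), P n) := by
    intro j M hM
    induction M, hM using Nat.le_induction with
    | base => rfl
    | succ M hM ih =>
      rw [Finset.prod_range_succ, ← ih, ← sub_eq_zero, ← map_sub]
      suffices h : PowerSeries.X ^ (M + 1) ∣ (∏ n ∈ Finset.range M, P n) * P M -
          ∏ n ∈ Finset.range M, P n from PowerSeries.X_pow_dvd_iff.1 h j (by omega)
      have : (∏ n ∈ Finset.range M, P n) * P M - ∏ n ∈ Finset.range M, P n =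
        (∏ n ∈ Finset.range M, P n) * (P M - 1) := by ring
      rw [this]
      exact (hP M).mul_left _
  rw [PowerSeries.X_pow_dvd_iff]
  intro j hj
  rw [map_sub, infProd, PowerSeries.coeff_mk, key j N hj, sub_self]

lemma dvd_mul_sub_mul {c a b a' b' : A} (h : c ∣ a - a') (h' : c ∣ b - b') :
    c ∣ a * b - a' * b' := by
  have : a * b - a' * b' = (a - a') * b + a' * (b - b') := by ring
  rw [this]
  exact dvd_add (h.mul_right _) (h'.mul_left _)

/-- An infinite product of exponentials is the exponential of the sum of the exponents. -/
lemma infProd_mul_cexp {P : ℕ → PowerSeries A} (hP : ∀ n, PowerSeries.X ^ (n + 1) ∣ P n - 1)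
    (hy : ∀ i, IsNilpotent (y i)) {e : ℕ → ι → PowerSeries ℂ} {E : ι → PowerSeries ℂ}
    (h : ∀ N i, PowerSeries.X ^ N ∣ E i - ∑ n ∈ Finset.range N, e n i) :
    infProd (fun n => P n * cexp y (e n)) = infProd P * cexp y E := by
  refine infProd_eq fun N => ?_
  rw [Finset.prod_mul_distrib, ← cexp_sum hy]
  refine dvd_mul_sub_mul (infProd_sub_dvd hP N) (cexp_sub_dvd hy fun i => ?_)
  rw [Finset.sum_apply]
  exact h N i

lemma infProd_cexp (hy : ∀ i, IsNilpotent (y i)) {e : ℕ → ι → PowerSeries ℂ}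
    {E : ι → PowerSeries ℂ} (h : ∀ N i, PowerSeries.X ^ N ∣ E i - ∑ n ∈ Finset.range N, e n i) :
    infProd (fun n => cexp y (e n)) = cexp y E := by
  refine infProd_eq fun N => ?_
  rw [← cexp_sum hy]
  refine cexp_sub_dvd hy fun i => ?_
  rw [Finset.sum_apply]
  exact h N i

end

end Series

section TraceSeries

variable {A : Type*} [CommRing A] [Algebra ℂ A] {r : ℕ}

/-- The series `∑_{i ≥ 1} i^p X^i`, i.e. the polylogarithm of order `-p`. -/
noncomputable def polylog (p : ℕ) : PowerSeries ℂ := posSeries fun i => (i : ℂ) ^ p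

lemma coeff_polylog (p i : ℕ) :
    PowerSeries.coeff i (polylog p) = if i = 0 then 0 else (i : ℂ) ^ p := coeff_posSeries _ _

/-- `tr e^{iF}`, expanded in powers of `i`. -/
lemma trace_nilExp_pow {F : Matrix (Fin r) (Fin r) A} {N : ℕ} (hF : F ^ (N + 1) = 0) (i : ℕ) :
    ((nilExp F) ^ i).trace = r + ∑ j ∈ Finset.range N,
      (((j + 1).factorial : ℂ)⁻¹ * (i : ℂ) ^ (j + 1)) • (F ^ (j + 1)).trace := by
  rw [← nilExp_nsmul ⟨_, hF⟩, nilExp_eq_sum (N := N + 1) (by rw [smul_pow, hF, smul_zero]),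
    Matrix.trace_sum, Finset.sum_range_succ', add_comm]
  congr 1
  · simp
  · refine Finset.sum_congr rfl fun j _ => ?_
    rw [smul_pow, Matrix.trace_smul, Matrix.trace_smul, mul_smul, ← Nat.cast_smul_eq_nsmul ℂ]
    push_cast
    rfl

/-- The series `∑_{i ≥ 1} i^j Xⁱ / (j + 1)!`, which is the coefficient of `tr F^{j+1}` in the
logarithm of `∑ ch(Sᵏ) Xᵏ`. -/
noncomputable def expCoef (j : ℕ) : PowerSeries ℂ := ((j + 1).factorial : ℂ)⁻¹ • polylog j

lemma coeff_eulerD_expCoef (j i : ℕ) : PowerSeries.coeff i (eulerD ℂ (expCoef j)) =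
    if i = 0 then 0 else ((j + 1).factorial : ℂ)⁻¹ * (i : ℂ) ^ (j + 1) := by
  rw [coeff_eulerD, expCoef, PowerSeries.coeff_smul, coeff_polylog, smul_eq_mul]
  split_ifs
  · simp
  · ring

lemma eulerD_cexp {ι : Type*} [Fintype ι] {y : ι → A} (hy : ∀ i, IsNilpotent (y i))
    (e : ι → PowerSeries ℂ) : eulerD A (cexp y e) =
      (∑ i, PowerSeries.C (y i) * lft A (eulerD ℂ (e i))) * cexp y e := by
  rw [cexp, derivation_nilExp _ (isNilpotent_expSum hy e), map_sum]
  simp only [eulerD_C_mul_lft]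

lemma coeff_zero_cexp {ι : Type*} [Fintype ι] {y : ι → A} (hy : ∀ i, IsNilpotent (y i))
    {e : ι → PowerSeries ℂ} (he : ∀ i, PowerSeries.coeff 0 (e i) = 0) :
    PowerSeries.coeff 0 (cexp y e) = 1 := by
  have h : PowerSeries.X ^ 1 ∣ cexp y e - cexp y 0 := by
    refine cexp_sub_dvd hy fun i => ?_
    rw [Pi.zero_apply, sub_zero, pow_one, PowerSeries.X_dvd_iff,
      ← PowerSeries.coeff_zero_eq_constantCoeff_apply, he]
  have := PowerSeries.X_pow_dvd_iff.1 h 0 one_pos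
  rw [cexp_zero, map_sub, sub_eq_zero] at this
  rw [this]
  simp

lemma sum_fin_C_mul (y : ℕ → A) (e : ℕ → PowerSeries ℂ) (N m : ℕ) :
    PowerSeries.coeff m (∑ i : Fin N, PowerSeries.C (y i) * lft A (e i)) =
      ∑ j ∈ Finset.range N, PowerSeries.coeff m (e j) • y j := by
  rw [← Fin.sum_univ_eq_sum_range (fun j => PowerSeries.coeff m (e j) • y j), map_sum]
  refine Finset.sum_congr rfl fun i _ => ?_
  rw [PowerSeries.coeff_C_mul, coeff_lft, Algebra.smul_def, mul_comm]

/-- The series `∑ ch(Sᵏ) Xᵏ` is an exponential of traces: by Newton's identity both sides solve the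
same linear equation `X Y' = h Y` and have the same constant term. -/
lemma chSym_nilExp {F : Matrix (Fin r) (Fin r) A} {N : ℕ} (hF : F ^ (N + 1) = 0)
    (hy : ∀ j : Fin N, IsNilpotent (F ^ (j.val + 1)).trace) :
    PowerSeries.mk (chSym (nilExp F)) = PowerSeries.mk (chSym (1 : Matrix (Fin r) (Fin r) A)) *
      cexp (fun j : Fin N => (F ^ (j.val + 1)).trace) (fun j => expCoef j) := by
  refine eulerD_unique (h := posSeries fun i => ((nilExp F) ^ i).trace) (eulerD_chSym _) ?_ ?_ ?_
  · rw [Derivation.leibniz, eulerD_cexp hy, eulerD_chSym, smul_eq_mul, smul_eq_mul]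
    have : posSeries (fun i => ((nilExp F) ^ i).trace) =
        posSeries (fun i => ((1 : Matrix (Fin r) (Fin r) A) ^ i).trace) +
        ∑ i : Fin N, PowerSeries.C ((F ^ (i.val + 1)).trace) * lft A (eulerD ℂ (expCoef i)) := by
      ext m
      rw [map_add, coeff_posSeries, coeff_posSeries,
        sum_fin_C_mul (fun j => (F ^ (j + 1)).trace) (fun j => eulerD ℂ (expCoef j))]
      simp only [coeff_eulerD_expCoef]
      split_ifs with hm
      · simp
      · rw [trace_nilExp_pow hF]; simp
    rw [this]
    ring
  · rw [coeff_posSeries, if_pos rfl]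
  · rw [PowerSeries.coeff_zero_eq_constantCoeff_apply, PowerSeries.coeff_zero_eq_constantCoeff_apply,
      map_mul, ← PowerSeries.coeff_zero_eq_constantCoeff_apply (cexp _ _), coeff_zero_cexp hy]
    · simp [coeff_zero_chSym]
    · intro i
      rw [expCoef, PowerSeries.coeff_smul, coeff_polylog, if_pos rfl, smul_zero]

/-- The series `∑ ch(⋀ᵏ) Xᵏ` is an exponential of traces, by the same argument as for the symmetric
powers. -/
lemma chExt_nilExp {F : Matrix (Fin r) (Fin r) A} {N : ℕ} (hF : F ^ (N + 1) = 0)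
    (hy : ∀ j : Fin N, IsNilpotent (F ^ (j.val + 1)).trace) :
    PowerSeries.mk (chExt (nilExp F)) = PowerSeries.mk (chExt (1 : Matrix (Fin r) (Fin r) A)) *
      cexp (fun j : Fin N => (F ^ (j.val + 1)).trace)
        (fun j => -twist ℂ (-1) 1 one_ne_zero (expCoef j)) := by
  refine eulerD_unique (h := posSeries fun i => (-1) ^ (i - 1) * ((nilExp F) ^ i).trace)
    (eulerD_chExt _) ?_ ?_ ?_
  · rw [Derivation.leibniz, eulerD_cexp hy, eulerD_chExt, smul_eq_mul, smul_eq_mul]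
    have h2 : ∀ j m, PowerSeries.coeff m (eulerD ℂ (-twist ℂ (-1) 1 one_ne_zero (expCoef j))) =
        if m = 0 then 0 else
          (-1) ^ (m - 1) * (((j + 1).factorial : ℂ)⁻¹ * (m : ℂ) ^ (j + 1)) := by
      intro j m
      have h := coeff_eulerD_expCoef j m
      rw [coeff_eulerD] at h
      rw [coeff_eulerD, map_neg, coeff_twist, if_pos (one_dvd _), Nat.div_one, Int.cast_neg,
        Int.cast_one, mul_neg, mul_left_comm, h]
      split_ifs with hm
      · simp
      · obtain ⟨m, rfl⟩ := Nat.exists_eq_succ_of_ne_zero hm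
        rw [Nat.succ_sub_one, Nat.succ_eq_add_one, pow_succ (-1 : ℂ) m]
        ring
    have : posSeries (fun i => (-1) ^ (i - 1) * ((nilExp F) ^ i).trace) =
        posSeries (fun i => (-1) ^ (i - 1) * ((1 : Matrix (Fin r) (Fin r) A) ^ i).trace) +
        ∑ i : Fin N, PowerSeries.C ((F ^ (i.val + 1)).trace) *
          lft A (eulerD ℂ (-twist ℂ (-1) 1 one_ne_zero (expCoef i))) := by
      ext m
      rw [map_add, coeff_posSeries, coeff_posSeries, sum_fin_C_mul (fun j => (F ^ (j + 1)).trace)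
        (fun j => eulerD ℂ (-twist ℂ (-1) 1 one_ne_zero (expCoef j)))]
      simp only [h2]
      split_ifs with hm
      · simp
      · rw [trace_nilExp_pow hF, mul_add, Finset.mul_sum]
        congr 1
        · simp
        · refine Finset.sum_congr rfl fun j _ => ?_
          rw [mul_smul ((-1 : ℂ) ^ (m - 1)), Algebra.smul_def ((-1 : ℂ) ^ (m - 1))]
          simp
    rw [this]
    ring
  · rw [coeff_posSeries, if_pos rfl]
  · rw [PowerSeries.coeff_zero_eq_constantCoeff_apply, PowerSeries.coeff_zero_eq_constantCoeff_apply,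
      map_mul, ← PowerSeries.coeff_zero_eq_constantCoeff_apply (cexp _ _), coeff_zero_cexp hy]
    · simp [coeff_zero_chExt]
    · intro i
      rw [map_neg, coeff_twist, expCoef, PowerSeries.coeff_smul]
      simp [coeff_polylog]

end TraceSeries

/-! ### Chern characters of tensor powers as exponentials -/

section ClosedForms

variable {A : Type*} [CommRing A] [Algebra ℂ A] {r : ℕ}

/-- The traces of the even powers `F^2, F^4, …, F^{2M}`. -/
def evenTr (M : ℕ) (F : Matrix (Fin r) (Fin r) A) (m : Fin M) : A := (F ^ (2 * (m.val + 1))).trace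

/-- The algebraic properties of the curvature of a metric connection at a point, in an orthonormal
frame: the matrix `F` is skew symmetric, `F^{2M+1} = 0`, and the traces of its powers are nilpotent.
-/
structure IsCurv (M : ℕ) (F : Matrix (Fin r) (Fin r) A) : Prop where
  skew : F.transpose = -F
  pow : F ^ (2 * M + 1) = 0
  nil : ∀ j, IsNilpotent (F ^ (j + 1)).trace

variable {M : ℕ} {F : Matrix (Fin r) (Fin r) A}

/-- A skew symmetric matrix and its transpose have the same traces of powers, so that those of odd
order vanish. -/
lemma IsCurv.trace_odd (h : IsCurv M F) (j : ℕ) : (F ^ (2 * j + 1)).trace = 0 := by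
  have h1 : (F ^ (2 * j + 1)).trace = -(F ^ (2 * j + 1)).trace := by
    conv_lhs => rw [← Matrix.trace_transpose, Matrix.transpose_pow, h.skew,
      Odd.neg_pow ⟨j, rfl⟩, Matrix.trace_neg]
  have h2 : ((2 : ℕ) : A) * (F ^ (2 * j + 1)).trace = ((2 : ℕ) : A) * 0 := by
    push_cast
    linear_combination h1
  exact natCast_mul_cancel two_ne_zero h2

lemma IsCurv.nil' (h : IsCurv M F) (m : Fin M) : IsNilpotent (evenTr M F m) := h.nil _

lemma IsCurv.cexp_eq (h : IsCurv M F) (e : ℕ → PowerSeries ℂ) :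
    cexp (fun j : Fin (2 * M) => (F ^ (j.val + 1)).trace) (fun j => e j) =
      cexp (evenTr M F) fun m => e (2 * m + 1) := by
  rw [cexp, cexp]
  congr 1
  rw [Fin.sum_univ_eq_sum_range fun j => PowerSeries.C ((F ^ (j + 1)).trace) * lft A (e j)]
  have h1 : ∀ K, ∑ j ∈ Finset.range (2 * K), PowerSeries.C ((F ^ (j + 1)).trace) * lft A (e j) =
      ∑ m ∈ Finset.range K, PowerSeries.C ((F ^ (2 * (m + 1))).trace) * lft A (e (2 * m + 1)) := by
    intro K
    induction K with
    | zero => simp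
    | succ K ih =>
      rw [mul_add, mul_one, Finset.sum_range_succ, Finset.sum_range_succ, ih,
        Finset.sum_range_succ, h.trace_odd, map_zero, zero_mul, add_zero]
      rfl
  rw [h1, ← Fin.sum_univ_eq_sum_range
    fun m => PowerSeries.C ((F ^ (2 * (m + 1))).trace) * lft A (e (2 * m + 1))]
  rfl

lemma mk_chExt_one : PowerSeries.mk (chExt (1 : Matrix (Fin r) (Fin r) A)) =
    (1 + PowerSeries.X) ^ r := by
  have h : Matrix.det (1 + (Polynomial.X : Polynomial A) •
      (1 : Matrix (Fin r) (Fin r) A).map Polynomial.C) = (1 + Polynomial.X) ^ r := by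
    have : (1 + (Polynomial.X : Polynomial A) • (1 : Matrix (Fin r) (Fin r) A).map Polynomial.C) =
        (1 + Polynomial.X : Polynomial A) • (1 : Matrix (Fin r) (Fin r) (Polynomial A)) := by
      rw [Matrix.map_one _ (map_zero _) (map_one _), add_smul, one_smul]
    rw [this, Matrix.det_smul, Matrix.det_one, mul_one, Fintype.card_fin]
  ext k
  rw [PowerSeries.coeff_mk, chExt_eq_coeff, h, ← Polynomial.coeff_coe]
  simp

lemma mk_chSym_one_mul : PowerSeries.mk (chSym (1 : Matrix (Fin r) (Fin r) A)) *
    (1 - PowerSeries.X) ^ r = 1 := by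
  set P : PowerSeries A := posSeries fun i => ((1 : Matrix (Fin r) (Fin r) A) ^ i).trace with hP
  have hX : eulerD A (1 - PowerSeries.X) = -PowerSeries.X := by
    ext m
    rw [coeff_eulerD, map_sub, map_neg, PowerSeries.coeff_one, PowerSeries.coeff_X]
    rcases m with _ | _ | m <;> simp
  have hPX : P * (1 - PowerSeries.X) = (r : PowerSeries A) * PowerSeries.X := by
    ext m
    rw [mul_sub, mul_one, map_sub, ← nsmul_eq_mul, map_nsmul, PowerSeries.coeff_X]
    rcases m with _ | _ | m
    · simp [hP, coeff_posSeries]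
    · rw [PowerSeries.coeff_succ_mul_X]; simp [hP, coeff_posSeries]
    · rw [PowerSeries.coeff_succ_mul_X]; simp [hP, coeff_posSeries]
  have hE : eulerD A ((1 - PowerSeries.X) ^ r) = -P * (1 - PowerSeries.X) ^ r := by
    rw [Derivation.leibniz_pow, hX]
    rcases r with _ | r
    · have : P = 0 := by
        ext m
        rw [hP, coeff_posSeries]
        simp [Matrix.trace]
      simp [this]
    · rw [Nat.add_sub_cancel, neg_mul, pow_succ' _ r, ← mul_assoc, hPX, nsmul_eq_mul, smul_eq_mul]
      ring
  refine eulerD_unique (h := 0) ?_ ?_ ?_ ?_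
  · rw [Derivation.leibniz, hE, eulerD_chSym, smul_eq_mul, smul_eq_mul]
    ring
  · rw [zero_mul, Derivation.map_one_eq_zero]
  · rw [map_zero]
  · simp [coeff_zero_chSym]

lemma chSRed_nilExp (h : IsCurv M F) (ε : ℤ) (d : ℕ) (hd : d ≠ 0) :
    chSRed ε d (nilExp F) =
      cexp (evenTr M F) fun m => twist ℂ ε d hd (expCoef (2 * m + 1)) := by
  rw [chSRed, chS, chLam, atPow_eq_twist _ _ hd, atPow_eq_twist _ _ hd, mk_chExt_one,
    chSym_nilExp h.pow fun j => h.nil _, h.cexp_eq expCoef, map_mul, twist_cexp h.nil',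
    mul_right_comm]
  have : twist A (-ε) d hd ((1 + PowerSeries.X) ^ r) = twist A ε d hd ((1 - PowerSeries.X) ^ r) := by
    rw [map_pow, map_pow, map_add, map_sub, twist_X, twist_X, map_one, map_one]
    push_cast
    ring
  rw [this, ← map_mul, mk_chSym_one_mul, map_one, one_mul]

lemma chLam_nilExp (h : IsCurv M F) (ε : ℤ) (d : ℕ) (hd : d ≠ 0) :
    chLam ε d (nilExp F) = (1 + (ε : PowerSeries A) * PowerSeries.X ^ d) ^ r *
      cexp (evenTr M F) fun m => -twist ℂ (-ε) d hd (expCoef (2 * m + 1)) := by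
  have hE := chExt_nilExp h.pow fun j => h.nil j
  rw [mk_chExt_one] at hE
  rw [chLam, atPow_eq_twist _ _ hd, hE,
    h.cexp_eq fun j => -twist ℂ (-1) 1 one_ne_zero (expCoef j), map_mul, twist_cexp h.nil', map_pow,
    map_add, map_one, twist_X]
  have ht : ∀ m : ℕ, twist ℂ ε d hd (-twist ℂ (-1) 1 one_ne_zero (expCoef (2 * m + 1))) =
      -twist ℂ (-ε) d hd (expCoef (2 * m + 1)) := by
    intro m
    rw [map_neg, twist_twist]
    exact congrArg _ (twist_congr _ _ (by rw [pow_one, neg_one_mul]) (mul_one d) _)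
  simp only [ht]

lemma chLamRed_nilExp (h : IsCurv M F) (ε : ℤ) (d : ℕ) (hd : d ≠ 0) :
    chLamRed ε d (nilExp F) =
      cexp (evenTr M F) fun m => -twist ℂ (-ε) d hd (expCoef (2 * m + 1)) := by
  rw [chLamRed, chLam_nilExp h ε d hd, chS, atPow_eq_twist _ _ hd, mul_right_comm]
  have : (1 + (ε : PowerSeries A) * PowerSeries.X ^ d) ^ r =
      twist A (-ε) d hd ((1 - PowerSeries.X) ^ r) := by
    rw [map_pow, map_sub, twist_X, map_one]
    push_cast
    ring
  rw [this, ← map_mul, mul_comm (_ ^ r), mk_chSym_one_mul, map_one, one_mul]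

end ClosedForms

section DivisorSums

/-- The series `∑_{N ≥ 1} σ_p(N) X^N = ∑_{n ≥ 1} ∑_{i ≥ 1} i^p X^{ni}`. -/
noncomputable def sigSeries (p : ℕ) : PowerSeries ℂ :=
  PowerSeries.mk fun j => (ArithmeticFunction.sigma p j : ℂ)

lemma coeff_zero_sigSeries (p : ℕ) : PowerSeries.coeff 0 (sigSeries p) = 0 := by
  simp [sigSeries]

lemma sigSeries_sub_dvd (p N : ℕ) : PowerSeries.X ^ N ∣
    sigSeries p - ∑ n ∈ Finset.range N, twist ℂ 1 (n + 1) n.succ_ne_zero (polylog p) := by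
  rw [PowerSeries.X_pow_dvd_iff]
  intro j hj
  rw [map_sub, sub_eq_zero, map_sum, sigSeries, PowerSeries.coeff_mk]
  rcases eq_or_ne j 0 with rfl | hj0
  · simp [coeff_twist, coeff_polylog]
  rw [ArithmeticFunction.sigma_apply, ← Nat.sum_div_divisors, Nat.cast_sum]
  have h1 : ∀ n, PowerSeries.coeff j (twist ℂ 1 (n + 1) n.succ_ne_zero (polylog p)) =
      if n + 1 ∣ j then (((j / (n + 1) : ℕ) ^ p : ℕ) : ℂ) else 0 := by
    intro n
    rw [coeff_twist, coeff_polylog]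
    by_cases h : n + 1 ∣ j
    · rw [if_pos h, if_pos h, if_neg (Nat.div_pos (Nat.le_of_dvd (Nat.pos_of_ne_zero hj0) h)
        n.succ_pos).ne']
      simp
    · rw [if_neg h, if_neg h]
  simp only [h1]
  rw [← Finset.sum_filter]
  refine (Finset.sum_bij (fun n _ => n + 1) ?_ ?_ ?_ ?_).symm
  · intro n hn
    exact Nat.mem_divisors.2 ⟨(Finset.mem_filter.1 hn).2, hj0⟩
  · intro a _ b _ h
    exact Nat.succ_injective h
  · intro d hd
    have hd1 := Nat.pos_of_mem_divisors hd
    have hd2 := Nat.divisor_le hd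
    exact ⟨d - 1, Finset.mem_filter.2 ⟨Finset.mem_range.2 (by omega),
      by rw [Nat.sub_add_cancel hd1]; exact Nat.dvd_of_mem_divisors hd⟩, Nat.sub_add_cancel hd1⟩
  · intro n _
    rfl

/-- The coefficients `s_{2j}(X)/(2j)!`, `j = m + 1`, where `s_{2j} = ∑ σ_{2j-1}(N) X^N`. -/
noncomputable def sigCoef (m : ℕ) : PowerSeries ℂ :=
  ((2 * m + 2).factorial : ℂ)⁻¹ • sigSeries (2 * m + 1)

lemma sigCoef_sub_dvd (m N : ℕ) : PowerSeries.X ^ N ∣ sigCoef m -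
    ∑ n ∈ Finset.range N, twist ℂ 1 (n + 1) n.succ_ne_zero (expCoef (2 * m + 1)) := by
  have h : sigCoef m - ∑ n ∈ Finset.range N, twist ℂ 1 (n + 1) n.succ_ne_zero (expCoef (2 * m + 1)) =
      ((2 * m + 2).factorial : ℂ)⁻¹ • (sigSeries (2 * m + 1) -
        ∑ n ∈ Finset.range N, twist ℂ 1 (n + 1) n.succ_ne_zero (polylog (2 * m + 1))) := by
    rw [smul_sub, Finset.smul_sum]
    congr 1
    refine Finset.sum_congr rfl fun n _ => ?_
    rw [expCoef, map_smul]
  rw [h, PowerSeries.smul_eq_C_mul]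
  exact (sigSeries_sub_dvd _ _).mul_left _

/-- The exponents of the factors with `t = z^{2(n+1)}`, `n ≥ 0`, add up to `s(z²)` with `s = sigCoef
m`. -/
lemma even_sub_dvd (m N : ℕ) : PowerSeries.X ^ N ∣ twist ℂ 1 2 two_ne_zero (sigCoef m) -
    ∑ n ∈ Finset.range N, twist ℂ 1 (2 * (n + 1)) (by omega) (expCoef (2 * m + 1)) := by
  have := twist_dvd (ε := 1) two_ne_zero (sigCoef_sub_dvd m N)
  rw [map_sub, map_sum] at this
  simp only [twist_twist, one_pow, mul_one] at this
  exact (pow_dvd_pow _ (by omega)).trans this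

/-- The exponents of the factors with `t = z^{2n+1}`, `n ≥ 0`, add up to `s(z) - s(z²)` with `s =
sigCoef m`: remove the even ones from all of them. -/
lemma odd_sub_dvd (m N : ℕ) : PowerSeries.X ^ N ∣ sigCoef m - twist ℂ 1 2 two_ne_zero (sigCoef m) -
    ∑ n ∈ Finset.range N, twist ℂ 1 (2 * n + 1) (by omega) (expCoef (2 * m + 1)) := by
  have h1 : ∀ K, ∑ n ∈ Finset.range (2 * K), twist ℂ 1 (n + 1) n.succ_ne_zero (expCoef (2 * m + 1)) =
      ∑ n ∈ Finset.range K, twist ℂ 1 (2 * n + 1) (by omega) (expCoef (2 * m + 1)) +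
      ∑ n ∈ Finset.range K, twist ℂ 1 (2 * (n + 1)) (by omega) (expCoef (2 * m + 1)) := by
    intro K
    induction K with
    | zero => simp
    | succ K ih =>
      rw [mul_add, mul_one, Finset.sum_range_succ, Finset.sum_range_succ, ih,
        Finset.sum_range_succ, Finset.sum_range_succ]
      abel
  have h2 := sigCoef_sub_dvd m (2 * N)
  rw [h1] at h2
  have h3 := dvd_sub ((pow_dvd_pow _ (by omega : N ≤ 2 * N)).trans h2) (even_sub_dvd m N)
  convert h3 using 1
  ring

/-- The exponents of the factors with `t = -z^{2n+1}`, `n ≥ 0`, add up to `s(-z) - s(z²)` with `s =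
sigCoef m`. -/
lemma odd_neg_sub_dvd (m N : ℕ) : PowerSeries.X ^ N ∣ twist ℂ (-1) 1 one_ne_zero (sigCoef m) -
    twist ℂ 1 2 two_ne_zero (sigCoef m) -
    ∑ n ∈ Finset.range N, twist ℂ (-1) (2 * n + 1) (by omega) (expCoef (2 * m + 1)) := by
  have := twist_dvd (ε := -1) one_ne_zero (odd_sub_dvd m N)
  rw [map_sub, map_sub, map_sum, one_mul, twist_twist] at this
  rw [twist_congr (ε := (1 * (-1) ^ 2)) (ε' := 1) (d := 1 * 2) (d' := 2) (by omega) two_ne_zero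
    (by norm_num) (by norm_num)] at this
  have hs : ∀ n : ℕ, twist ℂ (-1) 1 one_ne_zero
      (twist ℂ 1 (2 * n + 1) (by omega) (expCoef (2 * m + 1))) =
      twist ℂ (-1) (2 * n + 1) (by omega) (expCoef (2 * m + 1)) := by
    intro n
    rw [twist_twist]
    exact twist_congr _ _ (by rw [one_mul, Odd.neg_one_pow ⟨n, rfl⟩]) (by omega) _
  simpa only [hs] using this

/-- The distribution relation `L(-x) + L(x) = 2^{p+1} L(x²)` for `L = polylog p`. -/
lemma twist_neg_polylog (p d : ℕ) (hd : d ≠ 0) : twist ℂ (-1) d hd (polylog p) =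
    (2 : ℂ) ^ (p + 1) • twist ℂ 1 (2 * d) (by omega) (polylog p) - twist ℂ 1 d hd (polylog p) := by
  have h1 : twist ℂ (-1) 1 one_ne_zero (polylog p) =
      (2 : ℂ) ^ (p + 1) • twist ℂ 1 2 two_ne_zero (polylog p) - polylog p := by
    ext i
    rw [map_sub, PowerSeries.coeff_smul, coeff_twist, coeff_twist, coeff_polylog, coeff_polylog,
      coeff_polylog, if_pos (one_dvd _), Nat.div_one]
    rcases Nat.even_or_odd' i with ⟨k, rfl | rfl⟩
    · rcases eq_or_ne k 0 with rfl | hk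
      · simp
      · have h2 : (2 : ℕ) * k / 2 = k := by omega
        rw [if_pos (dvd_mul_right _ _), h2, if_neg hk, if_neg (by omega), pow_mul]
        push_cast
        rw [smul_eq_mul, mul_pow]
        ring
    · have h3 : ¬ 2 ∣ 2 * k + 1 := by omega
      rw [if_neg h3, if_neg (by omega), pow_succ, pow_mul]
      simp
  have h2 := congrArg (twist ℂ 1 d hd) h1
  rw [map_sub, map_smul, twist_twist, twist_twist] at h2
  have h3 : twist ℂ (-1) d hd (polylog p) = twist ℂ (-1 * 1 ^ 1) (d * 1) (by omega) (polylog p) :=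
    twist_congr _ _ (by norm_num) (by omega) _
  have h4 : twist ℂ 1 (2 * d) (by omega) (polylog p) =
      twist ℂ (1 * 1 ^ 2) (d * 2) (by omega) (polylog p) :=
    twist_congr _ _ (by norm_num) (by omega) _
  rw [h3, h4]
  exact h2

/-- The exponents of the factors with `t = -z^{2(n+1)}`, `n ≥ 0`, add up to `2^{2m+2} s(z⁴) - s(z²)`
with `s = sigCoef m`. -/
lemma even_neg_sub_dvd (m N : ℕ) : PowerSeries.X ^ N ∣
    (2 : ℂ) ^ (2 * m + 2) • twist ℂ 1 4 four_ne_zero (sigCoef m) -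
      twist ℂ 1 2 two_ne_zero (sigCoef m) -
    ∑ n ∈ Finset.range N, twist ℂ (-1) (2 * (n + 1)) (by omega) (expCoef (2 * m + 1)) := by
  have h1 : ∀ n : ℕ, twist ℂ (-1) (2 * (n + 1)) (by omega) (expCoef (2 * m + 1)) =
      (2 : ℂ) ^ (2 * m + 2) • twist ℂ 1 2 two_ne_zero
        (twist ℂ 1 (2 * (n + 1)) (by omega) (expCoef (2 * m + 1))) -
      twist ℂ 1 (2 * (n + 1)) (by omega) (expCoef (2 * m + 1)) := by
    intro n
    have h0 : twist ℂ 1 2 two_ne_zero (twist ℂ 1 (2 * (n + 1)) (by omega) (polylog (2 * m + 1))) =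
        twist ℂ 1 (2 * (2 * (n + 1))) (by omega) (polylog (2 * m + 1)) := by
      rw [twist_twist]
      exact twist_congr _ _ (by simp) rfl _
    rw [expCoef, map_smul, map_smul, map_smul, twist_neg_polylog, smul_sub, h0, smul_comm]
  simp only [h1]
  rw [Finset.sum_sub_distrib, ← Finset.smul_sum, ← map_sum]
  have h2 := twist_dvd (ε := 1) two_ne_zero (even_sub_dvd m N)
  rw [map_sub, twist_twist] at h2
  have h3 := dvd_sub (((pow_dvd_pow _ (by omega : N ≤ 2 * N)).trans h2).mul_left
    (PowerSeries.C ((2 : ℂ) ^ (2 * m + 2)))) (even_sub_dvd m N)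
  rw [← PowerSeries.smul_eq_C_mul, smul_sub] at h3
  rw [twist_congr (ε := 1) (ε' := 1 * 1 ^ 2) (d := 4) (d' := 2 * 2) four_ne_zero (by omega)
    (by norm_num) (by norm_num)]
  convert h3 using 1
  abel

end DivisorSums

/-! ### Determinants of functions of a nilpotent matrix -/

section NilEntries

variable {A : Type*} [CommRing A] {ι : Type*} [Fintype ι] [DecidableEq ι]

lemma matrix_pow_mem {I : Ideal A} {F : Matrix ι ι A} (h : ∀ i j, F i j ∈ I) (k : ℕ) (i j : ι) :
    (F ^ k) i j ∈ I ^ k := by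
  induction k generalizing i j with
  | zero => simp
  | succ k ih =>
    rw [pow_succ, pow_succ, Matrix.mul_apply]
    exact Ideal.sum_mem _ fun a _ => Ideal.mul_mem_mul (ih _ _) (h _ _)

lemma matrix_pow_eq_zero {I : Ideal A} {N : ℕ} (hI : I ^ N = ⊥) {F : Matrix ι ι A}
    (h : ∀ i j, F i j ∈ I) : F ^ N = 0 := by
  ext i j
  have := matrix_pow_mem h N i j
  rwa [hI, Ideal.mem_bot] at this

lemma matrix_isNilpotent {F : Matrix ι ι A} (h : ∀ i j, IsNilpotent (F i j)) : IsNilpotent F := by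
  set I : Ideal A := Ideal.span (Set.range fun p : ι × ι => F p.1 p.2) with hI
  have hle : I ≤ nilradical A := by
    rw [hI, Ideal.span_le]
    rintro _ ⟨p, rfl⟩
    exact h _ _
  obtain ⟨N, hN⟩ := (Ideal.FG.isNilpotent_iff_le_nilradical
    (Submodule.fg_span (Set.finite_range _))).2 hle
  exact ⟨N, matrix_pow_eq_zero hN fun i j => Ideal.subset_span ⟨(i, j), rfl⟩⟩

lemma trace_pow_isNilpotent {F : Matrix ι ι A} (h : ∀ i j, IsNilpotent (F i j)) (j : ℕ) :
    IsNilpotent (F ^ (j + 1)).trace := by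
  refine isNilpotent_sum fun i _ => ?_
  have := matrix_pow_mem (I := nilradical A) (fun i j => mem_nilradical.2 (h i j)) (j + 1) i i
  exact mem_nilradical.1 (Ideal.pow_le_self j.succ_ne_zero this)

end NilEntries

section Scaled

open Polynomial

variable {A : Type*} [CommRing A] [Algebra ℂ A] {ι : Type*} [Fintype ι] [DecidableEq ι]

/-- The matrix `s F` over `A[s]`; identities for `F` are proved by differentiating in `s`. -/
noncomputable def scaled (F : Matrix ι ι A) : Matrix ι ι A[X] := (X : A[X]) • F.map C

lemma scaled_pow (F : Matrix ι ι A) (j : ℕ) :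
    scaled F ^ j = (X ^ j : A[X]) • (F ^ j).map C := by
  rw [scaled, _root_.smul_pow, ← RingHom.mapMatrix_apply, ← RingHom.mapMatrix_apply, map_pow]

lemma scaled_pow_eq_zero {F : Matrix ι ι A} {N : ℕ} (hF : F ^ N = 0) : scaled F ^ N = 0 := by
  rw [scaled_pow, hF, Matrix.map_zero _ C_0, smul_zero]

lemma trace_scaled_pow (F : Matrix ι ι A) (j : ℕ) :
    (scaled F ^ j).trace = X ^ j * C ((F ^ j).trace) := by
  rw [scaled_pow, Matrix.trace_smul, smul_eq_mul]
  congr 1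
  simp [Matrix.trace, map_sum]

lemma eulerP_X_pow_mul_C (j : ℕ) (a : A) :
    eulerP A (X ^ j * C a) = (j : ℂ) • (X ^ j * C a) := by
  change X * derivative (X ^ j * C a) = _
  rw [derivative_mul, derivative_C, mul_zero, add_zero, derivative_X_pow, Nat.cast_smul_eq_nsmul,
    nsmul_eq_mul]
  cases j with
  | zero => simp
  | succ j => rw [Nat.add_sub_cancel, map_natCast, pow_succ]; ring

lemma map_eulerP_evNil (F : Matrix ι ι A) (N : ℕ) (f : PowerSeries ℂ) :
    (evNil N (scaled F) f).map (eulerP A) = evNil N (scaled F) (eulerD ℂ f) := by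
  ext1 a b
  rw [Matrix.map_apply, evNil, evNil, Matrix.sum_apply, Matrix.sum_apply, map_sum]
  refine Finset.sum_congr rfl fun j _ => ?_
  rw [Matrix.smul_apply, Matrix.smul_apply, scaled_pow, Matrix.smul_apply, Matrix.map_apply,
    smul_eq_mul, Derivation.map_smul, eulerP_X_pow_mul_C, smul_smul, coeff_eulerD, mul_comm]

lemma trace_evNil_scaled (F : Matrix ι ι A) (N : ℕ) {K : PowerSeries ℂ}
    (hK : PowerSeries.coeff 0 K = 0) : (evNil (N + 1) (scaled F) K).trace =
      ∑ j ∈ Finset.range N, PowerSeries.coeff (j + 1) K • (X ^ (j + 1) * C ((F ^ (j + 1)).trace)) := by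
  rw [evNil, Matrix.trace_sum, Finset.sum_range_succ', hK, zero_smul, Matrix.trace_zero, add_zero]
  refine Finset.sum_congr rfl fun j _ => ?_
  rw [Matrix.trace_smul, trace_scaled_pow]

/-- Evaluation of polynomials, as a homomorphism of complex algebras. -/
noncomputable def evalC (a : A) : A[X] →ₐ[ℂ] A := (aeval a : A[X] →ₐ[A] A).restrictScalars ℂ

lemma evalC_apply (a : A) (p : A[X]) : evalC a p = p.eval a := by
  change aeval a p = _
  rw [coe_aeval_eq_eval]

lemma mapMatrix_evalC_scaled (a : A) (F : Matrix ι ι A) :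
    (evalC a).mapMatrix (scaled F) = a • F := by
  ext i j
  rw [AlgHom.mapMatrix_apply, Matrix.map_apply, evalC_apply, scaled]
  simp
  rw [mul_comm]

/-- A function of the scaling parameter with logarithmic derivative `∑ K_j s^j tr F^j` is determined
by its value at `s = 0`. -/
lemma eval_one_eq_nilExp {F : Matrix ι ι A} (N : ℕ) (K : PowerSeries ℂ)
    (hnil : ∀ j, IsNilpotent (F ^ (j + 1)).trace) {Y : A[X]}
    (hY : eulerP A Y = (∑ j ∈ Finset.range N,
      PowerSeries.coeff (j + 1) K • (X ^ (j + 1) * C ((F ^ (j + 1)).trace))) * Y) :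
    Y.eval 1 = Y.eval 0 * nilExp (∑ j ∈ Finset.range N,
      (PowerSeries.coeff (j + 1) K / (j + 1 : ℕ)) • (F ^ (j + 1)).trace) := by
  set h := ∑ j ∈ Finset.range N,
      PowerSeries.coeff (j + 1) K • (X ^ (j + 1) * C ((F ^ (j + 1)).trace)) with hh
  set E := ∑ j ∈ Finset.range N,
      (PowerSeries.coeff (j + 1) K / (j + 1 : ℕ)) • (X ^ (j + 1) * C ((F ^ (j + 1)).trace)) with hE
  have hnE : IsNilpotent E := by
    refine isNilpotent_sum fun j _ => ?_
    exact ((Commute.all _ _).isNilpotent_mul_left ((hnil j).map C)).smul _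
  have hDE : eulerP A E = h := by
    rw [hE, hh, map_sum]
    refine Finset.sum_congr rfl fun j _ => ?_
    rw [Derivation.map_smul, eulerP_X_pow_mul_C, smul_smul,
      div_mul_cancel₀ _ (Nat.cast_ne_zero.2 j.succ_ne_zero)]
  have hev : ∀ a : A, evalC a E = ∑ j ∈ Finset.range N,
      (PowerSeries.coeff (j + 1) K / (j + 1 : ℕ)) • (a ^ (j + 1) * (F ^ (j + 1)).trace) := by
    intro a
    rw [hE, map_sum]
    refine Finset.sum_congr rfl fun j _ => ?_
    rw [map_smul, evalC_apply]
    simp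
    rw [mul_comm]
  have hval : ∀ a : A, (C (Y.eval 0) * nilExp E).eval a = Y.eval 0 * nilExp (evalC a E) := by
    intro a
    rw [eval_mul, eval_C, ← evalC_apply a (nilExp E), map_nilExp _ hnE]
  -- both sides have the logarithmic derivative `h` and the same value at `s = 0`
  have hYE : Y = C (Y.eval 0) * nilExp E := by
    refine eulerP_unique (h := h) hY ?_ ?_ ?_
    · have hC : eulerP A (C (Y.eval 0)) = 0 := by
        change X * derivative (C (Y.eval 0)) = 0
        rw [derivative_C, mul_zero]
      rw [Derivation.leibniz, derivation_nilExp _ hnE, hDE, hC]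
      simp only [smul_eq_mul]
      ring
    · rw [hh, finsetSum_coeff]
      refine Finset.sum_eq_zero fun j _ => ?_
      rw [coeff_smul, pow_succ', mul_assoc, coeff_X_mul_zero, smul_zero]
    · rw [coeff_zero_eq_eval_zero, coeff_zero_eq_eval_zero, hval, hev]
      simp [nilExp_zero]
  conv_lhs => rw [hYE]
  rw [hval, hev]
  simp

/-- `det f(F) = exp tr log f(F)`, where `K = x (log f)'`: the determinant of `f(sF)` has the
logarithmic derivative `tr K(sF)` in the parameter `s`. -/
lemma det_evNil {F : Matrix ι ι A} {N : ℕ} (hF : F ^ (N + 1) = 0)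
    (hnil : ∀ j, IsNilpotent (F ^ (j + 1)).trace) {f K : PowerSeries ℂ}
    (hf : eulerD ℂ f = K * f) (hf0 : PowerSeries.coeff 0 f = 1) (hK : PowerSeries.coeff 0 K = 0) :
    (evNil (N + 1) F f).det = nilExp (∑ j ∈ Finset.range N,
      (PowerSeries.coeff (j + 1) K / (j + 1 : ℕ)) • (F ^ (j + 1)).trace) := by
  have hs := scaled_pow_eq_zero hF
  set M := evNil (N + 1) (scaled F) f with hM
  have hev : ∀ a : A, M.det.eval a = (evNil (N + 1) (a • F) f).det := by
    intro a
    rw [← evalC_apply, AlgHom.map_det, hM, map_evNil, mapMatrix_evalC_scaled]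
  have h := eval_one_eq_nilExp (F := F) N K hnil (Y := M.det) ?_
  · rw [hev, hev, one_smul, zero_smul] at h
    rw [h]
    have : evNil (N + 1) (0 : Matrix ι ι A) f = 1 := by
      rw [evNil, Finset.sum_range_succ']
      simp [hf0, -PowerSeries.coeff_zero_eq_constantCoeff]
    rw [this, Matrix.det_one, one_mul]
  · rw [derivation_det, hM, map_eulerP_evNil, hf, evNil_mul hs, ← hM, ← trace_evNil_scaled F N hK,
      Matrix.trace_mul_comm, mul_assoc, Matrix.mul_adjugate, Matrix.mul_smul, mul_one,
      Matrix.trace_smul, smul_eq_mul, mul_comm]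

end Scaled

/-! ### The trace of the spinor representation -/

section Gamma

variable {m : ℕ}

/-- Changing the sign in position `j`. The basis of the spinor module is indexed by sequences of
signs. -/
def flip (j : Fin m) (s : Fin m → Bool) : Fin m → Bool := Function.update s j (!s j)

/-- The nonzero entry of `gamma m j b` in the row `s`. -/
noncomputable def gammaCoef (j : Fin m) (b : Bool) (s : Fin m → Bool) : ℂ :=
  (∏ i ∈ Finset.univ.filter (· < j), if s i then (-1 : ℂ) else 1) *
    (if b then (if s j then Complex.I else -Complex.I) else 1)

lemma gamma_apply (j : Fin m) (b : Bool) (s t : Fin m → Bool) :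
    gamma m j b s t = if t = flip j s then gammaCoef j b s else 0 := rfl

lemma gamma_mul_apply (j : Fin m) (b : Bool) (N : Matrix (Fin m → Bool) (Fin m → Bool) ℂ)
    (s u : Fin m → Bool) : (gamma m j b * N) s u = gammaCoef j b s * N (flip j s) u := by
  rw [Matrix.mul_apply, Finset.sum_eq_single (flip j s)]
  · rw [gamma, Matrix.of_apply, flip, if_pos rfl]; rfl
  · intro t _ ht
    rw [gamma_apply, if_neg ht, zero_mul]
  · simp

lemma flip_flip (j : Fin m) (s : Fin m → Bool) : flip j (flip j s) = s := by
  simp [flip]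

lemma flip_comm (j j' : Fin m) (s : Fin m → Bool) : flip j (flip j' s) = flip j' (flip j s) := by
  rcases eq_or_ne j j' with rfl | h
  · rfl
  · rw [flip, flip, flip, flip, Function.update_of_ne h, Function.update_of_ne h.symm,
      Function.update_comm h]

lemma gammaCoef_flip_self (j : Fin m) (b b' : Bool) (s : Fin m → Bool) :
    gammaCoef j b s * gammaCoef j b' (flip j s) + gammaCoef j b' s * gammaCoef j b (flip j s) =
      if b = b' then 2 else 0 := by
  have h1 : ∏ i ∈ Finset.univ.filter (· < j), (if flip j s i then (-1 : ℂ) else 1) =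
      ∏ i ∈ Finset.univ.filter (· < j), if s i then (-1 : ℂ) else 1 := by
    refine Finset.prod_congr rfl fun i hi => ?_
    rw [flip, Function.update_of_ne (Finset.mem_filter.1 hi).2.ne]
  have h2 : (∏ i ∈ Finset.univ.filter (· < j), if s i then (-1 : ℂ) else 1) *
      (∏ i ∈ Finset.univ.filter (· < j), if s i then (-1 : ℂ) else 1) = 1 := by
    rw [← Finset.prod_mul_distrib]
    exact Finset.prod_eq_one fun i _ => by split_ifs <;> norm_num
  have h3 : flip j s j = !s j := by simp [flip]
  simp only [gammaCoef, h1, h3]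
  have h4 : ∀ x y z w : ℂ, ((∏ i ∈ Finset.univ.filter (· < j), if s i then (-1 : ℂ) else 1) * x) *
      ((∏ i ∈ Finset.univ.filter (· < j), if s i then (-1 : ℂ) else 1) * y) +
      ((∏ i ∈ Finset.univ.filter (· < j), if s i then (-1 : ℂ) else 1) * z) *
      ((∏ i ∈ Finset.univ.filter (· < j), if s i then (-1 : ℂ) else 1) * w) = x * y + z * w := by
    intro x y z w
    linear_combination (x * y + z * w) * h2
  rw [h4]
  have hI := Complex.I_mul_I
  cases b <;> cases b' <;> cases s j <;> simp <;> norm_num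

lemma gammaCoef_flip_of_lt {j j' : Fin m} (h : j < j') (b b' : Bool) (s : Fin m → Bool) :
    gammaCoef j b s * gammaCoef j' b' (flip j s) +
      gammaCoef j' b' s * gammaCoef j b (flip j' s) = 0 := by
  have h1 : gammaCoef j b (flip j' s) = gammaCoef j b s := by
    have : ∏ i ∈ Finset.univ.filter (· < j), (if flip j' s i then (-1 : ℂ) else 1) =
        ∏ i ∈ Finset.univ.filter (· < j), if s i then (-1 : ℂ) else 1 := by
      refine Finset.prod_congr rfl fun i hi => ?_
      rw [flip, Function.update_of_ne ((Finset.mem_filter.1 hi).2.trans h).ne]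
    rw [gammaCoef, gammaCoef, this, flip, Function.update_of_ne h.ne]
  have h2 : gammaCoef j' b' (flip j s) = -gammaCoef j' b' s := by
    have hj : j ∈ Finset.univ.filter (· < j') := by simp [h]
    have : ∏ i ∈ Finset.univ.filter (· < j'), (if flip j s i then (-1 : ℂ) else 1) =
        -∏ i ∈ Finset.univ.filter (· < j'), if s i then (-1 : ℂ) else 1 := by
      rw [← Finset.mul_prod_erase _ _ hj, ← Finset.mul_prod_erase _ _ hj, ← neg_mul]
      congr 1
      · simp only [flip, Function.update_self]
        cases s j <;> simp
      · refine Finset.prod_congr rfl fun i hi => ?_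
        rw [flip, Function.update_of_ne (Finset.ne_of_mem_erase hi)]
    rw [gammaCoef, gammaCoef, this, flip, Function.update_of_ne h.ne', neg_mul]
  rw [h1, h2]
  ring

/-- The Clifford relations. -/
lemma gamma_anticomm (j j' : Fin m) (b b' : Bool) :
    gamma m j b * gamma m j' b' + gamma m j' b' * gamma m j b =
      (if j = j' ∧ b = b' then (2 : ℂ) else 0) • 1 := by
  ext s u
  rw [Matrix.add_apply, gamma_mul_apply, gamma_mul_apply, gamma_apply, gamma_apply,
    flip_comm j' j, Matrix.smul_apply, Matrix.one_apply, smul_eq_mul, mul_ite, mul_ite, mul_ite,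
    mul_zero, mul_zero, mul_one, mul_zero]
  rcases lt_trichotomy j j' with h | rfl | h
  · have hn : ¬ (j = j' ∧ b = b') := fun h' => h.ne h'.1
    simp only [if_neg hn, ite_self]
    split_ifs
    · rw [gammaCoef_flip_of_lt h]
    · simp
  · rw [flip_flip]
    by_cases hu : u = s
    · subst hu
      rw [if_pos rfl, if_pos rfl, if_pos rfl, gammaCoef_flip_self]
      simp
    · rw [if_neg hu, if_neg hu, if_neg fun h => hu h.symm, add_zero]
  · have hn : ¬ (j = j' ∧ b = b') := fun h' => h.ne h'.1.symm
    simp only [if_neg hn, ite_self]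
    split_ifs
    · rw [add_comm, gammaCoef_flip_of_lt h]
    · simp

lemma clif_anticomm (l : ℕ) (a b : Fin (16 * l)) :
    clif l a * clif l b + clif l b * clif l a = if a = b then 2 else 0 := by
  have h2 : (2 : ℂ) • (1 : Matrix (Fin (8 * l) → Bool) (Fin (8 * l) → Bool) ℂ) = 2 := by
    rw [two_smul, one_add_one_eq_two]
  rw [clif, clif, gamma_anticomm, ite_smul, zero_smul, h2]
  refine if_congr ?_ rfl rfl
  rw [Fin.mk.injEq, Fin.ext_iff]
  constructor
  · rintro ⟨h1, h2⟩
    have h3 : (a.1 % 2 = 1 ↔ b.1 % 2 = 1) := by simpa using Bool.eq_iff_iff.1 h2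
    omega
  · intro h
    rw [h]; exact ⟨rfl, rfl⟩

end Gamma

section Clifford

open Kronecker

variable {B : Type*} [CommRing B] [Algebra ℂ B] {ι S : Type*} [Fintype ι] [DecidableEq ι]
  [Fintype S] [DecidableEq S]

/-- The element `¼ ∑ F_{ab} c_a c_b` of the Clifford algebra, the image of the skew matrix `F` under
the isomorphism `so(r) ≅ spin(r)`. -/
noncomputable def cliffordLift (F : Matrix ι ι B) (c : ι → Matrix S S B) : Matrix S S B :=
  ∑ a, ∑ b, ((1 / 4 : ℂ) • F a b) • (c a * c b)

/-- The algebra homomorphism `M ↦ M ⊗ 1`. -/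
noncomputable def kronLeft (ι : Type*) [Fintype ι] [DecidableEq ι] :
    Matrix S S B →ₐ[ℂ] Matrix (S × ι) (S × ι) B where
  toFun M := M ⊗ₖ (1 : Matrix ι ι B)
  map_one' := by simp
  map_mul' M N := by rw [← Matrix.mul_kronecker_mul, one_mul]
  map_zero' := by simp
  map_add' M N := by rw [Matrix.add_kronecker]
  commutes' r := by
    rw [Algebra.algebraMap_eq_smul_one, Algebra.algebraMap_eq_smul_one, Matrix.smul_kronecker]
    simp

/-- The algebra homomorphism `M ↦ 1 ⊗ M`. -/
noncomputable def kronRight (S : Type*) [Fintype S] [DecidableEq S] :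
    Matrix ι ι B →ₐ[ℂ] Matrix (S × ι) (S × ι) B where
  toFun M := (1 : Matrix S S B) ⊗ₖ M
  map_one' := by simp
  map_mul' M N := by rw [← Matrix.mul_kronecker_mul, one_mul]
  map_zero' := by simp
  map_add' M N := by rw [Matrix.kronecker_add]
  commutes' r := by
    rw [Algebra.algebraMap_eq_smul_one, Algebra.algebraMap_eq_smul_one, Matrix.kronecker_smul]
    simp

lemma kron_commute (M : Matrix S S B) (N : Matrix ι ι B) :
    Commute (kronLeft ι M) (kronRight S N) := by
  change M ⊗ₖ 1 * 1 ⊗ₖ N = 1 ⊗ₖ N * M ⊗ₖ 1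
  rw [← Matrix.mul_kronecker_mul, ← Matrix.mul_kronecker_mul]
  simp

/-- If `T` intertwines `W` and `Ω`, then it intertwines their exponentials. -/
lemma nilExp_intertwine {κ : Type*} [Fintype κ] [DecidableEq κ] {W : Matrix S S B}
    {Ω : Matrix κ κ B} {T : Matrix S κ B} (h : W * T = T * Ω) (hW : IsNilpotent W)
    (hΩ : IsNilpotent Ω) : nilExp W * T = T * nilExp Ω := by
  have hk : ∀ k, W ^ k * T = T * Ω ^ k := by
    intro k
    induction k with
    | zero => simp
    | succ k ih => rw [pow_succ, Matrix.mul_assoc, h, ← Matrix.mul_assoc, ih, Matrix.mul_assoc,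
        ← pow_succ]
  obtain ⟨N, hN⟩ := hW
  obtain ⟨K, hK⟩ := hΩ
  rw [nilExp_eq_sum (pow_eq_zero_of_le (le_max_left N K) hN),
    nilExp_eq_sum (pow_eq_zero_of_le (le_max_right N K) hK), Matrix.sum_mul, Matrix.mul_sum]
  refine Finset.sum_congr rfl fun j _ => ?_
  rw [Matrix.smul_mul, Matrix.mul_smul, hk]

variable {F : Matrix ι ι B} {c : ι → Matrix S S B}

/-- The commutator of `W = cliffordLift F c` and `c_b` is `∑_p F_{pb} c_p`: the adjoint action on
vectors is that of `F`. -/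
lemma cliffordLift_mul (hF : F.transpose = -F)
    (hc : ∀ a b, c a * c b + c b * c a = if a = b then 2 else 0) (b : ι) :
    cliffordLift F c * c b = c b * cliffordLift F c + ∑ p, F p b • c p := by
  have hs : ∀ p q, F q p = -F p q := fun p q => congrFun (congrFun hF p) q
  have h1 : ∀ p q, c p * c q * c b = c b * (c p * c q) +
      ((if q = b then (2 : ℂ) else 0) • c p - (if p = b then (2 : ℂ) else 0) • c q) := by
    intro p q
    have hq := hc q b
    have hp := hc p b
    have e1 : c q * c b = (if q = b then 2 else 0) - c b * c q := eq_sub_of_add_eq hq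
    have e2 : c p * c b = (if p = b then 2 else 0) - c b * c p := eq_sub_of_add_eq hp
    rw [mul_assoc, e1, mul_sub, ← mul_assoc, e2, sub_mul]
    have e3 : ∀ (P : Prop) [Decidable P], (if P then (2 : Matrix S S B) else 0) =
        (if P then (2 : ℂ) else 0) • (1 : Matrix S S B) := by
      intro P _
      split_ifs
      · rw [two_smul, one_add_one_eq_two]
      · rw [zero_smul]
    rw [e3, e3, Matrix.mul_smul, Matrix.smul_mul, mul_one, one_mul, mul_assoc]
    abel
  have h2 : cliffordLift F c * c b = c b * cliffordLift F c +
      ((1 / 4 : ℂ) • (∑ p, ∑ q, F p q • ((if q = b then (2 : ℂ) else 0) • c p)) -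
       (1 / 4 : ℂ) • (∑ p, ∑ q, F p q • ((if p = b then (2 : ℂ) else 0) • c q))) := by
    rw [← smul_sub, ← Finset.sum_sub_distrib]
    simp only [← Finset.sum_sub_distrib]
    rw [cliffordLift, Finset.sum_mul, Finset.mul_sum, Finset.smul_sum, ← Finset.sum_add_distrib]
    refine Finset.sum_congr rfl fun p _ => ?_
    rw [Finset.sum_mul, Finset.mul_sum, Finset.smul_sum, ← Finset.sum_add_distrib]
    refine Finset.sum_congr rfl fun q _ => ?_
    rw [Matrix.smul_mul, h1, Matrix.mul_smul, smul_add, ← smul_sub, smul_assoc (1 / 4 : ℂ) (F p q)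
      (_ - _)]
  rw [h2]
  congr 1
  have h3 : ∑ p, ∑ q, F p q • ((if q = b then (2 : ℂ) else 0) • c p) =
      (2 : ℂ) • ∑ p, F p b • c p := by
    rw [Finset.smul_sum]
    refine Finset.sum_congr rfl fun p _ => ?_
    rw [Finset.sum_eq_single b]
    · rw [if_pos rfl, smul_comm]
    · intro q _ hq
      rw [if_neg hq, zero_smul, smul_zero]
    · simp
  have h4 : ∑ p, ∑ q, F p q • ((if p = b then (2 : ℂ) else 0) • c q) =
      -((2 : ℂ) • ∑ p, F p b • c p) := by
    rw [Finset.sum_eq_single b, Finset.smul_sum, ← Finset.sum_neg_distrib]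
    · refine Finset.sum_congr rfl fun q _ => ?_
      rw [if_pos rfl, smul_comm, hs q b, neg_smul, smul_neg]
    · intro p _ hp
      refine Finset.sum_eq_zero fun q _ => ?_
      rw [if_neg hp, zero_smul, smul_zero]
    · simp
  rw [h3, h4, smul_neg, sub_neg_eq_add, smul_smul, ← add_smul]
  norm_num

/-- For `W = cliffordLift F c`, the exponentiated form `e^W c_b = ∑_p (e^F)_{pb} c_p e^W` of the
commutation relation. -/
lemma nilExp_cliffordLift_mul (hF : F.transpose = -F) (hFn : IsNilpotent F)
    (hc : ∀ a b, c a * c b + c b * c a = if a = b then 2 else 0)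
    (hW : IsNilpotent (cliffordLift F c)) (b : ι) :
    nilExp (cliffordLift F c) * c b = ∑ p, nilExp F p b • (c p * nilExp (cliffordLift F c)) := by
  set W := cliffordLift F c with hWd
  -- `T` is the row of all the `c_p`; the commutation relation says that `W T = T (W ⊗ 1 + 1 ⊗ F)`,
  -- and the two summands on the right commute
  set T : Matrix S (S × ι) B := Matrix.of fun s p => c p.2 s p.1 with hT
  have hTl : ∀ (M : Matrix S S B) s t b, (M * T) s (t, b) = (M * c b) s t := by
    intro M s t b
    rfl
  have hTk : ∀ (M : Matrix S S B) (N : Matrix ι ι B) s t b,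
      (T * (M ⊗ₖ N)) s (t, b) = (∑ p, N p b • (c p * M)) s t := by
    intro M N s t b
    rw [Matrix.mul_apply, Fintype.sum_prod_type, Finset.sum_comm, Matrix.sum_apply]
    refine Finset.sum_congr rfl fun p _ => ?_
    rw [Matrix.smul_apply, Matrix.mul_apply, smul_eq_mul, Finset.mul_sum]
    refine Finset.sum_congr rfl fun u _ => ?_
    rw [Matrix.kroneckerMap_apply, hT, Matrix.of_apply]
    ring
  have h1 : W * T = T * (kronLeft ι W + kronRight S F) := by
    ext s ⟨t, b⟩
    have e1 := hTk W 1 s t b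
    have e2 := hTk 1 F s t b
    rw [hTl, hWd, cliffordLift_mul hF hc, Matrix.mul_add, Matrix.add_apply, Matrix.add_apply]
    change _ = (T * (W ⊗ₖ (1 : Matrix ι ι B)) : Matrix S (S × ι) B) s (t, b) +
      (T * ((1 : Matrix S S B) ⊗ₖ F) : Matrix S (S × ι) B) s (t, b)
    rw [e1, e2]
    congr 1
    · rw [Finset.sum_eq_single b]
      · rw [Matrix.one_apply_eq, one_smul]
      · intro p _ hp
        rw [Matrix.one_apply_ne hp, zero_smul]
      · simp
    · simp only [mul_one]
  have h2 := nilExp_intertwine h1 hW ((kron_commute W F).isNilpotent_add (hW.map (kronLeft ι))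
    (hFn.map (kronRight S)))
  rw [nilExp_add (kron_commute W F) (hW.map (kronLeft ι)) (hFn.map (kronRight S)),
    ← map_nilExp _ hW, ← map_nilExp _ hFn] at h2
  have h3 : (kronLeft ι (nilExp W) * kronRight S (nilExp F) : Matrix (S × ι) (S × ι) B) =
      nilExp W ⊗ₖ nilExp F := by
    change nilExp W ⊗ₖ 1 * 1 ⊗ₖ nilExp F = _
    rw [← Matrix.mul_kronecker_mul, mul_one, one_mul]
  rw [h3] at h2
  ext s t
  rw [← hTl, h2, hTk]

/-- For `W = cliffordLift F c`, the matrix `M` of the `tr (c_a c_b e^W)` satisfies `M (1 + e^F) = 2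
tr e^W`: move `c_b` cyclically around the trace and use `c_a c_b + c_b c_a = 2 δ_{ab}`. -/
lemma cliffordTrace_mul (hF : F.transpose = -F) (hFn : IsNilpotent F)
    (hc : ∀ a b, c a * c b + c b * c a = if a = b then 2 else 0)
    (hW : IsNilpotent (cliffordLift F c)) :
    (Matrix.of fun a b => (c a * c b * nilExp (cliffordLift F c)).trace) * (1 + nilExp F) =
      (2 * (nilExp (cliffordLift F c)).trace) • (1 : Matrix ι ι B) := by
  set E := nilExp (cliffordLift F c) with hE
  ext a b
  rw [mul_add, mul_one, Matrix.add_apply, Matrix.of_apply, Matrix.mul_apply]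
  have h1 : ∑ p, (Matrix.of fun a b => (c a * c b * E).trace) a p * nilExp F p b =
      (c b * c a * E).trace := by
    have h := nilExp_cliffordLift_mul hF hFn hc hW b
    rw [← hE] at h
    calc _ = (c a * ∑ p, nilExp F p b • (c p * E)).trace := by
          rw [Finset.mul_sum, Matrix.trace_sum]
          refine Finset.sum_congr rfl fun p _ => ?_
          rw [Matrix.of_apply, Matrix.mul_smul, Matrix.trace_smul, smul_eq_mul, mul_comm, mul_assoc]
      _ = (c b * c a * E).trace := by
          rw [← h, ← mul_assoc, Matrix.trace_mul_comm, ← mul_assoc]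
  rw [h1, ← Matrix.trace_add, ← add_mul, hc]
  rcases eq_or_ne a b with rfl | hab
  · rw [if_pos rfl, two_mul, Matrix.trace_add]; simp [two_mul]
  · simp [hab]

end Clifford

section Spinor

open Polynomial

variable {A : Type*} [CommRing A] [Algebra ℂ A]

/-- The series `-½ x/(1 + eˣ)`. Its value at `x` plus its value at `-x` is `½ x tanh(x/2)`, so that
its trace on a skew matrix `sF` is the logarithmic derivative of the spinor character `∏ 2 cosh(s
xⱼ/2)`. -/
noncomputable def spinorSeries : PowerSeries ℂ :=
  (-1 / 2 : ℂ) • (PowerSeries.X * (1 + PowerSeries.exp ℂ)⁻¹)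

lemma one_add_exp_mul_inv : (1 + PowerSeries.exp ℂ) * (1 + PowerSeries.exp ℂ)⁻¹ = 1 := by
  refine PowerSeries.mul_inv_cancel _ ?_
  rw [map_add, PowerSeries.constantCoeff_exp, map_one]
  norm_num

lemma scaled_cliffordLift {ι S : Type*} [Fintype ι] [DecidableEq ι] [Fintype S] [DecidableEq S]
    (F : Matrix ι ι A) (c : ι → Matrix S S A) :
    scaled (cliffordLift F c) = cliffordLift (scaled F) fun a => (c a).map C := by
  rw [scaled, cliffordLift, cliffordLift, ← RingHom.mapMatrix_apply, map_sum, Finset.smul_sum]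
  refine Finset.sum_congr rfl fun a _ => ?_
  rw [map_sum, Finset.smul_sum]
  refine Finset.sum_congr rfl fun b _ => ?_
  ext1 s t
  rw [← RingHom.mapMatrix_apply, ← RingHom.mapMatrix_apply, ← map_mul, RingHom.mapMatrix_apply,
    RingHom.mapMatrix_apply, Matrix.smul_apply, Matrix.smul_apply, Matrix.map_apply,
    Matrix.map_apply, Matrix.smul_apply, scaled, Matrix.smul_apply, Matrix.map_apply, smul_eq_mul,
    smul_eq_mul, smul_eq_mul, smul_eq_mul, map_mul, Algebra.smul_mul_assoc]
  have : C ((1 / 4 : ℂ) • F a b) = (1 / 4 : ℂ) • C (F a b) := (smul_C _ _).symm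
  rw [this]
  simp only [Algebra.smul_mul_assoc, mul_smul_comm, mul_assoc]

/-- The spinor character as an exponential of traces. In terms of formal eigenvalues `±xⱼ` of `F` it
is `∏ 2 cosh(xⱼ/2)`; without eigenvalues, `tr e^{sW}` satisfies a linear differential equation in
`s`, by the formula for the traces `tr (c_a c_b e^{sW})`. -/
lemma chSpinor_eq {l N : ℕ} {F : Matrix (Fin (16 * l)) (Fin (16 * l)) A}
    (hskew : F.transpose = -F) (hF : F ^ (N + 1) = 0) (hnil : ∀ i j, IsNilpotent (F i j)) :
    chSpinor F = (2 : ℂ) ^ (8 * l) • nilExp (∑ j ∈ Finset.range N,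
      (PowerSeries.coeff (j + 1) spinorSeries / (j + 1 : ℕ)) • (F ^ (j + 1)).trace) := by
  set c : Fin (16 * l) → Matrix (Fin (8 * l) → Bool) (Fin (8 * l) → Bool) A :=
    fun a => (clif l a).map (algebraMap ℂ A) with hcdef
  have hc : ∀ a b, c a * c b + c b * c a = if a = b then 2 else 0 := by
    intro a b
    simp only [hcdef, ← RingHom.mapMatrix_apply]
    rw [← map_mul, ← map_mul, ← map_add, clif_anticomm]
    split_ifs
    · rw [map_ofNat]
    · rw [map_zero]
  have hch : chSpinor F = (nilExp (cliffordLift F c)).trace := by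
    rw [chSpinor, cliffordLift]
    simp only [hcdef, ← RingHom.mapMatrix_apply, map_mul]
  obtain ⟨K, hK⟩ : IsNilpotent (cliffordLift F c) := by
    refine matrix_isNilpotent fun s t => ?_
    rw [cliffordLift, Matrix.sum_apply]
    refine isNilpotent_sum fun a _ => ?_
    rw [Matrix.sum_apply]
    refine isNilpotent_sum fun b _ => ?_
    rw [Matrix.smul_apply, smul_eq_mul]
    exact (Commute.all _ _).isNilpotent_mul_right ((hnil a b).smul _)
  have hK' := scaled_pow_eq_zero hK
  set c' : Fin (16 * l) → Matrix (Fin (8 * l) → Bool) (Fin (8 * l) → Bool) A[X] :=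
    fun a => (c a).map C with hc'def
  have hc' : ∀ a b, c' a * c' b + c' b * c' a = if a = b then 2 else 0 := by
    intro a b
    simp only [hc'def, ← RingHom.mapMatrix_apply]
    rw [← map_mul, ← map_mul, ← map_add, hc]
    split_ifs
    · rw [map_ofNat]
    · rw [map_zero]
  have hs := scaled_pow_eq_zero hF
  have hskew' : (scaled F).transpose = -scaled F := by
    rw [scaled, Matrix.transpose_smul, ← Matrix.transpose_map, hskew, ← smul_neg]
    congr 1
    ext1 i j
    simp
  set E := nilExp (scaled (cliffordLift F c)) with hE
  have hE' : E = evNil K (scaled (cliffordLift F c)) (PowerSeries.exp ℂ) := nilExp_eq_evNil hK'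
  have hcl : scaled (cliffordLift F c) = cliffordLift (scaled F) c' := scaled_cliffordLift F c
  have hev : ∀ a : A, E.trace.eval a = (nilExp (a • cliffordLift F c)).trace := by
    intro a
    rw [← evalC_apply, AddMonoidHom.map_trace, ← AlgHom.mapMatrix_apply, hE,
      map_nilExp _ ⟨K, hK'⟩, mapMatrix_evalC_scaled]
  have h := eval_one_eq_nilExp (F := F) N spinorSeries (trace_pow_isNilpotent hnil) (Y := E.trace) ?_
  · rw [hev, hev, one_smul, zero_smul, nilExp_zero, Matrix.trace_one] at h
    rw [hch, h, Algebra.smul_def]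
    congr 1
    simp [map_ofNat]
  · have hM := cliffordTrace_mul hskew' ⟨_, hs⟩ hc' (hcl ▸ ⟨K, hK'⟩)
    rw [← hcl, ← hE] at hM
    set M : Matrix (Fin (16 * l)) (Fin (16 * l)) A[X] :=
      Matrix.of fun a b => (c' a * c' b * E).trace with hMdef
    -- solve for `M`, as `1 + e^{sF}` is invertible
    have hM2 : M = (2 * E.trace) • evNil (N + 1) (scaled F) (1 + PowerSeries.exp ℂ)⁻¹ := by
      calc M = M * ((1 + nilExp (scaled F)) * evNil (N + 1) (scaled F) (1 + PowerSeries.exp ℂ)⁻¹) := by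
            rw [nilExp_eq_evNil hs]
            nth_rw 1 [← evNil_one hs]
            rw [← evNil_add, ← evNil_mul hs, one_add_exp_mul_inv, evNil_one hs, mul_one]
        _ = _ := by rw [← mul_assoc, hM, Matrix.smul_mul, one_mul]
    -- the derivative of `tr e^{sW}` is `tr (sW e^{sW})`, which is expressed by `M`
    have hD : eulerP A E.trace = (scaled (cliffordLift F c) * E).trace := by
      have e1 : eulerP A E.trace = (E.map (eulerP A)).trace := by
        simp [Matrix.trace, map_sum]
      have e2 : eulerD ℂ (PowerSeries.exp ℂ) = PowerSeries.X * PowerSeries.exp ℂ := by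
        change PowerSeries.X * PowerSeries.derivative ℂ _ = _
        rw [PowerSeries.derivative_exp]
      rw [e1, hE', map_eulerP_evNil, e2, evNil_mul hK', evNil_X hK']
    have hD2 : eulerP A E.trace = (-1 / 4 : ℂ) • (scaled F * M).trace := by
      have e3 : (scaled F * M).trace = -∑ a, ∑ b, scaled F a b * (c' a * c' b * E).trace := by
        have : scaled F = -(scaled F).transpose := by rw [hskew', neg_neg]
        rw [Matrix.trace]
        simp only [Matrix.diag_apply, Matrix.mul_apply]
        rw [Finset.sum_comm, ← Finset.sum_neg_distrib]
        refine Finset.sum_congr rfl fun a _ => ?_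
        rw [← Finset.sum_neg_distrib]
        refine Finset.sum_congr rfl fun b _ => ?_
        conv_lhs => rw [this]
        rw [Matrix.neg_apply, Matrix.transpose_apply, hMdef, Matrix.of_apply, neg_mul]
      rw [hD, e3, hcl, cliffordLift, Finset.sum_mul, Matrix.trace_sum, smul_neg, ← neg_smul,
        Finset.smul_sum]
      refine Finset.sum_congr rfl fun a _ => ?_
      rw [Finset.sum_mul, Matrix.trace_sum, Finset.smul_sum]
      refine Finset.sum_congr rfl fun b _ => ?_
      rw [Matrix.smul_mul, Matrix.trace_smul, smul_assoc, smul_eq_mul]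
      norm_num
    have hK0 : PowerSeries.coeff 0 spinorSeries = 0 := by
      rw [spinorSeries, PowerSeries.coeff_smul, PowerSeries.coeff_zero_X_mul, smul_zero]
    rw [hD2, hM2, Matrix.mul_smul, Matrix.trace_smul, ← trace_evNil_scaled F N hK0, spinorSeries]
    have e4 : evNil (N + 1) (scaled F) ((-1 / 2 : ℂ) • (PowerSeries.X * (1 + PowerSeries.exp ℂ)⁻¹)) =
        (-1 / 2 : ℂ) • (scaled F * evNil (N + 1) (scaled F) (1 + PowerSeries.exp ℂ)⁻¹) := by
      have e5 := evNil_mul hs PowerSeries.X (1 + PowerSeries.exp ℂ)⁻¹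
      rw [evNil_X hs] at e5
      rw [← e5]
      simp only [evNil, PowerSeries.coeff_smul, Finset.smul_sum, smul_smul, smul_eq_mul]
    rw [e4, Matrix.trace_smul, smul_eq_mul, Algebra.smul_mul_assoc, mul_comm _ E.trace, mul_assoc, two_mul,
      mul_add, smul_add, ← add_smul, mul_comm E.trace]
    norm_num

end Spinor

/-! ### Hyperbolic series and the Â-form -/

section Hyperbolic

open PowerSeries

/-- The series `e^{x/2}`. -/
noncomputable def expHalf : PowerSeries ℂ := rescale (1 / 2 : ℂ) (exp ℂ)

/-- The series `e^{-x/2}`. -/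
noncomputable def expNegHalf : PowerSeries ℂ := rescale (-1 / 2 : ℂ) (exp ℂ)

lemma coeff_rescale_exp (a : ℂ) (j : ℕ) :
    coeff j (rescale a (exp ℂ)) = a ^ j * (j.factorial : ℂ)⁻¹ := by
  rw [coeff_rescale, coeff_exp]
  simp

lemma expHalf_mul_expNegHalf : expHalf * expNegHalf = 1 := by
  rw [expHalf, expNegHalf, exp_mul_exp_eq_exp_add]
  norm_num

lemma expHalf_mul_expHalf : expHalf * expHalf = exp ℂ := by
  rw [expHalf, exp_mul_exp_eq_exp_add]
  norm_num

lemma eulerD_rescale_exp (a : ℂ) :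
    eulerD ℂ (rescale a (exp ℂ)) = C a * X * rescale a (exp ℂ) := by
  ext j
  rw [coeff_eulerD, mul_assoc, coeff_C_mul]
  cases j with
  | zero => simp
  | succ j =>
    rw [coeff_succ_X_mul, coeff_rescale_exp, coeff_rescale_exp, Nat.factorial_succ]
    have : ((j : ℂ) + 1) ≠ 0 := by exact_mod_cast j.succ_ne_zero
    push_cast
    field_simp
    ring

lemma eulerD_expHalf : eulerD ℂ expHalf = C (1 / 2 : ℂ) * X * expHalf := eulerD_rescale_exp _

lemma eulerD_expNegHalf : eulerD ℂ expNegHalf = -(C (1 / 2 : ℂ) * X * expNegHalf) := by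
  rw [expNegHalf, eulerD_rescale_exp, ← neg_mul, ← neg_mul, ← map_neg]
  norm_num

/-- The generating series `x/(eˣ - 1)` of the Bernoulli numbers. -/
noncomputable abbrev bern : PowerSeries ℂ := bernoulliPowerSeries ℂ

lemma coeff_bern (j : ℕ) : coeff j bern = (bernoulli j : ℂ) / j.factorial := by
  rw [bern, bernoulliPowerSeries, coeff_mk]
  simp

lemma bern_mul : bern * (exp ℂ - 1) = X := bernoulliPowerSeries_mul_exp_sub_one ℂ

lemma two_C_half : (2 : PowerSeries ℂ) * C (1 / 2 : ℂ) = 1 := by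
  rw [show (2 : PowerSeries ℂ) = C (2 : ℂ) from (map_ofNat C 2).symm, ← map_mul]
  norm_num

lemma exp_sub_one_ne_zero : exp ℂ - 1 ≠ 0 := by
  intro h
  have := congrArg (coeff 1) h
  simp [coeff_exp, coeff_one] at this

lemma one_add_exp_ne_zero : 1 + exp ℂ ≠ 0 := by
  intro h
  have := congrArg (coeff 0) h
  simp at this

lemma expHalf_ne_zero : expHalf ≠ 0 := left_ne_zero_of_mul_eq_one expHalf_mul_expNegHalf

lemma spinorSeries_mul : spinorSeries * (1 + exp ℂ) = -(C (1 / 2 : ℂ) * X) := by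
  rw [spinorSeries, smul_eq_C_mul, mul_assoc, mul_assoc, mul_comm _⁻¹, one_add_exp_mul_inv, mul_one,
    ← neg_mul, ← map_neg]
  norm_num

/-- `-x/(1 + eˣ) = 2x/(e^{2x} - 1) - x/(eˣ - 1)`. -/
lemma two_mul_spinorSeries : 2 * spinorSeries = rescale 2 bern - bern := by
  have h2 : rescale 2 bern * (exp ℂ * exp ℂ - 1) = 2 * X := by
    have h := congrArg (rescale (2 : ℂ)) bern_mul
    rw [map_mul, map_sub, map_one, rescale_X, ← pow_two] at *
    rw [← Nat.cast_two (R := ℂ), ← exp_pow_eq_rescale_exp] at h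
    rw [Nat.cast_two] at h
    rw [h, map_ofNat]
  refine mul_right_cancel₀ (mul_ne_zero exp_sub_one_ne_zero one_add_exp_ne_zero) ?_
  linear_combination 2 * (exp ℂ - 1) * spinorSeries_mul - h2 + (exp ℂ + 1) * bern_mul -
    (exp ℂ - 1) * X * two_C_half

lemma coeff_spinorSeries (j : ℕ) : coeff j spinorSeries =
    (2 ^ j - 1) * ((bernoulli j : ℂ) / (2 * j.factorial)) := by
  have h := congrArg (coeff j) two_mul_spinorSeries
  rw [show (2 : PowerSeries ℂ) = C (2 : ℂ) from (map_ofNat C 2).symm, coeff_C_mul, map_sub,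
    coeff_rescale, coeff_bern] at h
  have hj : (j.factorial : ℂ) ≠ 0 := Nat.cast_ne_zero.2 j.factorial_ne_zero
  have : coeff j spinorSeries = (2 ^ j * (bernoulli j / j.factorial) - bernoulli j / j.factorial) / 2 := by
    rw [← h]; ring
  rw [this]
  field_simp

/-- The series `sinh(x/2)/(x/2)`. -/
noncomputable def sinhcHalf : PowerSeries ℂ :=
  PowerSeries.mk fun j => if Even j then ((j + 1).factorial : ℂ)⁻¹ * (1 / 2) ^ j else 0

lemma X_mul_sinhcHalf : X * sinhcHalf = expHalf - expNegHalf := by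
  ext j
  rw [map_sub, expHalf, expNegHalf, coeff_rescale_exp, coeff_rescale_exp]
  cases j with
  | zero => simp
  | succ j =>
    rw [coeff_succ_X_mul, sinhcHalf, coeff_mk]
    rcases Nat.even_or_odd j with hj | hj
    · rw [if_pos hj, show (-1 / 2 : ℂ) = -(1 / 2) by norm_num, hj.add_one.neg_pow, pow_succ]
      ring
    · rw [if_neg (Nat.not_even_iff_odd.2 hj), show (-1 / 2 : ℂ) = -(1 / 2) by norm_num,
        hj.add_one.neg_pow, sub_self]

lemma eulerD_X : eulerD ℂ (X : PowerSeries ℂ) = X := by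
  ext j
  rw [coeff_eulerD, coeff_X]
  split_ifs with h <;> simp [h]

/-- The logarithmic derivative of `sinh(x/2)/(x/2)` is `x/(eˣ - 1) - 1 + x/2`. -/
lemma eulerD_sinhcHalf : eulerD ℂ sinhcHalf = (bern - 1 + C (1 / 2 : ℂ) * X) * sinhcHalf := by
  have h1 := congrArg (eulerD ℂ) X_mul_sinhcHalf
  rw [Derivation.leibniz, map_sub, eulerD_expHalf, eulerD_expNegHalf, eulerD_X, smul_eq_mul,
    smul_eq_mul] at h1
  have h2 : bern * (expHalf - expNegHalf) = X * expNegHalf := by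
    refine mul_right_cancel₀ expHalf_ne_zero ?_
    linear_combination bern * expHalf_mul_expHalf - (bern + X) * expHalf_mul_expNegHalf + bern_mul
  refine mul_left_cancel₀ X_ne_zero ?_
  linear_combination h1 - (bern + C (1 / 2 : ℂ) * X) * X_mul_sinhcHalf - h2 +
    X * expNegHalf * two_C_half

/-- The series `cosh(x/2)`. -/
noncomputable def coshHalf : PowerSeries ℂ := C (1 / 2 : ℂ) * (expHalf + expNegHalf)

lemma eulerD_C_mul (a : ℂ) (f : PowerSeries ℂ) : eulerD ℂ (C a * f) = C a * eulerD ℂ f := by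
  rw [← smul_eq_C_mul, Derivation.map_smul, smul_eq_C_mul]

lemma eulerD_coshHalf :
    eulerD ℂ coshHalf = (C (1 / 2 : ℂ) * X + 2 * spinorSeries) * coshHalf := by
  rw [coshHalf, eulerD_C_mul, map_add, eulerD_expHalf, eulerD_expNegHalf]
  refine mul_right_cancel₀ one_add_exp_ne_zero ?_
  have h : (1 + exp ℂ) * (expHalf - expNegHalf) = (exp ℂ - 1) * (expHalf + expNegHalf) := by
    linear_combination (2 * expNegHalf) * expHalf_mul_expHalf - 2 * expHalf * expHalf_mul_expNegHalf
  linear_combination C (1 / 2 : ℂ) * C (1 / 2 : ℂ) * X * h -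
    2 * C (1 / 2 : ℂ) * (expHalf + expNegHalf) * spinorSeries_mul

lemma expHalf_eq : expHalf = coshHalf + C (1 / 2 : ℂ) * (X * sinhcHalf) := by
  rw [X_mul_sinhcHalf, coshHalf]
  linear_combination -expHalf * two_C_half

lemma coeff_zero_sinhcHalf : coeff 0 sinhcHalf = 1 := by
  rw [sinhcHalf, coeff_mk]; simp

lemma coeff_zero_coshHalf : coeff 0 coshHalf = 1 := by
  rw [coshHalf, coeff_C_mul, map_add, expHalf, expNegHalf, coeff_rescale_exp, coeff_rescale_exp]
  norm_num

end Hyperbolic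

section Constants

variable {A : Type*} [CommRing A] [Algebra ℂ A]

/-- The constant term `-B_{2j}/(4j (2j)!)`, `j = m + 1`, of the Eisenstein series. -/
noncomputable def eisConst (m : ℕ) : ℂ :=
  -(bernoulli (2 * m + 2) : ℂ) / (2 * (2 * m + 2 : ℕ) * (2 * m + 2).factorial)

/-- A sum in which only the terms of even order contribute. -/
lemma sum_odd_eq {M : ℕ} (t : ℕ → A) (K : ℕ → ℂ)
    (hodd : ∀ j, K (2 * j + 1) • t (2 * j + 1) = 0) :
    ∑ j ∈ Finset.range (2 * M), K (j + 1) • t (j + 1) =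
      ∑ m : Fin M, K (2 * m.val + 2) • t (2 * (m.val + 1)) := by
  rw [Fin.sum_univ_eq_sum_range fun m => K (2 * m + 2) • t (2 * (m + 1))]
  induction M with
  | zero => simp
  | succ M ih =>
    rw [mul_add, mul_one, Finset.sum_range_succ, Finset.sum_range_succ, ih, hodd, add_zero,
      Finset.sum_range_succ]
    rfl

lemma unipPow_eq_evNil {u : A} {N : ℕ} (hu : (u - 1) ^ N = 0) (r : ℚ) :
    unipPow r u = evNil N (u - 1) (PowerSeries.map (algebraMap ℚ ℂ)
      (PowerSeries.binomialSeries ℚ r)) := by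
  rw [unipPow, evNil, sum_range_of_pow_eq_zero (fun j => ((Ring.choose r j : ℚ) : ℂ))
    (pow_nilpotencyClass ⟨N, hu⟩) hu]
  refine Finset.sum_congr rfl fun j _ => ?_
  simp

/-- Both sides are unipotent, and inverse to `exp a` after squaring. -/
lemma unipPow_nilExp {a : A} (ha : IsNilpotent a) :
    unipPow (-1 / 2) (nilExp a) = nilExp ((-1 / 2 : ℂ) • a) := by
  have hone : ∀ b : A, IsNilpotent b → IsNilpotent (nilExp b - 1) := by
    intro b hb
    obtain ⟨c, hc⟩ : b ∣ nilExp b - 1 := by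
      have := nilExp_sub_dvd (c := b) hb IsNilpotent.zero (by rw [sub_zero])
      rwa [nilExp_zero] at this
    rw [hc]
    exact (Commute.all _ _).isNilpotent_mul_right hb
  have hb : IsNilpotent ((-1 / 2 : ℂ) • a) := ha.smul _
  obtain ⟨N, hN⟩ := hone a ha
  set s := unipPow (-1 / 2) (nilExp a) with hs
  set t := nilExp ((-1 / 2 : ℂ) • a) with ht
  have hs2 : s * s * nilExp a = 1 := by
    rw [hs, unipPow_eq_evNil hN, ← evNil_mul hN]
    have : nilExp a = evNil N (nilExp a - 1) (1 + PowerSeries.X) := by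
      rw [evNil_add, evNil_one hN, evNil_X hN]; ring
    nth_rw 2 [this]
    rw [← evNil_mul hN, ← map_mul, ← PowerSeries.binomialSeries_add]
    have h1 : (1 + PowerSeries.X : PowerSeries ℂ) = PowerSeries.map (algebraMap ℚ ℂ)
        (PowerSeries.binomialSeries ℚ (1 : ℚ)) := by
      have := PowerSeries.binomialSeries_nat (R := ℚ) (A := ℚ) 1
      rw [Nat.cast_one, pow_one] at this
      rw [this, map_add, map_one, PowerSeries.map_X]
    rw [h1, ← map_mul, ← PowerSeries.binomialSeries_add]
    norm_num
    exact evNil_one hN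
  have ht2 : t * t * nilExp a = 1 := by
    rw [ht, ← nilExp_add (Commute.all _ _) hb hb, ← nilExp_add (Commute.all _ _) _ ha, ← add_smul]
    · have : ((-1 / 2 + -1 / 2 : ℂ) • a + a) = 0 := by
        have h : (-1 / 2 + -1 / 2 : ℂ) = -1 := by norm_num
        rw [h, neg_smul, one_smul, neg_add_cancel]
      rw [this, nilExp_zero]
    · rw [← add_smul]; exact ha.smul _
  have hsn : IsNilpotent (s - 1) := by
    have hd : (nilExp a - 1) ∣ s - 1 := by
      rw [hs, unipPow_eq_evNil (N := N + 1) (by rw [pow_succ, hN, zero_mul]), evNil,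
        Finset.sum_range_succ']
      simp only [pow_zero, PowerSeries.coeff_map, PowerSeries.binomialSeries_coeff,
        Ring.choose_zero_right, smul_eq_mul, mul_one, map_one, one_smul, add_sub_cancel_right]
      refine Finset.dvd_sum fun j _ => ?_
      rw [Algebra.smul_def, pow_succ]
      exact (Dvd.intro_left _ rfl).mul_left _
    obtain ⟨c, hc⟩ := hd
    rw [hc]
    exact (Commute.all _ _).isNilpotent_mul_right ⟨N, hN⟩
  have htn := hone _ hb
  -- `s + t` is `2` plus a nilpotent element, so that `s² = t²` implies `s = t`
  have hu : IsUnit (s + t) := by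
    have h2 : IsUnit (2 : A) := by
      have : (2 : A) = algebraMap ℂ A 2 := (map_ofNat _ 2).symm
      rw [this]
      exact (IsUnit.mk0 (2 : ℂ) two_ne_zero).map _
    have : s + t = ((s - 1) + (t - 1)) + 2 := by ring
    rw [this]
    exact IsNilpotent.isUnit_add_right_of_commute ((Commute.all _ _).isNilpotent_add hsn htn) h2
      (Commute.all _ _)
  have hst : s * s = t * t := by
    calc s * s = s * s * (t * t * nilExp a) := by rw [ht2, mul_one]
      _ = (s * s * nilExp a) * (t * t) := by ring
      _ = t * t := by rw [hs2, one_mul]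
  have h0 : (s + t) * (s - t) = 0 := by linear_combination hst
  exact sub_eq_zero.1 ((hu.mul_right_eq_zero).1 h0)

variable {r M : ℕ} {F : Matrix (Fin r) (Fin r) A}

lemma nilSinhc_half (hF : F ^ (2 * M + 1) = 0) :
    nilSinhc ((1 / 2 : ℂ) • F) = evNil (2 * M + 1) F sinhcHalf := by
  have hF' : F ^ (2 * (2 * M + 1)) = 0 := pow_eq_zero_of_le (by omega) hF
  have hh : ((1 / 2 : ℂ) • F) ^ (2 * M + 1) = 0 := by rw [smul_pow, hF, smul_zero]
  have h1 : nilSinhc ((1 / 2 : ℂ) • F) = ∑ j ∈ Finset.range (2 * M + 1),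
      (((2 * j + 1).factorial : ℂ)⁻¹) • ((1 / 2 : ℂ) • F) ^ (2 * j) := by
    have key : ∀ a b : ℕ, ((1 / 2 : ℂ) • F) ^ a = 0 → ((1 / 2 : ℂ) • F) ^ b = 0 → a ≤ b →
        ∑ j ∈ Finset.range a, (((2 * j + 1).factorial : ℂ)⁻¹) • ((1 / 2 : ℂ) • F) ^ (2 * j) =
        ∑ j ∈ Finset.range b, (((2 * j + 1).factorial : ℂ)⁻¹) • ((1 / 2 : ℂ) • F) ^ (2 * j) := by
      intro a b ha _ hab
      refine Finset.sum_subset (Finset.range_subset_range.2 hab) fun j _ hj => ?_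
      have : a ≤ 2 * j := by
        have : a ≤ j := by simpa using hj
        omega
      rw [pow_eq_zero_of_le this ha, smul_zero]
    have hc := pow_nilpotencyClass (x := (1 / 2 : ℂ) • F) ⟨_, hh⟩
    rw [nilSinhc]
    exact key _ _ hc hh (Nat.sInf_le hh)
  have h2 : ∀ K, ∑ i ∈ Finset.range (2 * K), PowerSeries.coeff i sinhcHalf • F ^ i =
      ∑ j ∈ Finset.range K, (((2 * j + 1).factorial : ℂ)⁻¹) • ((1 / 2 : ℂ) • F) ^ (2 * j) := by
    intro K
    induction K with
    | zero => simp
    | succ K ih =>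
      rw [mul_add, mul_one, Finset.sum_range_succ, Finset.sum_range_succ, ih,
        Finset.sum_range_succ, sinhcHalf, PowerSeries.coeff_mk, PowerSeries.coeff_mk,
        if_pos (even_two_mul K), if_neg (by simp), zero_smul, add_zero, smul_pow, smul_smul]
  rw [h1, evNil_congr hF hF', evNil, h2]

/-- The form `Â` as the exponential of `∑ -B_{2j}/(4j (2j)!) tr F^{2j}`. -/
lemma aHat_eq (h : IsCurv M F) :
    aHat F = nilExp (∑ m : Fin M, eisConst m • evenTr M F m) := by
  have hdet := det_evNil h.pow h.nil eulerD_sinhcHalf coeff_zero_sinhcHalf (by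
    rw [map_add, map_sub, coeff_bern, PowerSeries.coeff_C_mul]; simp)
  rw [aHat, nilSinhc_half h.pow, hdet, unipPow_nilExp]
  · rw [sum_odd_eq (fun j => (F ^ j).trace) (fun j => PowerSeries.coeff j
      (bern - 1 + PowerSeries.C (1 / 2 : ℂ) * PowerSeries.X) / (j : ℕ)) (M := M) (by
        intro j; rw [h.trace_odd, smul_zero]), Finset.smul_sum]
    congr 1
    refine Finset.sum_congr rfl fun m _ => ?_
    rw [smul_smul, evenTr, eisConst, map_add, map_sub, coeff_bern, PowerSeries.coeff_C_mul,
      PowerSeries.coeff_one, PowerSeries.coeff_X, if_neg (by omega), if_neg (by omega)]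
    congr 1
    have : ((2 * m.val + 2).factorial : ℂ) ≠ 0 := Nat.cast_ne_zero.2 (Nat.factorial_ne_zero _)
    have : ((2 * m.val + 2 : ℕ) : ℂ) ≠ 0 := Nat.cast_ne_zero.2 (by omega)
    field_simp
    ring
  · exact isNilpotent_sum fun j _ => (h.nil j).smul _

/-- The spinor character in terms of the even traces. -/
lemma chSpinor_eq_evenTr {l : ℕ} {F : Matrix (Fin (16 * l)) (Fin (16 * l)) A} (h : IsCurv M F)
    (hnil : ∀ i j, IsNilpotent (F i j)) : chSpinor F = (2 : ℂ) ^ (8 * l) •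
      nilExp (∑ m : Fin M, (-(2 ^ (2 * m.val + 2) - 1) * eisConst m) • evenTr M F m) := by
  rw [chSpinor_eq h.skew h.pow hnil, sum_odd_eq (fun j => (F ^ j).trace)
    (fun j => PowerSeries.coeff j spinorSeries / (j : ℕ)) (M := M) (by
      intro j; rw [h.trace_odd, smul_zero])]
  congr 2
  refine Finset.sum_congr rfl fun m _ => ?_
  rw [evenTr, coeff_spinorSeries, eisConst]
  congr 1
  have : ((2 * m.val + 2).factorial : ℂ) ≠ 0 := Nat.cast_ne_zero.2 (Nat.factorial_ne_zero _)
  have : ((2 * m.val + 2 : ℕ) : ℂ) ≠ 0 := Nat.cast_ne_zero.2 (by omega)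
  field_simp

/-- The hyperbolic cosine of `c/2`, in terms of the traces `2 c^{2j}`. -/
lemma evNil_coshHalf {c : A} (hc : c ^ (2 * M + 1) = 0) :
    evNil (2 * M + 1) c coshHalf = nilExp (∑ m : Fin M,
      (-(2 ^ (2 * m.val + 2) - 1) * eisConst m) • ((2 : ℂ) • c ^ (2 * (m.val + 1)))) := by
  -- apply the formula for determinants to the `1 × 1` matrix `c`
  set F : Matrix (Fin 1) (Fin 1) A := Matrix.of fun _ _ => c with hFdef
  have hpow : ∀ k, (F ^ k) 0 0 = c ^ k := by
    intro k
    induction k with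
    | zero => simp
    | succ k ih => rw [pow_succ, Matrix.mul_apply, Fin.sum_univ_one, ih, pow_succ]; rfl
  have htr : ∀ k, (F ^ k).trace = c ^ k := by
    intro k
    rw [Matrix.trace, Fin.sum_univ_one, Matrix.diag_apply, hpow]
  have hF : F ^ (2 * M + 1) = 0 := by
    ext i j
    rw [Subsingleton.elim i 0, Subsingleton.elim j 0, hpow, hc]; rfl
  have hnil : ∀ j, IsNilpotent (F ^ (j + 1)).trace := by
    intro j
    rw [htr]
    exact IsNilpotent.pow_of_pos ⟨_, hc⟩ j.succ_ne_zero
  have hdet := det_evNil hF hnil eulerD_coshHalf coeff_zero_coshHalf (by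
    rw [map_add, PowerSeries.coeff_C_mul, two_mul, map_add, coeff_spinorSeries]; simp)
  have hev : (evNil (2 * M + 1) F coshHalf).det = evNil (2 * M + 1) c coshHalf := by
    rw [Matrix.det_fin_one, evNil, evNil, Matrix.sum_apply]
    refine Finset.sum_congr rfl fun j _ => ?_
    rw [Matrix.smul_apply, hpow]
  have hcoeff : ∀ j, PowerSeries.coeff j (PowerSeries.C (1 / 2 : ℂ) * PowerSeries.X +
      2 * spinorSeries) = (if j = 1 then 1 / 2 else 0) +
        (2 ^ j - 1) * ((bernoulli j : ℂ) / j.factorial) := by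
    intro j
    rw [map_add, PowerSeries.coeff_C_mul, PowerSeries.coeff_X, two_mul, map_add,
      coeff_spinorSeries]
    have : (j.factorial : ℂ) ≠ 0 := Nat.cast_ne_zero.2 (Nat.factorial_ne_zero _)
    split_ifs <;> field_simp <;> ring
  rw [← hev, hdet, sum_odd_eq (fun j => (F ^ j).trace) (fun j => PowerSeries.coeff j
    (PowerSeries.C (1 / 2 : ℂ) * PowerSeries.X + 2 * spinorSeries) / (j : ℕ)) (M := M) ?_]
  · congr 1
    refine Finset.sum_congr rfl fun m _ => ?_
    rw [htr, smul_smul, hcoeff, if_neg (by omega), eisConst]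
    congr 1
    have : ((2 * m.val + 2).factorial : ℂ) ≠ 0 := Nat.cast_ne_zero.2 (Nat.factorial_ne_zero _)
    have : ((2 * m.val + 2 : ℕ) : ℂ) ≠ 0 := Nat.cast_ne_zero.2 (by omega)
    field_simp
    ring
  · intro j
    suffices h : PowerSeries.coeff (2 * j + 1) (PowerSeries.C (1 / 2 : ℂ) * PowerSeries.X +
        2 * spinorSeries) = 0 by
      simp only [h, zero_div, zero_smul]
    rw [hcoeff]
    -- the odd coefficients vanish: `B_1 = -1/2` cancels `½ x`, and `B_j = 0` for odd `j ≥ 3`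
    rcases eq_or_ne j 0 with rfl | hj
    · norm_num [bernoulli_one]
    · rw [if_neg (by omega), bernoulli_eq_zero_of_odd ⟨j, rfl⟩ (by omega)]
      simp

/-- The decomposition `e^{c/2} = cosh(c/2) + sinh(c/2)`. -/
lemma nilExp_half {c : A} (hc : c ^ (2 * M + 1) = 0) : nilExp ((1 / 2 : ℂ) • c) =
    evNil (2 * M + 1) c coshHalf + ∑ j ∈ Finset.range M,
      ((1 / 2 : ℂ) * PowerSeries.coeff (2 * j) sinhcHalf) • c ^ (2 * j + 1) := by
  have h1 : nilExp ((1 / 2 : ℂ) • c) = evNil (2 * M + 1) c expHalf := by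
    rw [nilExp_eq_sum (N := 2 * M + 1) (by rw [smul_pow, hc, smul_zero]), evNil]
    refine Finset.sum_congr rfl fun j _ => ?_
    rw [expHalf, coeff_rescale_exp, smul_pow, smul_smul, mul_comm]
  rw [h1, expHalf_eq, evNil_add]
  congr 1
  have h2 : ∀ K, ∑ j ∈ Finset.range (2 * K + 1), PowerSeries.coeff j
      (PowerSeries.C (1 / 2 : ℂ) * (PowerSeries.X * sinhcHalf)) • c ^ j =
      ∑ j ∈ Finset.range K, ((1 / 2 : ℂ) * PowerSeries.coeff (2 * j) sinhcHalf) • c ^ (2 * j + 1) := by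
    intro K
    induction K with
    | zero => simp
    | succ K ih =>
      rw [show 2 * (K + 1) + 1 = 2 * K + 1 + 1 + 1 by ring, Finset.sum_range_succ,
        Finset.sum_range_succ, ih, Finset.sum_range_succ, PowerSeries.coeff_C_mul,
        PowerSeries.coeff_C_mul, PowerSeries.coeff_succ_X_mul, PowerSeries.coeff_succ_X_mul]
      have : PowerSeries.coeff (2 * K + 1) sinhcHalf = 0 := by
        rw [sinhcHalf, PowerSeries.coeff_mk, if_neg (by simp)]
      rw [this, mul_zero, zero_smul, add_zero]
  exact h2 M

end Constants

/-! ### The characteristic series as a sum of three exponentials -/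

section Products

variable {A : Type*} [CommRing A] [Algebra ℂ A]

lemma infProd_pow {P : ℕ → PowerSeries A} (hP : ∀ n, PowerSeries.X ^ (n + 1) ∣ P n - 1) (r : ℕ) :
    infProd (fun n => P n ^ r) = infProd P ^ r := by
  refine infProd_eq fun N => ?_
  rw [Finset.prod_pow]
  exact (infProd_sub_dvd hP N).trans (sub_dvd_pow_sub_pow _ _ r)

lemma lft_infProd (P : ℕ → PowerSeries ℂ) : lft A (infProd P) = infProd fun n => lft A (P n) := by
  ext j
  rw [coeff_lft, infProd, infProd, PowerSeries.coeff_mk, PowerSeries.coeff_mk, ← coeff_lft, map_prod]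

lemma lft_X : lft A PowerSeries.X = PowerSeries.X := PowerSeries.map_X _

/-- The factors `1 + ε X^d`. -/
lemma factor_sub_one_dvd (ε : ℤ) {d : ℕ → ℕ} (hd : ∀ n, n + 1 ≤ d n) (n : ℕ) :
    (PowerSeries.X : PowerSeries A) ^ (n + 1) ∣
      (1 + (ε : PowerSeries A) * PowerSeries.X ^ d n) - 1 := by
  rw [add_sub_cancel_left]
  exact (pow_dvd_pow _ (hd n)).mul_left _

/-- The product `∏_n (1 + ε X^{d(n)})`. -/
noncomputable def wProd (ε : ℤ) (d : ℕ → ℕ) : PowerSeries ℂ :=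
  infProd fun n => 1 + (ε : PowerSeries ℂ) * PowerSeries.X ^ d n

lemma lft_wProd (ε : ℤ) (d : ℕ → ℕ) :
    lft A (wProd ε d) = infProd fun n => 1 + (ε : PowerSeries A) * PowerSeries.X ^ d n := by
  rw [wProd, lft_infProd]
  simp only [map_add, map_one, map_mul, map_intCast, map_pow, lft_X]

variable {r M : ℕ} {F : Matrix (Fin r) (Fin r) A}

/-- The infinite product of the factors `ch(⋀_t E)`, `t = ε z^{d(n)}`, where `E m` is the sum of the
exponents of the factors. -/
lemma infProd_chLam (h : IsCurv M F) (ε : ℤ) (d : ℕ → ℕ) (hd : ∀ n, n + 1 ≤ d n)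
    {E : ℕ → PowerSeries ℂ} (hE : ∀ m N, PowerSeries.X ^ N ∣ E m - ∑ n ∈ Finset.range N,
      twist ℂ (-ε) (d n) (Nat.ne_of_gt ((Nat.succ_pos n).trans_le (hd n))) (expCoef (2 * m + 1))) :
    infProd (fun n => chLam ε (d n) (nilExp F)) =
      lft A (wProd ε d) ^ r * cexp (evenTr M F) fun m => -E m := by
  rw [lft_wProd, ← infProd_pow (factor_sub_one_dvd ε hd), ← infProd_mul_cexp
    (e := fun n (m : Fin M) => -twist ℂ (-ε) (d n)
      (Nat.ne_of_gt ((Nat.succ_pos n).trans_le (hd n))) (expCoef (2 * m + 1))) _ h.nil' _]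
  · congr 1
    funext n
    exact chLam_nilExp h ε (d n) _
  · intro n
    refine (factor_sub_one_dvd ε hd n).trans ?_
    have := sub_dvd_pow_sub_pow (1 + (ε : PowerSeries A) * PowerSeries.X ^ d n) 1 r
    rwa [one_pow] at this
  · intro N m
    have := (hE m N).neg_right
    simpa [Finset.sum_neg_distrib, neg_sub, sub_eq_add_neg, add_comm] using this

/-- The infinite product of the factors `ch(⋀_t (E - ℂʳ))`, `t = ε z^{d(n)}`. -/
lemma infProd_chLamRed (h : IsCurv M F) (ε : ℤ) (d : ℕ → ℕ) (hd : ∀ n, n + 1 ≤ d n)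
    {E : ℕ → PowerSeries ℂ} (hE : ∀ m N, PowerSeries.X ^ N ∣ E m - ∑ n ∈ Finset.range N,
      twist ℂ (-ε) (d n) (Nat.ne_of_gt ((Nat.succ_pos n).trans_le (hd n))) (expCoef (2 * m + 1))) :
    infProd (fun n => chLamRed ε (d n) (nilExp F)) = cexp (evenTr M F) fun m => -E m := by
  rw [← infProd_cexp (e := fun n (m : Fin M) => -twist ℂ (-ε) (d n)
      (Nat.ne_of_gt ((Nat.succ_pos n).trans_le (hd n))) (expCoef (2 * m + 1))) h.nil' _]
  · congr 1
    funext n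
    exact chLamRed_nilExp h ε (d n) _
  · intro N m
    have := (hE m N).neg_right
    simpa [Finset.sum_neg_distrib, neg_sub, sub_eq_add_neg, add_comm] using this

/-- The infinite product of the factors `ch(S_{qⁿ}(E - ℂʳ))`. -/
lemma infProd_chSRed (h : IsCurv M F) :
    infProd (fun n => chSRed 1 (2 * (n + 1)) (nilExp F)) =
      cexp (evenTr M F) fun m => twist ℂ 1 2 two_ne_zero (sigCoef m) := by
  rw [← infProd_cexp (e := fun n (m : Fin M) => twist ℂ 1 (2 * (n + 1)) (by omega)
    (expCoef (2 * m + 1))) h.nil' fun N m => even_sub_dvd m N]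
  congr 1
  funext n
  exact chSRed_nilExp h 1 _ _

end Products

section Exponents

/-- `G_{2j}/(2j)!` as a series, `j = m + 1`, where `G_{2j} = -B_{2j}/(4j) + ∑ σ_{2j-1}(N) X^N`. -/
noncomputable def eisCoef (m : ℕ) : PowerSeries ℂ := PowerSeries.C (eisConst m) + sigCoef m

/-- `G_{2j}(X²)/(2j)!`, `j = m + 1`; at `X = q^{1/2}` this is the Eisenstein series
`G_{2j}(τ)/(2j)!`. -/
noncomputable def eisTwo (m : ℕ) : PowerSeries ℂ := twist ℂ 1 2 two_ne_zero (eisCoef m)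

/-- The series by which `tr F_V^{2j}`, `j = m + 1`, is multiplied in the exponents of the three
twisting bundles `Δ(V) ⊗ ⨂ ⋀_{q^m}`, `⨂ ⋀_{-q^{r-1/2}}`, `⨂ ⋀_{q^{s-1/2}}`. With `G = G_{2j}/(2j)!`
these are `-(2^{2j} G(2τ) - G(τ))`, `-(G(τ/2) - G(τ))` and `-(G((τ+1)/2) - G(τ))`. -/
noncomputable def thetaExp (i : Fin 3) (m : ℕ) : PowerSeries ℂ :=
  ![-((2 : ℂ) ^ (2 * m + 2) • twist ℂ 1 4 four_ne_zero (eisCoef m) - eisTwo m),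
    -(eisCoef m - eisTwo m),
    -(twist ℂ (-1) 1 one_ne_zero (eisCoef m) - eisTwo m)] i

/-- The exponents `thetaExp`, corrected by `G_2/2!` for `j = 1`; after this correction they are
modular also in weight two. -/
noncomputable def thetaMod (i : Fin 3) (m : ℕ) : PowerSeries ℂ :=
  thetaExp i m + if m = 0 then eisTwo m else 0

/-- The scalar factors of the three summands: the parts of the twisting factors which remain for
`F_V = 0`, times `∏ (1 - qⁿ)^{8l}`. -/
noncomputable def thetaFac (l : ℕ) (i : Fin 3) : PowerSeries ℂ :=
  ![(2 : ℂ) ^ (8 * l) • (PowerSeries.X ^ (2 * l) * wProd 1 (fun n => 2 * (n + 1)) ^ (16 * l)),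
    wProd (-1) (fun n => 2 * n + 1) ^ (16 * l),
    wProd 1 (fun n => 2 * n + 1) ^ (16 * l)] i * wProd (-1) (fun n => 2 * (n + 1)) ^ (8 * l)

lemma twist_eisCoef (ε : ℤ) (d : ℕ) (hd : d ≠ 0) (m : ℕ) :
    twist ℂ ε d hd (eisCoef m) = PowerSeries.C (eisConst m) + twist ℂ ε d hd (sigCoef m) := by
  rw [eisCoef, map_add, twist_C]

end Exponents

section Combined

variable {A : Type*} [CommRing A] [Algebra ℂ A]

lemma C_smul (z : ℂ) (a : A) : PowerSeries.C (z • a) = z • PowerSeries.C a := by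
  ext j
  rw [PowerSeries.coeff_smul, PowerSeries.coeff_C, PowerSeries.coeff_C, smul_ite, smul_zero]

lemma C_nilExp_sum {ι : Type*} [Fintype ι] {y : ι → A} (hy : ∀ i, IsNilpotent (y i)) (a : ι → ℂ) :
    PowerSeries.C (nilExp (∑ i, a i • y i)) = cexp y fun i => PowerSeries.C (a i) := by
  have h := map_nilExp (Algebra.ofId A (PowerSeries A) |>.restrictScalars ℂ)
    (a := ∑ i, a i • y i) (isNilpotent_sum fun i _ => (hy i).smul _)
  have hC : ∀ x : A, (Algebra.ofId A (PowerSeries A) |>.restrictScalars ℂ) x = PowerSeries.C x :=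
    fun x => rfl
  rw [hC, hC] at h
  rw [h, cexp, map_sum]
  congr 1
  refine Finset.sum_congr rfl fun i _ => ?_
  have : lft A (PowerSeries.C (a i)) = PowerSeries.C (algebraMap ℂ A (a i)) := PowerSeries.map_C _ _
  rw [this, ← map_mul, Algebra.smul_def, mul_comm]

/-- The exponents of the three summands of `Q`, as functions of the bundle (`0`, `1`, `2` for `TZ`,
`ξ`, `V`) and of `m = j - 1`, without the contribution of `e^{c/2}`. The exponent of `ξ` is the sum
of the three theta exponents, up to a constant term which is missing because `Θ` contains no spinor
bundle of `ξ`. -/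
noncomputable def plainExp {M : ℕ} (i : Fin 3) : Fin 3 × Fin M → PowerSeries ℂ := fun p =>
  ![eisTwo p.2,
    ∑ i, thetaExp i p.2 - PowerSeries.C (-(2 ^ (2 * p.2.val + 2) - 1) * eisConst p.2),
    thetaExp i p.2] p.1

/-- The exponents of the three summands after completion by `cosh(c/2)` and correction in weight
two. The non-modular contributions of weight two are collected in the additional index `none`, which
stands for the form `-p₁(TZ) + 3 p₁(ξ) + p₁(V)`. -/
noncomputable def modExp {M : ℕ} (i : Fin 3) : Option (Fin 3 × Fin M) → PowerSeries ℂ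
  | none => -(2 : ℂ) • eisTwo 0
  | some p => ![if p.2.val = 0 then 0 else eisTwo p.2, ∑ i, thetaMod i p.2, thetaMod i p.2] p.1

variable {M d l : ℕ} (FT : Matrix (Fin d) (Fin d) A) (Fξ : Matrix (Fin 2) (Fin 2) A)
  (FV : Matrix (Fin (16 * l)) (Fin (16 * l)) A)

/-- The even traces of the three curvatures, of `TZ`, `ξ` and `V`. -/
def traces (M : ℕ) (p : Fin 3 × Fin M) : A := ![evenTr M FT p.2, evenTr M Fξ p.2, evenTr M FV p.2] p.1

/-- The even traces, together with the form `-p₁(TZ) + 3 p₁(ξ) + p₁(V)`. -/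
noncomputable def tracesOpt (M : ℕ) : Option (Fin 3 × Fin M) → A
  | none => -pontryagin FT + 3 * pontryagin Fξ + pontryagin FV
  | some p => traces FT Fξ FV M p

variable {FT Fξ FV}

lemma traces_nil (hT : IsCurv M FT) (hξ : IsCurv M Fξ) (hV : IsCurv M FV) (p : Fin 3 × Fin M) :
    IsNilpotent (traces FT Fξ FV M p) := by
  obtain ⟨i, m⟩ := p
  fin_cases i
  · exact hT.nil' m
  · exact hξ.nil' m
  · exact hV.nil' m

lemma cexp_traces (hT : IsCurv M FT) (hξ : IsCurv M Fξ) (hV : IsCurv M FV)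
    (e : Fin 3 × Fin M → PowerSeries ℂ) : cexp (traces FT Fξ FV M) e =
      cexp (evenTr M FT) (fun m => e (0, m)) * cexp (evenTr M Fξ) (fun m => e (1, m)) *
        cexp (evenTr M FV) (fun m => e (2, m)) := by
  rw [cexp, cexp, cexp, cexp, ← nilExp_add (Commute.all _ _) (isNilpotent_expSum hT.nil' _)
    (isNilpotent_expSum hξ.nil' _), ← nilExp_add (Commute.all _ _)
    ((Commute.all _ _).isNilpotent_add (isNilpotent_expSum hT.nil' _)
      (isNilpotent_expSum hξ.nil' _)) (isNilpotent_expSum hV.nil' _),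
    Fintype.sum_prod_type, Fin.sum_univ_three]
  rfl

lemma cexp_mul_cexp {ι : Type*} [Fintype ι] {y : ι → A} (hy : ∀ i, IsNilpotent (y i))
    {e e' e'' : ι → PowerSeries ℂ} (h : ∀ i, e i + e' i = e'' i) :
    cexp y e * cexp y e' = cexp y e'' := by
  rw [← cexp_add hy]
  congr 1
  funext i
  exact h i

lemma neg_even_exp (m : ℕ) : -((2 : ℂ) ^ (2 * m + 2) • twist ℂ 1 4 four_ne_zero (sigCoef m) -
      twist ℂ 1 2 two_ne_zero (sigCoef m)) =
    thetaExp 0 m - PowerSeries.C (-(2 ^ (2 * m + 2) - 1) * eisConst m) := by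
  rw [thetaExp, Matrix.cons_val_zero, eisTwo, twist_eisCoef, twist_eisCoef, smul_add,
    ← C_smul, smul_eq_mul, neg_mul, map_neg, sub_mul, one_mul, map_sub]
  abel

lemma neg_odd_exp (m : ℕ) : -(sigCoef m - twist ℂ 1 2 two_ne_zero (sigCoef m)) = thetaExp 1 m := by
  rw [thetaExp, Matrix.cons_val_one, Matrix.cons_val_zero, eisTwo, twist_eisCoef, eisCoef]
  abel

lemma neg_odd_neg_exp (m : ℕ) : -(twist ℂ (-1) 1 one_ne_zero (sigCoef m) -
    twist ℂ 1 2 two_ne_zero (sigCoef m)) = thetaExp 2 m := by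
  rw [thetaExp, Matrix.cons_val_two, Matrix.tail_cons, Matrix.head_cons, eisTwo, twist_eisCoef,
    twist_eisCoef]
  abel

lemma odd_sub_dvd' (m N : ℕ) : PowerSeries.X ^ N ∣ sigCoef m - twist ℂ 1 2 two_ne_zero (sigCoef m) -
    ∑ n ∈ Finset.range N, twist ℂ (- -1) (2 * n + 1) (by omega) (expCoef (2 * m + 1)) := by
  have := odd_sub_dvd m N
  rwa [show (1 : ℤ) = - -1 by norm_num] at this

/-- The Chern character of `Θ(T_ℂZ, ξ_ℂ)`: the three families of exterior powers of `ξ_ℂ` contribute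
the three theta exponents. -/
lemma chTheta_eq (hT : IsCurv M FT) (hξ : IsCurv M Fξ) :
    chTheta (nilExp FT) (nilExp Fξ) =
      cexp (evenTr M FT) (fun m => twist ℂ 1 2 two_ne_zero (sigCoef m)) *
      cexp (evenTr M Fξ) (fun m => ∑ i, thetaExp i m -
        PowerSeries.C (-(2 ^ (2 * m.val + 2) - 1) * eisConst m)) := by
  rw [chTheta, infProd_chSRed hT,
    infProd_chLamRed hξ 1 (fun n => 2 * (n + 1)) (fun n => by omega) even_neg_sub_dvd,
    infProd_chLamRed hξ 1 (fun n => 2 * n + 1) (fun n => by omega) odd_neg_sub_dvd,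
    infProd_chLamRed hξ (-1) (fun n => 2 * n + 1) (fun n => by omega) odd_sub_dvd']
  simp only [neg_even_exp, neg_odd_exp, neg_odd_neg_exp]
  rw [mul_assoc, mul_assoc]
  congr 1
  rw [cexp_mul_cexp hξ.nil' (fun m => rfl), cexp_mul_cexp hξ.nil']
  intro m
  rw [Fin.sum_univ_three]
  abel

lemma eulerPow_eq (e : ℕ) :
    (eulerPow e : PowerSeries A) = lft A (wProd (-1) fun n => 2 * (n + 1)) ^ e := by
  rw [eulerPow, lft_wProd]
  simp [sub_eq_add_neg]

/-- The twisting factors, as a sum of three exponentials. -/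
lemma eulerPow_mul_chTwist (hV : IsCurv M FV) (hnil : ∀ i j, IsNilpotent (FV i j)) :
    eulerPow (8 * l) * chTwist FV =
      ∑ i, lft A (thetaFac l i) * cexp (evenTr M FV) fun m => thetaExp i m := by
  have h0 : PowerSeries.C (chSpinor FV) * infProd (fun m => chLam 1 (2 * (m + 1)) (nilExp FV)) =
      (2 : ℂ) ^ (8 * l) • (lft A (wProd 1 fun n => 2 * (n + 1)) ^ (16 * l) *
        cexp (evenTr M FV) fun m => thetaExp 0 m) := by
    rw [chSpinor_eq_evenTr hV hnil,
      infProd_chLam hV 1 (fun n => 2 * (n + 1)) (fun n => by omega) even_neg_sub_dvd]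
    simp only [neg_even_exp]
    have h1 : PowerSeries.C ((2 : ℂ) ^ (8 * l) • nilExp (∑ m : Fin M,
        (-(2 ^ (2 * m.val + 2) - 1) * eisConst m) • evenTr M FV m)) = (2 : ℂ) ^ (8 * l) •
        cexp (evenTr M FV) fun m => PowerSeries.C (-(2 ^ (2 * m.val + 2) - 1) * eisConst m) := by
      rw [← C_nilExp_sum hV.nil', C_smul]
    rw [h1, Algebra.smul_mul_assoc]
    congr 1
    rw [mul_left_comm]
    congr 1
    exact cexp_mul_cexp hV.nil' fun m => by abel
  rw [chTwist, h0, infProd_chLam hV (-1) (fun n => 2 * n + 1) (fun n => by omega) odd_sub_dvd',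
    infProd_chLam hV 1 (fun n => 2 * n + 1) (fun n => by omega) odd_neg_sub_dvd, eulerPow_eq]
  simp only [neg_odd_exp, neg_odd_neg_exp]
  rw [Fin.sum_univ_three]
  simp only [thetaFac, Matrix.cons_val_zero, Matrix.cons_val_one, Matrix.cons_val_two,
    Matrix.tail_cons, Matrix.head_cons, map_mul, map_smul, map_pow, lft_X]
  rw [mul_smul_comm, Algebra.smul_mul_assoc, Algebra.smul_mul_assoc, mul_add, mul_add,
    mul_smul_comm]
  congr 1
  · congr 1
    · congr 1
      ring
    · ring
  · ring

/-- The series `Q` without the factor `e^{c/2}`. -/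
lemma plain_eq (hT : IsCurv M FT) (hξ : IsCurv M Fξ) (hV : IsCurv M FV)
    (hnil : ∀ i j, IsNilpotent (FV i j)) :
    PowerSeries.C (aHat FT) * chTheta (nilExp FT) (nilExp Fξ) * (eulerPow (8 * l) * chTwist FV) =
      ∑ i, lft A (thetaFac l i) * cexp (traces FT Fξ FV M) (plainExp i) := by
  rw [aHat_eq hT, C_nilExp_sum hT.nil', chTheta_eq hT hξ, eulerPow_mul_chTwist hV hnil,
    Finset.mul_sum]
  refine Finset.sum_congr rfl fun i _ => ?_
  rw [cexp_traces hT hξ hV]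
  have h1 : cexp (evenTr M FT) (fun m => PowerSeries.C (eisConst m)) *
      cexp (evenTr M FT) (fun m => twist ℂ 1 2 two_ne_zero (sigCoef m)) =
      cexp (evenTr M FT) fun m => eisTwo m :=
    cexp_mul_cexp hT.nil' fun m => by rw [eisTwo, twist_eisCoef]
  calc _ = cexp (evenTr M FT) (fun m => PowerSeries.C (eisConst m)) *
      cexp (evenTr M FT) (fun m => twist ℂ 1 2 two_ne_zero (sigCoef m)) *
      cexp (evenTr M Fξ) (fun m => ∑ i, thetaExp i m -
        PowerSeries.C (-(2 ^ (2 * m.val + 2) - 1) * eisConst m)) *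
      (lft A (thetaFac l i) * cexp (evenTr M FV) fun m => thetaExp i m) := by ring
    _ = _ := by
      rw [h1]
      simp only [plainExp, Matrix.cons_val_zero, Matrix.cons_val_one, Matrix.cons_val_two,
        Matrix.tail_cons, Matrix.head_cons]
      ring

lemma tracesOpt_nil (hT : IsCurv M FT) (hξ : IsCurv M Fξ) (hV : IsCurv M FV)
    (o : Option (Fin 3 × Fin M)) : IsNilpotent (tracesOpt FT Fξ FV M o) := by
  rcases o with _ | p
  · have hp : ∀ {s : ℕ} {F : Matrix (Fin s) (Fin s) A}, IsCurv M F → IsNilpotent (pontryagin F) := by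
      intro s F hF
      have := hF.nil 1
      rw [pow_two] at this
      exact this.smul _
    exact (Commute.all _ _).isNilpotent_add ((Commute.all _ _).isNilpotent_add (hp hT).neg
      ((Commute.all _ _).isNilpotent_mul_left (hp hξ))) (hp hV)
  · exact traces_nil hT hξ hV p

/-- Multiplication by `cosh(c/2)` supplies the missing constant term in the exponent of `ξ`. Then
the three corrections in weight two are collected: as `p₁ = ½ tr F²`, they combine to the multiple
`-2 · G_2/2!` of `-p₁(TZ) + 3 p₁(ξ) + p₁(V)`. -/
lemma cexp_modExp (hM : 0 < M) (hT : IsCurv M FT) (hξ : IsCurv M Fξ) (hV : IsCurv M FV)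
    (i : Fin 3) : cexp (evenTr M Fξ) (fun m => PowerSeries.C
      (-(2 ^ (2 * m.val + 2) - 1) * eisConst m)) * cexp (traces FT Fξ FV M) (plainExp i) =
      cexp (tracesOpt FT Fξ FV M) (modExp i) := by
  have h1 : cexp (evenTr M Fξ) (fun m => PowerSeries.C
      (-(2 ^ (2 * m.val + 2) - 1) * eisConst m)) * cexp (traces FT Fξ FV M) (plainExp i) =
      cexp (evenTr M FT) (fun m => eisTwo m) * cexp (evenTr M Fξ) (fun m => ∑ i, thetaExp i m) *
        cexp (evenTr M FV) (fun m => thetaExp i m) := by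
    rw [cexp_traces hT hξ hV, ← mul_assoc, ← mul_assoc, mul_comm _ (cexp (evenTr M FT) _),
      mul_assoc (cexp (evenTr M FT) _) _ _]
    rw [cexp_mul_cexp hξ.nil' (e'' := fun m => ∑ i, thetaExp i m)]
    · rfl
    · intro m
      simp only [plainExp, Matrix.cons_val_one, Matrix.cons_val_zero]
      abel
  rw [h1, cexp, cexp, cexp, cexp, Fintype.sum_option, Fintype.sum_prod_type, Fin.sum_univ_three,
    ← nilExp_add (Commute.all _ _) (isNilpotent_expSum hT.nil' _) (isNilpotent_expSum hξ.nil' _),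
    ← nilExp_add (Commute.all _ _) ((Commute.all _ _).isNilpotent_add
      (isNilpotent_expSum hT.nil' _) (isNilpotent_expSum hξ.nil' _)) (isNilpotent_expSum hV.nil' _)]
  congr 1
  obtain ⟨K, rfl⟩ := Nat.exists_eq_succ_of_ne_zero hM.ne'
  simp only [Fin.sum_univ_succ (n := K)]
  simp only [tracesOpt, traces, modExp, thetaMod, Matrix.cons_val_zero, Matrix.cons_val_one,
    Matrix.cons_val_two, Matrix.tail_cons, Matrix.head_cons, Fin.val_zero, Fin.val_succ, if_true,
    Nat.succ_ne_zero, if_false, add_zero, map_zero, mul_zero, zero_add]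
  have hp : ∀ {s : ℕ} (F : Matrix (Fin s) (Fin s) A),
      PowerSeries.C (pontryagin F) = (1 / 2 : ℂ) • PowerSeries.C (evenTr (K + 1) F 0) := by
    intro s F
    rw [pontryagin, evenTr, C_smul]
    simp only [Fin.val_zero, zero_add, mul_one, pow_two]
  have h3 : PowerSeries.C (3 : A) = 3 := map_ofNat _ 3
  rw [map_add, map_add, map_neg, map_mul, hp, hp, hp, h3, map_smul, Fin.sum_univ_three,
    Fin.sum_univ_three]
  simp only [map_add]
  have h2 : ∀ y : PowerSeries A, (1 / 2 : ℂ) • y * ((-2 : ℂ) • lft A (eisTwo 0)) =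
      -(y * lft A (eisTwo 0)) := by
    intro y
    rw [Algebra.smul_mul_assoc, mul_smul_comm, smul_smul]
    norm_num
  have h2' : ∀ y : PowerSeries A, -((1 / 2 : ℂ) • y) * ((-2 : ℂ) • lft A (eisTwo 0)) =
      y * lft A (eisTwo 0) := by
    intro y
    rw [neg_mul, h2, neg_neg]
  rw [add_mul, add_mul, mul_assoc 3, h2, h2, h2']
  ring

/-- The series `Q` before taking the component of degree `4k`: the part with `cosh(c/2)` in place of
`e^{c/2}` is a sum of three exponentials, and the part with `sinh(c/2)` is odd in `c`. -/
theorem qSeries_eq (hM : 0 < M) (hT : IsCurv M FT) (hξ : IsCurv M Fξ) (hV : IsCurv M FV)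
    (hnil : ∀ i j, IsNilpotent (FV i j)) {c : A} (hc : c ^ (2 * M + 1) = 0)
    (hcξ : ∀ m : Fin M, evenTr M Fξ m = (2 : ℂ) • c ^ (2 * (m.val + 1))) :
    qSeries FT Fξ c FV =
      ∑ i, lft A (thetaFac l i) * cexp (tracesOpt FT Fξ FV M) (modExp i) +
      PowerSeries.C (∑ j ∈ Finset.range M,
        ((1 / 2 : ℂ) * PowerSeries.coeff (2 * j) sinhcHalf) • c ^ (2 * j + 1)) *
        ∑ i, lft A (thetaFac l i) * cexp (traces FT Fξ FV M) (plainExp i) := by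
  have h1 : qSeries FT Fξ c FV = PowerSeries.C (nilExp ((1 / 2 : ℂ) • c)) *
      (PowerSeries.C (aHat FT) * chTheta (nilExp FT) (nilExp Fξ) *
        (eulerPow (8 * l) * chTwist FV)) := by
    rw [qSeries, map_mul]
    ring
  rw [h1, plain_eq hT hξ hV hnil, nilExp_half hc, map_add, add_mul]
  congr 1
  rw [evNil_coshHalf hc, Finset.mul_sum]
  refine Finset.sum_congr rfl fun i _ => ?_
  simp only [← hcξ]
  rw [C_nilExp_sum hξ.nil', mul_left_comm, cexp_modExp hM hT hξ hV]

end Combined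

section Expansion

variable {A : Type*} [CommRing A] [Algebra ℂ A] {ι : Type*} [Fintype ι] [DecidableEq ι]

/-- The coefficient of the monomial `y^γ` in the exponential of `∑ yᵢ eᵢ`. -/
noncomputable def monCoef {K : ℕ} (e : ι → PowerSeries ℂ) (γ : ι → Fin K) : PowerSeries ℂ :=
  ∏ i, ((γ i).val.factorial : ℂ)⁻¹ • e i ^ (γ i).val

/-- The exponential of `∑ yᵢ eᵢ` as a polynomial in the nilpotent elements `yᵢ`. -/
lemma cexp_expand {K : ℕ} {y : ι → A} (hy : ∀ i, y i ^ K = 0) (e : ι → PowerSeries ℂ) :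
    cexp y e = ∑ γ : ι → Fin K, PowerSeries.C (∏ i, y i ^ (γ i).val) * lft A (monCoef e γ) := by
  have hpow : ∀ i, (PowerSeries.C (y i) * lft A (e i)) ^ K = 0 := by
    intro i
    rw [mul_pow, ← map_pow, hy, map_zero, zero_mul]
  rw [cexp, nilExp_sum _ _ fun i _ => ⟨K, hpow i⟩]
  simp only [fun i => nilExp_eq_sum (hpow i)]
  simp only [← Fin.sum_univ_eq_sum_range
    (fun j => ((j.factorial : ℂ)⁻¹) • (_ : PowerSeries A) ^ j) K]
  rw [Finset.prod_univ_sum, Fintype.piFinset_univ]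
  refine Finset.sum_congr rfl fun γ _ => ?_
  rw [monCoef, map_prod, map_prod, ← Finset.prod_mul_distrib]
  refine Finset.prod_congr rfl fun i _ => ?_
  rw [map_smul, map_pow, map_pow, mul_pow, mul_smul_comm]

end Expansion

/-! ### Power series converging on the unit disc -/

section Convergence

/-- The power series which converge absolutely on the open unit disc. -/
def IsConv (f : PowerSeries ℂ) : Prop :=
  ∀ r : ℝ, 0 ≤ r → r < 1 → Summable fun n => ‖PowerSeries.coeff n f‖ * r ^ n

/-- The value of a power series at `z`; it is `0` by convention where the series does not converge.
-/
noncomputable def evAt (z : ℂ) (f : PowerSeries ℂ) : ℂ := ∑' n, PowerSeries.coeff n f * z ^ n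

variable {f g : PowerSeries ℂ} {z : ℂ}

lemma IsConv.summable_norm (hf : IsConv f) (hz : ‖z‖ < 1) :
    Summable fun n => ‖PowerSeries.coeff n f * z ^ n‖ := by
  simpa using hf ‖z‖ (norm_nonneg z) hz

lemma IsConv.summable (hf : IsConv f) (hz : ‖z‖ < 1) :
    Summable fun n => PowerSeries.coeff n f * z ^ n :=
  (hf.summable_norm hz).of_norm

lemma isConv_of_summable (h : ∀ r : ℝ, 0 ≤ r → r < 1 →
    Summable fun n => ‖PowerSeries.coeff n f * (r : ℂ) ^ n‖) : IsConv f := by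
  intro r h0 h1
  refine (h r h0 h1).congr fun n => ?_
  rw [norm_mul, norm_pow, Complex.norm_real, Real.norm_of_nonneg h0]

lemma norm_ofReal_lt {r : ℝ} (h0 : 0 ≤ r) (h1 : r < 1) : ‖(r : ℂ)‖ < 1 := by
  rwa [Complex.norm_real, Real.norm_of_nonneg h0]

lemma IsConv.add (hf : IsConv f) (hg : IsConv g) : IsConv (f + g) := by
  intro r h0 h1
  refine Summable.of_nonneg_of_le (fun n => by positivity) (fun n => ?_)
    ((hf r h0 h1).add (hg r h0 h1))
  rw [map_add, ← add_mul]
  gcongr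
  exact norm_add_le _ _

lemma coeff_mul_mul_pow (f g : PowerSeries ℂ) (z : ℂ) (n : ℕ) :
    PowerSeries.coeff n (f * g) * z ^ n = ∑ p ∈ Finset.HasAntidiagonal.antidiagonal n,
      (PowerSeries.coeff p.1 f * z ^ p.1) * (PowerSeries.coeff p.2 g * z ^ p.2) := by
  rw [PowerSeries.coeff_mul, Finset.sum_mul]
  refine Finset.sum_congr rfl fun p hp => ?_
  rw [← Finset.HasAntidiagonal.mem_antidiagonal.mp hp, pow_add]
  ring

lemma IsConv.mul (hf : IsConv f) (hg : IsConv g) : IsConv (f * g) := by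
  refine isConv_of_summable fun r h0 h1 => ?_
  have hz := norm_ofReal_lt h0 h1
  have h := summable_norm_sum_mul_antidiagonal_of_summable_norm (hf.summable_norm hz)
    (hg.summable_norm hz)
  refine h.congr fun n => ?_
  rw [coeff_mul_mul_pow]

lemma isConv_monomial (d : ℕ) (a : ℂ) : IsConv (PowerSeries.monomial d a) := by
  intro r _ _
  refine summable_of_ne_finset_zero (s := {d}) fun n hn => ?_
  rw [PowerSeries.coeff_monomial, if_neg (by simpa using hn), norm_zero, zero_mul]

lemma isConv_C (a : ℂ) : IsConv (PowerSeries.C a) := by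
  rw [← PowerSeries.monomial_zero_eq_C_apply]
  exact isConv_monomial 0 a

lemma isConv_one : IsConv 1 := by simpa using isConv_C 1

lemma isConv_X_pow (d : ℕ) : IsConv (PowerSeries.X ^ d) := by
  rw [PowerSeries.X_pow_eq]
  exact isConv_monomial d 1

lemma IsConv.smul (hf : IsConv f) (a : ℂ) : IsConv (a • f) := by
  rw [PowerSeries.smul_eq_C_mul]
  exact (isConv_C a).mul hf

lemma IsConv.neg (hf : IsConv f) : IsConv (-f) := by
  simpa using hf.smul (-1)

lemma IsConv.sub (hf : IsConv f) (hg : IsConv g) : IsConv (f - g) := by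
  rw [sub_eq_add_neg]
  exact hf.add hg.neg

lemma IsConv.pow (hf : IsConv f) (m : ℕ) : IsConv (f ^ m) := by
  induction m with
  | zero => simpa using isConv_one
  | succ m ih => rw [pow_succ]; exact ih.mul hf

lemma isConv_prod {ι : Type*} (s : Finset ι) {f : ι → PowerSeries ℂ} (hf : ∀ i, IsConv (f i)) :
    IsConv (∏ i ∈ s, f i) :=
  Finset.prod_induction f IsConv (fun _ _ => IsConv.mul) isConv_one fun i _ => hf i

lemma isConv_sum {ι : Type*} (s : Finset ι) {f : ι → PowerSeries ℂ} (hf : ∀ i, IsConv (f i)) :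
    IsConv (∑ i ∈ s, f i) :=
  Finset.sum_induction f IsConv (fun _ _ => IsConv.add) (by simpa using isConv_C 0) fun i _ => hf i

lemma evAt_monomial (z : ℂ) (d : ℕ) (a : ℂ) : evAt z (PowerSeries.monomial d a) = a * z ^ d := by
  rw [evAt, tsum_eq_single d, PowerSeries.coeff_monomial_same]
  intro n hn
  rw [PowerSeries.coeff_monomial, if_neg hn, zero_mul]

lemma evAt_C (z a : ℂ) : evAt z (PowerSeries.C a) = a := by
  simpa using evAt_monomial z 0 a

lemma evAt_one (z : ℂ) : evAt z 1 = 1 := by simpa using evAt_C z 1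

lemma evAt_X_pow (z : ℂ) (d : ℕ) : evAt z (PowerSeries.X ^ d) = z ^ d := by
  rw [PowerSeries.X_pow_eq, evAt_monomial, one_mul]

lemma evAt_add (hz : ‖z‖ < 1) (hf : IsConv f) (hg : IsConv g) :
    evAt z (f + g) = evAt z f + evAt z g := by
  rw [evAt, evAt, evAt, ← (hf.summable hz).tsum_add (hg.summable hz)]
  simp only [map_add, add_mul]

lemma evAt_mul (hz : ‖z‖ < 1) (hf : IsConv f) (hg : IsConv g) :
    evAt z (f * g) = evAt z f * evAt z g := by
  rw [evAt, evAt, evAt, tsum_mul_tsum_eq_tsum_sum_antidiagonal_of_summable_norm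
    (hf.summable_norm hz) (hg.summable_norm hz)]
  simp only [coeff_mul_mul_pow]

lemma evAt_smul (z : ℂ) (a : ℂ) (f : PowerSeries ℂ) : evAt z (a • f) = a * evAt z f := by
  rw [evAt, evAt, ← tsum_mul_left]
  simp only [PowerSeries.coeff_smul, smul_eq_mul, mul_assoc]

lemma evAt_neg (z : ℂ) (f : PowerSeries ℂ) : evAt z (-f) = -evAt z f := by
  simpa using evAt_smul z (-1) f

lemma evAt_sub (hz : ‖z‖ < 1) (hf : IsConv f) (hg : IsConv g) :
    evAt z (f - g) = evAt z f - evAt z g := by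
  rw [sub_eq_add_neg, evAt_add hz hf hg.neg, evAt_neg, sub_eq_add_neg]

lemma evAt_pow (hz : ‖z‖ < 1) (hf : IsConv f) (m : ℕ) : evAt z (f ^ m) = evAt z f ^ m := by
  induction m with
  | zero => simpa using evAt_one z
  | succ m ih => rw [pow_succ, evAt_mul hz (hf.pow m) hf, ih, pow_succ]

lemma evAt_prod (hz : ‖z‖ < 1) {ι : Type*} (s : Finset ι) {f : ι → PowerSeries ℂ}
    (hf : ∀ i, IsConv (f i)) : evAt z (∏ i ∈ s, f i) = ∏ i ∈ s, evAt z (f i) := by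
  induction s using Finset.cons_induction with
  | empty => simpa using evAt_one z
  | cons a s ha ih =>
    rw [Finset.prod_cons, Finset.prod_cons, evAt_mul hz (hf a) (isConv_prod s hf), ih]

lemma evAt_sum (hz : ‖z‖ < 1) {ι : Type*} (s : Finset ι) {f : ι → PowerSeries ℂ}
    (hf : ∀ i, IsConv (f i)) : evAt z (∑ i ∈ s, f i) = ∑ i ∈ s, evAt z (f i) := by
  induction s using Finset.cons_induction with
  | empty => simpa using evAt_C z 0
  | cons a s ha ih =>
    rw [Finset.sum_cons, Finset.sum_cons, evAt_add hz (hf a) (isConv_sum s hf), ih]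

/-- The substitution `X ↦ ε X^d` only inserts zero coefficients. -/
lemma hasSum_twist {ε : ℤ} {d : ℕ} (hd : d ≠ 0) (z : ℂ) {s : ℂ}
    (h : HasSum (fun n => PowerSeries.coeff n f * (ε * z ^ d) ^ n) s) :
    HasSum (fun n => PowerSeries.coeff n (twist ℂ ε d hd f) * z ^ n) s := by
  have hinj : Function.Injective fun n => d * n := fun a b hab =>
    Nat.eq_of_mul_eq_mul_left (Nat.pos_of_ne_zero hd) hab
  rw [← hinj.hasSum_iff]
  · refine h.congr_fun ?_ |> fun h => h
    intro n
    simp only [Function.comp_apply]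
    rw [coeff_twist, if_pos (dvd_mul_right d n), Nat.mul_div_cancel_left _ (Nat.pos_of_ne_zero hd),
      mul_pow, pow_mul]
    ring
  · intro n hn
    rw [coeff_twist, if_neg, zero_mul]
    rintro ⟨m, rfl⟩
    exact hn ⟨m, rfl⟩

lemma IsConv.twist (hf : IsConv f) {ε : ℤ} (hε : ε = 1 ∨ ε = -1) {d : ℕ} (hd : d ≠ 0) :
    IsConv (twist ℂ ε d hd f) := by
  refine isConv_of_summable fun r h0 h1 => ?_
  have h2 : Summable fun n => PowerSeries.coeff n f * (ε * (r : ℂ) ^ d) ^ n := by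
    refine hf.summable ?_
    rw [norm_mul, norm_pow, Complex.norm_real, Real.norm_of_nonneg h0]
    have : ‖(ε : ℂ)‖ = 1 := by rcases hε with rfl | rfl <;> simp
    rw [this, one_mul]
    exact pow_lt_one₀ h0 h1 hd
  exact (hasSum_twist hd _ h2.hasSum).summable.norm

lemma evAt_twist (hf : IsConv f) {ε : ℤ} (hε : ε = 1 ∨ ε = -1) {d : ℕ} (hd : d ≠ 0)
    (hz : ‖z‖ < 1) : evAt z (twist ℂ ε d hd f) = evAt (ε * z ^ d) f := by
  refine (hasSum_twist hd z (hf.summable ?_).hasSum).tsum_eq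
  rw [norm_mul, norm_pow]
  have : ‖(ε : ℂ)‖ = 1 := by rcases hε with rfl | rfl <;> simp
  rw [this, one_mul]
  exact pow_lt_one₀ (norm_nonneg _) hz hd

lemma IsConv.differentiableOn (hf : IsConv f) :
    DifferentiableOn ℂ (fun z => evAt z f) (Metric.ball 0 1) := by
  intro z hz
  rw [mem_ball_zero_iff] at hz
  obtain ⟨r, hr, hr1⟩ := exists_between hz
  have h0 : 0 ≤ r := (norm_nonneg z).trans hr.le
  have := Complex.differentiableOn_tsum_of_summable_norm (hf r h0 hr1)
    (F := fun n w => PowerSeries.coeff n f * w ^ n) (U := Metric.ball 0 r)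
    (fun n => by fun_prop) Metric.isOpen_ball (fun n w hw => by
      rw [norm_mul, norm_pow]
      gcongr
      exact (mem_ball_zero_iff.mp hw).le)
  exact (this.differentiableAt (Metric.isOpen_ball.mem_nhds (mem_ball_zero_iff.mpr hr))
    ).differentiableWithinAt

end Convergence

section InfiniteProducts

/-- The weighted `ℓ¹` norm `∑ |aₙ| rⁿ`, which is submultiplicative on the series converging on the
unit disc. -/
noncomputable def wNorm (r : ℝ) (f : PowerSeries ℂ) : ℝ := ∑' n, ‖PowerSeries.coeff n f‖ * r ^ n

variable {r : ℝ}

lemma wNorm_nonneg (h0 : 0 ≤ r) (f : PowerSeries ℂ) : 0 ≤ wNorm r f :=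
  tsum_nonneg fun n => by positivity

lemma wNorm_add_le (h0 : 0 ≤ r) (h1 : r < 1) {f g : PowerSeries ℂ} (hf : IsConv f)
    (hg : IsConv g) : wNorm r (f + g) ≤ wNorm r f + wNorm r g := by
  rw [wNorm, wNorm, wNorm, ← (hf r h0 h1).tsum_add (hg r h0 h1)]
  refine (hf.add hg r h0 h1).tsum_le_tsum (fun n => ?_) ((hf r h0 h1).add (hg r h0 h1))
  rw [map_add, ← add_mul]
  gcongr
  exact norm_add_le _ _

lemma wNorm_mul_le (h0 : 0 ≤ r) (h1 : r < 1) {f g : PowerSeries ℂ} (hf : IsConv f)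
    (hg : IsConv g) : wNorm r (f * g) ≤ wNorm r f * wNorm r g := by
  have hf' : Summable fun n => ‖‖PowerSeries.coeff n f‖ * r ^ n‖ := (hf r h0 h1).norm
  have hg' : Summable fun n => ‖‖PowerSeries.coeff n g‖ * r ^ n‖ := (hg r h0 h1).norm
  rw [wNorm, wNorm, wNorm, tsum_mul_tsum_eq_tsum_sum_antidiagonal_of_summable_norm hf' hg']
  refine (hf.mul hg r h0 h1).tsum_le_tsum (fun n => ?_)
    (summable_norm_sum_mul_antidiagonal_of_summable_norm hf' hg').of_norm
  rw [PowerSeries.coeff_mul]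
  calc _ ≤ (∑ p ∈ Finset.HasAntidiagonal.antidiagonal n, ‖PowerSeries.coeff p.1 f * PowerSeries.coeff p.2 g‖)
        * r ^ n := by gcongr; exact norm_sum_le _ _
    _ = _ := by
      rw [Finset.sum_mul]
      refine Finset.sum_congr rfl fun p hp => ?_
      rw [← Finset.HasAntidiagonal.mem_antidiagonal.mp hp, pow_add, norm_mul]
      ring

lemma wNorm_monomial (r : ℝ) (d : ℕ) (a : ℂ) :
    wNorm r (PowerSeries.monomial d a) = ‖a‖ * r ^ d := by
  rw [wNorm, tsum_eq_single d, PowerSeries.coeff_monomial_same]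
  intro n hn
  rw [PowerSeries.coeff_monomial, if_neg hn, norm_zero, zero_mul]

lemma factor_eq (ε : ℤ) (d : ℕ) : (1 : PowerSeries ℂ) + (ε : PowerSeries ℂ) * PowerSeries.X ^ d =
    1 + PowerSeries.monomial d (ε : ℂ) := by
  rw [PowerSeries.monomial_eq_C_mul_X_pow, map_intCast]

lemma isConv_factor (ε : ℤ) (d : ℕ) :
    IsConv ((1 : PowerSeries ℂ) + (ε : PowerSeries ℂ) * PowerSeries.X ^ d) := by
  rw [factor_eq]
  exact isConv_one.add (isConv_monomial _ _)

/-- A bound for the partial products which is independent of their length: a factor has norm at most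
`1 + rⁿ ≤ exp(rⁿ)`. -/
lemma wNorm_prod_le {ε : ℤ} (hε : ε = 1 ∨ ε = -1) {d : ℕ → ℕ} (hd : ∀ n, n + 1 ≤ d n)
    (h0 : 0 ≤ r) (h1 : r < 1) (N : ℕ) :
    wNorm r (∏ n ∈ Finset.range N, (1 + (ε : PowerSeries ℂ) * PowerSeries.X ^ d n)) ≤
      Real.exp (1 - r)⁻¹ := by
  have h2 : wNorm r (∏ n ∈ Finset.range N, (1 + (ε : PowerSeries ℂ) * PowerSeries.X ^ d n)) ≤
      Real.exp (∑ n ∈ Finset.range N, r ^ n) := by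
    induction N with
    | zero =>
      have := wNorm_monomial r 0 1
      rw [PowerSeries.monomial_zero_eq_C_apply, map_one] at this
      simp [this]
    | succ N ih =>
      rw [Finset.prod_range_succ, Finset.sum_range_succ, Real.exp_add]
      refine (wNorm_mul_le h0 h1 (isConv_prod _ fun n => isConv_factor ε _)
        (isConv_factor ε _)).trans ?_
      refine mul_le_mul ih ?_ (wNorm_nonneg h0 _) (Real.exp_pos _).le
      rw [factor_eq]
      refine (wNorm_add_le h0 h1 isConv_one (isConv_monomial _ _)).trans ?_
      have h3 := wNorm_monomial r 0 1
      rw [PowerSeries.monomial_zero_eq_C_apply, map_one] at h3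
      have h4 : ‖(ε : ℂ)‖ = 1 := by rcases hε with rfl | rfl <;> simp
      rw [h3, wNorm_monomial, h4, norm_one, one_mul, one_mul, pow_zero, add_comm]
      refine le_trans ?_ (Real.add_one_le_exp _)
      gcongr 1
      exact pow_le_pow_of_le_one h0 h1.le (by have := hd N; omega)
  refine h2.trans (Real.exp_le_exp.mpr ?_)
  rw [← tsum_geometric_of_lt_one h0 h1]
  exact (summable_geometric_of_lt_one h0 h1).sum_le_tsum _ fun n _ => by positivity

lemma coeff_wProd {ε : ℤ} {d : ℕ → ℕ} (hd : ∀ n, n + 1 ≤ d n) {j N : ℕ} (hj : j < N) :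
    PowerSeries.coeff j (∏ n ∈ Finset.range N, (1 + (ε : PowerSeries ℂ) * PowerSeries.X ^ d n)) =
      PowerSeries.coeff j (wProd ε d) := by
  have h := infProd_sub_dvd (factor_sub_one_dvd (A := ℂ) ε hd) N
  rw [PowerSeries.X_pow_dvd_iff] at h
  have := h j hj
  rw [map_sub, sub_eq_zero] at this
  exact this.symm

/-- The initial coefficients of the infinite product are those of a partial product, and the norms
of these are bounded. -/
lemma isConv_wProd {ε : ℤ} (hε : ε = 1 ∨ ε = -1) {d : ℕ → ℕ} (hd : ∀ n, n + 1 ≤ d n) :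
    IsConv (wProd ε d) := by
  intro r h0 h1
  refine summable_of_sum_range_le (c := Real.exp (1 - r)⁻¹) (fun n => by positivity) fun N => ?_
  refine le_trans ?_ (wNorm_prod_le hε hd h0 h1 N)
  rw [wNorm]
  rw [Finset.sum_congr rfl fun j hj => by rw [← coeff_wProd hd (Finset.mem_range.mp hj)]]
  exact (isConv_prod _ (fun n => isConv_factor ε _) r h0 h1).sum_le_tsum _
    fun n _ => by positivity

/-- The value of the infinite product is the limit of the values of the partial products, by
dominated convergence; the majorant comes from the uniform bound at a radius between `|z|` and `1`.
-/
lemma tendsto_evAt_wProd {ε : ℤ} (hε : ε = 1 ∨ ε = -1) {d : ℕ → ℕ} (hd : ∀ n, n + 1 ≤ d n)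
    {z : ℂ} (hz : ‖z‖ < 1) : Filter.Tendsto (fun N => ∏ n ∈ Finset.range N, (1 + (ε : ℂ) * z ^ d n))
      Filter.atTop (𝓝 (evAt z (wProd ε d))) := by
  have h1 : ∀ N, ∏ n ∈ Finset.range N, (1 + (ε : ℂ) * z ^ d n) =
      evAt z (∏ n ∈ Finset.range N, (1 + (ε : PowerSeries ℂ) * PowerSeries.X ^ d n)) := by
    intro N
    rw [evAt_prod hz _ fun n => isConv_factor ε _]
    refine Finset.prod_congr rfl fun n _ => ?_
    rw [factor_eq, evAt_add hz isConv_one (isConv_monomial _ _), evAt_one, evAt_monomial]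
  simp only [h1]
  obtain ⟨r, hr, hr1⟩ := exists_between hz
  have h0 : 0 < r := (norm_nonneg z).trans_lt hr
  refine tendsto_tsum_of_dominated_convergence
    (bound := fun n => Real.exp (1 - r)⁻¹ * (‖z‖ / r) ^ n) ?_ ?_ ?_
  · exact (summable_geometric_of_lt_one (by positivity) ((div_lt_one h0).mpr hr)).mul_left _
  · intro j
    refine tendsto_const_nhds.congr' ?_
    filter_upwards [Filter.eventually_gt_atTop j] with N hN
    rw [coeff_wProd hd hN]
  · refine Filter.Eventually.of_forall fun N j => ?_
    have h2 : ‖PowerSeries.coeff j (∏ n ∈ Finset.range N,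
        (1 + (ε : PowerSeries ℂ) * PowerSeries.X ^ d n))‖ * r ^ j ≤ Real.exp (1 - r)⁻¹ :=
      ((isConv_prod _ (fun n => isConv_factor ε _) r h0.le hr1).le_tsum j
        fun n _ => by positivity).trans (wNorm_prod_le hε hd h0.le hr1 N)
    rw [norm_mul, norm_pow, div_pow]
    rw [mul_div_assoc', le_div_iff₀ (pow_pos h0 j)]
    calc _ = (‖PowerSeries.coeff j (∏ n ∈ Finset.range N,
        (1 + (ε : PowerSeries ℂ) * PowerSeries.X ^ d n))‖ * r ^ j) * ‖z‖ ^ j := by ring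
      _ ≤ _ := by gcongr

end InfiniteProducts

/-! ### Triples of series permuted by `SL₂(ℤ)` -/

section Triples

/-- The nome `q^{1/2} = e^{πit}`. -/
noncomputable def nome (t : ℂ) : ℂ := Complex.exp (Real.pi * Complex.I * t)

lemma norm_nome_lt {t : ℂ} (ht : 0 < t.im) : ‖nome t‖ < 1 := by
  rw [nome, Complex.norm_exp, Real.exp_lt_one_iff]
  have : (Real.pi * Complex.I * t : ℂ).re = -(Real.pi * t.im) := by simp
  rw [this, neg_lt_zero]
  exact mul_pos Real.pi_pos ht

lemma nome_add_one (t : ℂ) : nome (t + 1) = -nome t := by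
  rw [nome, mul_add, Complex.exp_add, mul_one, Complex.exp_pi_mul_I, mul_neg_one, nome]

lemma nome_add_two (t : ℂ) : nome (t + 2) = nome t := by
  rw [← one_add_one_eq_two, ← add_assoc, nome_add_one, nome_add_one, neg_neg]

lemma nome_pow (t : ℂ) (d : ℕ) : nome t ^ d = nome (d * t) := by
  rw [nome, nome, ← Complex.exp_nat_mul]
  congr 1
  ring

lemma im_neg_one_div_pos {t : ℂ} (ht : 0 < t.im) : 0 < (-1 / t).im := by
  rw [neg_div, one_div, Complex.neg_im, Complex.inv_im, neg_div, neg_neg]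
  refine div_pos ht (Complex.normSq_pos.mpr ?_)
  rintro rfl
  simp at ht

lemma ne_zero_of_im_pos {t : ℂ} (ht : 0 < t.im) : t ≠ 0 := by
  rintro rfl
  simp at ht

variable {f g : PowerSeries ℂ}

lemma evAt_nome_twist (hf : IsConv f) {d : ℕ} (hd : d ≠ 0) {t : ℂ} (ht : 0 < t.im) :
    evAt (nome t) (twist ℂ 1 d hd f) = evAt (nome (d * t)) f := by
  rw [evAt_twist hf (Or.inl rfl) hd (norm_nome_lt ht), nome_pow, Int.cast_one, one_mul]

lemma evAt_nome_twist_neg (hf : IsConv f) {t : ℂ} (ht : 0 < t.im) :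
    evAt (nome t) (twist ℂ (-1) 1 one_ne_zero f) = evAt (nome (t + 1)) f := by
  rw [evAt_twist hf (Or.inr rfl) one_ne_zero (norm_nome_lt ht), nome_add_one, pow_one]
  norm_num

/-- A convergent series in `q^{1/2}` which transforms like a modular form of weight `w` for
`SL₂(ℤ)`. -/
structure IsLevelOne (w : ℕ) (f : PowerSeries ℂ) : Prop where
  conv : IsConv f
  translate : ∀ t : ℂ, 0 < t.im → evAt (nome (t + 1)) f = evAt (nome t) f
  invert : ∀ t : ℂ, 0 < t.im → evAt (nome (-1 / t)) f = t ^ w * evAt (nome t) f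

/-- Three convergent series in `q^{1/2}` which `SL₂(ℤ)` permutes in weight `w`: the translation
`τ ↦ τ + 1` fixes the first one and exchanges the other two, the inversion `τ ↦ -1/τ` exchanges the
first two. -/
structure IsTriple (w : ℕ) (h : Fin 3 → PowerSeries ℂ) : Prop where
  conv : ∀ i, IsConv (h i)
  translate_zero : ∀ t : ℂ, 0 < t.im → evAt (nome (t + 1)) (h 0) = evAt (nome t) (h 0)
  translate_one : ∀ t : ℂ, 0 < t.im → evAt (nome (t + 1)) (h 1) = evAt (nome t) (h 2)
  invert : ∀ t : ℂ, 0 < t.im → evAt (nome (-1 / t)) (h 0) = t ^ w * evAt (nome t) (h 1)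

lemma im_add_one_pos {t : ℂ} (ht : 0 < t.im) : 0 < (t + 1).im := by simpa using ht

variable {w w' : ℕ} {h h' : Fin 3 → PowerSeries ℂ}

lemma IsTriple.translate_two (hh : IsTriple w h) {t : ℂ} (ht : 0 < t.im) :
    evAt (nome (t + 1)) (h 2) = evAt (nome t) (h 1) := by
  rw [← hh.translate_one _ (im_add_one_pos ht), add_assoc, one_add_one_eq_two, nome_add_two]

lemma IsTriple.invert_one (hh : IsTriple w h) (hw : Even w) {t : ℂ} (ht : 0 < t.im) :
    evAt (nome (-1 / t)) (h 1) = t ^ w * evAt (nome t) (h 0) := by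
  have h1 := hh.invert _ (im_neg_one_div_pos ht)
  have ht0 := ne_zero_of_im_pos ht
  have h2 : -1 / (-1 / t) = t := by field_simp
  rw [h2] at h1
  rw [h1, ← mul_assoc, ← mul_pow, mul_div_cancel₀ _ ht0, hw.neg_one_pow, one_mul]

/-- The transformation law of the third series follows from the others, via `-1/t + 1 = -1/s` with
`s = -1/(t - 1) - 1`. -/
lemma IsTriple.invert_two (hh : IsTriple w h) (hw : Even w) {t : ℂ} (ht : 0 < t.im) :
    evAt (nome (-1 / t)) (h 2) = t ^ w * evAt (nome t) (h 2) := by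
  have ht1 : 0 < (t - 1).im := by simpa using ht
  have ht0 := ne_zero_of_im_pos ht
  have ht2 := ne_zero_of_im_pos ht1
  have hs := im_neg_one_div_pos ht1
  have hs' : 0 < (-1 / (t - 1) - 1).im := by simpa using hs
  have h1 : -1 / (-1 / (t - 1) - 1) = -1 / t + 1 := by
    have h3 : -1 / (t - 1) - 1 = -t / (t - 1) := by
      field_simp
      ring
    rw [h3, div_div_eq_mul_div, div_eq_iff (neg_ne_zero.mpr ht0)]
    field_simp
    ring
  have h2 := hh.invert_one hw hs'
  have h4 := hh.translate_zero _ hs'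
  rw [sub_add_cancel] at h4
  rw [h1, hh.translate_one _ (im_neg_one_div_pos ht), ← h4, hh.invert _ ht1, ← mul_assoc,
    ← mul_pow] at h2
  have h5 := hh.translate_two ht1
  rw [sub_add_cancel] at h5
  rw [h2, ← h5]
  congr 1
  have h6 : (-1 / (t - 1) - 1) * (t - 1) = -t := by
    field_simp
    ring
  rw [h6, hw.neg_pow]

/-- The sum of the three members of a triple is invariant under `SL₂(ℤ)`. -/
lemma IsTriple.sum (hh : IsTriple w h) (hw : Even w) : IsLevelOne w (∑ i, h i) where
  conv := isConv_sum _ hh.conv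
  translate t ht := by
    rw [evAt_sum (norm_nome_lt (im_add_one_pos ht)) _ hh.conv,
      evAt_sum (norm_nome_lt ht) _ hh.conv, Fin.sum_univ_three, Fin.sum_univ_three,
      hh.translate_zero t ht, hh.translate_one t ht, hh.translate_two ht]
    ring
  invert t ht := by
    rw [evAt_sum (norm_nome_lt (im_neg_one_div_pos ht)) _ hh.conv,
      evAt_sum (norm_nome_lt ht) _ hh.conv, Fin.sum_univ_three, Fin.sum_univ_three,
      hh.invert t ht, hh.invert_one hw ht, hh.invert_two hw ht]
    ring

lemma IsLevelOne.triple (hf : IsLevelOne w f) : IsTriple w fun _ => f where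
  conv _ := hf.conv
  translate_zero := hf.translate
  translate_one := hf.translate
  invert := hf.invert

lemma isTriple_zero (w : ℕ) : IsTriple w fun _ => 0 := by
  have h0 : ∀ z, evAt z 0 = 0 := fun z => by simpa using evAt_C z 0
  exact ⟨fun _ => by simpa using isConv_C 0, fun t _ => by rw [h0, h0], fun t _ => by rw [h0, h0],
    fun t _ => by rw [h0, h0, mul_zero]⟩

lemma isTriple_one : IsTriple 0 fun _ => 1 :=
  ⟨fun _ => isConv_one, fun t _ => by rw [evAt_one, evAt_one],
    fun t _ => by rw [evAt_one, evAt_one],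
    fun t _ => by rw [evAt_one, evAt_one, pow_zero, mul_one]⟩

lemma IsTriple.mul (hh : IsTriple w h) (hh' : IsTriple w' h') :
    IsTriple (w + w') fun i => h i * h' i where
  conv i := (hh.conv i).mul (hh'.conv i)
  translate_zero t ht := by
    rw [evAt_mul (norm_nome_lt (im_add_one_pos ht)) (hh.conv _) (hh'.conv _),
      evAt_mul (norm_nome_lt ht) (hh.conv _) (hh'.conv _), hh.translate_zero t ht,
      hh'.translate_zero t ht]
  translate_one t ht := by
    rw [evAt_mul (norm_nome_lt (im_add_one_pos ht)) (hh.conv _) (hh'.conv _),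
      evAt_mul (norm_nome_lt ht) (hh.conv _) (hh'.conv _), hh.translate_one t ht,
      hh'.translate_one t ht]
  invert t ht := by
    rw [evAt_mul (norm_nome_lt (im_neg_one_div_pos ht)) (hh.conv _) (hh'.conv _),
      evAt_mul (norm_nome_lt ht) (hh.conv _) (hh'.conv _), hh.invert t ht,
      hh'.invert t ht, pow_add]
    ring

lemma IsTriple.smul (hh : IsTriple w h) (a : ℂ) : IsTriple w fun i => a • h i where
  conv i := (hh.conv i).smul a
  translate_zero t ht := by rw [evAt_smul, evAt_smul, hh.translate_zero t ht]
  translate_one t ht := by rw [evAt_smul, evAt_smul, hh.translate_one t ht]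
  invert t ht := by
    rw [evAt_smul, evAt_smul, hh.invert t ht]
    ring

lemma IsTriple.pow (hh : IsTriple w h) (m : ℕ) : IsTriple (m * w) fun i => h i ^ m := by
  induction m with
  | zero => simpa using isTriple_one
  | succ m ih =>
    have := ih.mul hh
    rw [← Nat.succ_mul] at this
    simpa only [pow_succ] using this

lemma IsTriple.prod {ι : Type*} (s : Finset ι) {w : ι → ℕ} {h : ι → Fin 3 → PowerSeries ℂ}
    (hh : ∀ o, IsTriple (w o) (h o)) : IsTriple (∑ o ∈ s, w o) fun i => ∏ o ∈ s, h o i := by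
  induction s using Finset.cons_induction with
  | empty => simpa using isTriple_one
  | cons a s ha ih =>
    simp only [Finset.sum_cons, Finset.prod_cons]
    exact (hh a).mul ih

open scoped ModularForm in
/-- A series that transforms like a modular form of level one is one. Boundedness at the cusp is
automatic, as there are no negative powers of `q`. -/
lemma IsLevelOne.exists_modularForm (hf : IsLevelOne w f) :
    ∃ F : ModularForm 𝒮ℒ (w : ℕ), ∀ τ : UpperHalfPlane, F τ = evAt (nome τ) f := by
  have hS : (fun τ : UpperHalfPlane => evAt (nome τ) f) ∣[(w : ℤ)] ModularGroup.S =
      fun τ : UpperHalfPlane => evAt (nome τ) f := by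
    funext τ
    rw [ModularForm.SL_slash_apply, UpperHalfPlane.modular_S_smul, ModularGroup.denom_S]
    have h1 : ((UpperHalfPlane.mk _ τ.im_inv_neg_coe_pos : UpperHalfPlane) : ℂ) = -1 / τ := by
      change (-(τ : ℂ))⁻¹ = _
      rw [inv_neg, neg_div, one_div]
    rw [h1, hf.invert _ τ.im_pos, zpow_neg, zpow_natCast]
    have := pow_ne_zero w τ.ne_zero
    field_simp
  have hT : (fun τ : UpperHalfPlane => evAt (nome τ) f) ∣[(w : ℤ)] ModularGroup.T =
      fun τ : UpperHalfPlane => evAt (nome τ) f := by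
    funext τ
    rw [ModularForm.SL_slash_apply, UpperHalfPlane.modular_T_smul]
    have h1 : (((1 : ℝ) +ᵥ τ : UpperHalfPlane) : ℂ) = τ + 1 := by
      rw [UpperHalfPlane.coe_vadd]
      push_cast
      ring
    rw [h1, hf.translate _ τ.im_pos]
    have h2 : UpperHalfPlane.denom (ModularGroup.T : GL (Fin 2) ℝ) τ = 1 := by
      rw [ModularGroup.denom_apply]
      simp [ModularGroup.T]
    rw [h2, one_zpow, mul_one]
  refine ⟨{ toFun := fun τ => evAt (nome τ) f
            slash_action_eq' := ?_
            holo' := ?_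
            bdd_at_cusps' := ?_ }, fun τ => rfl⟩
  · rintro _ ⟨A, rfl⟩
    exact SlashInvariantForm.slash_action_generators_SL2Z hS hT A
  · rw [UpperHalfPlane.mdifferentiable_iff]
    have h1 : DifferentiableOn ℂ (fun t => evAt (nome t) f) {t | 0 < t.im} :=
      hf.conv.differentiableOn.comp (t := Metric.ball 0 1)
        (by unfold nome; fun_prop) fun t ht => mem_ball_zero_iff.mpr (norm_nome_lt ht)
    refine h1.congr fun t ht => ?_
    simp [UpperHalfPlane.ofComplex_apply_of_im_pos ht]
  · intro c hc
    rw [Subgroup.IsArithmetic.isCusp_iff_isCusp_SL2Z] at hc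
    rw [OnePoint.isBoundedAt_iff_forall_SL2Z hc]
    intro A _
    rw [SlashInvariantForm.slash_action_generators_SL2Z hS hT]
    refine UpperHalfPlane.isBoundedAtImInfty_of_hasSum_qExpansion (h := 2) two_pos
      (c := fun n => PowerSeries.coeff n f) fun τ => ?_
    have h1 : Function.Periodic.qParam 2 τ = nome τ := by
      rw [Function.Periodic.qParam, nome]
      congr 1
      push_cast
      ring
    rw [h1]
    exact (hf.conv.summable (norm_nome_lt τ.im_pos)).hasSum

end Triples

/-! ### Eta quotients and Eisenstein series -/

section Eta

lemma tendsto_prod_eta {t : ℂ} (ht : 0 < t.im) :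
    Filter.Tendsto (fun N => ∏ n ∈ Finset.range N, (1 - (nome t ^ 2) ^ (n + 1))) Filter.atTop
      (𝓝 (∏' n, (1 - ModularForm.eta_q n t))) := by
  have h2 : ∀ n, ModularForm.eta_q n t = (nome t ^ 2) ^ (n + 1) := by
    intro n
    rw [ModularForm.eta_q_eq_pow, nome_pow, nome]
    congr 2
    push_cast
    ring
  simp only [h2]
  have h1 : ‖nome t ^ 2‖ < 1 := by
    rw [norm_pow]
    exact pow_lt_one₀ (norm_nonneg _) (norm_nome_lt ht) two_ne_zero
  exact (ModularForm.multipliable_one_sub_pow h1).hasProd.tendsto_prod_nat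

/-- The product `∏ (1 - qⁿ)` at `q = e^{2πit}`. -/
noncomputable def eulerFun (t : ℂ) : ℂ := ∏' n, (1 - ModularForm.eta_q n t)

lemma eulerFun_ne_zero {t : ℂ} (ht : 0 < t.im) : eulerFun t ≠ 0 := ModularForm.eta_tprod_ne_zero ht

lemma evAt_wProd_even {t : ℂ} (ht : 0 < t.im) :
    evAt (nome t) (wProd (-1) fun n => 2 * (n + 1)) = eulerFun t := by
  refine tendsto_nhds_unique (tendsto_evAt_wProd (Or.inr rfl) (fun n => by omega)
    (norm_nome_lt ht)) ?_
  refine (tendsto_prod_eta ht).congr fun N => Finset.prod_congr rfl fun n _ => ?_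
  rw [pow_mul]
  push_cast
  ring

lemma im_nat_mul_pos {t : ℂ} (ht : 0 < t.im) {d : ℕ} (hd : d ≠ 0) : 0 < ((d : ℂ) * t).im := by
  rw [Complex.mul_im]
  simpa using mul_pos (Nat.cast_pos.mpr (Nat.pos_of_ne_zero hd)) ht

lemma im_div_two_pos {t : ℂ} (ht : 0 < t.im) : 0 < (t / 2).im := by
  rw [← Complex.ofReal_ofNat, Complex.div_ofReal_im]
  exact half_pos ht

/-- `∏ (1 + qⁿ) ∏ (1 - qⁿ) = ∏ (1 - q^{2n})`. -/
lemma evAt_wProd_one_even {t : ℂ} (ht : 0 < t.im) :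
    evAt (nome t) (wProd 1 fun n => 2 * (n + 1)) * eulerFun t = eulerFun (2 * t) := by
  have h2 : 0 < (2 * t).im := by simpa using im_nat_mul_pos ht two_ne_zero
  refine tendsto_nhds_unique ((tendsto_evAt_wProd (Or.inl rfl) (fun n => by omega)
    (norm_nome_lt ht)).mul (tendsto_prod_eta ht)) ?_
  refine (tendsto_prod_eta h2).congr fun N => ?_
  rw [← Finset.prod_mul_distrib]
  refine Finset.prod_congr rfl fun n _ => ?_
  have h3 : nome (2 * t) = nome t ^ 2 := by rw [nome_pow, Nat.cast_ofNat]
  rw [h3, pow_mul]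
  push_cast
  ring

lemma prod_range_two_mul (f : ℕ → ℂ) (N : ℕ) : ∏ n ∈ Finset.range (2 * N), f n =
    (∏ n ∈ Finset.range N, f (2 * n)) * ∏ n ∈ Finset.range N, f (2 * n + 1) := by
  induction N with
  | zero => simp
  | succ N ih =>
    rw [Nat.mul_succ, Finset.prod_range_succ, Finset.prod_range_succ, ih, Finset.prod_range_succ,
      Finset.prod_range_succ]
    ring

/-- `∏ (1 - q^{n-1/2}) ∏ (1 - qⁿ) = ∏ (1 - q^{n/2})`. -/
lemma evAt_wProd_odd {t : ℂ} (ht : 0 < t.im) :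
    evAt (nome t) (wProd (-1) fun n => 2 * n + 1) * eulerFun t = eulerFun (t / 2) := by
  refine tendsto_nhds_unique ((tendsto_evAt_wProd (Or.inr rfl) (fun n => by omega)
    (norm_nome_lt ht)).mul (tendsto_prod_eta ht)) ?_
  have h1 := (tendsto_prod_eta (im_div_two_pos ht)).comp
    (Filter.tendsto_id.const_mul_atTop' (two_pos : 0 < 2))
  refine h1.congr fun N => ?_
  have h3 : nome (t / 2) ^ 2 = nome t := by rw [nome_pow]; congr 1; push_cast; ring
  simp only [Function.comp_apply, id, h3]
  rw [prod_range_two_mul]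
  congr 1
  · refine Finset.prod_congr rfl fun n _ => ?_
    push_cast
    ring
  · refine Finset.prod_congr rfl fun n _ => ?_
    rw [← pow_mul]
    ring_nf

lemma evAt_neg_wProd {z : ℂ} (hz : ‖z‖ < 1) {ε ε' : ℤ} (hε : ε = 1 ∨ ε = -1)
    (hε' : ε' = 1 ∨ ε' = -1) {d : ℕ → ℕ} (hd : ∀ n, n + 1 ≤ d n)
    (h : ∀ n, (ε : ℂ) * (-1) ^ d n = ε') :
    evAt (-z) (wProd ε d) = evAt z (wProd ε' d) := by
  refine tendsto_nhds_unique (tendsto_evAt_wProd hε hd (by rwa [norm_neg]))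
    ((tendsto_evAt_wProd hε' hd hz).congr fun N => Finset.prod_congr rfl fun n _ => ?_)
  rw [neg_pow, ← h n, mul_assoc]

lemma eta_eq (t : ℂ) :
    ModularForm.eta t = Complex.exp (2 * Real.pi * Complex.I * t / 24) * eulerFun t := by
  rw [ModularForm.eta, eulerFun, Function.Periodic.qParam]
  push_cast
  rfl

/-- In the eighth power of the transformation law of `η` no root of unity is left. -/
lemma eta_inv_pow_eight {t : ℂ} (ht : 0 < t.im) :
    ModularForm.eta (-1 / t) ^ 8 = t ^ 4 * ModularForm.eta t ^ 8 := by
  have h1 : ModularForm.eta (-1 / t) = (Complex.sqrt Complex.I)⁻¹ *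
      (Complex.sqrt t * ModularForm.eta t) := ModularForm.eta_comp_eq_csqrt_I_inv ht
  have h2 : ∀ z : ℂ, z ≠ 0 → Complex.sqrt z ^ 8 = z ^ 4 := by
    intro z hz
    rw [sqrt_eq_exp hz, ← Complex.exp_nat_mul,
      show ((8 : ℕ) : ℂ) * (Complex.log z / 2) = (4 : ℕ) * Complex.log z by push_cast; ring,
      Complex.exp_nat_mul, Complex.exp_log hz]
  rw [h1, mul_pow, mul_pow, inv_pow, h2 _ Complex.I_ne_zero, h2 _ (ne_zero_of_im_pos ht),
    Complex.I_pow_four, inv_one, one_mul]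

/-- `2⁸ η(2τ)^{16}/η(τ)⁸` at `-1/t` is `t⁴` times `η(τ/2)^{16}/η(τ)⁸` at `t`: combine the
transformation laws of `η` at `t` and at `t/2`. -/
lemma eulerFun_inv {t : ℂ} (ht : 0 < t.im) :
    (2 : ℂ) ^ 8 * nome (-1 / t) ^ 2 * evAt (nome (-1 / t)) (wProd 1 fun n => 2 * (n + 1)) ^ 16 *
      eulerFun (-1 / t) ^ 8 =
    t ^ 4 * (evAt (nome t) (wProd (-1) fun n => 2 * n + 1) ^ 16 * eulerFun t ^ 8) := by
  have hs := im_neg_one_div_pos ht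
  have ht2 := im_div_two_pos ht
  have h1 := evAt_wProd_one_even hs
  have h2 := evAt_wProd_odd ht
  have h3 := eta_inv_pow_eight ht
  have h4 := eta_inv_pow_eight ht2
  have h5 : -1 / (t / 2) = 2 * (-1 / t) := by
    have := ne_zero_of_im_pos ht
    field_simp
  rw [h5] at h4
  have h6 : Complex.exp (2 * Real.pi * Complex.I * (2 * (-1 / t)) / 24) =
      Complex.exp (2 * Real.pi * Complex.I * (-1 / t) / 24) ^ 2 := by
    rw [← Complex.exp_nat_mul]
    congr 1
    push_cast
    ring
  have h7 : Complex.exp (2 * Real.pi * Complex.I * t / 24) =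
      Complex.exp (2 * Real.pi * Complex.I * (t / 2) / 24) ^ 2 := by
    rw [← Complex.exp_nat_mul]
    congr 1
    push_cast
    ring
  have h8 : nome (-1 / t) ^ 2 = Complex.exp (2 * Real.pi * Complex.I * (-1 / t) / 24) ^ 24 := by
    rw [nome, ← Complex.exp_nat_mul, ← Complex.exp_nat_mul]
    congr 1
    push_cast
    ring
  rw [eta_eq, eta_eq, h7] at h3
  rw [eta_eq, eta_eq, h6] at h4
  rw [h8]
  have hx := Complex.exp_ne_zero (2 * Real.pi * Complex.I * (-1 / t) / 24)
  have he := eulerFun_ne_zero hs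
  generalize Complex.exp (2 * Real.pi * Complex.I * (-1 / t) / 24) = x at *
  generalize Complex.exp (2 * Real.pi * Complex.I * (t / 2) / 24) = y at *
  generalize evAt (nome (-1 / t)) (wProd 1 fun n => 2 * (n + 1)) = a at *
  generalize evAt (nome t) (wProd (-1) fun n => 2 * n + 1) = b at *
  refine mul_right_cancel₀ (pow_ne_zero 8 (mul_ne_zero hx he)) ?_
  calc _ = 2 ^ 8 * ((x ^ 2 * (a * eulerFun (-1 / t))) ^ 8) ^ 2 := by ring
    _ = 2 ^ 8 * ((t / 2) ^ 4 * (y * (b * eulerFun t)) ^ 8) ^ 2 := by rw [h1, h4, h2]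
    _ = t ^ 4 * (b ^ 16 * eulerFun t ^ 8) * (t ^ 4 * (y ^ 2 * eulerFun t) ^ 8) := by ring
    _ = _ := by rw [← h3]

lemma isConv_thetaFac (l : ℕ) (i : Fin 3) : IsConv (thetaFac l i) := by
  refine IsConv.mul ?_ ((isConv_wProd (Or.inr rfl) fun n => by omega).pow _)
  fin_cases i
  · exact ((isConv_X_pow _).mul ((isConv_wProd (Or.inl rfl) fun n => by omega).pow _)).smul _
  · exact (isConv_wProd (Or.inr rfl) fun n => by omega).pow _
  · exact (isConv_wProd (Or.inl rfl) fun n => by omega).pow _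

lemma evAt_thetaFac_zero {z : ℂ} (hz : ‖z‖ < 1) (l : ℕ) : evAt z (thetaFac l 0) =
    ((2 : ℂ) ^ 8 * z ^ 2 * evAt z (wProd 1 fun n => 2 * (n + 1)) ^ 16 *
      evAt z (wProd (-1) fun n => 2 * (n + 1)) ^ 8) ^ l := by
  have h1 : IsConv (wProd 1 fun n => 2 * (n + 1)) := isConv_wProd (Or.inl rfl) fun n => by omega
  have h2 : IsConv (wProd (-1) fun n => 2 * (n + 1)) := isConv_wProd (Or.inr rfl) fun n => by omega
  rw [thetaFac, Matrix.cons_val_zero, evAt_mul hz (((isConv_X_pow _).mul (h1.pow _)).smul _)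
    (h2.pow _), evAt_smul, evAt_mul hz (isConv_X_pow _) (h1.pow _), evAt_X_pow, evAt_pow hz h1,
    evAt_pow hz h2]
  simp only [mul_pow, ← pow_mul]
  ring

lemma evAt_thetaFac_one {z : ℂ} (hz : ‖z‖ < 1) (l : ℕ) : evAt z (thetaFac l 1) =
    (evAt z (wProd (-1) fun n => 2 * n + 1) ^ 16 *
      evAt z (wProd (-1) fun n => 2 * (n + 1)) ^ 8) ^ l := by
  have h1 : IsConv (wProd (-1) fun n => 2 * n + 1) := isConv_wProd (Or.inr rfl) fun n => by omega
  have h2 : IsConv (wProd (-1) fun n => 2 * (n + 1)) := isConv_wProd (Or.inr rfl) fun n => by omega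
  rw [thetaFac, Matrix.cons_val_one, Matrix.cons_val_zero, evAt_mul hz (h1.pow _) (h2.pow _),
    evAt_pow hz h1, evAt_pow hz h2]
  ring

lemma evAt_thetaFac_two {z : ℂ} (hz : ‖z‖ < 1) (l : ℕ) : evAt z (thetaFac l 2) =
    (evAt z (wProd 1 fun n => 2 * n + 1) ^ 16 *
      evAt z (wProd (-1) fun n => 2 * (n + 1)) ^ 8) ^ l := by
  have h1 : IsConv (wProd 1 fun n => 2 * n + 1) := isConv_wProd (Or.inl rfl) fun n => by omega
  have h2 : IsConv (wProd (-1) fun n => 2 * (n + 1)) := isConv_wProd (Or.inr rfl) fun n => by omega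
  rw [thetaFac, Matrix.cons_val_two, Matrix.tail_cons, Matrix.head_cons,
    evAt_mul hz (h1.pow _) (h2.pow _), evAt_pow hz h1, evAt_pow hz h2]
  ring

/-- The factors are `2^{8l} η(2τ)^{16l} / η(τ)^{8l}`, `η(τ/2)^{16l} / η(τ)^{8l}` and the translate of
the latter. -/
lemma isTriple_thetaFac (l : ℕ) : IsTriple (l * 4) (thetaFac l) where
  conv := isConv_thetaFac l
  translate_zero t ht := by
    rw [evAt_thetaFac_zero (norm_nome_lt (im_add_one_pos ht)), evAt_thetaFac_zero (norm_nome_lt ht),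
      nome_add_one,
      evAt_neg_wProd (norm_nome_lt ht) (Or.inl rfl) (Or.inl rfl) (fun n => by omega)
        (fun n => by rw [pow_mul]; simp),
      evAt_neg_wProd (norm_nome_lt ht) (Or.inr rfl) (Or.inr rfl) (fun n => by omega)
        (fun n => by rw [pow_mul]; simp), neg_sq]
  translate_one t ht := by
    rw [evAt_thetaFac_one (norm_nome_lt (im_add_one_pos ht)), evAt_thetaFac_two (norm_nome_lt ht),
      nome_add_one,
      evAt_neg_wProd (norm_nome_lt ht) (Or.inr rfl) (Or.inl rfl) (fun n => by omega)
        (fun n => by rw [pow_succ, pow_mul]; simp),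
      evAt_neg_wProd (norm_nome_lt ht) (Or.inr rfl) (Or.inr rfl) (fun n => by omega)
        (fun n => by rw [pow_mul]; simp)]
  invert t ht := by
    have hs := im_neg_one_div_pos ht
    rw [evAt_thetaFac_zero (norm_nome_lt hs), evAt_thetaFac_one (norm_nome_lt ht),
      evAt_wProd_even hs, evAt_wProd_even ht, eulerFun_inv ht, mul_pow, ← pow_mul, mul_comm l]

end Eta

section Eisenstein

lemma isConv_sigSeries (p : ℕ) : IsConv (sigSeries p) := by
  intro r h0 h1
  refine Summable.of_nonneg_of_le (fun n => by positivity) (fun n => ?_)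
    (summable_pow_mul_geometric_of_norm_lt_one (p + 1)
      (show ‖r‖ < 1 by rwa [Real.norm_of_nonneg h0]))
  rw [sigSeries, PowerSeries.coeff_mk, Complex.norm_natCast]
  gcongr
  exact_mod_cast ArithmeticFunction.sigma_le_pow_succ p n

lemma isConv_sigCoef (m : ℕ) : IsConv (sigCoef m) := (isConv_sigSeries _).smul _

lemma isConv_eisCoef (m : ℕ) : IsConv (eisCoef m) := (isConv_C _).add (isConv_sigCoef m)

lemma evAt_eisCoef {z : ℂ} (hz : ‖z‖ < 1) (m : ℕ) : evAt z (eisCoef m) = eisConst m +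
    ((2 * m + 2).factorial : ℂ)⁻¹ *
      ∑' n : ℕ+, (ArithmeticFunction.sigma (2 * m + 1) n : ℂ) * z ^ (n : ℕ) := by
  rw [eisCoef, evAt_add hz (isConv_C _) (isConv_sigCoef m), evAt_C, sigCoef, evAt_smul, evAt,
    ((isConv_sigSeries (2 * m + 1)).summable hz).tsum_eq_zero_add, coeff_zero_sigSeries, zero_mul,
    zero_add, tsum_pnat_eq_tsum_succ
      (f := fun n => (ArithmeticFunction.sigma (2 * m + 1) n : ℂ) * z ^ n)]
  simp only [sigSeries, PowerSeries.coeff_mk]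

lemma nome_two_mul (t : ℂ) : nome (2 * t) = Complex.exp (2 * Real.pi * Complex.I * t) := by
  rw [nome]
  congr 1
  ring

/-- The even Eisenstein series of weight at least four in Mathlib's normalization. -/
lemma eisCoef_eq_E (m : ℕ) (τ : UpperHalfPlane) (h3 : 3 ≤ 2 * (m + 1) + 2) :
    evAt (nome (2 * τ)) (eisCoef (m + 1)) = eisConst (m + 1) * ModularForm.E h3 τ := by
  have h2 : 0 < (2 * (τ : ℂ)).im := by simpa using im_nat_mul_pos τ.im_pos two_ne_zero
  -- `B_{2j} ≠ 0`, because `ζ(2j) ≠ 0`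
  have hB : (bernoulli (2 * (m + 1) + 2) : ℂ) ≠ 0 := by
    intro h
    have hz := riemannZeta_two_mul_nat (k := m + 2) (by omega)
    rw [show 2 * (m + 2) = 2 * (m + 1) + 2 by ring, h, mul_zero, zero_div] at hz
    refine riemannZeta_ne_zero_of_one_le_re ?_ hz
    norm_num
    linarith [(Nat.cast_nonneg m : (0 : ℝ) ≤ m)]
  rw [EisensteinSeries.q_expansion_bernoulli h3 ⟨m + 2, by ring⟩, evAt_eisCoef (norm_nome_lt h2),
    nome_two_mul, mul_sub, mul_one, sub_eq_add_neg, ← mul_assoc, ← neg_mul]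
  simp only [zpow_natCast]
  congr 2
  rw [eisConst]
  have hf : ((2 * (m + 1) + 2).factorial : ℂ) ≠ 0 := Nat.cast_ne_zero.mpr (Nat.factorial_ne_zero _)
  have hm : ((2 * (m + 1) + 2 : ℕ) : ℂ) ≠ 0 := Nat.cast_ne_zero.mpr (by omega)
  field_simp

open scoped ModularForm in
lemma modularForm_inv {k : ℕ} (f : ModularForm 𝒮ℒ k) (τ : UpperHalfPlane) :
    f (ModularGroup.S • τ) = (τ : ℂ) ^ k * f τ := by
  have h := congrFun (f.slash_action_eq' _ ⟨ModularGroup.S, rfl⟩) τ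
  have h1 : f (ModularGroup.S • τ) * UpperHalfPlane.denom ModularGroup.S τ ^ (-(k : ℤ)) = f τ := by
    rw [← ModularForm.SL_slash_apply]
    exact h
  rw [ModularGroup.denom_S, zpow_neg, zpow_natCast] at h1
  rw [← h1]
  have := pow_ne_zero k τ.ne_zero
  field_simp

lemma coe_S_smul (τ : UpperHalfPlane) : ((ModularGroup.S • τ : UpperHalfPlane) : ℂ) = -1 / τ := by
  rw [UpperHalfPlane.modular_S_smul]
  change (-(τ : ℂ))⁻¹ = _
  rw [inv_neg, neg_div, one_div]

lemma eisCoef_invert (m : ℕ) {t : ℂ} (ht : 0 < t.im) :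
    evAt (nome (2 * (-1 / t))) (eisCoef (m + 1)) =
      t ^ (2 * (m + 1) + 2) * evAt (nome (2 * t)) (eisCoef (m + 1)) := by
  have h3 : 3 ≤ 2 * (m + 1) + 2 := by omega
  have h1 := eisCoef_eq_E m ⟨t, ht⟩ h3
  have h2 := eisCoef_eq_E m (ModularGroup.S • ⟨t, ht⟩) h3
  rw [modularForm_inv, coe_S_smul] at h2
  change evAt (nome (2 * t)) _ = _ at h1
  change evAt (nome (2 * (-1 / t))) _ = _ * (t ^ _ * _) at h2
  rw [h1, h2]
  ring

lemma eisCoef_zero_eq_E2 (τ : UpperHalfPlane) :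
    evAt (nome (2 * τ)) (eisCoef 0) = -(1 / 48) * EisensteinSeries.E2 τ := by
  have h2 : 0 < (2 * (τ : ℂ)).im := by simpa using im_nat_mul_pos τ.im_pos two_ne_zero
  rw [evAt_eisCoef (norm_nome_lt h2), nome_two_mul, EisensteinSeries.E2_eq_tsum_cexp]
  simp [eisConst, Nat.factorial, bernoulli_two]
  ring

open scoped ModularForm in
/-- The quasi-modularity of `G_2`. -/
lemma eisCoef_zero_invert {t : ℂ} (ht : 0 < t.im) :
    evAt (nome (2 * (-1 / t))) (eisCoef 0) = t ^ 2 * evAt (nome (2 * t)) (eisCoef 0) +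
      (Complex.I / (8 * Real.pi)) * t := by
  have h1 := eisCoef_zero_eq_E2 ⟨t, ht⟩
  have h2 := eisCoef_zero_eq_E2 (ModularGroup.S • ⟨t, ht⟩)
  have h3 := congrFun (EisensteinSeries.E2_slash_action ModularGroup.S) ⟨t, ht⟩
  rw [ModularForm.SL_slash_apply, ModularGroup.denom_S, Pi.sub_apply, Pi.smul_apply,
    EisensteinSeries.D2_S, riemannZeta_two] at h3
  rw [coe_S_smul] at h2
  change evAt (nome (2 * t)) _ = _ at h1
  change evAt (nome (2 * (-1 / t))) _ = _ at h2
  change _ * t ^ _ = _ - _ • (2 * Real.pi * Complex.I / t) at h3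
  rw [h1, h2]
  have ht0 := ne_zero_of_im_pos ht
  have hpi : (Real.pi : ℂ) ≠ 0 := Complex.ofReal_ne_zero.mpr Real.pi_ne_zero
  generalize EisensteinSeries.E2 (ModularGroup.S • ⟨t, ht⟩) = a at *
  generalize EisensteinSeries.E2 ⟨t, ht⟩ = b at *
  rw [zpow_neg, smul_eq_mul] at h3
  field_simp at h3 ⊢
  linear_combination (-8) * h3

/-- The three series built from a series `f` with `f(q)` quasi-modular of weight `w`: for `δ = 0`,
`-(2^w f(q²) - f(q))` and `-(f(±q^{1/2}) - f(q))`; the multiple `δ f(q)` corrects the failure of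
modularity. -/
noncomputable def thetaOf (w : ℕ) (δ : ℂ) (f : PowerSeries ℂ) (i : Fin 3) : PowerSeries ℂ :=
  ![-((2 : ℂ) ^ w • twist ℂ 1 4 four_ne_zero f - twist ℂ 1 2 two_ne_zero f),
    -(f - twist ℂ 1 2 two_ne_zero f),
    -(twist ℂ (-1) 1 one_ne_zero f - twist ℂ 1 2 two_ne_zero f)] i +
    δ • twist ℂ 1 2 two_ne_zero f

lemma nome_add_two_mul (t : ℂ) (n : ℕ) : nome (t + 2 * n) = nome t := by
  induction n with
  | zero => simp
  | succ n ih => rw [Nat.cast_succ, mul_add, mul_one, ← add_assoc, nome_add_two, ih]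

variable {f : PowerSeries ℂ} {w : ℕ} {δ : ℂ}

lemma isConv_thetaOf (hf : IsConv f) (w : ℕ) (δ : ℂ) (i : Fin 3) : IsConv (thetaOf w δ f i) := by
  have h2 : IsConv (twist ℂ 1 2 two_ne_zero f) := hf.twist (Or.inl rfl) _
  refine IsConv.add ?_ (h2.smul _)
  fin_cases i
  · exact (((hf.twist (Or.inl rfl) _).smul _).sub h2).neg
  · exact (hf.sub h2).neg
  · exact ((hf.twist (Or.inr rfl) _).sub h2).neg

lemma evAt_thetaOf_zero (hf : IsConv f) {t : ℂ} (ht : 0 < t.im) :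
    evAt (nome t) (thetaOf w δ f 0) =
      -(2 ^ w * evAt (nome (4 * t)) f - evAt (nome (2 * t)) f) + δ * evAt (nome (2 * t)) f := by
  have hz := norm_nome_lt ht
  have h2 : IsConv (twist ℂ 1 2 two_ne_zero f) := hf.twist (Or.inl rfl) _
  have h4 : IsConv (twist ℂ 1 4 four_ne_zero f) := hf.twist (Or.inl rfl) _
  rw [thetaOf, Matrix.cons_val_zero, evAt_add hz ((h4.smul _).sub h2).neg (h2.smul _), evAt_neg,
    evAt_sub hz (h4.smul _) h2, evAt_smul, evAt_smul, evAt_nome_twist hf _ ht,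
    evAt_nome_twist hf _ ht]
  norm_cast

lemma evAt_thetaOf_one (hf : IsConv f) {t : ℂ} (ht : 0 < t.im) :
    evAt (nome t) (thetaOf w δ f 1) =
      -(evAt (nome t) f - evAt (nome (2 * t)) f) + δ * evAt (nome (2 * t)) f := by
  have hz := norm_nome_lt ht
  have h2 : IsConv (twist ℂ 1 2 two_ne_zero f) := hf.twist (Or.inl rfl) _
  rw [thetaOf, Matrix.cons_val_one, Matrix.cons_val_zero, evAt_add hz (hf.sub h2).neg (h2.smul _),
    evAt_neg, evAt_sub hz hf h2, evAt_smul, evAt_nome_twist hf _ ht]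
  norm_cast

lemma evAt_thetaOf_two (hf : IsConv f) {t : ℂ} (ht : 0 < t.im) :
    evAt (nome t) (thetaOf w δ f 2) =
      -(evAt (nome (t + 1)) f - evAt (nome (2 * t)) f) + δ * evAt (nome (2 * t)) f := by
  have hz := norm_nome_lt ht
  have h2 : IsConv (twist ℂ 1 2 two_ne_zero f) := hf.twist (Or.inl rfl) _
  have h1 : IsConv (twist ℂ (-1) 1 one_ne_zero f) := hf.twist (Or.inr rfl) _
  rw [thetaOf, Matrix.cons_val_two, Matrix.tail_cons, Matrix.head_cons,
    evAt_add hz (h1.sub h2).neg (h2.smul _), evAt_neg, evAt_sub hz h1 h2, evAt_smul,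
    evAt_nome_twist hf _ ht, evAt_nome_twist_neg hf ht]
  norm_cast

/-- If the value of `f` at `q` transforms like a modular form of weight `w` up to an additional term
`κ t`, then `thetaOf w δ f` is a triple as soon as these terms cancel, which is the hypothesis `hκ`:
it holds with `δ = 1` for `w = 2`, and with `κ = 0` for modular `f`. -/
lemma isTriple_thetaOf (hf : IsConv f) {κ : ℂ} (hκ : 2 ^ w * κ = 2 * (1 + δ) * κ)
    (hinv : ∀ t : ℂ, 0 < t.im → evAt (nome (2 * (-1 / t))) f =
      t ^ w * evAt (nome (2 * t)) f + κ * t) : IsTriple w (thetaOf w δ f) where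
  conv := isConv_thetaOf hf w δ
  translate_zero t ht := by
    rw [evAt_thetaOf_zero hf (im_add_one_pos ht), evAt_thetaOf_zero hf ht]
    have h1 := nome_add_two_mul (2 * t) 1
    have h2 := nome_add_two_mul (4 * t) 2
    rw [show 2 * (t + 1) = 2 * t + 2 * (1 : ℕ) by push_cast; ring, h1,
      show 4 * (t + 1) = 4 * t + 2 * (2 : ℕ) by push_cast; ring, h2]
  translate_one t ht := by
    rw [evAt_thetaOf_one hf (im_add_one_pos ht), evAt_thetaOf_two hf ht]
    have h1 := nome_add_two_mul (2 * t) 1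
    rw [show 2 * (t + 1) = 2 * t + 2 * (1 : ℕ) by push_cast; ring, h1]
  invert t ht := by
    rw [evAt_thetaOf_zero hf (im_neg_one_div_pos ht), evAt_thetaOf_one hf ht, hinv t ht]
    have h1 := hinv (t / 2) (im_div_two_pos ht)
    have ht0 := ne_zero_of_im_pos ht
    rw [show 2 * (-1 / (t / 2)) = 4 * (-1 / t) by field_simp; norm_num,
      show 2 * (t / 2) = t by ring, div_pow] at h1
    rw [h1]
    have h2 : (2 : ℂ) ^ w ≠ 0 := pow_ne_zero _ two_ne_zero
    field_simp
    linear_combination (-t) * hκ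

/-- In weight two the correction is `δ = 1`; in higher weight none is necessary. -/
lemma isTriple_thetaMod (m : ℕ) : IsTriple (2 * m + 2) fun i => thetaMod i m := by
  have h : (fun i => thetaMod i m) =
      thetaOf (2 * m + 2) (if m = 0 then 1 else 0) (eisCoef m) := by
    funext i
    rw [thetaMod, thetaExp, thetaOf, eisTwo]
    split <;> simp
  rw [h]
  rcases m with _ | m
  · exact isTriple_thetaOf (isConv_eisCoef 0) (by rw [if_pos rfl]; norm_num)
      fun t ht => eisCoef_zero_invert ht
  · refine isTriple_thetaOf (isConv_eisCoef _) (κ := 0) (by simp) fun t ht => ?_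
    rw [zero_mul, add_zero]
    exact eisCoef_invert m ht

lemma isLevelOne_eisTwo (m : ℕ) : IsLevelOne (2 * (m + 1) + 2) (eisTwo (m + 1)) where
  conv := (isConv_eisCoef _).twist (Or.inl rfl) _
  translate t ht := by
    rw [eisTwo, evAt_nome_twist (isConv_eisCoef _) _ (im_add_one_pos ht),
      evAt_nome_twist (isConv_eisCoef _) _ ht, Nat.cast_ofNat, mul_add, mul_one, nome_add_two]
  invert t ht := by
    rw [eisTwo, evAt_nome_twist (isConv_eisCoef _) _ (im_neg_one_div_pos ht),
      evAt_nome_twist (isConv_eisCoef _) _ ht, Nat.cast_ofNat, eisCoef_invert m ht]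

end Eisenstein

section Monomials

variable {M : ℕ}

/-- The weight attached to the exponents; the form `-p₁(TZ) + 3 p₁(ξ) + p₁(V)` has none. -/
def expWeight : Option (Fin 3 × Fin M) → ℕ
  | none => 0
  | some p => 2 * p.2 + 2

/-- The exponents of `TZ` and `ξ` are the same in the three summands and of level one, those of `V`
are permuted. -/
lemma isTriple_modExp (p : Fin 3 × Fin M) :
    IsTriple (expWeight (some p)) fun i => modExp i (some p) := by
  obtain ⟨j, m⟩ := p
  simp only [modExp, expWeight]
  fin_cases j
  · simp only [Fin.zero_eta, Matrix.cons_val_zero]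
    by_cases hm : m.val = 0
    · simp only [hm, if_true]
      exact isTriple_zero _
    · obtain ⟨m', hm'⟩ := Nat.exists_eq_succ_of_ne_zero hm
      simp only [hm', Nat.succ_ne_zero, if_false]
      exact (isLevelOne_eisTwo m').triple
  · exact ((isTriple_thetaMod m.val).sum ⟨m.val + 1, by ring⟩).triple
  · exact isTriple_thetaMod m.val

lemma isConv_eisTwo (m : ℕ) : IsConv (eisTwo m) := (isConv_eisCoef m).twist (Or.inl rfl) _

lemma isConv_modExp (i : Fin 3) (o : Option (Fin 3 × Fin M)) : IsConv (modExp i o) := by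
  rcases o with _ | p
  · exact (isConv_eisTwo 0).smul _
  · exact (isTriple_modExp p).conv i

variable {ι : Type*} [Fintype ι]

lemma isConv_monCoef {K : ℕ} {e : ι → PowerSeries ℂ} (he : ∀ o, IsConv (e o)) (γ : ι → Fin K) :
    IsConv (monCoef e γ) :=
  isConv_prod _ fun o => ((he o).pow _).smul _

/-- The coefficient of the monomial with exponents `γ` in the traces, in the part of `Q` with
`cosh(c/2)` in place of `e^{c/2}`. -/
noncomputable def modCoef (l : ℕ) {K : ℕ} (γ : Option (Fin 3 × Fin M) → Fin K) : PowerSeries ℂ :=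
  ∑ i, thetaFac l i * monCoef (modExp i) γ

lemma isConv_modCoef (l : ℕ) {K : ℕ} (γ : Option (Fin 3 × Fin M) → Fin K) :
    IsConv (modCoef l γ) :=
  isConv_sum _ fun i => (isConv_thetaFac l i).mul (isConv_monCoef (isConv_modExp i) γ)

/-- The coefficients of the monomials which do not contain the form `-p₁(TZ) + 3 p₁(ξ) + p₁(V)` are
modular. -/
lemma isLevelOne_modCoef (l : ℕ) {K : ℕ} (γ : Option (Fin 3 × Fin M) → Fin K)
    (h0 : (γ none).val = 0) :
    IsLevelOne (4 * l + ∑ o, (γ o).val * expWeight o) (modCoef l γ) := by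
  have h1 : ∀ o : Option (Fin 3 × Fin M), IsTriple ((γ o).val * expWeight o) fun i =>
      ((γ o).val.factorial : ℂ)⁻¹ • modExp i o ^ (γ o).val := by
    rintro (_ | p)
    · simpa [h0, expWeight] using isTriple_one
    · exact ((isTriple_modExp p).pow _).smul _
  have h2 := (isTriple_thetaFac l).mul (IsTriple.prod Finset.univ h1)
  rw [mul_comm l] at h2
  refine h2.sum ⟨2 * l + ∑ o, (γ o).val * (expWeight o / 2), ?_⟩
  have h3 : ∑ o, (γ o).val * expWeight o = 2 * ∑ o, (γ o).val * (expWeight o / 2) := by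
    rw [Finset.mul_sum]
    refine Finset.sum_congr rfl fun o _ => ?_
    rcases o with _ | p
    · simp [expWeight]
    · have : expWeight (some p) / 2 = p.2.val + 1 := by simp only [expWeight]; omega
      rw [this, expWeight]
      ring
  rw [h3]
  ring

end Monomials

/-! ### Connections in coordinates -/

section Calculus

variable {E G : Type*} [NormedAddCommGroup E] [NormedSpace ℝ E] [NormedAddCommGroup G]
  [NormedSpace ℝ G]

/-- The covariant derivative `d s(w) + Γ(w) s` of a vector valued function. -/
noncomputable def flatCov (Γ : E → E →L[ℝ] G →L[ℝ] G) (s : E → G) (p w : E) : G :=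
  fderiv ℝ s p w + Γ p w (s p)

/-- The curvature `dΓ + Γ ∧ Γ` of a connection form. -/
noncomputable def flatCurv (Γ : E → E →L[ℝ] G →L[ℝ] G) (p u w : E) : G →L[ℝ] G :=
  fderiv ℝ Γ p u w - fderiv ℝ Γ p w u + (Γ p u ∘L Γ p w - Γ p w ∘L Γ p u)

theorem flatCov_flatCov {Γ : E → E →L[ℝ] G →L[ℝ] G} {s : E → G} {W : E → E} {p : E}
    (hΓ : DifferentiableAt ℝ Γ p) (hs : ContDiffAt ℝ 2 s p) (hW : DifferentiableAt ℝ W p) (u : E) :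
    flatCov Γ (fun y => flatCov Γ s y (W y)) p u =
      fderiv ℝ (fderiv ℝ s) p u (W p) + fderiv ℝ s p (fderiv ℝ W p u) +
      (fderiv ℝ Γ p u (W p) (s p) + Γ p (fderiv ℝ W p u) (s p) + Γ p (W p) (fderiv ℝ s p u)) +
      Γ p u (fderiv ℝ s p (W p)) + Γ p u (Γ p (W p) (s p)) := by
  have h1 : DifferentiableAt ℝ (fderiv ℝ s) p :=
    (hs.fderiv_right (m := 1) (by norm_num)).differentiableAt (by norm_num)
  have hs1 : DifferentiableAt ℝ s p := hs.differentiableAt (by norm_num)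
  have e1 : HasFDerivAt (fun y => fderiv ℝ s y (W y)) _ p := h1.hasFDerivAt.clm_apply hW.hasFDerivAt
  have e2 : HasFDerivAt (fun y => Γ y (W y)) _ p := hΓ.hasFDerivAt.clm_apply hW.hasFDerivAt
  have e3 : HasFDerivAt (fun y => Γ y (W y) (s y)) _ p := e2.clm_apply hs1.hasFDerivAt
  have e4 := e1.add e3
  unfold flatCov
  rw [show (fun y => fderiv ℝ s y (W y) + Γ y (W y) (s y)) =
    (fun y => fderiv ℝ s y (W y)) + (fun y => Γ y (W y) (s y)) from rfl, e4.fderiv]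
  simp
  abel

/-- `[∇_U, ∇_W] - ∇_{[U,W]} = dΓ + Γ ∧ Γ`, by the symmetry of second derivatives. -/
theorem flatCov_commutator {Γ : E → E →L[ℝ] G →L[ℝ] G} {s : E → G} {U W : E → E} {p : E}
    (hΓ : DifferentiableAt ℝ Γ p) (hs : ContDiffAt ℝ 2 s p) (hU : DifferentiableAt ℝ U p)
    (hW : DifferentiableAt ℝ W p) :
    flatCov Γ (fun y => flatCov Γ s y (W y)) p (U p) -
      flatCov Γ (fun y => flatCov Γ s y (U y)) p (W p) -
      flatCov Γ s p (VectorField.lieBracket ℝ U W p) = flatCurv Γ p (U p) (W p) (s p) := by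
  have hsymm : fderiv ℝ (fderiv ℝ s) p (U p) (W p) = fderiv ℝ (fderiv ℝ s) p (W p) (U p) :=
    (hs.isSymmSndFDerivAt (by simp)) _ _
  rw [flatCov_flatCov hΓ hs hW, flatCov_flatCov hΓ hs hU, hsymm]
  simp only [flatCov, VectorField.lieBracket, flatCurv, map_sub,
    add_apply, sub_apply, ContinuousLinearMap.comp_apply]
  abel

end Calculus

section Chart

variable {n : ℕ} {Z : Type*} [TopologicalSpace Z] [ChartedSpace (Euc n) Z]

/-- The differential of the inverse of the chart around `x₀`. -/
noncomputable def chartD (x₀ : Z) (p : Euc n) :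
    Euc n →L[ℝ] TangentSpace (𝓡 n) ((extChartAt (𝓡 n) x₀).symm p) :=
  mfderiv 𝓘(ℝ, Euc n) (𝓡 n) (extChartAt (𝓡 n) x₀).symm p

variable [IsManifold (𝓡 n) ∞ Z]

lemma contMDiffAt_chart_symm {x₀ : Z} {p : Euc n} (hp : p ∈ (extChartAt (𝓡 n) x₀).target) :
    ContMDiffAt 𝓘(ℝ, Euc n) (𝓡 n) ∞ (extChartAt (𝓡 n) x₀).symm p :=
  (contMDiffOn_extChartAt_symm x₀).contMDiffAt ((isOpen_extChartAt_target x₀).mem_nhds hp)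

lemma isInvertible_chartD {x₀ : Z} {p : Euc n} (hp : p ∈ (extChartAt (𝓡 n) x₀).target) :
    (chartD x₀ p).IsInvertible := by
  have : IsManifold (𝓡 n) 1 Z := IsManifold.of_le (n := ∞) (by norm_cast)
  have := isInvertible_mfderivWithin_extChartAt_symm (I := 𝓡 n) hp
  rwa [ModelWithCorners.range_eq_univ, mfderivWithin_univ] at this

lemma chartD_comp_mfderiv {x₀ : Z} {p : Euc n} (hp : p ∈ (extChartAt (𝓡 n) x₀).target)
    (v : TangentSpace (𝓡 n) ((extChartAt (𝓡 n) x₀).symm p)) :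
    chartD x₀ p (mfderiv (𝓡 n) 𝓘(ℝ, Euc n) (extChartAt (𝓡 n) x₀)
      ((extChartAt (𝓡 n) x₀).symm p) v) = v := by
  have : IsManifold (𝓡 n) 1 Z := IsManifold.of_le (n := ∞) (by norm_cast)
  have := mfderivWithin_extChartAt_symm_comp_mfderiv_extChartAt (I := 𝓡 n) hp
  rw [ModelWithCorners.range_eq_univ, mfderivWithin_univ] at this
  exact congr($this v)

lemma mfderiv_comp_chartD {x₀ : Z} {p : Euc n} (hp : p ∈ (extChartAt (𝓡 n) x₀).target)
    (v : Euc n) :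
    mfderiv (𝓡 n) 𝓘(ℝ, Euc n) (extChartAt (𝓡 n) x₀)
      ((extChartAt (𝓡 n) x₀).symm p) (chartD x₀ p v) = v := by
  have : IsManifold (𝓡 n) 1 Z := IsManifold.of_le (n := ∞) (by norm_cast)
  have := mfderiv_extChartAt_comp_mfderivWithin_extChartAt_symm (I := 𝓡 n) hp
  rw [ModelWithCorners.range_eq_univ, mfderivWithin_univ] at this
  exact congr($this v)

/-- The vector field with constant coordinates `v` in the chart around `x₀`. -/
noncomputable def coordField (x₀ : Z) (v : Euc n) (y : Z) : TangentSpace (𝓡 n) y :=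
  VectorField.mpullback (𝓡 n) 𝓘(ℝ, Euc n) (extChartAt (𝓡 n) x₀) (fun _ => v) y

lemma coordField_symm {x₀ : Z} {p : Euc n} (hp : p ∈ (extChartAt (𝓡 n) x₀).target) (v : Euc n) :
    coordField x₀ v ((extChartAt (𝓡 n) x₀).symm p) = chartD x₀ p v := by
  have : IsManifold (𝓡 n) 1 Z := IsManifold.of_le (n := ∞) (by norm_cast)
  have hi := isInvertible_mfderiv_extChartAt (I := 𝓡 n) ((extChartAt (𝓡 n) x₀).map_target hp)
  obtain ⟨e, he⟩ := hi
  unfold coordField VectorField.mpullback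
  have h2 := mfderiv_comp_chartD hp v
  rw [← he] at h2 ⊢
  rw [ContinuousLinearMap.inverse_equiv]
  apply e.injective
  exact (e.apply_symm_apply v).trans h2.symm

lemma contMDiffAt_coordField {x₀ y : Z} (hy : y ∈ (extChartAt (𝓡 n) x₀).source) (v : Euc n) :
    ContMDiffAt (𝓡 n) ((𝓡 n).prod 𝓘(ℝ, Euc n)) ∞
      (fun y => Bundle.TotalSpace.mk' (Euc n) (E := fun y : Z => TangentSpace (𝓡 n) y) y
        (coordField x₀ v y)) y := by
  have : IsManifold (𝓡 n) 1 Z := IsManifold.of_le (n := ∞) (by norm_cast)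
  have : IsManifold (𝓡 n) (∞ + 1) Z := inferInstanceAs (IsManifold (𝓡 n) ∞ Z)
  rw [← contMDiffWithinAt_univ]
  apply ContMDiffWithinAt.mpullback_vectorField_preimage (n := ∞) (t := Set.univ)
  · rw [contMDiffWithinAt_univ]
    exact contMDiffAt_vectorSpace_iff_contDiffAt.2 contDiffAt_const
  · exact contMDiffAt_extChartAt' (by simpa using hy)
  · exact isInvertible_mfderiv_extChartAt hy
  · norm_num

end Chart

/-! ### Connection forms in orthonormal frames -/

section Connection

variable {n : ℕ} {Z : Type*} [TopologicalSpace Z] [T2Space Z] [ChartedSpace (Euc n) Z]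
  [IsManifold (𝓡 n) ∞ Z]
  {F : Type*} [NormedAddCommGroup F] [NormedSpace ℝ F] [FiniteDimensional ℝ F]
  {V : Z → Type*} [TopologicalSpace (Bundle.TotalSpace F V)]
  [∀ x, NormedAddCommGroup (V x)] [∀ x, InnerProductSpace ℝ (V x)]
  [FiberBundle F V] [VectorBundle ℝ F V] [ContMDiffVectorBundle ∞ F V (𝓡 n)]

/-- Smoothness of a section on a set. -/
abbrev SmoothSec (F : Type*) [NormedAddCommGroup F] [NormedSpace ℝ F]
    {V : Z → Type*} [TopologicalSpace (Bundle.TotalSpace F V)] [∀ x, TopologicalSpace (V x)]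
    [FiberBundle F V]  (σ : ∀ x, V x) (U : Set Z) : Prop :=
  ContMDiffOn (𝓡 n) ((𝓡 n).prod 𝓘(ℝ, F)) ∞ (fun x => Bundle.TotalSpace.mk' F x (σ x)) U

/-- A local section is extended by means of a bump function. This is needed because the smoothness
of a covariant derivative refers to global sections. -/
lemma exists_global_section {σ : ∀ x, V x} {U : Set Z} (hU : IsOpen U)
    (hσ : SmoothSec (n := n) F σ U) {x : Z} (hx : x ∈ U) :
    ∃ σ' : ∀ x, V x, SmoothSec (n := n) F σ' Set.univ ∧ ∀ᶠ y in 𝓝 x, σ' y = σ y := by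
  obtain ⟨f, hf1, hf2⟩ := (SmoothBumpFunction.nhds_basis_tsupport (I := 𝓡 n) x).mem_iff.1
    (hU.mem_nhds hx)
  refine ⟨fun y => f y • σ y, ?_, ?_⟩
  · exact (ContMDiffOn.smul_section_of_tsupport (ψ := f) f.contMDiff.contMDiffOn hU hf2 hσ).contMDiffOn
  · filter_upwards [f.eventuallyEq_one] with y hy
    simp [hy]

variable (cov : CovariantDerivative (𝓡 n) F V)

/-- A covariant derivative is local. -/
lemma cov_congr {σ σ' : ∀ x, V x} {x : Z} (h : ∀ᶠ y in 𝓝 x, σ y = σ' y)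
    (hσ : MDifferentiableAt (𝓡 n) ((𝓡 n).prod 𝓘(ℝ, F)) (fun x => Bundle.TotalSpace.mk' F x (σ x)) x) :
    cov σ x = cov σ' x := by
  refine cov.isCovariantDerivativeOnUniv.congr_of_eventuallyEq hσ ?_ Filter.univ_mem h
  refine hσ.congr_of_eventuallyEq ?_
  filter_upwards [h] with y hy
  rw [hy]

/-- The covariant derivative of a smooth local section is smooth. -/
lemma contMDiffOn_cov [h : CovariantDerivative.ContMDiffCovariantDerivative cov ∞]
    {σ : ∀ x, V x} {U : Set Z} (hU : IsOpen U) (hσ : SmoothSec (n := n) F σ U) :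
    ContMDiffOn (𝓡 n) ((𝓡 n).prod 𝓘(ℝ, Euc n →L[ℝ] F)) ∞
      (fun x => Bundle.TotalSpace.mk' (Euc n →L[ℝ] F)
        (E := fun x => TangentSpace (𝓡 n) x →L[ℝ] V x) x (cov σ x)) U := by
  intro x hx
  obtain ⟨σ', hs, he⟩ := exists_global_section hU hσ hx
  have h1 := h.contMDiff.contMDiff (σ := σ') (by exact hs)
  refine ContMDiffAt.contMDiffWithinAt ?_
  refine (h1.contMDiffAt Filter.univ_mem).congr_of_eventuallyEq ?_
  filter_upwards [he.eventually_nhds, hU.mem_nhds hx] with y hy hyU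
  have hd := ((hσ y hyU).contMDiffAt (hU.mem_nhds hyU)).mdifferentiableAt (by simp)
  rw [cov_congr cov (hy.mono fun z hz => hz.symm) hd]

variable [IsContMDiffRiemannianBundle (𝓡 n) ∞ F V]
variable {r : ℕ} {e : Fin r → ∀ x, V x} {U : Set Z}

lemma frame_expansion (he : IsOrthonormalFrameOn (n := n) F e U) (hr : Module.finrank ℝ F = r)
    {x : Z} (hx : x ∈ U) (s : V x) : s = ∑ a, (inner ℝ (e a x) s : ℝ) • e a x := by
  have hcard : Fintype.card (Fin r) = Module.finrank ℝ (V x) := by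
    rw [Fintype.card_fin, ← hr]
    exact ((trivializationAt F V x).continuousLinearEquivAt ℝ x
      (FiberBundle.mem_baseSet_trivializationAt' x)).toLinearEquiv.finrank_eq.symm
  by_cases h0 : r = 0
  · subst h0
    have : FiniteDimensional ℝ (V x) := VectorBundle.finiteDimensional ℝ F V x
    have : Subsingleton (V x) := Module.finrank_zero_iff (R := ℝ).1 (by simpa using hcard.symm)
    exact Subsingleton.elim _ _
  have : Nonempty (Fin r) := ⟨⟨0, Nat.pos_of_ne_zero h0⟩⟩
  have hspan := (he.orthonormal x hx).linearIndependent.span_eq_top_of_card_eq_finrank hcard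
  let b := OrthonormalBasis.mk (he.orthonormal x hx) hspan.ge
  have := (b.sum_repr s).symm
  simpa [b, b.repr_apply_apply] using this

/-- The matrix `ω(v)` with entries `⟨e_b, ∇_v e_c⟩`, where `v` has constant coordinates in the chart
around `x₀`. -/
noncomputable def connMatrix (e : Fin r → ∀ x, V x) (x₀ : Z) (p v : Euc n) :
    Matrix (Fin r) (Fin r) ℝ :=
  Matrix.of fun b c => inner ℝ (e b ((extChartAt (𝓡 n) x₀).symm p))
          (cov (e c) ((extChartAt (𝓡 n) x₀).symm p) (chartD x₀ p v))

/-- The connection form of `cov` in the frame `e`, in the chart around `x₀`. -/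
noncomputable def connForm (e : Fin r → ∀ x, V x) (x₀ : Z) (p : Euc n) :
    Euc n →L[ℝ] (Fin r → ℝ) →L[ℝ] (Fin r → ℝ) :=
  LinearMap.toContinuousLinearMap
  { toFun := fun v => LinearMap.toContinuousLinearMap (Matrix.toLin' (connMatrix cov e x₀ p v))
    map_add' := fun s t => by
      rw [← map_add, ← map_add]
      congr 2
      ext a b
      simp only [connMatrix, map_add, inner_add_right, Matrix.of_apply, Matrix.add_apply]
    map_smul' := fun s t => by
      rw [RingHom.id_apply, ← map_smul, ← map_smul]
      congr 2
      ext a b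
      simp only [connMatrix, map_smul, inner_smul_right, Matrix.of_apply, Matrix.smul_apply,
        smul_eq_mul] }

lemma connForm_apply (x₀ : Z) (p v : Euc n) (s : Fin r → ℝ) (b : Fin r) :
    connForm cov e x₀ p v s b = ∑ c, (inner ℝ (e b ((extChartAt (𝓡 n) x₀).symm p))
          (cov (e c) ((extChartAt (𝓡 n) x₀).symm p) (chartD x₀ p v)) : ℝ) * s c := rfl

/-- The coordinates of a section in the frame `e` and the chart around `x₀`. -/
noncomputable def coordSec (e : Fin r → ∀ x, V x) (x₀ : Z) (σ : ∀ x, V x) (p : Euc n) : Fin r → ℝ :=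
  fun b => inner ℝ (e b ((extChartAt (𝓡 n) x₀).symm p)) (σ ((extChartAt (𝓡 n) x₀).symm p))

lemma contDiffAt_of_manifold {f : Z → ℝ} {x₀ : Z} {p : Euc n}
    (hp : p ∈ (extChartAt (𝓡 n) x₀).target)
    (hf : ContMDiffAt (𝓡 n) 𝓘(ℝ, ℝ) ∞ f ((extChartAt (𝓡 n) x₀).symm p)) :
    ContDiffAt ℝ ∞ (fun p => f ((extChartAt (𝓡 n) x₀).symm p)) p :=
  contMDiffAt_iff_contDiffAt.1 (hf.comp p (contMDiffAt_chart_symm hp))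

lemma coordSec_contDiffAt (he : IsOrthonormalFrameOn (n := n) F e U) (hU : IsOpen U)
    {σ : ∀ x, V x} {x₀ : Z} {p : Euc n}
    (hp : p ∈ (extChartAt (𝓡 n) x₀).target) (hpU : (extChartAt (𝓡 n) x₀).symm p ∈ U)
    (hσ : ContMDiffAt (𝓡 n) ((𝓡 n).prod 𝓘(ℝ, F)) ∞ (fun x => Bundle.TotalSpace.mk' F x (σ x))
      ((extChartAt (𝓡 n) x₀).symm p)) :
    ContDiffAt ℝ ∞ (coordSec e x₀ σ) p := by
  rw [contDiffAt_pi]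
  intro b
  exact contDiffAt_of_manifold hp
    (((he.smooth b).contMDiffAt (hU.mem_nhds hpU)).inner_bundle hσ)

lemma contDiffAt_clm_of_apply {D E G : Type*} [NormedAddCommGroup D] [NormedSpace ℝ D]
    [NormedAddCommGroup E] [NormedSpace ℝ E] [FiniteDimensional ℝ E]
    [NormedAddCommGroup G] [NormedSpace ℝ G] {f : D → E →L[ℝ] G} {m : WithTop ℕ∞} {p : D}
    (h : ∀ y, ContDiffAt ℝ m (fun x => f x y) p) : ContDiffAt ℝ m f p := by
  let e₁ := ContinuousLinearEquiv.ofFinrankEq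
    (Module.finrank_fin_fun (R := ℝ) (n := Module.finrank ℝ E)).symm
  let e₂ := (e₁.arrowCongr (1 : G ≃L[ℝ] G)).trans
    (ContinuousLinearEquiv.piRing (Fin (Module.finrank ℝ E)))
  rw [← Function.id_comp f, ← e₂.symm_comp_self]
  exact e₂.symm.contDiff.contDiffAt.comp p (contDiffAt_pi.2 fun i => h _)

/-- The connection form in a smooth frame is smooth. -/
lemma connForm_contDiffAt [CovariantDerivative.ContMDiffCovariantDerivative cov ∞]
    (he : IsOrthonormalFrameOn (n := n) F e U) (hU : IsOpen U) {x₀ : Z} {p : Euc n}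
    (hp : p ∈ (extChartAt (𝓡 n) x₀).target) (hpU : (extChartAt (𝓡 n) x₀).symm p ∈ U) :
    ContDiffAt ℝ ∞ (connForm cov e x₀) p := by
  refine contDiffAt_clm_of_apply fun v => contDiffAt_clm_of_apply fun s => ?_
  rw [contDiffAt_pi]
  intro b
  have hopen : (extChartAt (𝓡 n) x₀).target ∈ 𝓝 p := (isOpen_extChartAt_target x₀).mem_nhds hp
  refine ContDiffAt.congr_of_eventuallyEq (f := fun p => ∑ c,
    (inner ℝ (e b ((extChartAt (𝓡 n) x₀).symm p)) (cov (e c) ((extChartAt (𝓡 n) x₀).symm p)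
      (coordField x₀ v ((extChartAt (𝓡 n) x₀).symm p))) : ℝ) * s c) ?_ ?_
  · refine ContDiffAt.sum fun c _ => ContDiffAt.mul ?_ contDiffAt_const
    refine contDiffAt_of_manifold (f := fun y => inner ℝ (e b y) (cov (e c) y (coordField x₀ v y))) hp ?_
    refine ((he.smooth b).contMDiffAt (hU.mem_nhds hpU)).inner_bundle ?_
    refine ContMDiffAt.clm_bundle_apply
      ((contMDiffOn_cov cov hU (he.smooth c)).contMDiffAt (hU.mem_nhds hpU)) ?_
    exact contMDiffAt_coordField ((extChartAt (𝓡 n) x₀).map_target hp) v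
  · filter_upwards [hopen] with q hq
    rw [connForm_apply]
    simp only [coordField_symm hq]

/-- The connection in coordinates: `∇_v σ` has the components `dσ(v) + ω(v) σ`. -/
lemma inner_cov (he : IsOrthonormalFrameOn (n := n) F e U) (hU : IsOpen U)
    (hr : Module.finrank ℝ F = r) {σ : ∀ x, V x} {x₀ : Z} {p : Euc n}
    (hp : p ∈ (extChartAt (𝓡 n) x₀).target) (hpU : (extChartAt (𝓡 n) x₀).symm p ∈ U)
    (hσ : MDifferentiableAt (𝓡 n) ((𝓡 n).prod 𝓘(ℝ, F)) (fun x => Bundle.TotalSpace.mk' F x (σ x))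
      ((extChartAt (𝓡 n) x₀).symm p)) (v : Euc n) (b : Fin r) :
    inner ℝ (e b ((extChartAt (𝓡 n) x₀).symm p))
      (cov σ ((extChartAt (𝓡 n) x₀).symm p) (chartD x₀ p v)) =
    flatCov (connForm cov e x₀) (coordSec e x₀ σ) p v b := by
  set y := (extChartAt (𝓡 n) x₀).symm p with hy
  have hin : IsContMDiffRiemannianBundle (𝓡 n) 1 F V :=
    IsContMDiffRiemannianBundle.of_le (n := ∞) (by norm_cast)
  have hed : ∀ a, MDifferentiableAt (𝓡 n) ((𝓡 n).prod 𝓘(ℝ, F))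
      (fun x => Bundle.TotalSpace.mk' F x (e a x)) y := fun a =>
    ((he.smooth a).contMDiffAt (hU.mem_nhds hpU)).mdifferentiableAt (by simp)
  let g : Fin r → Z → ℝ := fun a x => inner ℝ (e a x) (σ x)
  have hg : ∀ a, MDifferentiableAt (𝓡 n) 𝓘(ℝ, ℝ) (g a) y := fun a => (hed a).inner_bundle hσ
  -- expand `σ` in the frame near `y`, with coefficients `g a`
  have h1 : cov σ y = ∑ a, cov (g a • e a) y := by
    have : ∀ (s : Finset (Fin r)), cov (∑ a ∈ s, g a • e a) y = ∑ a ∈ s, cov (g a • e a) y ∧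
        MDifferentiableAt (𝓡 n) ((𝓡 n).prod 𝓘(ℝ, F))
      (fun x => Bundle.TotalSpace.mk' F x ((∑ a ∈ s, g a • e a) x)) y := by
      intro s
      induction s using Finset.induction_on with
      | empty =>
        simp only [Finset.sum_empty, CovariantDerivative.zero]
        exact ⟨rfl, Bundle.mdifferentiableAt_zeroSection ..⟩
      | insert a s ha ih =>
        rw [Finset.sum_insert ha, Finset.sum_insert ha]
        have h2 := (hg a).smul_section (hed a)
        refine ⟨?_, mdifferentiableAt_add_section h2 ih.2⟩
        rw [cov.isCovariantDerivativeOnUniv.add h2 ih.2 trivial, ih.1]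
    rw [← (this Finset.univ).1]
    refine cov_congr cov ?_ hσ
    filter_upwards [hU.mem_nhds hpU] with z hz
    rw [Finset.sum_apply]
    exact frame_expansion he hr hz (σ z)
  have horth := he.orthonormal y hpU
  have hder : ∀ a, mfderiv (𝓡 n) 𝓘(ℝ, ℝ) (g a) y (chartD x₀ p v) =
      fderiv ℝ (coordSec e x₀ σ) p v a := by
    intro a
    have e1 : (fun q => coordSec e x₀ σ q a) = g a ∘ (extChartAt (𝓡 n) x₀).symm := rfl
    have e2 : DifferentiableAt ℝ (coordSec e x₀ σ) p := by
      rw [differentiableAt_pi]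
      intro a
      exact mdifferentiableAt_iff_differentiableAt.1 ((hg a).comp p
        ((contMDiffAt_chart_symm hp).mdifferentiableAt (by simp)))
    have e3 := mfderiv_comp p (hg a) ((contMDiffAt_chart_symm hp).mdifferentiableAt (by simp))
    have e5 : fderiv ℝ (fun q => coordSec e x₀ σ q a) p v =
        mfderiv (𝓡 n) 𝓘(ℝ, ℝ) (g a) y (chartD x₀ p v) := by
      rw [← mfderiv_eq_fderiv, e1]
      exact congr($e3 v)
    have e4 : fderiv ℝ (fun q => coordSec e x₀ σ q a) p v = fderiv ℝ (coordSec e x₀ σ) p v a := by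
      rw [fderiv_pi (fun a => differentiableAt_pi.1 e2 a)]
      rfl
    exact e5.symm.trans e4
  -- the Leibniz rule for each term
  have h2 : ∀ a, inner ℝ (e b y) (cov (g a • e a) y (chartD x₀ p v)) =
      g a y * inner ℝ (e b y) (cov (e a) y (chartD x₀ p v)) +
        (if b = a then fderiv ℝ (coordSec e x₀ σ) p v a else 0) := by
    intro a
    rw [cov.isCovariantDerivativeOnUniv.leibniz (hed a) (hg a) trivial]
    rw [← hder a]
    have h3 := orthonormal_iff_ite.1 horth b a
    change inner ℝ (e b y) (g a y • cov (e a) y (chartD x₀ p v) +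
      (mvfderiv (𝓡 n) (g a) y (chartD x₀ p v)) • e a y) = g a y * inner ℝ (e b y) (cov (e a) y (chartD x₀ p v)) +
        (if b = a then (mvfderiv (𝓡 n) (g a) y (chartD x₀ p v)) else 0)
    rw [inner_add_right, inner_smul_right, inner_smul_right, h3]
    split_ifs <;> simp
  rw [h1]
  have h4 : (∑ a, cov (g a • e a) y) (chartD x₀ p v) = ∑ a, cov (g a • e a) y (chartD x₀ p v) := by
    rw [sum_apply]
  rw [h4, inner_sum]
  simp only [h2, Finset.sum_add_distrib, Finset.sum_ite_eq, Finset.mem_univ, if_true]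
  unfold flatCov
  rw [Pi.add_apply, connForm_apply, add_comm]
  congr 1
  refine Finset.sum_congr rfl fun c _ => ?_
  rw [mul_comm]
  rfl

end Connection

/-! ### Curvature in coordinates -/

section FlatCurv

variable {E G : Type*} [NormedAddCommGroup E] [NormedSpace ℝ E] [NormedAddCommGroup G]
  [NormedSpace ℝ G] (Γ : E → E →L[ℝ] G →L[ℝ] G) (p : E)

lemma flatCurv_add_left (u u' w : E) :
    flatCurv Γ p (u + u') w = flatCurv Γ p u w + flatCurv Γ p u' w := by
  ext s
  simp [flatCurv]
  abel

lemma flatCurv_smul_left (c : ℝ) (u w : E) : flatCurv Γ p (c • u) w = c • flatCurv Γ p u w := by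
  ext s
  simp [flatCurv, smul_sub, smul_add]

lemma flatCurv_swap (u w : E) : flatCurv Γ p u w = -flatCurv Γ p w u := by
  ext s
  simp [flatCurv]
  abel

end FlatCurv

section Connection

variable {n : ℕ} {Z : Type*} [TopologicalSpace Z] [T2Space Z] [ChartedSpace (Euc n) Z]
  [IsManifold (𝓡 n) ∞ Z]
  {F : Type*} [NormedAddCommGroup F] [NormedSpace ℝ F] [FiniteDimensional ℝ F]
  {V : Z → Type*} [TopologicalSpace (Bundle.TotalSpace F V)]
  [∀ x, NormedAddCommGroup (V x)] [∀ x, InnerProductSpace ℝ (V x)]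
  [FiberBundle F V] [VectorBundle ℝ F V] [ContMDiffVectorBundle ∞ F V (𝓡 n)]

variable (cov : CovariantDerivative (𝓡 n) F V)
variable [IsContMDiffRiemannianBundle (𝓡 n) ∞ F V]
variable {r : ℕ} {e : Fin r → ∀ x, V x} {U : Set Z}

/-- The coordinates of a vector field in the chart around `x₀`. -/
noncomputable def coordVec (x₀ : Z) (W : ∀ y : Z, TangentSpace (𝓡 n) y) (q : Euc n) : Euc n :=
  VectorField.mpullback 𝓘(ℝ, Euc n) (𝓡 n) (extChartAt (𝓡 n) x₀).symm W q

lemma chartD_coordVec {x₀ : Z} {q : Euc n} (hq : q ∈ (extChartAt (𝓡 n) x₀).target)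
    (W : ∀ y : Z, TangentSpace (𝓡 n) y) :
    chartD x₀ q (coordVec x₀ W q) = W ((extChartAt (𝓡 n) x₀).symm q) := by
  obtain ⟨e, he⟩ := isInvertible_chartD hq
  unfold coordVec VectorField.mpullback
  change chartD x₀ q ((chartD x₀ q).inverse _) = _
  rw [← he, ContinuousLinearMap.inverse_equiv]
  exact e.apply_symm_apply _

lemma chartD_injective {x₀ : Z} {q : Euc n} (hq : q ∈ (extChartAt (𝓡 n) x₀).target) :
    Function.Injective (chartD x₀ q) := by
  obtain ⟨e, he⟩ := isInvertible_chartD hq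
  rw [← he]
  exact e.injective

lemma coordVec_contDiffAt {x₀ : Z} {p : Euc n} (hp : p ∈ (extChartAt (𝓡 n) x₀).target)
    {W : ∀ y : Z, TangentSpace (𝓡 n) y}
    (hW : ContMDiffAt (𝓡 n) ((𝓡 n).prod 𝓘(ℝ, Euc n)) ∞
      (fun y => Bundle.TotalSpace.mk' (Euc n) (E := fun y : Z => TangentSpace (𝓡 n) y) y (W y))
      ((extChartAt (𝓡 n) x₀).symm p)) : ContDiffAt ℝ ∞ (coordVec x₀ W) p := by
  have : IsManifold (𝓡 n) 1 Z := IsManifold.of_le (n := ∞) (by norm_cast)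
  have : IsManifold (𝓡 n) (∞ + 1) Z := inferInstanceAs (IsManifold (𝓡 n) ∞ Z)
  refine contMDiffAt_vectorSpace_iff_contDiffAt.1 (contMDiffWithinAt_univ.1 ?_)
  apply ContMDiffWithinAt.mpullback_vectorField_preimage (n := ∞) (t := Set.univ)
  · rwa [contMDiffWithinAt_univ]
  · exact contMDiffAt_chart_symm hp
  · exact isInvertible_chartD hp
  · norm_num

lemma mlieBracket_eq_lieBracket {E : Type*} [NormedAddCommGroup E] [NormedSpace ℝ E]
    (U W : ∀ x : E, TangentSpace 𝓘(ℝ, E) x) (p : E) :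
    VectorField.mlieBracket 𝓘(ℝ, E) U W p = VectorField.lieBracket ℝ U W p := by
  rw [← VectorField.mlieBracketWithin_univ, VectorField.mlieBracketWithin_eq_lieBracketWithin]
  exact congrFun (VectorField.lieBracketWithin_univ (𝕜 := ℝ) (E := E) (V := U) (W := W)) p

/-- Lie brackets are computed in coordinates. -/
lemma chartD_lieBracket {x₀ : Z} {p : Euc n} (hp : p ∈ (extChartAt (𝓡 n) x₀).target)
    {U W : ∀ y : Z, TangentSpace (𝓡 n) y}
    (hU : MDifferentiableAt (𝓡 n) ((𝓡 n).prod 𝓘(ℝ, Euc n))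
      (fun y => Bundle.TotalSpace.mk' (Euc n) (E := fun y : Z => TangentSpace (𝓡 n) y) y (U y))
      ((extChartAt (𝓡 n) x₀).symm p))
    (hW : MDifferentiableAt (𝓡 n) ((𝓡 n).prod 𝓘(ℝ, Euc n))
      (fun y => Bundle.TotalSpace.mk' (Euc n) (E := fun y : Z => TangentSpace (𝓡 n) y) y (W y))
      ((extChartAt (𝓡 n) x₀).symm p)) :
    chartD x₀ p (VectorField.lieBracket ℝ (coordVec x₀ U) (coordVec x₀ W) p) =
      VectorField.mlieBracket (𝓡 n) U W ((extChartAt (𝓡 n) x₀).symm p) := by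
  have : IsManifold (𝓡 n) (minSmoothness ℝ 3) Z :=
    IsManifold.of_le (n := ∞) (by simp; norm_cast)
  have : IsManifold (𝓡 n) 2 Z := IsManifold.of_le (n := ∞) (by norm_cast)
  have : IsManifold (𝓡 n) (minSmoothness ℝ 2) Z :=
    IsManifold.of_le (n := ∞) (by simp; norm_cast)
  have h := VectorField.mpullback_mlieBracket (n := ∞) hU hW (contMDiffAt_chart_symm hp)
    (by simp; norm_cast)
  have h2 : VectorField.mlieBracket 𝓘(ℝ, Euc n) (coordVec x₀ U) (coordVec x₀ W) p =
      VectorField.lieBracket ℝ (coordVec x₀ U) (coordVec x₀ W) p :=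
    mlieBracket_eq_lieBracket _ _ p
  rw [← chartD_coordVec hp (VectorField.mlieBracket (𝓡 n) U W)]
  congr 1
  exact (h.trans h2).symm

/-- The curvature in coordinates is `dΓ + Γ ∧ Γ`. -/
lemma inner_curvature [CovariantDerivative.ContMDiffCovariantDerivative cov ∞]
    (he : IsOrthonormalFrameOn (n := n) F e U) (hU : IsOpen U)
    (hr : Module.finrank ℝ F = r) {x₀ : Z} {p : Euc n}
    (hp : p ∈ (extChartAt (𝓡 n) x₀).target) (hpU : (extChartAt (𝓡 n) x₀).symm p ∈ U)
    (u w : Euc n) (s : V ((extChartAt (𝓡 n) x₀).symm p)) (b : Fin r) :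
    inner ℝ (e b ((extChartAt (𝓡 n) x₀).symm p))
      (curvature cov ((extChartAt (𝓡 n) x₀).symm p) (chartD x₀ p u) (chartD x₀ p w) s) =
    flatCurv (connForm cov e x₀) p u w
      (fun c => inner ℝ (e c ((extChartAt (𝓡 n) x₀).symm p)) s) b := by
  have : IsManifold (𝓡 n) 1 Z := IsManifold.of_le (n := ∞) (by norm_cast)
  have : IsManifold (𝓡 n) (∞ + 1) Z := inferInstanceAs (IsManifold (𝓡 n) ∞ Z)
  have : ContMDiffVectorBundle 1 F V (𝓡 n) := ContMDiffVectorBundle.of_le (n := ∞) (by norm_cast)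
  set X : ∀ y : Z, TangentSpace (𝓡 n) y := FiberBundle.extend (Euc n) (chartD x₀ p u) with hX
  set W : ∀ y : Z, TangentSpace (𝓡 n) y := FiberBundle.extend (Euc n) (chartD x₀ p w) with hW
  set σ : ∀ y : Z, V y := FiberBundle.extend F s with hσ
  have hXs : ContMDiffAt (𝓡 n) ((𝓡 n).prod 𝓘(ℝ, Euc n)) ∞
      (fun y => Bundle.TotalSpace.mk' (Euc n) (E := fun y : Z => TangentSpace (𝓡 n) y) y (X y)) ((extChartAt (𝓡 n) x₀).symm p) :=
    FiberBundle.contMDiffAt_extend ..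
  have hWs : ContMDiffAt (𝓡 n) ((𝓡 n).prod 𝓘(ℝ, Euc n)) ∞
      (fun y => Bundle.TotalSpace.mk' (Euc n) (E := fun y : Z => TangentSpace (𝓡 n) y) y (W y)) ((extChartAt (𝓡 n) x₀).symm p) :=
    FiberBundle.contMDiffAt_extend ..
  obtain ⟨N', hN', hσN'⟩ := FiberBundle.exists_contMDiffOn_extend (𝓡 n) F s (k := ∞)
  obtain ⟨N, hNN, hNo, hyN⟩ := mem_nhds_iff.1 hN'
  have hσN : SmoothSec (n := n) F σ N := hσN'.mono hNN
  have hcont : ContinuousAt (extChartAt (𝓡 n) x₀).symm p := (contMDiffAt_chart_symm hp).continuousAt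
  have hXp : coordVec x₀ X p = u := by
    apply chartD_injective hp
    rw [chartD_coordVec hp]
    exact FiberBundle.extend_apply_self ..
  have hWp : coordVec x₀ W p = w := by
    apply chartD_injective hp
    rw [chartD_coordVec hp]
    exact FiberBundle.extend_apply_self ..
  have hσy : σ ((extChartAt (𝓡 n) x₀).symm p) = s := FiberBundle.extend_apply_self ..
  -- `∇_Y σ` in coordinates, on a neighbourhood of `p`, so that it can be differentiated again
  have key : ∀ (Y : ∀ y : Z, TangentSpace (𝓡 n) y), ∀ᶠ q in 𝓝 p,
      coordSec e x₀ (fun y => cov σ y (Y y)) q =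
        flatCov (connForm cov e x₀) (coordSec e x₀ σ) q (coordVec x₀ Y q) := by
    intro Y
    filter_upwards [(isOpen_extChartAt_target x₀).mem_nhds hp,
      hcont.eventually_mem (hNo.mem_nhds hyN), hcont.eventually_mem (hU.mem_nhds hpU)]
      with q hq hqN hqU
    ext b
    rw [← inner_cov cov he hU hr hq hqU
      (((hσN _ hqN).contMDiffAt (hNo.mem_nhds hqN)).mdifferentiableAt (by simp)),
      chartD_coordVec hq]
    rfl
  have key2 : ∀ (Y : ∀ y : Z, TangentSpace (𝓡 n) y),
      ContMDiffAt (𝓡 n) ((𝓡 n).prod 𝓘(ℝ, Euc n)) ∞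
      (fun y => Bundle.TotalSpace.mk' (Euc n) (E := fun y : Z => TangentSpace (𝓡 n) y) y (Y y)) ((extChartAt (𝓡 n) x₀).symm p) →
      ∀ (v : Euc n), inner ℝ (e b ((extChartAt (𝓡 n) x₀).symm p)) (cov (fun y => cov σ y (Y y)) ((extChartAt (𝓡 n) x₀).symm p) (chartD x₀ p v)) =
        flatCov (connForm cov e x₀) (fun q =>
        flatCov (connForm cov e x₀) (coordSec e x₀ σ) q (coordVec x₀ Y q)) p v b := by
    intro Y hY v
    have h1 : MDifferentiableAt (𝓡 n) ((𝓡 n).prod 𝓘(ℝ, F))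
        (fun x => Bundle.TotalSpace.mk' F x (cov σ x (Y x))) ((extChartAt (𝓡 n) x₀).symm p) :=
      (ContMDiffAt.clm_bundle_apply
        ((contMDiffOn_cov cov hNo hσN).contMDiffAt (hNo.mem_nhds hyN)) hY).mdifferentiableAt
          (by simp)
    rw [inner_cov cov he hU hr hp hpU h1]
    simp only [flatCov]
    rw [Filter.EventuallyEq.fderiv_eq (key Y), (Filter.EventuallyEq.eq_of_nhds (key Y))]
    rfl
  have hcs : ContDiffAt ℝ ∞ (coordSec e x₀ σ) p :=
    coordSec_contDiffAt he hU hp hpU ((hσN _ hyN).contMDiffAt (hNo.mem_nhds hyN))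
  have hcomm := flatCov_commutator
    ((connForm_contDiffAt cov he hU hp hpU).differentiableAt (by simp))
    (hcs.of_le (by norm_cast))
    ((coordVec_contDiffAt hp hXs).differentiableAt (by simp))
    ((coordVec_contDiffAt hp hWs).differentiableAt (by simp))
  rw [hXp, hWp] at hcomm
  have hlast : inner ℝ (e b ((extChartAt (𝓡 n) x₀).symm p)) (cov σ ((extChartAt (𝓡 n) x₀).symm p) (VectorField.mlieBracket (𝓡 n) X W ((extChartAt (𝓡 n) x₀).symm p))) =
      flatCov (connForm cov e x₀) (coordSec e x₀ σ) p
        (VectorField.lieBracket ℝ (coordVec x₀ X) (coordVec x₀ W) p) b := by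
    rw [← inner_cov cov he hU hr hp hpU
      (((hσN _ hyN).contMDiffAt (hNo.mem_nhds hyN)).mdifferentiableAt (by simp)),
      chartD_lieBracket hp (hXs.mdifferentiableAt (by simp)) (hWs.mdifferentiableAt (by simp))]
  have hfin : flatCurv (connForm cov e x₀) p u w (coordSec e x₀ σ p) b = _ :=
    congrFun hcomm.symm b
  have hcp : coordSec e x₀ σ p = fun c => inner ℝ (e c ((extChartAt (𝓡 n) x₀).symm p)) s := by
    ext c
    change inner ℝ (e c ((extChartAt (𝓡 n) x₀).symm p)) (σ ((extChartAt (𝓡 n) x₀).symm p)) = _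
    rw [hσy]
  rw [hcp] at hfin
  rw [hfin]
  change inner ℝ (e b ((extChartAt (𝓡 n) x₀).symm p)) (cov (fun y => cov σ y (W y)) ((extChartAt (𝓡 n) x₀).symm p) (chartD x₀ p u) -
    cov (fun y => cov σ y (X y)) ((extChartAt (𝓡 n) x₀).symm p) (chartD x₀ p w) -
    cov σ ((extChartAt (𝓡 n) x₀).symm p) (VectorField.mlieBracket (𝓡 n) X W ((extChartAt (𝓡 n) x₀).symm p))) = _
  rw [inner_sub_right, inner_sub_right, key2 W hWs, key2 X hXs, hlast]
  rfl

/-- The connection form of a metric connection in an orthonormal frame is skew symmetric: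
differentiate `⟨e_b, e_c⟩ = δ_{bc}`. -/
lemma connMatrix_skew (hm : cov.IsMetricCompatible)
    (he : IsOrthonormalFrameOn (n := n) F e U) (hU : IsOpen U) {x₀ : Z} {p : Euc n}
    (hpU : (extChartAt (𝓡 n) x₀).symm p ∈ U) (v : Euc n) (b c : Fin r) :
    connMatrix cov e x₀ p v b c = -connMatrix cov e x₀ p v c b := by
  have : IsContMDiffRiemannianBundle (𝓡 n) 1 F V :=
    IsContMDiffRiemannianBundle.of_le (n := ∞) (by norm_cast)
  have : ContMDiffVectorBundle 1 F V (𝓡 n) := ContMDiffVectorBundle.of_le (n := ∞) (by norm_cast)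
  set y := (extChartAt (𝓡 n) x₀).symm p with hy
  have hed : ∀ a, MDifferentiableAt (𝓡 n) ((𝓡 n).prod 𝓘(ℝ, F))
      (fun x => Bundle.TotalSpace.mk' F x (e a x)) y := fun a =>
    ((he.smooth a).contMDiffAt (hU.mem_nhds hpU)).mdifferentiableAt (by simp)
  have h1 := hm.mvfderiv_inner_eq (FiberBundle.extend (Euc n) (chartD x₀ p v)) (hed b) (hed c)
  have h2 : (fun x => inner ℝ (e b x) (e c x)) =ᶠ[𝓝 y] fun _ => if b = c then (1 : ℝ) else 0 := by
    filter_upwards [hU.mem_nhds hpU] with z hz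
    exact orthonormal_iff_ite.1 (he.orthonormal z hz) b c
  have h3 : mfderiv (𝓡 n) 𝓘(ℝ, ℝ) (fun x => inner ℝ (e b x) (e c x)) y = 0 := by
    rw [h2.mfderiv_eq]
    exact mfderiv_const
  have h4 : mvfderiv (𝓡 n) (fun x => inner ℝ (e b x) (e c x)) y
      (FiberBundle.extend (Euc n) (chartD x₀ p v) y) = 0 := by
    unfold mvfderiv
    rw [h3]
    rfl
  have hx : FiberBundle.extend (Euc n) (chartD x₀ p v) y = chartD x₀ p v :=
    FiberBundle.extend_apply_self ..
  rw [h4] at h1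
  simp only [hx] at h1
  rw [real_inner_comm] at h1
  simp only [connMatrix, Matrix.of_apply]
  linarith

end Connection

/-! ### The exterior algebra as an algebra of forms -/

section ExtAlg

variable {n : ℕ}

/-- The algebra of complex valued forms at a point. -/
abbrev Ext (n : ℕ) : Type := ExteriorAlgebra ℂ (CCovec n)

lemma covec_expand (α : CCovec n) :
    α = ∑ i, α (EuclideanSpace.single i 1) • dx i := by
  refine (EuclideanSpace.basisFun (Fin n) ℝ).toBasis.ext fun j => ?_
  simp only [OrthonormalBasis.coe_toBasis, EuclideanSpace.basisFun_apply, LinearMap.sum_apply,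
    LinearMap.smul_apply, dx, LinearMap.coe_mk, AddHom.coe_mk]
  simp [apply_ite Complex.ofReal]

/-- The basis of the `dx i`. -/
noncomputable def dxBasis : Module.Basis (Fin n) ℂ (CCovec n) :=
  .ofEquivFun
  { toFun := fun α i => α (EuclideanSpace.single i 1)
    invFun := fun c => ∑ i, c i • dx i
    left_inv := fun α => (covec_expand α).symm
    right_inv := fun c => by
      ext j
      simp [dx, apply_ite Complex.ofReal]
    map_add' := fun _ _ => rfl
    map_smul' := fun _ _ => rfl }

lemma dxBasis_apply (i : Fin n) : dxBasis i = dx i := by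
  simp [dxBasis, Pi.single_apply]

instance : Module.Finite ℂ (Ext n) := .of_basis (dxBasis (n := n)).ExteriorAlgebra

attribute [local instance] Matrix.linftyOpNormedRing Matrix.linftyOpNormedAlgebra

/-- Forms at a point as operators (left multiplications), in order to norm them. -/
noncomputable def extMatrix (n : ℕ) :
    Ext n →ₐ[ℂ] Matrix (Finset (Fin n)) (Finset (Fin n)) ℂ :=
  Algebra.leftMulMatrix (dxBasis (n := n)).ExteriorAlgebra

/-- A norm on the algebra of forms, by left multiplication operators. It only serves to speak of
derivatives of form valued functions; by finite dimensionality the choice is immaterial. -/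
noncomputable instance : NormedRing (Ext n) :=
  NormedRing.induced (Ext n) (Matrix (Finset (Fin n)) (Finset (Fin n)) ℂ) (extMatrix n)
    (Algebra.leftMulMatrix_injective _)

noncomputable instance : NormedAlgebra ℂ (Ext n) :=
  NormedAlgebra.induced ℂ (Ext n) (Matrix (Finset (Fin n)) (Finset (Fin n)) ℂ) (extMatrix n)

instance : FiniteDimensional ℝ (Ext n) := FiniteDimensional.complexToReal (Ext n)

/-- The value of the degree `p` component of a form on tangent vectors, on the whole exterior
algebra; `evalForm` is its restriction to forms of even degree. -/
noncomputable def evalExt (p : ℕ) (v : Fin p → Euc n) : Ext n →ₗ[ℂ] ℂ :=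
  ExteriorAlgebra.liftAlternating (R := ℂ) (M := CCovec n) (N := ℂ)
    (Pi.single p ((Matrix.detRowAlternating (n := Fin p) (R := ℂ)).compLinearMap
      (LinearMap.pi fun j => (LinearMap.applyₗ' ℂ (v j) : CCovec n →ₗ[ℂ] ℂ))))

lemma evalForm_eq (p : ℕ) (v : Fin p → Euc n) (a : EvenForms n) :
    evalForm p v a = evalExt p v a.val := rfl

lemma evalExt_ιMulti_same {p : ℕ} (v : Fin p → Euc n) (α : Fin p → CCovec n) :
    evalExt p v (ExteriorAlgebra.ιMulti ℂ p α) = Matrix.det (Matrix.of fun i j => α i (v j)) := by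
  rw [evalExt, ExteriorAlgebra.liftAlternating_apply_ιMulti, Pi.single_eq_same]
  rfl

lemma evalExt_ιMulti_ne {p m : ℕ} (h : m ≠ p) (v : Fin p → Euc n) (α : Fin m → CCovec n) :
    evalExt p v (ExteriorAlgebra.ιMulti ℂ m α) = 0 := by
  rw [evalExt, ExteriorAlgebra.liftAlternating_apply_ιMulti, Pi.single_eq_of_ne h]
  rfl

/-- Induction over sums of products of covectors. -/
lemma ext_induction {P : Ext n → Prop} (h1 : ∀ m (α : Fin m → CCovec n),
      P (ExteriorAlgebra.ιMulti ℂ m α)) (h2 : ∀ a b, P a → P b → P (a + b))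
    (h3 : ∀ (c : ℂ) a, P a → P (c • a)) (a : Ext n) : P a := by
  have ha : a ∈ Submodule.span ℂ (Set.range fun x : Σ m, (Fin m → CCovec n) =>
      ExteriorAlgebra.ιMulti ℂ x.1 x.2) := by
    rw [ExteriorAlgebra.ιMulti_span]; trivial
  induction ha using Submodule.span_induction with
  | mem x hx => obtain ⟨⟨m, α⟩, rfl⟩ := hx; exact h1 m α
  | zero => simpa using h3 0 _ (h1 0 ![])
  | add x y _ _ hx hy => exact h2 x y hx hy
  | smul c x _ hx => exact h3 c x hx

/-- The degree `p` component of a form, as an alternating map. -/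
noncomputable def altForm (p : ℕ) : Ext n →ₗ[ℂ] (Euc n [⋀^Fin p]→L[ℝ] ℂ) where
  toFun a :=
    { toFun := fun v => evalExt p v a
      map_update_add' := fun {hd} v i x y => by
        obtain rfl := Subsingleton.elim hd (instDecidableEqFin p)
        induction a using ext_induction with
        | h1 m α =>
          by_cases h : m = p
          · subst h
            simp only [evalExt_ιMulti_same]
            simp only [← Matrix.det_transpose (Matrix.of _)]
            have e : ∀ z, (Matrix.of fun i_1 j => α i_1 (Function.update v i z j)).transpose =
                Matrix.updateRow (Matrix.of fun i_1 j => α i_1 (v j)).transpose i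
                  (fun k => α k z) := by
              intro z
              ext j k
              by_cases hj : j = i
              · subst hj; simp
              · simp [hj]
            rw [e, e, e, ← Matrix.det_updateRow_add]
            congr 2
            ext k
            simp
          · simp [evalExt_ιMulti_ne h]
        | h2 a b ha hb => rw [map_add, map_add, map_add, ha, hb]; ring
        | h3 c a ha => rw [map_smul, map_smul, map_smul, ha, smul_add]
      map_update_smul' := fun {hd} v i c x => by
        obtain rfl := Subsingleton.elim hd (instDecidableEqFin p)
        induction a using ext_induction with
        | h1 m α =>
          by_cases h : m = p
          · subst h
            simp only [evalExt_ιMulti_same]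
            simp only [← Matrix.det_transpose (Matrix.of _)]
            have e : ∀ z, (Matrix.of fun i_1 j => α i_1 (Function.update v i z j)).transpose =
                Matrix.updateRow (Matrix.of fun i_1 j => α i_1 (v j)).transpose i
                  (fun k => α k z) := by
              intro z
              ext j k
              by_cases hj : j = i
              · subst hj; simp
              · simp [hj]
            rw [e, e, Complex.real_smul, ← Matrix.det_updateRow_smul]
            congr 2
            ext k
            simp
          · simp [evalExt_ιMulti_ne h]
        | h2 a b ha hb => rw [map_add, map_add, ha, hb, smul_add]
        | h3 b a ha => rw [map_smul, map_smul, ha, smul_comm]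
      map_eq_zero_of_eq' := fun v i j hv hij => by
        change evalExt p v a = 0
        induction a using ext_induction with
        | h1 m α =>
          by_cases h : m = p
          · subst h
            rw [evalExt_ιMulti_same]
            exact Matrix.det_zero_of_column_eq hij fun k => by simp [hv]
          · exact evalExt_ιMulti_ne h _ _
        | h2 a b ha hb => rw [map_add, ha, hb, add_zero]
        | h3 b a ha => rw [map_smul, ha, smul_zero]
      cont := by
        change Continuous fun v => evalExt p v a
        induction a using ext_induction with
        | h1 m α =>
          by_cases h : m = p
          · subst h
            simp only [evalExt_ιMulti_same]
            refine Continuous.matrix_det ?_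
            refine continuous_matrix fun i j => ?_
            exact (LinearMap.continuous_of_finiteDimensional (α i)).comp (continuous_apply j)
          · simp only [evalExt_ιMulti_ne h]
            exact continuous_const
        | h2 a b ha hb => simp only [map_add]; exact ha.add hb
        | h3 b a ha => simp only [map_smul]; exact ha.const_smul b }
  map_add' a b := by ext v; exact map_add (evalExt p v) a b
  map_smul' c a := by ext v; exact map_smul (evalExt p v) c a

lemma altForm_apply (p : ℕ) (a : Ext n) (v : Fin p → Euc n) : altForm p a v = evalExt p v a := rfl

/-- Expansion along the first factor. -/
lemma evalExt_ι_mul {p : ℕ} (v : Fin (p + 1) → Euc n) (α : CCovec n) (a : Ext n) :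
    evalExt (p + 1) v (ExteriorAlgebra.ι ℂ α * a) =
      ∑ i : Fin (p + 1), (-1) ^ (i : ℕ) * α (v i) * evalExt p (i.removeNth v) a := by
  induction a using ext_induction with
  | h1 m β =>
    have e : ExteriorAlgebra.ι ℂ α * ExteriorAlgebra.ιMulti ℂ m β =
        ExteriorAlgebra.ιMulti ℂ (m + 1) (Fin.cons α β) := by
      rw [ExteriorAlgebra.ιMulti_succ_apply]
      rfl
    rw [e]
    by_cases h : m = p
    · subst h
      simp only [evalExt_ιMulti_same]
      rw [Matrix.det_succ_row_zero]
      rfl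
    · rw [evalExt_ιMulti_ne (by omega)]
      simp [evalExt_ιMulti_ne h]
  | h2 a b ha hb => rw [mul_add, map_add, ha, hb, ← Finset.sum_add_distrib]; simp [mul_add]
  | h3 c a ha =>
    rw [mul_smul_comm, map_smul, ha, smul_eq_mul, Finset.mul_sum]
    refine Finset.sum_congr rfl fun i _ => ?_
    rw [map_smul, smul_eq_mul]
    ring

/-- Pull-back of covectors. -/
noncomputable def pullCov (L : Euc n →ₗ[ℝ] Euc n) : CCovec n →ₗ[ℂ] CCovec n where
  toFun α := α ∘ₗ L
  map_add' _ _ := rfl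
  map_smul' _ _ := rfl

/-- Pull-back of forms. -/
noncomputable def pull (L : Euc n →ₗ[ℝ] Euc n) : Ext n →ₐ[ℂ] Ext n :=
  ExteriorAlgebra.map (pullCov L)

lemma evalExt_pull (L : Euc n →ₗ[ℝ] Euc n) {p : ℕ} (v : Fin p → Euc n) (a : Ext n) :
    evalExt p v (pull L a) = evalExt p (fun i => L (v i)) a := by
  induction a using ext_induction with
  | h1 m β =>
    rw [pull, ExteriorAlgebra.map_apply_ιMulti]
    by_cases h : m = p
    · subst h
      simp only [evalExt_ιMulti_same]
      rfl
    · simp [evalExt_ιMulti_ne h]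
  | h2 a b ha hb => rw [map_add, map_add, map_add, ha, hb]
  | h3 c a ha => rw [map_smul, map_smul, map_smul, ha]

lemma evalExt_dx {p : ℕ} (f g : Fin p → Fin n) :
    evalExt p (fun j => EuclideanSpace.single (f j) 1)
      (ExteriorAlgebra.ιMulti ℂ p fun i => dx (g i)) =
    ∑ σ : Equiv.Perm (Fin p), ((Equiv.Perm.sign σ : ℤ) : ℂ) * if g ∘ σ = f then 1 else 0 := by
  rw [evalExt_ιMulti_same, Matrix.det_apply']
  refine Finset.sum_congr rfl fun σ _ => ?_
  congr 1
  simp only [Matrix.of_apply, dx, LinearMap.coe_mk, AddHom.coe_mk]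
  have : ∀ i, (((EuclideanSpace.single (f i) (1 : ℝ)) (g (σ i)) : ℝ) : ℂ) =
      if g (σ i) = f i then 1 else 0 := by
    intro i
    rw [PiLp.single_apply]
    split_ifs <;> simp_all
  simp only [this]
  rw [Finset.prod_ite_zero]
  simp [funext_iff]

/-- The form of degree `p` with the values `β` on basis vectors, `β` being thought of as
alternating. The factor `1/p!` allows to sum over all tuples of indices instead of the increasing
ones. -/
noncomputable def formOf {p : ℕ} (β : (Fin p → Euc n) → ℂ) : Ext n :=
  ((p.factorial : ℂ)⁻¹) • ∑ f : Fin p → Fin n,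
    β (fun j => EuclideanSpace.single (f j) 1) • ExteriorAlgebra.ιMulti ℂ p fun i => dx (f i)

lemma formOf_add {p : ℕ} (β β' : (Fin p → Euc n) → ℂ) :
    formOf (fun v => β v + β' v) = formOf β + formOf β' := by
  simp only [formOf, add_smul, Finset.sum_add_distrib, smul_add]

lemma formOf_smul {p : ℕ} (c : ℂ) (β : (Fin p → Euc n) → ℂ) :
    formOf (fun v => c • β v) = c • formOf β := by
  simp only [formOf, smul_eq_mul, mul_smul, ← Finset.smul_sum]
  rw [smul_comm]

/-- An alternating map is recovered from the form that it defines. -/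
lemma evalExt_formOf {p : ℕ} (β : Euc n [⋀^Fin p]→L[ℝ] ℂ) (v : Fin p → Euc n) :
    evalExt p v (formOf β) = β v := by
  have key : (altForm p (formOf β)).toAlternatingMap = β.toAlternatingMap := by
    refine Module.Basis.ext_alternating (EuclideanSpace.basisFun (Fin n) ℝ).toBasis fun g _ => ?_
    simp only [OrthonormalBasis.coe_toBasis, EuclideanSpace.basisFun_apply]
    change evalExt p (fun i => EuclideanSpace.single (g i) 1) (formOf β) =
      β (fun i => EuclideanSpace.single (g i) 1)
    rw [formOf, map_smul, map_sum]
    simp only [map_smul, evalExt_dx, smul_eq_mul, Finset.mul_sum]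
    rw [Finset.sum_comm]
    have : ∀ σ : Equiv.Perm (Fin p), ∑ f : Fin p → Fin n,
        (p.factorial : ℂ)⁻¹ * (β (fun j => EuclideanSpace.single (f j) 1) *
          (((Equiv.Perm.sign σ : ℤ) : ℂ) * if f ∘ σ = g then 1 else 0)) =
        (p.factorial : ℂ)⁻¹ * β (fun i => EuclideanSpace.single (g i) 1) := by
      intro σ
      rw [Finset.sum_eq_single (g ∘ σ.symm)]
      · have e1 : (g ∘ σ.symm) ∘ σ = g := by ext i; simp
        have e2 : β (fun j => EuclideanSpace.single ((g ∘ σ.symm) j) 1) =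
            ((Equiv.Perm.sign σ : ℤ) : ℂ) * β (fun i => EuclideanSpace.single (g i) 1) := by
          have := β.toAlternatingMap.map_perm (fun i => EuclideanSpace.single (g i) 1) σ.symm
          refine this.trans ?_
          rw [Equiv.Perm.sign_symm, Units.smul_def, zsmul_eq_mul]
          rfl
        rw [e2, if_pos e1]
        have : ((Equiv.Perm.sign σ : ℤ) : ℂ) * ((Equiv.Perm.sign σ : ℤ) : ℂ) = 1 := by
          norm_cast
          simp
        linear_combination ((p.factorial : ℂ)⁻¹ * β (fun i => EuclideanSpace.single (g i) 1)) * this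
      · intro f _ hf
        rw [if_neg]
        · simp
        · rintro rfl
          apply hf
          ext i; simp
      · simp
    rw [Finset.sum_congr rfl fun σ _ => this σ]
    rw [Finset.sum_const, Finset.card_univ, Fintype.card_perm, Fintype.card_fin, nsmul_eq_mul,
      mul_inv_cancel_left₀ (by exact_mod_cast p.factorial_ne_zero)]
  exact congr($key v)

/-- A homogeneous form is recovered from its values. -/
lemma formOf_evalExt {p : ℕ} {a : Ext n} (ha : a ∈ ⋀[ℂ]^p (CCovec n)) :
    formOf (fun v => evalExt p v a) = a := by
  have hspan : a ∈ Submodule.span ℂ (Set.range fun g : Fin p → Fin n =>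
      ExteriorAlgebra.ιMulti ℂ p fun i => dx (g i)) := by
    have hs := exteriorPower.ιMulti_span_fixedDegree_of_span_eq_top (R := ℂ) (n := p)
      (M := CCovec n) (Module.Basis.span_eq (dxBasis (n := n)))
    rw [← hs] at ha
    refine Submodule.span_mono ?_ ha
    rintro _ ⟨α, hα, rfl⟩
    choose g hg using fun i => hα (Set.mem_range_self i)
    refine ⟨g, ?_⟩
    change ExteriorAlgebra.ιMulti ℂ p _ = _
    congr 1
    ext1 i
    rw [← hg, dxBasis_apply]
  clear ha
  induction hspan using Submodule.span_induction with
  | mem x hx =>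
    obtain ⟨g, rfl⟩ := hx
    rw [formOf]
    simp only [evalExt_dx, Finset.sum_smul]
    rw [Finset.sum_comm]
    have : ∀ σ : Equiv.Perm (Fin p), ∑ f : Fin p → Fin n,
        ((((Equiv.Perm.sign σ : ℤ) : ℂ) * if g ∘ σ = f then 1 else 0) •
          ExteriorAlgebra.ιMulti ℂ p fun i => dx (n := n) (f i)) =
        ExteriorAlgebra.ιMulti ℂ p fun i => dx (g i) := by
      intro σ
      rw [Finset.sum_eq_single (g ∘ σ)]
      · have := (ExteriorAlgebra.ιMulti ℂ p).map_perm (fun i => dx (n := n) (g i)) σ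
        rw [show (fun i => dx (n := n) ((g ∘ σ) i)) = (fun i => dx (g i)) ∘ σ from rfl, this,
          Units.smul_def, ← Int.cast_smul_eq_zsmul ℂ, smul_smul, if_pos rfl, mul_one]
        have : ((Equiv.Perm.sign σ : ℤ) : ℂ) * ((Equiv.Perm.sign σ : ℤ) : ℂ) = 1 := by
          norm_cast
          simp
        rw [this, one_smul]
      · intro f _ hf
        rw [if_neg (Ne.symm hf)]
        simp
      · simp
    rw [Finset.sum_congr rfl fun σ _ => this σ]
    rw [Finset.sum_const, Finset.card_univ, Fintype.card_perm, Fintype.card_fin,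
      ← Nat.cast_smul_eq_nsmul ℂ, smul_smul,
      inv_mul_cancel₀ (by exact_mod_cast p.factorial_ne_zero), one_smul]
  | zero => simp [formOf]
  | add x y _ _ hx hy =>
    simp only [map_add]
    exact (formOf_add _ _).trans (congrArg₂ _ hx hy)
  | smul c x _ hx =>
    simp only [map_smul]
    exact (formOf_smul c _).trans (congrArg _ hx)

end ExtAlg

/-! ### The exterior derivative and the Bianchi identity -/

section DExt

variable {n : ℕ}

/-- The coordinate one-form `dx^k` in the exterior algebra. -/
noncomputable def dxE (k : Fin n) : Ext n := ExteriorAlgebra.ι ℂ (dx k)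

lemma dxE_mul_dxE (i j : Fin n) : dxE i * dxE j = -(dxE j * dxE i) := ext_ι_swap _ _

lemma dxE_mul_self (i : Fin n) : dxE i * dxE i = 0 := ExteriorAlgebra.ι_sq_zero _

/-- The exterior derivative `∑ dx^k ∧ ∂_k f` of a form valued function. -/
noncomputable def dExt (f : Euc n → Ext n) (p : Euc n) : Ext n :=
  ∑ k, dxE k * fderiv ℝ f p (EuclideanSpace.single k 1)

lemma dExt_congr {f g : Euc n → Ext n} {p : Euc n} (h : f =ᶠ[𝓝 p] g) : dExt f p = dExt g p := by
  simp only [dExt, h.fderiv_eq]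

lemma dExt_const (c : Ext n) (p : Euc n) : dExt (fun _ => c) p = 0 := by
  simp [dExt]

lemma dExt_add {f g : Euc n → Ext n} {p : Euc n} (hf : DifferentiableAt ℝ f p)
    (hg : DifferentiableAt ℝ g p) : dExt (fun q => f q + g q) p = dExt f p + dExt g p := by
  simp only [dExt, fderiv_fun_add hf hg, add_apply, mul_add, Finset.sum_add_distrib]

lemma dExt_sum {ι : Type*} {s : Finset ι} {f : ι → Euc n → Ext n} {p : Euc n}
    (hf : ∀ i ∈ s, DifferentiableAt ℝ (f i) p) :
    dExt (fun q => ∑ i ∈ s, f i q) p = ∑ i ∈ s, dExt (f i) p := by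
  simp only [dExt, fderiv_fun_sum hf, sum_apply, Finset.mul_sum]
  exact Finset.sum_comm

lemma dExt_const_smul (c : ℂ) {f : Euc n → Ext n} {p : Euc n} (hf : DifferentiableAt ℝ f p) :
    dExt (fun q => c • f q) p = c • dExt f p := by
  simp only [dExt, fderiv_fun_const_smul hf c, Finset.smul_sum]
  refine Finset.sum_congr rfl fun k _ => ?_
  rw [← mul_smul_comm]
  rfl

lemma dExt_mul {f g : Euc n → Ext n} {p : Euc n} (hf : DifferentiableAt ℝ f p)
    (hg : DifferentiableAt ℝ g p) : dExt (fun q => f q * g q) p =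
      dExt f p * g p + ∑ k, dxE k * f p * fderiv ℝ g p (EuclideanSpace.single k 1) := by
  have h := (hf.hasFDerivAt.mul' hg.hasFDerivAt).fderiv
  simp only [dExt]
  rw [show (fun q => f q * g q) = f * g from rfl, h, Finset.sum_mul, ← Finset.sum_add_distrib]
  refine Finset.sum_congr rfl fun k _ => ?_
  simp only [add_apply, smul_apply, smul_eq_mul, MulOpposite.smul_eq_mul_unop,
    MulOpposite.unop_op]
  rw [mul_add, add_comm, mul_assoc, mul_assoc]

/-- The Leibniz rule for a product whose first factor is of even degree. -/
lemma dExt_mul_of_comm {f g : Euc n → Ext n} {p : Euc n} (hf : DifferentiableAt ℝ f p)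
    (hg : DifferentiableAt ℝ g p) (h : ∀ k, dxE k * f p = f p * dxE k) :
    dExt (fun q => f q * g q) p = dExt f p * g p + f p * dExt g p := by
  rw [dExt_mul hf hg, dExt, dExt, Finset.mul_sum]
  simp only [h, mul_assoc]

/-- The Leibniz rule for a product whose first factor is of odd degree. -/
lemma dExt_mul_of_anticomm {f g : Euc n → Ext n} {p : Euc n} (hf : DifferentiableAt ℝ f p)
    (hg : DifferentiableAt ℝ g p) (h : ∀ k, dxE k * f p = -(f p * dxE k)) :
    dExt (fun q => f q * g q) p = dExt f p * g p - f p * dExt g p := by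
  rw [dExt_mul hf hg, dExt, dExt, Finset.mul_sum]
  simp only [h, mul_assoc, neg_mul, Finset.sum_neg_distrib, sub_eq_add_neg]

/-- The contraction of the antisymmetric `dx^i ∧ dx^j` with a symmetric family vanishes. -/
lemma sum_antisymm {A : Fin n → Fin n → Ext n} (h : ∀ i j, A i j = A j i) :
    ∑ i, ∑ j, dxE i * (dxE j * A i j) = 0 := by
  have : ∑ i, ∑ j, dxE i * (dxE j * A i j) = -∑ i, ∑ j, dxE i * (dxE j * A i j) := by
    conv_rhs => rw [Finset.sum_comm]
    rw [← Finset.sum_neg_distrib]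
    refine Finset.sum_congr rfl fun i _ => ?_
    rw [← Finset.sum_neg_distrib]
    refine Finset.sum_congr rfl fun j _ => ?_
    rw [← mul_assoc, ← mul_assoc, dxE_mul_dxE i j, h i j, neg_mul]
  have h2 : (2 : ℂ) • ∑ i, ∑ j, dxE i * (dxE j * A i j) = 0 := by
    rw [two_smul]
    nth_rewrite 1 [this]
    exact neg_add_cancel _
  exact (smul_eq_zero.1 h2).resolve_left (by norm_num)

lemma fderiv_dExt {f : Euc n → Ext n} {p : Euc n} (hf : ContDiffAt ℝ 2 f p) (v : Euc n) :
    fderiv ℝ (dExt f) p v = ∑ j, dxE j *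
      fderiv ℝ (fderiv ℝ f) p v (EuclideanSpace.single j 1) := by
  have h1 : DifferentiableAt ℝ (fderiv ℝ f) p :=
    (hf.fderiv_right (m := 1) (by norm_num)).differentiableAt (by norm_num)
  have h2 : HasFDerivAt (fun q => ∑ j, dxE j * fderiv ℝ f q (EuclideanSpace.single j 1))
      (∑ j : Fin n, (dxE j) • ((fderiv ℝ (fderiv ℝ f) p).flip (EuclideanSpace.single j 1))) p := by
    refine HasFDerivAt.fun_sum fun j _ => ?_
    refine HasFDerivAt.const_mul ?_ (dxE j)
    simpa using h1.hasFDerivAt.clm_apply (hasFDerivAt_const (EuclideanSpace.single j (1 : ℝ)) p)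
  have h3 : fderiv ℝ (dExt f) p = _ := h2.fderiv
  rw [h3]
  simp [sum_apply]

/-- `d² = 0`, by the symmetry of second derivatives. -/
lemma dExt_dExt {f : Euc n → Ext n} {p : Euc n} (hf : ContDiffAt ℝ 2 f p) :
    dExt (dExt f) p = 0 := by
  rw [dExt]
  simp only [fderiv_dExt hf, Finset.mul_sum]
  exact sum_antisymm fun i j => (hf.isSymmSndFDerivAt (by simp)) _ _

lemma dExt_differentiableAt {f : Euc n → Ext n} {p : Euc n} (hf : ContDiffAt ℝ ∞ f p) :
    ContDiffAt ℝ ∞ (dExt f) p := by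
  unfold dExt
  refine ContDiffAt.sum fun k _ => contDiffAt_const.mul ?_
  exact (hf.fderiv_right (m := ∞) (by norm_cast)).clm_apply contDiffAt_const

/-- `altForm` as a continuous real linear map. -/
noncomputable def altFormL (m : ℕ) : Ext n →L[ℝ] (Euc n [⋀^Fin m]→L[ℝ] ℂ) :=
  LinearMap.toContinuousLinearMap ((altForm m).restrictScalars ℝ)

/-- `evalExt` as a continuous real linear map. -/
noncomputable def evalExtL (m : ℕ) (v : Fin m → Euc n) : Ext n →L[ℝ] ℂ :=
  LinearMap.toContinuousLinearMap ((evalExt m v).restrictScalars ℝ)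

/-- `dExt` is Mathlib's exterior derivative on the components of each degree. -/
lemma extDeriv_altForm {m : ℕ} {f : Euc n → Ext n} {p : Euc n} (hf : DifferentiableAt ℝ f p)
    (v : Fin (m + 1) → Euc n) :
    extDeriv (fun q => altForm m (f q)) p v = evalExt (m + 1) v (dExt f p) := by
  have h1 : DifferentiableAt ℝ (fun q => altForm m (f q)) p :=
    ((altFormL m).hasFDerivAt.comp p hf.hasFDerivAt).differentiableAt
  rw [extDeriv_apply h1, dExt, map_sum]
  simp only [dxE, evalExt_ι_mul]
  rw [Finset.sum_comm]
  refine Finset.sum_congr rfl fun i _ => ?_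
  have h2 : HasFDerivAt (fun q => altForm m (f q) (i.removeNth v))
      ((evalExtL m (i.removeNth v)).comp (fderiv ℝ f p)) p :=
    (evalExtL m (i.removeNth v)).hasFDerivAt.comp p hf.hasFDerivAt
  rw [h2.fderiv]
  have h3 : v i = ∑ k, (v i k) • EuclideanSpace.single k (1 : ℝ) := by
    have := (EuclideanSpace.basisFun (Fin n) ℝ).sum_repr (v i)
    simpa using this.symm
  have h4 : ((evalExtL m (i.removeNth v)).comp (fderiv ℝ f p)) (v i) =
      ∑ k, (v i k : ℂ) * evalExt m (i.removeNth v)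
        (fderiv ℝ f p (EuclideanSpace.single k 1)) := by
    conv_lhs => rw [h3]
    rw [map_sum]
    refine Finset.sum_congr rfl fun k _ => ?_
    rw [map_smul, Complex.real_smul]
    rfl
  rw [h4, Finset.smul_sum]
  refine Finset.sum_congr rfl fun k _ => ?_
  simp [dx, mul_assoc]

end DExt

section Matrices

variable {n r : ℕ}

/-- The entrywise exterior derivative of a matrix of forms. -/
noncomputable def dMat (M : Euc n → Matrix (Fin r) (Fin r) (Ext n)) (p : Euc n) :
    Matrix (Fin r) (Fin r) (Ext n) :=
  Matrix.of fun a b => dExt (fun q => M q a b) p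

lemma dMat_mul_of_comm {M N : Euc n → Matrix (Fin r) (Fin r) (Ext n)} {p : Euc n}
    (hM : ∀ a b, DifferentiableAt ℝ (fun q => M q a b) p)
    (hN : ∀ a b, DifferentiableAt ℝ (fun q => N q a b) p)
    (h : ∀ k a b, dxE k * M p a b = M p a b * dxE k) :
    dMat (fun q => M q * N q) p = dMat M p * N p + M p * dMat N p := by
  ext a b
  simp only [dMat, Matrix.of_apply, Matrix.mul_apply, Matrix.add_apply]
  rw [dExt_sum (f := fun c q => M q a c * N q c b) fun c _ => (hM a c).mul (hN c b),
    ← Finset.sum_add_distrib]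
  exact Finset.sum_congr rfl fun c _ => dExt_mul_of_comm (hM a c) (hN c b) fun k => h k a c

lemma dMat_mul_of_anticomm {M N : Euc n → Matrix (Fin r) (Fin r) (Ext n)} {p : Euc n}
    (hM : ∀ a b, DifferentiableAt ℝ (fun q => M q a b) p)
    (hN : ∀ a b, DifferentiableAt ℝ (fun q => N q a b) p)
    (h : ∀ k a b, dxE k * M p a b = -(M p a b * dxE k)) :
    dMat (fun q => M q * N q) p = dMat M p * N p - M p * dMat N p := by
  ext a b
  simp only [dMat, Matrix.of_apply, Matrix.mul_apply, Matrix.sub_apply]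
  rw [dExt_sum (f := fun c q => M q a c * N q c b) fun c _ => (hM a c).mul (hN c b),
    ← Finset.sum_sub_distrib]
  exact Finset.sum_congr rfl fun c _ => dExt_mul_of_anticomm (hM a c) (hN c b) fun k => h k a c

/-- The curvature `dA + A ∧ A` of a matrix of one-forms. -/
noncomputable def curvForm (A : Euc n → Matrix (Fin r) (Fin r) (Ext n)) (p : Euc n) :
    Matrix (Fin r) (Fin r) (Ext n) := dMat A p + A p * A p

lemma contDiffAt_curvForm {A : Euc n → Matrix (Fin r) (Fin r) (Ext n)} {p : Euc n}
    (hA : ∀ a b, ContDiffAt ℝ ∞ (fun q => A q a b) p) (a b : Fin r) :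
    ContDiffAt ℝ ∞ (fun q => curvForm A q a b) p := by
  simp only [curvForm, dMat, Matrix.add_apply, Matrix.of_apply, Matrix.mul_apply]
  exact (dExt_differentiableAt (hA a b)).add
    (ContDiffAt.sum fun c _ => (hA a c).mul (hA c b))

lemma contDiffAt_pow {M : Euc n → Matrix (Fin r) (Fin r) (Ext n)} {p : Euc n}
    (hM : ∀ a b, ContDiffAt ℝ ∞ (fun q => M q a b) p) (m : ℕ) (a b : Fin r) :
    ContDiffAt ℝ ∞ (fun q => (M q ^ m) a b) p := by
  induction m generalizing a b with
  | zero => simp only [pow_zero]; exact contDiffAt_const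
  | succ m ih =>
    simp only [pow_succ, Matrix.mul_apply]
    exact ContDiffAt.sum fun c _ => (ih a c).mul (hM c b)

/-- The Bianchi identity `dΩ = Ω A - A Ω`. -/
lemma dMat_curvForm {A : Euc n → Matrix (Fin r) (Fin r) (Ext n)} {p : Euc n}
    (hA : ∀ a b, ContDiffAt ℝ ∞ (fun q => A q a b) p)
    (h : ∀ k a b, dxE k * A p a b = -(A p a b * dxE k)) :
    dMat (curvForm A) p = curvForm A p * A p - A p * curvForm A p := by
  have hd : ∀ a b, DifferentiableAt ℝ (fun q => A q a b) p := fun a b =>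
    (hA a b).differentiableAt (by simp)
  have h1 : dMat (curvForm A) p = dMat (fun q => A q * A q) p := by
    ext a b
    simp only [dMat, curvForm, Matrix.of_apply, Matrix.add_apply, Matrix.mul_apply]
    rw [dExt_add ((dExt_differentiableAt (hA a b)).differentiableAt (by simp))
      ((ContDiffAt.sum fun c _ => (hA a c).mul (hA c b)).differentiableAt (by simp)),
      add_eq_right]
    exact dExt_dExt ((hA a b).of_le (by norm_cast))
  rw [h1, dMat_mul_of_anticomm hd hd h, curvForm]
  noncomm_ring

/-- Traces of powers of the curvature are closed. -/
lemma dExt_trace_curvForm_pow {A : Euc n → Matrix (Fin r) (Fin r) (Ext n)} {p : Euc n}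
    (hA : ∀ a b, ContDiffAt ℝ ∞ (fun q => A q a b) p)
    (h : ∀ k a b, dxE k * A p a b = -(A p a b * dxE k))
    (hc : ∀ a b y, curvForm A p a b * y = y * curvForm A p a b) (m : ℕ) :
    dExt (fun q => (curvForm A q ^ m).trace) p = 0 := by
  have hcm : ∀ m a b y, (curvForm A p ^ m) a b * y = y * (curvForm A p ^ m) a b := by
    intro m
    induction m with
    | zero =>
      intro a b y
      rw [pow_zero, Matrix.one_apply]
      split_ifs <;> simp
    | succ m ih =>
      intro a b y
      rw [pow_succ, Matrix.mul_apply, Finset.sum_mul, Finset.mul_sum]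
      refine Finset.sum_congr rfl fun c _ => ?_
      rw [mul_assoc, hc, ← mul_assoc, ih, mul_assoc]
  have hd : ∀ m a b, DifferentiableAt ℝ (fun q => (curvForm A q ^ m) a b) p := fun m a b =>
    (contDiffAt_pow (contDiffAt_curvForm hA) m a b).differentiableAt (by simp)
  -- `d(Ω^m) = Ω^m A - A Ω^m`, from the Bianchi identity; the trace of the right-hand side
  -- vanishes, since `Ω` is of even degree
  have key : ∀ m, dMat (fun q => curvForm A q ^ m) p =
      curvForm A p ^ m * A p - A p * curvForm A p ^ m := by
    intro m
    induction m with
    | zero =>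
      simp only [pow_zero, one_mul, mul_one, sub_self]
      ext a b
      simp only [dMat, Matrix.of_apply, dExt_const, Matrix.zero_apply]
    | succ m ih =>
      simp only [pow_succ]
      rw [dMat_mul_of_comm (hd m) (fun a b => by simpa using hd 1 a b)
        (fun k a b => (hcm m a b _).symm), ih, dMat_curvForm hA h]
      noncomm_ring
  have e : dExt (fun q => (curvForm A q ^ m).trace) p =
      (dMat (fun q => curvForm A q ^ m) p).trace := by
    simp only [Matrix.trace, Matrix.diag, dMat, Matrix.of_apply]
    exact dExt_sum fun a _ => hd m a a
  rw [e, key, Matrix.trace_sub, sub_eq_zero]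
  simp only [Matrix.trace, Matrix.diag, Matrix.mul_apply]
  rw [Finset.sum_comm]
  exact Finset.sum_congr rfl fun a _ => Finset.sum_congr rfl fun b _ => hcm m _ _ _

end Matrices

/-! ### Smooth closed forms and exactness -/

section TwoForm

variable {n : ℕ}

lemma val_wedge₂ (α β : CCovec n) :
    (wedge₂ α β).val = ExteriorAlgebra.ι ℂ α * ExteriorAlgebra.ι ℂ β := rfl

lemma val_twoForm (β : Euc n → Euc n → ℂ) :
    (twoForm β).val = ∑ i : Fin n, ∑ j : Fin n, if i < j then
      β (EuclideanSpace.single i 1) (EuclideanSpace.single j 1) • (dxE i * dxE j) else 0 := by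
  simp only [twoForm, map_sum]
  refine Finset.sum_congr rfl fun i _ => Finset.sum_congr rfl fun j _ => ?_
  split_ifs
  · rw [map_smul, val_wedge₂]; rfl
  · rw [map_zero]

lemma sum_sum_eq_sum_lt {M : Type*} [AddCommMonoid M] (A : Fin n → Fin n → M)
    (h : ∀ i, A i i = 0) :
    ∑ i, ∑ j, A i j = ∑ i, ∑ j, if i < j then A i j + A j i else 0 := by
  have h1 : ∀ i j, A i j = (if i < j then A i j else 0) + if j < i then A i j else 0 := by
    intro i j
    rcases lt_trichotomy i j with h' | h' | h'
    · simp [h', h'.le.not_gt]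
    · subst h'; simp [h]
    · simp [h', h'.le.not_gt]
  have h2 : ∑ i, ∑ j, (if j < i then A i j else 0) = ∑ i, ∑ j, if i < j then A j i else 0 :=
    Finset.sum_comm
  calc ∑ i, ∑ j, A i j = ∑ i, ∑ j, ((if i < j then A i j else 0) + if j < i then A i j else 0) :=
        Finset.sum_congr rfl fun i _ => Finset.sum_congr rfl fun j _ => h1 i j
    _ = _ := by
        simp only [Finset.sum_add_distrib]
        rw [h2]
        simp only [← Finset.sum_add_distrib]
        refine Finset.sum_congr rfl fun i _ => Finset.sum_congr rfl fun j _ => ?_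
        split_ifs <;> simp

lemma mul_mem_deg {p q : ℕ} {a b : Ext n} (ha : a ∈ ⋀[ℂ]^p (CCovec n))
    (hb : b ∈ ⋀[ℂ]^q (CCovec n)) : a * b ∈ ⋀[ℂ]^(p + q) (CCovec n) := by
  rw [ExteriorAlgebra.exteriorPower, pow_add]
  exact Submodule.mul_mem_mul ha hb

lemma ι_mem_deg (α : CCovec n) : ExteriorAlgebra.ι ℂ α ∈ ⋀[ℂ]^1 (CCovec n) := by
  rw [ExteriorAlgebra.exteriorPower, pow_one]
  exact ⟨α, rfl⟩

lemma twoForm_mem_deg (β : Euc n → Euc n → ℂ) : (twoForm β).val ∈ ⋀[ℂ]^2 (CCovec n) := by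
  rw [val_twoForm]
  refine Submodule.sum_mem _ fun i _ => Submodule.sum_mem _ fun j _ => ?_
  split_ifs
  · exact Submodule.smul_mem _ _ (mul_mem_deg (ι_mem_deg _) (ι_mem_deg _))
  · exact Submodule.zero_mem _

lemma pull_mem_deg (L : Euc n →ₗ[ℝ] Euc n) {p : ℕ} {a : Ext n} (ha : a ∈ ⋀[ℂ]^p (CCovec n)) :
    pull L a ∈ ⋀[ℂ]^p (CCovec n) := by
  have h := Submodule.mem_map_of_mem (f := (pull L).toLinearMap) ha
  rw [ExteriorAlgebra.exteriorPower, Submodule.map_pow] at h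
  have hle : Submodule.map (pull L).toLinearMap (LinearMap.range (ExteriorAlgebra.ι ℂ)) ≤
      LinearMap.range (ExteriorAlgebra.ι ℂ (M := CCovec n)) := by
    rintro _ ⟨_, ⟨α, rfl⟩, rfl⟩
    exact ⟨pullCov L α, (ExteriorAlgebra.map_apply_ι _ _).symm⟩
  have hle' := pow_le_pow_left' hle p
  exact hle' h

lemma formOf_mem_deg {p : ℕ} (β : (Fin p → Euc n) → ℂ) : formOf β ∈ ⋀[ℂ]^p (CCovec n) := by
  refine Submodule.smul_mem _ _ (Submodule.sum_mem _ fun f _ => Submodule.smul_mem _ _ ?_)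
  exact ExteriorAlgebra.ιMulti_range ℂ p ⟨_, rfl⟩

/-- The projection to the degree `p` component, in terms of its values on tangent vectors. -/
noncomputable def projL (p : ℕ) : Ext n →L[ℝ] Ext n :=
  LinearMap.toContinuousLinearMap <| LinearMap.restrictScalars ℝ
  { toFun := fun a => formOf fun v => evalExt p v a
    map_add' := fun a b => by
      simp only [map_add]
      exact formOf_add _ _
    map_smul' := fun c a => by
      simp only [map_smul]
      exact formOf_smul c _ : Ext n →ₗ[ℂ] Ext n }

lemma projL_apply (p : ℕ) (a : Ext n) : projL p a = formOf fun v => evalExt p v a := rfl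

lemma evalExt_ι_mul_ι (v : Fin 2 → Euc n) (α β : CCovec n) :
    evalExt 2 v (ExteriorAlgebra.ι ℂ α * ExteriorAlgebra.ι ℂ β) =
      α (v 0) * β (v 1) - α (v 1) * β (v 0) := by
  have : ExteriorAlgebra.ι ℂ α * ExteriorAlgebra.ι ℂ β =
      ExteriorAlgebra.ιMulti ℂ 2 ![α, β] := by
    simp [ExteriorAlgebra.ιMulti_apply]
  rw [this, evalExt_ιMulti_same, Matrix.det_fin_two]
  simp

lemma evalExt_twoForm {β : Euc n → Euc n → ℂ} (B : Euc n →ₗ[ℝ] Euc n →ₗ[ℝ] ℂ)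
    (hB : ∀ u w, B u w = β u w) (hs : ∀ u w, β u w = -β w u) (v : Fin 2 → Euc n) :
    evalExt 2 v (twoForm β).val = β (v 0) (v 1) := by
  have hx : ∀ w : Euc n, w = ∑ k, (w k) • EuclideanSpace.single k (1 : ℝ) := by
    intro w
    have := (EuclideanSpace.basisFun (Fin n) ℝ).sum_repr w
    simpa using this.symm
  have h1 : β (v 0) (v 1) = ∑ i, ∑ j, ((v 0 i : ℂ) * (v 1 j)) *
      β (EuclideanSpace.single i 1) (EuclideanSpace.single j 1) := by
    rw [← hB]
    conv_lhs => rw [hx (v 0), hx (v 1)]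
    simp only [map_sum, map_smul, LinearMap.sum_apply, LinearMap.smul_apply, hB,
      Complex.real_smul]
    simp only [Finset.mul_sum]
    rw [Finset.sum_comm]
    refine Finset.sum_congr rfl fun i _ => Finset.sum_congr rfl fun j _ => ?_
    ring
  rw [h1, sum_sum_eq_sum_lt, val_twoForm, map_sum]
  · refine Finset.sum_congr rfl fun i _ => ?_
    rw [map_sum]
    refine Finset.sum_congr rfl fun j _ => ?_
    split_ifs
    · rw [map_smul, dxE, dxE, evalExt_ι_mul_ι, hs (EuclideanSpace.single j 1)]
      simp only [dx, LinearMap.coe_mk, AddHom.coe_mk, smul_eq_mul]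
      ring
    · rw [map_zero]
  · intro i
    have := hs (EuclideanSpace.single i 1) (EuclideanSpace.single i 1)
    have h0 : β (EuclideanSpace.single i 1) (EuclideanSpace.single i 1) = 0 := by
      linear_combination this / 2
    rw [h0, mul_zero]

/-- Pulling back a two-form given by its values on basis vectors; these are bilinear and
alternating, so that the values on all vectors are known. -/
lemma pull_twoForm {β β' : Euc n → Euc n → ℂ} (B B' : Euc n →ₗ[ℝ] Euc n →ₗ[ℝ] ℂ)
    (hB : ∀ u w, B u w = β u w) (hs : ∀ u w, β u w = -β w u)
    (hB' : ∀ u w, B' u w = β' u w) (hs' : ∀ u w, β' u w = -β' w u)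
    (L : Euc n →ₗ[ℝ] Euc n) (h : ∀ u w, β (L u) (L w) = β' u w) :
    pull L (twoForm β).val = (twoForm β').val := by
  rw [← formOf_evalExt (pull_mem_deg L (twoForm_mem_deg β)),
    ← formOf_evalExt (twoForm_mem_deg β')]
  congr 1
  ext v
  rw [evalExt_pull, evalExt_twoForm B hB hs, evalExt_twoForm B' hB' hs', h]

end TwoForm

section Sections

variable {n : ℕ} {Z : Type*} [TopologicalSpace Z] [T2Space Z] [ChartedSpace (Euc n) Z]
  [IsManifold (𝓡 n) ∞ Z]

/-- `chartD` as an endomorphism of the model space. -/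
noncomputable def chartL (x₀ : Z) (p : Euc n) : Euc n →ₗ[ℝ] Euc n where
  toFun v := chartD x₀ p v
  map_add' v w := map_add (chartD x₀ p) v w
  map_smul' c v := map_smul (chartD x₀ p) c v

/-- The differential of the chart around `x₀`, as an endomorphism of the model space. -/
noncomputable def chartInv (x₀ y : Z) (v : Euc n) : Euc n :=
  mfderiv (𝓡 n) 𝓘(ℝ, Euc n) (extChartAt (𝓡 n) x₀) y v

lemma chartL_chartInv {x₀ : Z} {p : Euc n} (hp : p ∈ (extChartAt (𝓡 n) x₀).target) (v : Euc n) :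
    chartL x₀ p (chartInv x₀ ((extChartAt (𝓡 n) x₀).symm p) v) = v :=
  chartD_comp_mfderiv hp v

lemma chartInv_chartL {x₀ : Z} {p : Euc n} (hp : p ∈ (extChartAt (𝓡 n) x₀).target) (v : Euc n) :
    chartInv x₀ ((extChartAt (𝓡 n) x₀).symm p) (chartL x₀ p v) = v :=
  mfderiv_comp_chartD hp v

lemma inChart_apply {p : ℕ} (η : ∀ x : Z, TangentSpace (𝓡 n) x [⋀^Fin p]→L[ℝ] ℂ) (x₀ : Z)
    (q : Euc n) (v : Fin p → Euc n) :
    inChart η x₀ q v = η ((extChartAt (𝓡 n) x₀).symm q) (fun i => chartL x₀ q (v i)) := rfl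

lemma extD_apply {p : ℕ} (η : ∀ x : Z, TangentSpace (𝓡 n) x [⋀^Fin p]→L[ℝ] ℂ) (x : Z)
    (v : Fin (p + 1) → Euc n) :
    extD η x v = extDeriv (inChart η x) (extChartAt (𝓡 n) x x) (fun i => chartInv x x (v i)) := rfl

/-- The expression of a field of even forms in the chart around `x₀`, as a function on the model
space. -/
noncomputable def locRep (x₀ : Z) (a : Z → EvenForms n) (p : Euc n) : Ext n :=
  pull (chartL x₀ p) (a ((extChartAt (𝓡 n) x₀).symm p)).val

/-- Smooth closed forms of even, possibly mixed, degree: the expression `locRep` in every chart is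
smooth with vanishing exterior derivative. -/
def SmoothClosed (a : Z → EvenForms n) : Prop :=
  ∀ x₀ : Z, ∀ p ∈ (extChartAt (𝓡 n) x₀).target,
    ContDiffAt ℝ ∞ (locRep x₀ a) p ∧ dExt (locRep x₀ a) p = 0

/-- Pulled back forms of even degree commute with all forms. -/
lemma pull_val_comm (L : Euc n →ₗ[ℝ] Euc n) (a : EvenForms n) (y : Ext n) :
    pull L a.val * y = y * pull L a.val := by
  refine even_mul_comm _ ?_ y
  have h : ∀ x ∈ CliffordAlgebra.evenOdd (0 : QuadraticForm ℂ (CCovec n)) 0,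
      pull L x ∈ CliffordAlgebra.evenOdd (0 : QuadraticForm ℂ (CCovec n)) 0 := by
    intro x hx
    induction x, hx using CliffordAlgebra.even_induction with
    | algebraMap r =>
      rw [AlgHom.commutes]
      exact SetLike.algebraMap_mem_graded _ _
    | add a b ha hb iha ihb => rw [map_add]; exact Submodule.add_mem _ iha ihb
    | ι_mul_ι_mul α β a ha iha =>
      have e : pull L (CliffordAlgebra.ι 0 α * CliffordAlgebra.ι 0 β * a) =
          CliffordAlgebra.ι 0 (pullCov L α) * CliffordAlgebra.ι 0 (pullCov L β) * pull L a := by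
        rw [map_mul, map_mul]
        congr 2 <;> exact ExteriorAlgebra.map_apply_ι _ _
      rw [e]
      have := SetLike.mul_mem_graded
        (CliffordAlgebra.ι_mul_ι_mem_evenOdd_zero (0 : QuadraticForm ℂ (CCovec n))
          (pullCov L α) (pullCov L β)) iha
      simpa using this
  exact h _ a.2

lemma SmoothClosed.mul {a b : Z → EvenForms n} (ha : SmoothClosed a) (hb : SmoothClosed b) :
    SmoothClosed (a * b) := by
  intro x₀ p hp
  obtain ⟨ha1, ha2⟩ := ha x₀ p hp
  obtain ⟨hb1, hb2⟩ := hb x₀ p hp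
  have e : locRep x₀ (a * b) = fun q => locRep x₀ a q * locRep x₀ b q := by
    ext1 q
    simp only [locRep, Pi.mul_apply, map_mul]
  rw [e]
  refine ⟨ha1.mul hb1, ?_⟩
  rw [dExt_mul_of_comm (ha1.differentiableAt (by simp)) (hb1.differentiableAt (by simp))
    (fun k => (pull_val_comm _ _ _).symm), ha2, hb2, zero_mul, mul_zero, add_zero]

lemma SmoothClosed.add {a b : Z → EvenForms n} (ha : SmoothClosed a) (hb : SmoothClosed b) :
    SmoothClosed (a + b) := by
  intro x₀ p hp
  obtain ⟨ha1, ha2⟩ := ha x₀ p hp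
  obtain ⟨hb1, hb2⟩ := hb x₀ p hp
  have e : locRep x₀ (a + b) = fun q => locRep x₀ a q + locRep x₀ b q := by
    ext1 q
    simp only [locRep, Pi.add_apply, map_add]
  rw [e]
  refine ⟨ha1.add hb1, ?_⟩
  rw [dExt_add (ha1.differentiableAt (by simp)) (hb1.differentiableAt (by simp)), ha2, hb2,
    add_zero]

lemma SmoothClosed.const_smul {a : Z → EvenForms n} (c : ℂ) (ha : SmoothClosed a) :
    SmoothClosed (c • a) := by
  intro x₀ p hp
  obtain ⟨ha1, ha2⟩ := ha x₀ p hp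
  have e : locRep x₀ (c • a) = fun q => c • locRep x₀ a q := by
    ext1 q
    simp only [locRep, Pi.smul_apply, map_smul]
  rw [e]
  refine ⟨ha1.const_smul c, ?_⟩
  rw [dExt_const_smul c (ha1.differentiableAt (by simp)), ha2, smul_zero]

lemma SmoothClosed.one : SmoothClosed (1 : Z → EvenForms n) := by
  intro x₀ p hp
  have e : locRep x₀ (1 : Z → EvenForms n) = fun q => 1 := by
    ext1 q
    simp only [locRep, Pi.one_apply, map_one]
  rw [e]
  exact ⟨contDiffAt_const, dExt_const _ _⟩

lemma SmoothClosed.zero : SmoothClosed (0 : Z → EvenForms n) := by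
  simpa using SmoothClosed.one.const_smul (Z := Z) (n := n) 0

lemma SmoothClosed.pow {a : Z → EvenForms n} (ha : SmoothClosed a) (m : ℕ) :
    SmoothClosed (a ^ m) := by
  induction m with
  | zero => simpa using SmoothClosed.one
  | succ m ih => rw [pow_succ]; exact ih.mul ha

lemma SmoothClosed.prod {ι : Type*} {s : Finset ι} {a : ι → Z → EvenForms n}
    (ha : ∀ i ∈ s, SmoothClosed (a i)) : SmoothClosed (∏ i ∈ s, a i) :=
  Finset.prod_induction _ _ (fun _ _ h h' => h.mul h') SmoothClosed.one ha

lemma SmoothClosed.sum {ι : Type*} {s : Finset ι} {a : ι → Z → EvenForms n}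
    (ha : ∀ i ∈ s, SmoothClosed (a i)) : SmoothClosed (∑ i ∈ s, a i) :=
  Finset.sum_induction _ _ (fun _ _ h h' => h.add h') SmoothClosed.zero ha

/-- The degree `m` component of a field of forms. -/
noncomputable def formField (m : ℕ) (a : Z → Ext n) (x : Z) :
    TangentSpace (𝓡 n) x [⋀^Fin m]→L[ℝ] ℂ :=
  (altForm m (a x) : Euc n [⋀^Fin m]→L[ℝ] ℂ)

lemma inChart_altForm (a : Z → Ext n) (m : ℕ) (x₀ : Z) (p : Euc n) :
    inChart (n := n) (Z := Z) (formField m a) x₀ p =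
      altForm m (pull (chartL x₀ p) (a ((extChartAt (𝓡 n) x₀).symm p))) := by
  ext v
  exact (inChart_apply (formField m a) x₀ p v).trans (evalExt_pull _ _ _).symm

/-- The degree `m` part of a smooth closed form is a smooth form. -/
lemma SmoothClosed.isSmoothForm {a : Z → EvenForms n} (ha : SmoothClosed a) (m : ℕ) :
    IsSmoothForm (n := n) (Z := Z)
      (formField m fun x => (a x).val) := by
  intro x₀ p hp
  refine ContDiffAt.contDiffWithinAt ?_
  have e : inChart (n := n) (Z := Z)
      (formField m fun x => (a x).val) x₀ =
      fun q => altFormL m (locRep x₀ a q) := by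
    ext1 q
    exact inChart_altForm _ _ _ _
  rw [e]
  exact (altFormL m).contDiff.contDiffAt.comp p (ha x₀ p hp).1

/-- If the four-form `P` is `dβ` and `a` is closed, then `P ∧ a = d(β ∧ a)` is exact. -/
lemma isExact_mul {P a : Z → EvenForms n} (hPd : ∀ x, (P x).val ∈ ⋀[ℂ]^4 (CCovec n))
    (hP : IsExact (n := n) (Z := Z) 4 (fun x v => evalForm 4 v (P x))) (ha : SmoothClosed a)
    (m : ℕ) : IsExact (n := n) (Z := Z) (m + 1) (fun x v => evalForm (m + 1) v (P x * a x)) := by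
  obtain ⟨β, hβ, hPβ⟩ := hP
  -- the three-form `β`, as an element of the exterior algebra
  let b : Z → Ext n := fun x => formOf (p := 3) fun v => (β x v : ℂ)
  have hb : ∀ x v, evalExt 3 v (b x) = β x v := fun x v => evalExt_formOf (β x) v
  have hpull : ∀ (x₀ : Z) (p : Euc n),
      pull (chartL x₀ p) (b ((extChartAt (𝓡 n) x₀).symm p)) =
        formOf (p := 3) fun v => (inChart β x₀ p v : ℂ) := by
    intro x₀ p
    rw [← formOf_evalExt (pull_mem_deg _ (formOf_mem_deg _))]
    congr 1
    ext v
    rw [evalExt_pull, hb, inChart_apply]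
  have hsm : ∀ x₀ : Z, ∀ p ∈ (extChartAt (𝓡 n) x₀).target, ContDiffAt ℝ ∞
      (fun q => pull (chartL x₀ q) (b ((extChartAt (𝓡 n) x₀).symm q))) p := by
    intro x₀ p hp
    simp only [hpull, formOf]
    refine ContDiffAt.const_smul _ (ContDiffAt.sum fun f _ => ?_)
    have h1 := (hβ x₀).contDiffAt ((isOpen_extChartAt_target x₀).mem_nhds hp)
    have h2 := (ContinuousAlternatingMap.apply ℝ (Euc n) ℂ
      (fun j => EuclideanSpace.single (f j) (1 : ℝ))).contDiff.contDiffAt.comp p h1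
    exact h2.smul (contDiffAt_const (c := ExteriorAlgebra.ιMulti ℂ 3 fun i => dx (n := n) (f i)))
  refine ⟨formField m fun x => b x * (a x).val, ?_, ?_⟩
  · intro x₀ p hp
    refine ContDiffAt.contDiffWithinAt ?_
    have e : inChart (n := n) (Z := Z)
        (formField m fun x => b x * (a x).val) x₀ =
        fun q => altFormL m (pull (chartL x₀ q) (b ((extChartAt (𝓡 n) x₀).symm q)) *
          locRep x₀ a q) := by
      ext1 q
      rw [inChart_altForm, map_mul]
      rfl
    rw [e]
    exact (altFormL m).contDiff.contDiffAt.comp p ((hsm x₀ p hp).mul (ha x₀ p hp).1)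
  · intro x v
    have hx : extChartAt (𝓡 n) x x ∈ (extChartAt (𝓡 n) x).target := mem_extChartAt_target x
    set p := extChartAt (𝓡 n) x x with hp
    have hsymm : (extChartAt (𝓡 n) x).symm p = x := extChartAt_to_inv x
    set B : Euc n → Ext n :=
      fun q => pull (chartL x q) (b ((extChartAt (𝓡 n) x).symm q)) with hB
    have hBq : ∀ q, B q = formOf (p := 3) fun v => (inChart β x q v : ℂ) := hpull x
    have hBd : DifferentiableAt ℝ B p := (hsm x p hx).differentiableAt (by simp)
    have had : DifferentiableAt ℝ (locRep x a) p := (ha x p hx).1.differentiableAt (by simp)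
    have hin : inChart (n := n) (Z := Z)
        (formField m fun x => b x * (a x).val) x =
        fun q => altForm m (locRep x a q * B q) := by
      ext1 q
      rw [inChart_altForm, map_mul, locRep, pull_val_comm]
    have hinβ : inChart β x = fun q => altForm 3 (B q) := by
      ext1 q
      ext w
      rw [altForm_apply, hBq, evalExt_formOf]
    -- the derivatives of a field of three-forms are three-forms
    have hB3 : ∀ w, fderiv ℝ B p w ∈ ⋀[ℂ]^3 (CCovec n) := by
      intro w
      have hBT : ∀ q, B q = projL 3 (B q) := by
        intro q
        have : B q ∈ ⋀[ℂ]^3 (CCovec n) := by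
          rw [hBq]
          exact formOf_mem_deg _
        exact (formOf_evalExt this).symm
      have h1 := (projL 3).hasFDerivAt.comp p hBd.hasFDerivAt
      have h2 := h1.congr_of_eventuallyEq (f₁ := B) (Filter.Eventually.of_forall hBT)
      rw [h2.fderiv, ContinuousLinearMap.comp_apply, projL_apply]
      exact formOf_mem_deg _
    clear_value B
    have hdB : dExt B p ∈ ⋀[ℂ]^4 (CCovec n) := by
      refine Submodule.sum_mem _ fun k _ => ?_
      exact mul_mem_deg (p := 1) (q := 3) (ι_mem_deg _) (hB3 _)
    -- `dβ = P` in the chart around `x`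
    have hPB : dExt B p = pull (chartL x p) (P x).val := by
      rw [← formOf_evalExt hdB, ← formOf_evalExt (pull_mem_deg _ (hPd x))]
      congr 1
      ext w
      rw [← extDeriv_altForm hBd, ← hinβ, evalExt_pull, ← evalForm_eq]
      have h1 := hPβ x (fun i => chartL x p (w i))
      rw [extD_apply] at h1
      refine Eq.trans ?_ h1.symm
      congr 1
      ext1 i
      have := chartInv_chartL hx (w i)
      rw [hsymm] at this
      exact this.symm
    refine Eq.trans ?_ (extD_apply (formField m fun x => b x * (a x).val) x v).symm
    rw [hin, ← hp]
    refine Eq.trans ?_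
      (extDeriv_altForm (f := fun q => locRep x a q * B q) (had.mul hBd) _).symm
    rw [dExt_mul_of_comm had hBd (fun k => (pull_val_comm _ _ _).symm), (ha x p hx).2, zero_mul,
      zero_add, hPB, locRep, hsymm, ← map_mul, evalExt_pull]
    change evalExt (m + 1) v (P x * a x).val = _
    rw [mul_comm, map_mul]
    congr 2
    ext1 i
    have := chartL_chartInv hx (v i)
    rw [hsymm] at this
    exact this.symm

end Sections

/-! ### Chern–Weil forms are closed -/

section Flat

variable {n r : ℕ} (Γ : Euc n → Euc n →L[ℝ] (Fin r → ℝ) →L[ℝ] (Fin r → ℝ)) (p : Euc n)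

/-- A matrix valued one-form, as a matrix of elements of the exterior algebra. -/
noncomputable def extOfForm : Matrix (Fin r) (Fin r) (Ext n) :=
  Matrix.of fun a b =>
    ∑ k, ((Γ p (EuclideanSpace.single k 1) (Pi.single b 1) a : ℝ) : ℂ) • dxE k

lemma extOfForm_anticomm (k : Fin n) (a b : Fin r) :
    dxE k * extOfForm Γ p a b = -(extOfForm Γ p a b * dxE k) := by
  simp only [extOfForm, Matrix.of_apply, Finset.mul_sum, Finset.sum_mul, mul_smul_comm,
    smul_mul_assoc, ← Finset.sum_neg_distrib, ← smul_neg]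
  exact Finset.sum_congr rfl fun j _ => by rw [dxE_mul_dxE k j]

lemma exists_hasFDerivAt_entry {Γ : Euc n → Euc n →L[ℝ] (Fin r → ℝ) →L[ℝ] (Fin r → ℝ)}
    {p : Euc n} (hΓ : DifferentiableAt ℝ Γ p) (v : Euc n) (a b : Fin r) :
    ∃ L : Euc n →L[ℝ] ℝ, HasFDerivAt (fun q => Γ q v (Pi.single b 1) a) L p ∧
      ∀ u, L u = fderiv ℝ Γ p u v (Pi.single b 1) a := by
  have h1 := (hΓ.hasFDerivAt.clm_apply (hasFDerivAt_const v p)).clm_apply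
    (hasFDerivAt_const (Pi.single b 1 : Fin r → ℝ) p)
  have h2 := hasFDerivAt_pi'.1 h1 a
  refine ⟨_, h2, fun u => ?_⟩
  simp

lemma clm_apply_eq_sum (T : (Fin r → ℝ) →L[ℝ] (Fin r → ℝ)) (s : Fin r → ℝ) (a : Fin r) :
    T s a = ∑ b, s b * T (Pi.single b 1) a := by
  conv_lhs => rw [pi_eq_sum_univ' s, map_sum]
  simp only [Finset.sum_apply, map_smul, Pi.smul_apply, smul_eq_mul]

lemma contDiffAt_extOfForm {Γ : Euc n → Euc n →L[ℝ] (Fin r → ℝ) →L[ℝ] (Fin r → ℝ)}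
    {p : Euc n} (hΓ : ContDiffAt ℝ ∞ Γ p) (a b : Fin r) :
    ContDiffAt ℝ ∞ (fun q => extOfForm Γ q a b) p := by
  simp only [extOfForm, Matrix.of_apply]
  refine ContDiffAt.sum fun k _ => ?_
  have h1 : ContDiffAt ℝ ∞ (fun q => Γ q (EuclideanSpace.single k 1) (Pi.single b 1) a) p :=
    contDiffAt_pi.1 ((hΓ.clm_apply contDiffAt_const).clm_apply contDiffAt_const) a
  exact (Complex.ofRealCLM.contDiff.contDiffAt.comp p h1).smul (contDiffAt_const (c := dxE k))

lemma dExt_extOfForm {Γ : Euc n → Euc n →L[ℝ] (Fin r → ℝ) →L[ℝ] (Fin r → ℝ)}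
    {p : Euc n} (hΓ : DifferentiableAt ℝ Γ p) (a b : Fin r) :
    dExt (fun q => extOfForm Γ q a b) p = ∑ i, ∑ k,
      ((fderiv ℝ Γ p (EuclideanSpace.single i 1) (EuclideanSpace.single k 1)
        (Pi.single b 1) a : ℝ) : ℂ) • (dxE i * dxE k) := by
  choose L hL hL' using fun k : Fin n =>
    exists_hasFDerivAt_entry hΓ (EuclideanSpace.single k (1 : ℝ)) a b
  have h : HasFDerivAt (fun q => extOfForm Γ q a b)
      (∑ k, ((Complex.ofRealCLM ∘L L k).smulRight (dxE k))) p := by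
    simp only [extOfForm, Matrix.of_apply]
    refine HasFDerivAt.fun_sum fun k _ => ?_
    exact (Complex.ofRealCLM.hasFDerivAt.comp p (hL k)).smul_const (dxE k)
  rw [dExt, h.fderiv]
  refine Finset.sum_congr rfl fun i _ => ?_
  rw [sum_apply, Finset.mul_sum]
  refine Finset.sum_congr rfl fun k _ => ?_
  rw [← hL', ← mul_smul_comm]
  rfl

/-- The curvature `dA + A ∧ A`, computed in the exterior algebra, is the matrix of two-forms with
values `dΓ + Γ ∧ Γ`. -/
lemma curvForm_extOfForm {Γ : Euc n → Euc n →L[ℝ] (Fin r → ℝ) →L[ℝ] (Fin r → ℝ)}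
    {p : Euc n} (hΓ : DifferentiableAt ℝ Γ p) (a b : Fin r) :
    curvForm (extOfForm Γ) p a b =
      (twoForm fun u w => ((flatCurv Γ p u w (Pi.single b 1) a : ℝ) : ℂ)).val := by
  have h2 : (extOfForm Γ p * extOfForm Γ p) a b = ∑ i, ∑ k,
      ((Γ p (EuclideanSpace.single i 1) (Γ p (EuclideanSpace.single k 1)
        (Pi.single b 1)) a : ℝ) : ℂ) • (dxE i * dxE k) := by
    simp only [Matrix.mul_apply, extOfForm, Matrix.of_apply, Finset.sum_mul_sum]
    rw [Finset.sum_comm]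
    refine Finset.sum_congr rfl fun i _ => ?_
    rw [Finset.sum_comm]
    refine Finset.sum_congr rfl fun k _ => ?_
    rw [clm_apply_eq_sum (Γ p (EuclideanSpace.single i 1)) (Γ p (EuclideanSpace.single k 1) _),
      Complex.ofReal_sum, Finset.sum_smul]
    refine Finset.sum_congr rfl fun c _ => ?_
    rw [smul_mul_smul_comm, Complex.ofReal_mul, mul_comm]
  rw [curvForm, Matrix.add_apply, h2]
  change dExt (fun q => extOfForm Γ q a b) p + _ = _
  rw [dExt_extOfForm hΓ, ← Finset.sum_add_distrib, val_twoForm]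
  simp only [← Finset.sum_add_distrib, ← add_smul]
  rw [sum_sum_eq_sum_lt _ fun i => by rw [dxE_mul_self, smul_zero]]
  refine Finset.sum_congr rfl fun i _ => Finset.sum_congr rfl fun k _ => ?_
  split_ifs
  · rw [dxE_mul_dxE k i, smul_neg, ← sub_eq_add_neg, ← sub_smul]
    congr 1
    simp only [flatCurv, add_apply, sub_apply, ContinuousLinearMap.comp_apply, Pi.add_apply,
      Pi.sub_apply]
    push_cast
    ring
  · rfl

/-- The curvature as a bilinear map. -/
noncomputable def flatCurvBilin (s : Fin r → ℝ) (a : Fin r) : Euc n →ₗ[ℝ] Euc n →ₗ[ℝ] ℂ :=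
  LinearMap.mk₂ ℝ (fun u w => ((flatCurv Γ p u w s a : ℝ) : ℂ))
    (fun u u' w => by
      rw [flatCurv_add_left, add_apply, Pi.add_apply]
      push_cast; rfl)
    (fun c u w => by
      rw [flatCurv_smul_left, smul_apply, Pi.smul_apply]
      simp)
    (fun u w w' => by
      rw [flatCurv_swap, flatCurv_add_left, flatCurv_swap Γ p u w, flatCurv_swap Γ p u w']
      simp
      ring)
    (fun c u w => by
      rw [flatCurv_swap, flatCurv_smul_left, flatCurv_swap Γ p u w]
      simp)

/-- The curvature of a skew symmetric connection form is skew symmetric. -/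
lemma flatCurv_skew {Γ : Euc n → Euc n →L[ℝ] (Fin r → ℝ) →L[ℝ] (Fin r → ℝ)}
    {p : Euc n} (hΓ : DifferentiableAt ℝ Γ p)
    (hs : ∀ᶠ q in 𝓝 p, ∀ v a b, Γ q v (Pi.single b 1) a = -Γ q v (Pi.single a 1) b)
    (u w : Euc n) (a b : Fin r) :
    flatCurv Γ p u w (Pi.single b 1) a = -flatCurv Γ p u w (Pi.single a 1) b := by
  have h1 : ∀ u w, fderiv ℝ Γ p u w (Pi.single b 1) a = -fderiv ℝ Γ p u w (Pi.single a 1) b := by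
    intro u w
    obtain ⟨L, e1, hL⟩ := exists_hasFDerivAt_entry hΓ w a b
    obtain ⟨L', e2, hL'⟩ := exists_hasFDerivAt_entry hΓ w b a
    have e3 := e2.neg.congr_of_eventuallyEq (f₁ := fun q => Γ q w (Pi.single b 1) a)
      (hs.mono fun q hq => hq w a b)
    have := e1.unique e3
    rw [← hL, ← hL', this]
    rfl
  have h2 : ∀ u w, Γ p u (Γ p w (Pi.single b 1)) a = Γ p w (Γ p u (Pi.single a 1)) b := by
    intro u w
    rw [clm_apply_eq_sum (Γ p u), clm_apply_eq_sum (Γ p w)]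
    refine Finset.sum_congr rfl fun c _ => ?_
    rw [hs.self_of_nhds w c b, hs.self_of_nhds u a c]
    ring
  simp only [flatCurv, add_apply, sub_apply, ContinuousLinearMap.comp_apply, Pi.add_apply,
      Pi.sub_apply, h1, h2]
  ring

end Flat

section Connection

variable {n : ℕ} {Z : Type*} [TopologicalSpace Z] [T2Space Z] [ChartedSpace (Euc n) Z]
  [IsManifold (𝓡 n) ∞ Z]
  {F : Type*} [NormedAddCommGroup F] [NormedSpace ℝ F] [FiniteDimensional ℝ F]
  {V : Z → Type*} [TopologicalSpace (Bundle.TotalSpace F V)]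
  [∀ x, NormedAddCommGroup (V x)] [∀ x, InnerProductSpace ℝ (V x)]
  [FiberBundle F V] [VectorBundle ℝ F V] [ContMDiffVectorBundle ∞ F V (𝓡 n)]

variable (cov : CovariantDerivative (𝓡 n) F V)
variable [IsContMDiffRiemannianBundle (𝓡 n) ∞ F V]
  [CovariantDerivative.ContMDiffCovariantDerivative cov ∞]
variable {r : ℕ} {e e' : Fin r → ∀ x, V x} {U U' : Set Z}

lemma twoForm_sum {ι : Type*} (s : Finset ι) (β : ι → Euc n → Euc n → ℂ) (c : ι → ℂ) :
    twoForm (fun u w => ∑ i ∈ s, c i * β i u w) = ∑ i ∈ s, c i • twoForm (β i) := by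
  simp only [twoForm, Finset.smul_sum]
  conv_rhs => rw [Finset.sum_comm]
  refine Finset.sum_congr rfl fun i _ => ?_
  conv_rhs => rw [Finset.sum_comm]
  refine Finset.sum_congr rfl fun j _ => ?_
  split_ifs
  · simp only [Finset.sum_smul, mul_smul]
  · simp

lemma connForm_skew (hm : cov.IsMetricCompatible)
    (he : IsOrthonormalFrameOn (n := n) F e U) (hU : IsOpen U) {x₀ : Z} {p : Euc n}
    (hp : p ∈ (extChartAt (𝓡 n) x₀).target) (hpU : (extChartAt (𝓡 n) x₀).symm p ∈ U) :
    ∀ᶠ q in 𝓝 p, ∀ v a b, connForm cov e x₀ q v (Pi.single b 1) a =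
      -connForm cov e x₀ q v (Pi.single a 1) b := by
  filter_upwards [(contMDiffAt_chart_symm hp).continuousAt.eventually_mem (hU.mem_nhds hpU)]
    with q hq v a b
  have := connMatrix_skew cov hm he hU hq v a b
  simpa [connForm_apply, connMatrix, Pi.single_apply] using this

/-- The curvature in terms of the connection form, for arbitrary tangent vectors. -/
lemma inner_curvature' (he : IsOrthonormalFrameOn (n := n) F e U) (hU : IsOpen U)
    (hr : Module.finrank ℝ F = r) {x₀ : Z} {p : Euc n}
    (hp : p ∈ (extChartAt (𝓡 n) x₀).target) (hpU : (extChartAt (𝓡 n) x₀).symm p ∈ U)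
    (u w : Euc n) (s : V ((extChartAt (𝓡 n) x₀).symm p)) (b : Fin r) :
    inner ℝ (e b ((extChartAt (𝓡 n) x₀).symm p))
      (curvature cov ((extChartAt (𝓡 n) x₀).symm p) u w s) =
    flatCurv (connForm cov e x₀) p (chartInv x₀ ((extChartAt (𝓡 n) x₀).symm p) u)
      (chartInv x₀ ((extChartAt (𝓡 n) x₀).symm p) w)
      (fun c => inner ℝ (e c ((extChartAt (𝓡 n) x₀).symm p)) s) b := by
  rw [← inner_curvature cov he hU hr hp hpU]
  have h1 := chartL_chartInv hp u
  have h2 := chartL_chartInv hp w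
  congr 2
  · exact h1.symm
  · exact h2.symm

lemma exists_chart_point (x : Z) : ∃ x₀ : Z, ∃ p ∈ (extChartAt (𝓡 n) x₀).target,
    (extChartAt (𝓡 n) x₀).symm p = x :=
  ⟨x, extChartAt (𝓡 n) x x, mem_extChartAt_target x, extChartAt_to_inv x⟩

lemma curvMatrix_skew (hm : cov.IsMetricCompatible) (he : IsOrthonormalFrameOn (n := n) F e U)
    (hU : IsOpen U) (hr : Module.finrank ℝ F = r) {x : Z} (hx : x ∈ U) (a b : Fin r) :
    curvMatrix cov x (fun a => e a x) a b = -curvMatrix cov x (fun a => e a x) b a := by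
  obtain ⟨x₀, p, hp, rfl⟩ := exists_chart_point (n := n) x
  simp only [curvMatrix, Matrix.of_apply, ← smul_neg]
  congr 1
  have h : ∀ (u w : Euc n), inner ℝ (e a ((extChartAt (𝓡 n) x₀).symm p))
      (curvature cov ((extChartAt (𝓡 n) x₀).symm p) u w (e b ((extChartAt (𝓡 n) x₀).symm p))) =
      -inner ℝ (e b ((extChartAt (𝓡 n) x₀).symm p))
      (curvature cov ((extChartAt (𝓡 n) x₀).symm p) u w (e a ((extChartAt (𝓡 n) x₀).symm p))) := by
    intro u w
    rw [inner_curvature' cov he hU hr hp hx, inner_curvature' cov he hU hr hp hx]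
    have h1 : ∀ b, (fun c => inner ℝ (e c ((extChartAt (𝓡 n) x₀).symm p))
        (e b ((extChartAt (𝓡 n) x₀).symm p))) = (Pi.single b (1 : ℝ) : Fin r → ℝ) := by
      intro b
      ext c
      rw [orthonormal_iff_ite.1 (he.orthonormal _ hx) c b, Pi.single_apply]
    rw [h1, h1]
    exact flatCurv_skew ((connForm_contDiffAt cov he hU hp hx).differentiableAt (by simp))
      (connForm_skew cov hm he hU hp hx) _ _ a b
  simp only [twoForm, ← Finset.sum_neg_distrib]
  refine Finset.sum_congr rfl fun i _ => Finset.sum_congr rfl fun j _ => ?_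
  split_ifs
  · rw [← neg_smul]
    congr 1
    have := h (EuclideanSpace.single i 1) (EuclideanSpace.single j 1)
    exact_mod_cast congrArg Complex.ofReal this
  · simp

/-- The matrix of the change of orthonormal frames, with entries `⟨e_a, e'_b⟩`. -/
noncomputable def frameChange (e e' : Fin r → ∀ x, V x) (x : Z) :
    Matrix (Fin r) (Fin r) (EvenForms n) :=
  Matrix.of fun a b => algebraMap ℂ (EvenForms n) ((inner ℝ (e a x) (e' b x) : ℝ) : ℂ)

lemma frameChange_mul (he' : IsOrthonormalFrameOn (n := n) F e' U')
    (he : IsOrthonormalFrameOn (n := n) F e U)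
    (hr : Module.finrank ℝ F = r) {x : Z} (hx : x ∈ U) (hx' : x ∈ U') :
    frameChange (n := n) e e' x * (frameChange e e' x).transpose = 1 := by
  ext a b : 1
  simp only [Matrix.mul_apply, frameChange, Matrix.transpose_apply, Matrix.of_apply, ← map_mul,
    ← map_sum, Matrix.one_apply]
  have h1 : ∑ c, (inner ℝ (e a x) (e' c x) : ℝ) * inner ℝ (e b x) (e' c x) =
      if a = b then 1 else 0 := by
    rw [← orthonormal_iff_ite.1 (he.orthonormal x hx) a b]
    conv_rhs => rw [frame_expansion (n := n) he' hr hx' (e b x), inner_sum]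
    refine Finset.sum_congr rfl fun c _ => ?_
    rw [inner_smul_right, mul_comm, real_inner_comm]
  have h2 : (∑ c, ((inner ℝ (e a x) (e' c x) : ℝ) : ℂ) * ((inner ℝ (e b x) (e' c x) : ℝ) : ℂ)) =
      if a = b then 1 else 0 := by
    rw [← Complex.ofReal_one, ← Complex.ofReal_zero, ← apply_ite Complex.ofReal, ← h1]
    push_cast; rfl
  rw [h2]
  split_ifs <;> simp

/-- A change of orthonormal frames conjugates the curvature by an orthogonal matrix. -/
lemma curvMatrix_frameChange (he' : IsOrthonormalFrameOn (n := n) F e' U')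
    (he : IsOrthonormalFrameOn (n := n) F e U) (hU : IsOpen U)
    (hr : Module.finrank ℝ F = r) {x : Z} (hx : x ∈ U) (hx' : x ∈ U') :
    curvMatrix cov x (fun a => e' a x) = (frameChange e e' x).transpose *
      curvMatrix cov x (fun a => e a x) * frameChange e e' x := by
  obtain ⟨x₀, p, hp, hpx⟩ := exists_chart_point (n := n) x
  have hlin : ∀ (c : Fin r) (u w : Euc n) (s : V x), inner ℝ (e c x) (curvature cov x u w s) =
      ∑ d, (inner ℝ (e d x) s : ℝ) * inner ℝ (e c x) (curvature cov x u w (e d x)) := by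
    subst hpx
    intro c u w s
    have h1 : ∀ b, (fun c => inner ℝ (e c ((extChartAt (𝓡 n) x₀).symm p))
        (e b ((extChartAt (𝓡 n) x₀).symm p))) = (Pi.single b (1 : ℝ) : Fin r → ℝ) := by
      intro b
      ext c
      rw [orthonormal_iff_ite.1 (he.orthonormal _ hx) c b, Pi.single_apply]
    simp only [inner_curvature' cov he hU hr hp hx, h1]
    exact clm_apply_eq_sum _ _ _
  ext a b : 1
  have hβ : ∀ (u w : Euc n), ((inner ℝ (e' a x) (curvature cov x u w (e' b x)) : ℝ) : ℂ) =
      ∑ d, ∑ c, (((inner ℝ (e c x) (e' a x) : ℝ) : ℂ) * ((inner ℝ (e d x) (e' b x) : ℝ) : ℂ)) *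
        ((inner ℝ (e c x) (curvature cov x u w (e d x)) : ℝ) : ℂ) := by
    intro u w
    have h1 : inner ℝ (e' a x) (curvature cov x u w (e' b x)) =
        ∑ c, (inner ℝ (e c x) (e' a x) : ℝ) * inner ℝ (e c x) (curvature cov x u w (e' b x)) := by
      conv_lhs => rw [frame_expansion (n := n) he hr hx (e' a x), sum_inner]
      refine Finset.sum_congr rfl fun c _ => ?_
      rw [real_inner_smul_left]
    rw [h1, Finset.sum_comm]
    push_cast
    refine Finset.sum_congr rfl fun c _ => ?_
    rw [hlin c u w (e' b x)]
    push_cast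
    rw [Finset.mul_sum]
    refine Finset.sum_congr rfl fun d _ => ?_
    ring
  simp only [Matrix.mul_apply, Matrix.transpose_apply, curvMatrix, Matrix.of_apply, frameChange]
  rw [show (twoForm fun u w => ((inner ℝ (e' a x) (curvature cov x u w (e' b x)) : ℝ) : ℂ)) =
    twoForm fun u w => ∑ d, (1 : ℂ) * ∑ c, (((inner ℝ (e c x) (e' a x) : ℝ) : ℂ) *
      ((inner ℝ (e d x) (e' b x) : ℝ) : ℂ)) *
        ((inner ℝ (e c x) (curvature cov x u w (e d x)) : ℝ) : ℂ) from by
      congr 1; ext u w; rw [hβ]; simp only [one_mul]]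
  rw [twoForm_sum, Finset.smul_sum]
  refine Finset.sum_congr rfl fun d _ => ?_
  rw [twoForm_sum, one_smul, Finset.smul_sum, Finset.sum_mul]
  refine Finset.sum_congr rfl fun c _ => ?_
  rw [mul_smul, ← Algebra.smul_def, mul_comm (_ • _), ← Algebra.smul_def]
  simp only [smul_smul]
  congr 1
  ring

lemma trace_conj_pow {R : Type*} [CommRing R] {O M : Matrix (Fin r) (Fin r) R}
    (hO : O * O.transpose = 1) (m : ℕ) :
    ((O.transpose * M * O) ^ m).trace = (M ^ m).trace := by
  have h : (O.transpose * M * O) ^ m = O.transpose * M ^ m * O := by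
    induction m with
    | zero =>
      rw [pow_zero, pow_zero, mul_one]
      exact (mul_eq_one_comm.1 hO).symm
    | succ m ih =>
      rw [pow_succ, ih, pow_succ]
      calc O.transpose * M ^ m * O * (O.transpose * M * O) =
          O.transpose * M ^ m * (O * O.transpose) * M * O := by noncomm_ring
        _ = _ := by rw [hO]; noncomm_ring
  rw [h, Matrix.trace_mul_comm, ← mul_assoc, hO, one_mul]

/-- The matrix `F` in the chart around `x₀` is `(√-1/2π)(dA + A ∧ A)`, where `A` is the connection
form. -/
lemma pull_curvMatrix (he : IsOrthonormalFrameOn (n := n) F e U) (hU : IsOpen U)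
    (hr : Module.finrank ℝ F = r) {x₀ : Z} {p : Euc n}
    (hp : p ∈ (extChartAt (𝓡 n) x₀).target) (hpU : (extChartAt (𝓡 n) x₀).symm p ∈ U) :
    (curvMatrix cov ((extChartAt (𝓡 n) x₀).symm p)
      (fun a => e a ((extChartAt (𝓡 n) x₀).symm p))).map
        ((pull (chartL x₀ p)).comp EvenForms.val) =
      (Complex.I / (2 * Real.pi)) • curvForm (extOfForm (connForm cov e x₀)) p := by
  ext a b : 1
  rw [Matrix.smul_apply, curvForm_extOfForm
    ((connForm_contDiffAt cov he hU hp hpU).differentiableAt (by simp))]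
  simp only [Matrix.map_apply, curvMatrix, Matrix.of_apply, AlgHom.comp_apply, map_smul]
  congr 1
  have h1 : (fun c => inner ℝ (e c ((extChartAt (𝓡 n) x₀).symm p))
      (e b ((extChartAt (𝓡 n) x₀).symm p))) = (Pi.single b (1 : ℝ) : Fin r → ℝ) := by
    ext c
    rw [orthonormal_iff_ite.1 (he.orthonormal _ hpU) c b, Pi.single_apply]
  let M : Euc n →ₗ[ℝ] Euc n :=
    { toFun := fun v => chartInv x₀ ((extChartAt (𝓡 n) x₀).symm p) v
      map_add' := fun v w => map_add (mfderiv (𝓡 n) 𝓘(ℝ, Euc n) (extChartAt (𝓡 n) x₀) _) v w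
      map_smul' := fun c w => map_smul (mfderiv (𝓡 n) 𝓘(ℝ, Euc n) (extChartAt (𝓡 n) x₀) _) c w }
  refine pull_twoForm
    ((flatCurvBilin (connForm cov e x₀) p (Pi.single b 1) a).compl₁₂ M M)
    (flatCurvBilin (connForm cov e x₀) p (Pi.single b 1) a) ?_ ?_ ?_ ?_ _ ?_
  · intro u w
    rw [inner_curvature' cov he hU hr hp hpU, h1]
    rfl
  · intro u w
    rw [inner_curvature' cov he hU hr hp hpU, inner_curvature' cov he hU hr hp hpU,
      flatCurv_swap]
    simp
  · intro u w
    rfl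
  · intro u w
    rw [flatCurv_swap]
    simp
  · intro u w
    rw [inner_curvature' cov he hU hr hp hpU, h1, chartInv_chartL hp, chartInv_chartL hp]

/-- The forms `tr F^m` are smooth and closed. The frame in which `F` is computed may jump from point
to point, but the trace does not depend on it, so that near a given point one smooth frame can be
used. -/
lemma smoothClosed_trace {ι : Type*} {𝒰 : ι → Set Z} {f : ι → Fin r → ∀ x, V x}
    (hf : ∀ i, IsOrthonormalFrameOn (n := n) F (f i) (𝒰 i)) (h𝒰 : ∀ i, IsOpen (𝒰 i))
    (hr : Module.finrank ℝ F = r) {idx : Z → ι} (hidx : ∀ x, x ∈ 𝒰 (idx x)) (m : ℕ) :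
    SmoothClosed fun x => ((curvMatrix cov x fun a => f (idx x) a x) ^ m).trace := by
  intro x₀ p hp
  set i := idx ((extChartAt (𝓡 n) x₀).symm p) with hi
  have hpi := hidx ((extChartAt (𝓡 n) x₀).symm p)
  rw [← hi] at hpi
  have hΓ := connForm_contDiffAt cov (hf i) (h𝒰 i) hp hpi
  have hev : locRep x₀ (fun x => ((curvMatrix cov x fun a => f (idx x) a x) ^ m).trace) =ᶠ[𝓝 p]
      fun q => (Complex.I / (2 * Real.pi)) ^ m •
        (curvForm (extOfForm (connForm cov (f i) x₀)) q ^ m).trace := by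
    filter_upwards [(isOpen_extChartAt_target x₀).mem_nhds hp,
      (contMDiffAt_chart_symm hp).continuousAt.eventually_mem ((h𝒰 i).mem_nhds hpi)] with q hq hqi
    rw [locRep, curvMatrix_frameChange cov (hf _) (hf i) (h𝒰 i) hr hqi (hidx _),
      trace_conj_pow (frameChange_mul (hf _) (hf i) hr hqi (hidx _)), ← Matrix.trace_smul,
      ← smul_pow, ← pull_curvMatrix cov (hf i) (h𝒰 i) hr hq hqi]
    rw [← AlgHom.comp_apply, AddMonoidHom.map_trace]
    congr 1
    exact map_pow (((pull (chartL x₀ q)).comp EvenForms.val).toRingHom.mapMatrix (m := Fin r)) _ m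
  have hA : ∀ a b, ContDiffAt ℝ ∞ (fun q => extOfForm (connForm cov (f i) x₀) q a b) p :=
    contDiffAt_extOfForm hΓ
  have hcm : ∀ a b y, curvForm (extOfForm (connForm cov (f i) x₀)) p a b * y =
      y * curvForm (extOfForm (connForm cov (f i) x₀)) p a b := by
    intro a b y
    rw [curvForm_extOfForm (hΓ.differentiableAt (by simp))]
    exact even_mul_comm _ (Subtype.property _) y
  have hsm : ContDiffAt ℝ ∞ (fun q =>
      (curvForm (extOfForm (connForm cov (f i) x₀)) q ^ m).trace) p := by
    simp only [Matrix.trace, Matrix.diag]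
    exact ContDiffAt.sum fun a _ => contDiffAt_pow (contDiffAt_curvForm hA) m a a
  refine ⟨(hsm.const_smul _).congr_of_eventuallyEq hev, ?_⟩
  rw [dExt_congr hev, dExt_const_smul _ (hsm.differentiableAt (by simp)),
    dExt_trace_curvForm_pow hA (fun k a b => extOfForm_anticomm _ _ k a b) hcm, smul_zero]

end Connection

/-! ### Degrees and nilpotency of characteristic forms -/

section Degrees

variable {n : ℕ}

/-- The even form `a` is homogeneous of degree `p`. -/
def InDeg (p : ℕ) (a : EvenForms n) : Prop := a.val ∈ ⋀[ℂ]^p (CCovec n)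

variable {p q : ℕ} {a b : EvenForms n}

lemma InDeg.mul (ha : InDeg p a) (hb : InDeg q b) : InDeg (p + q) (a * b) := by
  rw [InDeg, map_mul]
  exact mul_mem_deg ha hb

lemma inDeg_one : InDeg 0 (1 : EvenForms n) := by
  rw [InDeg, map_one, ExteriorAlgebra.exteriorPower, pow_zero]
  exact Submodule.one_le.mp le_rfl

lemma InDeg.add (ha : InDeg p a) (hb : InDeg p b) : InDeg p (a + b) := by
  rw [InDeg, map_add]
  exact Submodule.add_mem _ ha hb

lemma InDeg.smul (ha : InDeg p a) (c : ℂ) : InDeg p (c • a) := by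
  rw [InDeg, map_smul]
  exact Submodule.smul_mem _ _ ha

lemma inDeg_zero (p : ℕ) : InDeg p (0 : EvenForms n) := by
  rw [InDeg, map_zero]
  exact Submodule.zero_mem _

lemma InDeg.pow (ha : InDeg p a) (m : ℕ) : InDeg (m * p) (a ^ m) := by
  induction m with
  | zero => simpa using inDeg_one
  | succ m ih =>
    rw [pow_succ, Nat.succ_mul]
    exact ih.mul ha

lemma InDeg.prod {ι : Type*} (s : Finset ι) {d : ι → ℕ} {f : ι → EvenForms n}
    (h : ∀ i, InDeg (d i) (f i)) : InDeg (∑ i ∈ s, d i) (∏ i ∈ s, f i) := by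
  induction s using Finset.cons_induction with
  | empty => simpa using inDeg_one
  | cons i s hi ih =>
    rw [Finset.sum_cons, Finset.prod_cons]
    exact (h i).mul ih

lemma InDeg.sum {ι : Type*} (s : Finset ι) {f : ι → EvenForms n} (h : ∀ i, InDeg p (f i)) :
    InDeg p (∑ i ∈ s, f i) :=
  Finset.sum_induction f (InDeg p) (fun _ _ => InDeg.add) (inDeg_zero p) fun i _ => h i

lemma evalForm_eq_zero (ha : InDeg q a) (h : q ≠ p) (v : Fin p → Euc n) : evalForm p v a = 0 := by
  rw [evalForm_eq]
  have hs : (⋀[ℂ]^q (CCovec n) : Submodule ℂ (Ext n)) ≤ LinearMap.ker (evalExt p v) := by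
    rw [← ExteriorAlgebra.ιMulti_span_fixedDegree, Submodule.span_le]
    rintro _ ⟨α, rfl⟩
    exact evalExt_ιMulti_ne h v α
  exact hs ha

lemma evalForm_add (v : Fin p → Euc n) (a b : EvenForms n) :
    evalForm p v (a + b) = evalForm p v a + evalForm p v b := by
  simp only [evalForm_eq, map_add]

lemma evalForm_smul (v : Fin p → Euc n) (c : ℂ) (a : EvenForms n) :
    evalForm p v (c • a) = c * evalForm p v a := by
  simp only [evalForm_eq, map_smul, smul_eq_mul]

lemma evalForm_sum {ι : Type*} (s : Finset ι) (v : Fin p → Euc n) (f : ι → EvenForms n) :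
    evalForm p v (∑ i ∈ s, f i) = ∑ i ∈ s, evalForm p v (f i) := by
  simp only [evalForm_eq, map_sum]

lemma twoForm_inDeg (β : Euc n → Euc n → ℂ) : InDeg 2 (twoForm β) := twoForm_mem_deg β

variable {r : ℕ} {F : Matrix (Fin r) (Fin r) (EvenForms n)}

lemma inDeg_matrix_pow (h : ∀ i j, InDeg 2 (F i j)) (m : ℕ) (i j : Fin r) :
    InDeg (m * 2) ((F ^ m) i j) := by
  induction m generalizing i j with
  | zero =>
    rw [pow_zero, zero_mul, Matrix.one_apply]
    split
    · exact inDeg_one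
    · exact inDeg_zero 0
  | succ m ih =>
    rw [pow_succ, Nat.succ_mul, Matrix.mul_apply]
    exact InDeg.sum _ fun k => (ih i k).mul (h k j)

lemma inDeg_trace_pow (h : ∀ i j, InDeg 2 (F i j)) (m : ℕ) : InDeg (m * 2) (F ^ m).trace :=
  InDeg.sum _ fun i => inDeg_matrix_pow h m i i

lemma inDeg_pontryagin (h : ∀ i j, InDeg 2 (F i j)) : InDeg 4 (pontryagin F) := by
  have := (inDeg_trace_pow h 2).smul (1 / 2)
  rwa [pow_two] at this

lemma inDeg_anomaly {d l : ℕ} {FT : Matrix (Fin d) (Fin d) (EvenForms n)}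
    {Fξ : Matrix (Fin 2) (Fin 2) (EvenForms n)}
    {FV : Matrix (Fin (16 * l)) (Fin (16 * l)) (EvenForms n)} (hT : ∀ i j, InDeg 2 (FT i j))
    (hξ : ∀ i j, InDeg 2 (Fξ i j)) (hV : ∀ i j, InDeg 2 (FV i j)) :
    InDeg 4 (-pontryagin FT + 3 * pontryagin Fξ + pontryagin FV) := by
  have h3 : InDeg 4 (3 * pontryagin Fξ) := by
    have := (inDeg_pontryagin hξ).smul 3
    rwa [Algebra.smul_def, map_ofNat] at this
  have h1 : InDeg 4 (-pontryagin FT) := by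
    have := (inDeg_pontryagin hT).smul (-1)
    rwa [neg_one_smul] at this
  exact (h1.add h3).add (inDeg_pontryagin hV)

/-- The degrees of the even traces and of `-p₁(TZ) + 3 p₁(ξ) + p₁(V)`. -/
def formDeg {M : ℕ} : Option (Fin 3 × Fin M) → ℕ
  | none => 4
  | some p => 2 * (p.2 + 1) * 2

variable {d l M : ℕ} {FT : Matrix (Fin d) (Fin d) (EvenForms n)}
    {Fξ : Matrix (Fin 2) (Fin 2) (EvenForms n)}
    {FV : Matrix (Fin (16 * l)) (Fin (16 * l)) (EvenForms n)}

lemma inDeg_traces (hT : ∀ i j, InDeg 2 (FT i j)) (hξ : ∀ i j, InDeg 2 (Fξ i j))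
    (hV : ∀ i j, InDeg 2 (FV i j)) (p : Fin 3 × Fin M) :
    InDeg (2 * (p.2 + 1) * 2) (traces FT Fξ FV M p) := by
  obtain ⟨i, m⟩ := p
  fin_cases i
  · exact inDeg_trace_pow hT _
  · exact inDeg_trace_pow hξ _
  · exact inDeg_trace_pow hV _

lemma inDeg_tracesOpt (hT : ∀ i j, InDeg 2 (FT i j)) (hξ : ∀ i j, InDeg 2 (Fξ i j))
    (hV : ∀ i j, InDeg 2 (FV i j)) (o : Option (Fin 3 × Fin M)) :
    InDeg (formDeg o) (tracesOpt FT Fξ FV M o) := by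
  rcases o with _ | p
  · exact inDeg_anomaly hT hξ hV
  · exact inDeg_traces hT hξ hV p

end Degrees

section Nilpotency

variable {n : ℕ}

instance : Module.Finite ℂ (EvenForms n) :=
  Module.Finite.of_injective (EvenForms.val (n := n)).toLinearMap Subtype.val_injective

instance : IsNoetherianRing (EvenForms n) :=
  IsNoetherianRing.of_finite ℂ (EvenForms n)

lemma wedge₂_sq (α β : CCovec n) : wedge₂ α β ^ 2 = 0 := by
  refine Subtype.val_injective ?_
  change EvenForms.val (wedge₂ α β ^ 2) = EvenForms.val 0
  rw [map_pow, val_wedge₂, map_zero, pow_two]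
  rw [ext_pair_comm, mul_assoc, ← mul_assoc (ExteriorAlgebra.ι ℂ β),
    ext_ι_swap β α, neg_mul, mul_neg, mul_assoc, ExteriorAlgebra.ι_sq_zero, mul_zero, mul_zero,
    neg_zero]

/-- Two-forms are nilpotent, as sums of commuting elements of square zero. -/
lemma twoForm_isNilpotent (β : Euc n → Euc n → ℂ) : IsNilpotent (twoForm β) := by
  refine isNilpotent_sum fun i _ => isNilpotent_sum fun j _ => ?_
  split
  · exact IsNilpotent.smul ⟨2, wedge₂_sq _ _⟩ _
  · exact IsNilpotent.zero

/-- A common bound for the nilpotency of all forms of positive degree. -/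
lemma exists_nilradical_pow (n : ℕ) : ∃ M, 0 < M ∧ nilradical (EvenForms n) ^ M = ⊥ := by
  obtain ⟨N, hN⟩ := IsNoetherianRing.isNilpotent_nilradical (EvenForms n)
  refine ⟨N + 1, N.succ_pos, ?_⟩
  rw [pow_succ, hN, zero_mul]
  rfl

variable {M : ℕ}

lemma pow_eq_zero_of_nilpotent (hM : nilradical (EvenForms n) ^ M = ⊥) {a : EvenForms n}
    (ha : IsNilpotent a) : a ^ M = 0 := by
  have := Ideal.pow_mem_pow (mem_nilradical.mpr ha) M
  rwa [hM, Ideal.mem_bot] at this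

lemma isCurv_of_nilpotent (hM : nilradical (EvenForms n) ^ M = ⊥) {r : ℕ}
    {F : Matrix (Fin r) (Fin r) (EvenForms n)} (hF : ∀ i j, F i j = -F j i)
    (hnil : ∀ i j, IsNilpotent (F i j)) : IsCurv M F where
  skew := by
    ext i j
    exact hF j i
  pow := by
    rw [show 2 * M + 1 = M + (M + 1) by ring, pow_add,
      matrix_pow_eq_zero hM fun i j => mem_nilradical.mpr (hnil i j), zero_mul]
  nil := trace_pow_isNilpotent hnil

end Nilpotency

section Rotation

variable {A : Type*} [CommRing A] [Algebra ℂ A]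

/-- For a skew `2 × 2` matrix with formal eigenvalues `±c`, the even traces are `2 c^{2j}`, where
`c` is the first Chern form. -/
lemma evenTr_plane {F : Matrix (Fin 2) (Fin 2) A} (hF : ∀ i j, F i j = -F j i) {M : ℕ}
    (m : Fin M) :
    evenTr M F m = (2 : ℂ) • (F 0 0 + Complex.I • F 1 0) ^ (2 * (m.val + 1)) := by
  have h0 : ∀ i, F i i = 0 := by
    intro i
    have h1 : (2 : ℂ) • F i i = 0 := by
      rw [two_smul]
      nth_rewrite 1 [hF i i]
      exact neg_add_cancel _
    have h2 := congrArg (fun x => (2 : ℂ)⁻¹ • x) h1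
    simpa [smul_smul] using h2
  have hsq : F ^ 2 = (Complex.I • F 1 0) ^ 2 • (1 : Matrix (Fin 2) (Fin 2) A) := by
    rw [smul_pow, Complex.I_sq, neg_one_smul]
    ext i j
    rw [pow_two, Matrix.mul_apply, Fin.sum_univ_two]
    fin_cases i <;> fin_cases j <;> simp [h0, hF 0 1, pow_two]
  rw [evenTr, pow_mul, hsq, smul_pow, one_pow, Matrix.trace_smul, Matrix.trace_one, h0, zero_add,
    ← pow_mul, Fintype.card_fin, smul_eq_mul, Nat.cast_ofNat, two_smul, mul_two]

end Rotation

section Coefficients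

variable {n d l M : ℕ} {FT : Matrix (Fin d) (Fin d) (EvenForms n)}
    {Fξ : Matrix (Fin 2) (Fin 2) (EvenForms n)}
    {FV : Matrix (Fin (16 * l)) (Fin (16 * l)) (EvenForms n)}

/-- The monomials in the even traces and the form `-p₁(TZ) + 3 p₁(ξ) + p₁(V)`. -/
noncomputable def traceMon (FT : Matrix (Fin d) (Fin d) (EvenForms n))
    (Fξ : Matrix (Fin 2) (Fin 2) (EvenForms n))
    (FV : Matrix (Fin (16 * l)) (Fin (16 * l)) (EvenForms n))
    (γ : Option (Fin 3 × Fin M) → Fin M) : EvenForms n :=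
  ∏ o, tracesOpt FT Fξ FV M o ^ (γ o).val

lemma inDeg_traceMon (hT : ∀ i j, InDeg 2 (FT i j)) (hξ : ∀ i j, InDeg 2 (Fξ i j))
    (hV : ∀ i j, InDeg 2 (FV i j)) (γ : Option (Fin 3 × Fin M) → Fin M) :
    InDeg (∑ o, (γ o).val * formDeg o) (traceMon FT Fξ FV γ) :=
  InDeg.prod _ fun o => (inDeg_tracesOpt hT hξ hV o).pow _

/-- The component of degree `4k` as a finite sum of forms times power series. Only the even part of
`e^{c/2}` matters: the traces have degrees divisible by four, and odd powers of `c` have degrees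
which are not. -/
theorem evalForm_coeff_qSeries {k : ℕ} (hM : 0 < M)
    (hnM : nilradical (EvenForms n) ^ M = ⊥)
    (hT : ∀ i j, InDeg 2 (FT i j)) (hξ : ∀ i j, InDeg 2 (Fξ i j)) (hV : ∀ i j, InDeg 2 (FV i j))
    (hTn : ∀ i j, IsNilpotent (FT i j)) (hξn : ∀ i j, IsNilpotent (Fξ i j))
    (hVn : ∀ i j, IsNilpotent (FV i j)) (hTs : ∀ i j, FT i j = -FT j i)
    (hξs : ∀ i j, Fξ i j = -Fξ j i) (hVs : ∀ i j, FV i j = -FV j i)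
    (v : Fin (4 * k) → Euc n) (j : ℕ) :
    evalForm (4 * k) v (PowerSeries.coeff j
      (qSeries FT Fξ (Fξ 0 0 + Complex.I • Fξ 1 0) FV)) =
      ∑ γ : Option (Fin 3 × Fin M) → Fin M,
        evalForm (4 * k) v (traceMon FT Fξ FV γ) * PowerSeries.coeff j (modCoef l γ) := by
  have cT := isCurv_of_nilpotent hnM hTs hTn
  have cξ := isCurv_of_nilpotent hnM hξs hξn
  have cV := isCurv_of_nilpotent hnM hVs hVn
  set c := Fξ 0 0 + Complex.I • Fξ 1 0 with hc
  have hcn : IsNilpotent c :=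
    (Commute.all _ _).isNilpotent_add (hξn 0 0) ((hξn 1 0).smul _)
  have hc0 : c ^ (2 * M + 1) = 0 := by
    rw [show 2 * M + 1 = M + (M + 1) by ring, pow_add, pow_eq_zero_of_nilpotent hnM hcn, zero_mul]
  have hcd : InDeg 2 c := (hξ 0 0).add ((hξ 1 0).smul _)
  rw [qSeries_eq hM cT cξ cV hVn hc0 (evenTr_plane hξs)]
  simp only [cexp_expand (fun o => pow_eq_zero_of_nilpotent hnM (tracesOpt_nil cT cξ cV o)),
    cexp_expand (fun p => pow_eq_zero_of_nilpotent hnM (traces_nil cT cξ cV p))]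
  -- collect the coefficient of each monomial
  have h1 : ∀ {κ : Type} [Fintype κ] (Y : κ → EvenForms n) (h : Fin 3 → κ → PowerSeries ℂ),
      PowerSeries.coeff j (∑ i, lft (EvenForms n) (thetaFac l i) *
        ∑ γ, PowerSeries.C (Y γ) * lft (EvenForms n) (h i γ)) =
      ∑ γ, PowerSeries.coeff j (∑ i, thetaFac l i * h i γ) • Y γ := by
    intro κ _ Y h
    simp only [Finset.mul_sum]
    rw [Finset.sum_comm, map_sum]
    refine Finset.sum_congr rfl fun γ _ => ?_
    have h2 : ∑ i, lft (EvenForms n) (thetaFac l i) *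
        (PowerSeries.C (Y γ) * lft (EvenForms n) (h i γ)) =
        PowerSeries.C (Y γ) * lft (EvenForms n) (∑ i, thetaFac l i * h i γ) := by
      rw [map_sum, Finset.mul_sum]
      refine Finset.sum_congr rfl fun i _ => ?_
      rw [map_mul]
      ring
    rw [h2, PowerSeries.coeff_C_mul, coeff_lft, Algebra.smul_def, mul_comm]
  rw [map_add, h1, evalForm_add, evalForm_sum, PowerSeries.coeff_C_mul,
    h1, Finset.sum_mul, evalForm_sum]
  -- the terms with an odd power of `c` have degree `2` modulo `4`
  have hodd : ∀ i ∈ Finset.range M, evalForm (4 * k) v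
      ((((1 / 2 : ℂ) * PowerSeries.coeff (2 * i) sinhcHalf) • c ^ (2 * i + 1)) *
        ∑ γ : Fin 3 × Fin M → Fin M, PowerSeries.coeff j
          (∑ i, thetaFac l i * monCoef (plainExp i) γ) •
          ∏ p, traces FT Fξ FV M p ^ (γ p).val) = 0 := by
    intro i _
    rw [Finset.mul_sum, evalForm_sum]
    refine Finset.sum_eq_zero fun γ _ => ?_
    have hdeg := ((hcd.pow (2 * i + 1)).smul ((1 / 2 : ℂ) *
      PowerSeries.coeff (2 * i) sinhcHalf)).mul ((InDeg.prod Finset.univ fun p =>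
        (inDeg_traces hT hξ hV p).pow (γ p).val).smul (PowerSeries.coeff j
          (∑ i, thetaFac l i * monCoef (plainExp i) γ)))
    refine evalForm_eq_zero hdeg ?_ v
    have h3 : ∑ p : Fin 3 × Fin M, (γ p).val * (2 * (p.2.val + 1) * 2) =
        4 * ∑ p : Fin 3 × Fin M, (γ p).val * (p.2.val + 1) := by
      rw [Finset.mul_sum]
      exact Finset.sum_congr rfl fun p _ => by ring
    rw [h3]
    omega
  rw [Finset.sum_eq_zero hodd, add_zero]
  refine Finset.sum_congr rfl fun γ _ => ?_
  rw [evalForm_smul, mul_comm, traceMon, modCoef]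

end Coefficients

/-! ### Modularity -/

section CurvatureFields

variable {n : ℕ} {Z : Type*} [TopologicalSpace Z] [ChartedSpace (Euc n) Z]

/-- The properties of the matrix `(√-1/2π) Ω` of a metric connection, in orthonormal frames which may
change from point to point, on which the modularity rests. -/
structure IsCurvField {r : ℕ} (F : Z → Matrix (Fin r) (Fin r) (EvenForms n)) : Prop where
  deg : ∀ x i j, InDeg 2 (F x i j)
  nil : ∀ x i j, IsNilpotent (F x i j)
  skew : ∀ x i j, F x i j = -F x j i
  closed : ∀ m, SmoothClosed fun x => (F x ^ m).trace

variable [T2Space Z] [IsManifold (𝓡 n) ∞ Z]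

/-- The curvature of a metric connection in orthonormal frames has these properties. -/
lemma isCurvField_curvMatrix
    {F : Type*} [NormedAddCommGroup F] [NormedSpace ℝ F] [FiniteDimensional ℝ F]
    {V : Z → Type*} [TopologicalSpace (Bundle.TotalSpace F V)]
    [∀ x, NormedAddCommGroup (V x)] [∀ x, InnerProductSpace ℝ (V x)]
    [FiberBundle F V] [VectorBundle ℝ F V] [ContMDiffVectorBundle ∞ F V (𝓡 n)]
    [IsContMDiffRiemannianBundle (𝓡 n) ∞ F V]
    (cov : CovariantDerivative (𝓡 n) F V)
    [CovariantDerivative.ContMDiffCovariantDerivative cov ∞] (hm : cov.IsMetricCompatible)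
    {r : ℕ} {ι : Type*} {𝒰 : ι → Set Z} {f : ι → Fin r → ∀ x, V x}
    (hf : ∀ i, IsOrthonormalFrameOn (n := n) F (f i) (𝒰 i)) (h𝒰 : ∀ i, IsOpen (𝒰 i))
    (hr : Module.finrank ℝ F = r) {idx : Z → ι} (hidx : ∀ x, x ∈ 𝒰 (idx x)) :
    IsCurvField fun x => curvMatrix cov x fun a => f (idx x) a x where
  deg x i j := (twoForm_inDeg _).smul _
  nil x i j := by
    rw [curvMatrix, Matrix.of_apply]
    exact (twoForm_isNilpotent _).smul _
  skew x i j := curvMatrix_skew cov hm (hf (idx x)) (h𝒰 _) hr (hidx x) i j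
  closed m := smoothClosed_trace cov hf h𝒰 hr hidx m

variable {r : ℕ} {F : Z → Matrix (Fin r) (Fin r) (EvenForms n)}

lemma IsCurvField.closed_pontryagin (hF : IsCurvField F) :
    SmoothClosed fun x => pontryagin (F x) := by
  have := (hF.closed 2).const_smul (1 / 2)
  simp only [pow_two] at this
  exact this

variable {d l M : ℕ} {FT : Z → Matrix (Fin d) (Fin d) (EvenForms n)}
    {Fξ : Z → Matrix (Fin 2) (Fin 2) (EvenForms n)}
    {FV : Z → Matrix (Fin (16 * l)) (Fin (16 * l)) (EvenForms n)}

/-- All the traces and the form `-p₁(TZ) + 3 p₁(ξ) + p₁(V)` are closed. -/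
lemma smoothClosed_tracesOpt (hT : IsCurvField FT) (hξ : IsCurvField Fξ) (hV : IsCurvField FV)
    (o : Option (Fin 3 × Fin M)) :
    SmoothClosed fun x => tracesOpt (FT x) (Fξ x) (FV x) M o := by
  rcases o with _ | ⟨i, m⟩
  · have h1 := hT.closed_pontryagin.const_smul (-1)
    have h2 := hξ.closed_pontryagin.const_smul 3
    have h3 := (h1.add h2).add hV.closed_pontryagin
    have e : (fun x => tracesOpt (FT x) (Fξ x) (FV x) M none) =
        (-1 : ℂ) • (fun x => pontryagin (FT x)) + (3 : ℂ) • (fun x => pontryagin (Fξ x)) +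
          fun x => pontryagin (FV x) := by
      funext x
      simp only [tracesOpt, Pi.add_apply, Pi.smul_apply, neg_one_smul]
      rw [Algebra.smul_def (3 : ℂ), map_ofNat]
      rfl
    rw [e]
    exact h3
  · fin_cases i
    · exact hT.closed _
    · exact hξ.closed _
    · exact hV.closed _

lemma smoothClosed_traceMon (hT : IsCurvField FT) (hξ : IsCurvField Fξ) (hV : IsCurvField FV)
    (γ : Option (Fin 3 × Fin M) → Fin M) :
    SmoothClosed fun x => traceMon (FT x) (Fξ x) (FV x) γ := by
  have h := SmoothClosed.prod (s := Finset.univ) fun o (_ : o ∈ Finset.univ) =>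
    (smoothClosed_tracesOpt hT hξ hV o).pow (γ o).val
  convert! h using 1
  funext x
  simp [traceMon]

end CurvatureFields

section ModularForms

variable {w : ℕ}

lemma exists_modularForm_sum {ι : Type*} (s : Finset ι) (a : ι → ℂ)
    (F : ι → ModularForm 𝒮ℒ (w : ℕ)) :
    ∃ G : ModularForm 𝒮ℒ (w : ℕ), ∀ τ, G τ = ∑ i ∈ s, a i * F i τ := by
  induction s using Finset.cons_induction with
  | empty => exact ⟨0, fun τ => by simp⟩
  | cons i s hi ih =>
    obtain ⟨G, hG⟩ := ih
    refine ⟨a i • F i + G, fun τ => ?_⟩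
    rw [Finset.sum_cons, ← hG]
    rfl

/-- A form of degree `4 j` is accompanied by a modular form of weight `4 l + 2 j`. -/
lemma weight_eq {k l M : ℕ} {γ : Option (Fin 3 × Fin M) → Fin M} (h0 : (γ none).val = 0)
    (h : ∑ o, (γ o).val * formDeg o = 4 * k) :
    4 * l + ∑ o, (γ o).val * expWeight o = 4 * l + 2 * k := by
  rw [Fintype.sum_option, h0, zero_mul, zero_add] at h ⊢
  have h1 : ∑ p : Fin 3 × Fin M, (γ (some p)).val * formDeg (some p) =
      2 * ∑ p : Fin 3 × Fin M, (γ (some p)).val * expWeight (some p) := by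
    rw [Finset.mul_sum]
    refine Finset.sum_congr rfl fun p _ => ?_
    rw [formDeg, expWeight]
    ring
  omega

/-- The coefficient of a monomial of degree `4k` without the factor `-p₁(TZ) + 3 p₁(ξ) + p₁(V)` as a
modular form of weight `4l + 2k`. For other monomials the value is arbitrary, so that the modular
forms can be chosen for all of them at once. -/
lemma exists_modularForm_modCoef (k l : ℕ) {M : ℕ} (γ : Option (Fin 3 × Fin M) → Fin M) :
    ∃ F : ModularForm 𝒮ℒ (4 * l + 2 * k : ℕ), (γ none).val = 0 →
      ∑ o, (γ o).val * formDeg o = 4 * k →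
      ∀ τ : UpperHalfPlane, F τ = evAt (nome τ) (modCoef l γ) := by
  by_cases h : (γ none).val = 0 ∧ ∑ o, (γ o).val * formDeg o = 4 * k
  · have h1 := isLevelOne_modCoef l γ h.1
    rw [weight_eq h.1 h.2] at h1
    obtain ⟨F, hF⟩ := h1.exists_modularForm
    exact ⟨F, fun _ _ => hF⟩
  · exact ⟨0, fun h1 h2 => absurd ⟨h1, h2⟩ h⟩

end ModularForms

section Assembly

variable {k l : ℕ} {Z : Type*} [TopologicalSpace Z] [T2Space Z]
  [ChartedSpace (Euc (4 * k)) Z] [IsManifold (𝓡 (4 * k)) ∞ Z]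

/-- Splitting off one factor `-p₁(TZ) + 3 p₁(ξ) + p₁(V)`. -/
lemma traceMon_eq_mul {n d M : ℕ} {FT : Matrix (Fin d) (Fin d) (EvenForms n)}
    {Fξ : Matrix (Fin 2) (Fin 2) (EvenForms n)}
    {FV : Matrix (Fin (16 * l)) (Fin (16 * l)) (EvenForms n)}
    {γ : Option (Fin 3 × Fin M) → Fin M} (h : (γ none).val ≠ 0) :
    traceMon FT Fξ FV γ = (-pontryagin FT + 3 * pontryagin Fξ + pontryagin FV) *
      (tracesOpt FT Fξ FV M none ^ ((γ none).val - 1) *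
        ∏ p, tracesOpt FT Fξ FV M (some p) ^ (γ (some p)).val) := by
  obtain ⟨j, hj⟩ := Nat.exists_eq_succ_of_ne_zero h
  rw [traceMon, Fintype.prod_option, hj, pow_succ', mul_assoc]
  rfl

lemma isExact_congr {n p : ℕ} {Z : Type*} [TopologicalSpace Z] [ChartedSpace (Euc n) Z]
    {β β' : ∀ x : Z, (Fin p → TangentSpace (𝓡 n) x) → ℂ} (hβ : IsExact (n := n) p β)
    (h : ∀ x v, β' x v = β x v) : IsExact (n := n) p β' := by
  have : β' = β := by
    funext x v
    exact h x v
  rwa [this]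

lemma evalForm_of_eq_zero {n p : ℕ} {b : EvenForms n} (h : b = 0) (v : Fin p → Euc n) :
    evalForm p v b = 0 := by
  rw [h, evalForm_eq, map_zero, map_zero]

/-- Forms of positive degree vanish on a manifold of dimension zero. -/
lemma eq_zero_of_inDeg {p : ℕ} (hp : p ≠ 0) {n : ℕ} (hn : n = 0) {a : EvenForms n}
    (ha : InDeg p a) : a = 0 := by
  subst hn
  refine Subtype.val_injective ?_
  change EvenForms.val a = EvenForms.val 0
  have hrange : LinearMap.range (ExteriorAlgebra.ι ℂ (M := CCovec 0)) = ⊥ := by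
    rw [LinearMap.range_eq_bot]
    ext α
    have : α = 0 := by
      ext v
      rw [Subsingleton.elim v 0, map_zero, map_zero]
    rw [this, map_zero, map_zero]
  rw [InDeg, ExteriorAlgebra.exteriorPower, hrange, ← Submodule.zero_eq_bot, zero_pow hp,
    Submodule.zero_eq_bot, Submodule.mem_bot] at ha
  rw [ha, map_zero]

/-- In top degree, the product of an exact four-form with a smooth closed form is exact; in dimension
zero there are no four-forms. -/
lemma isExact_mul_top {n : ℕ} {Z : Type*} [TopologicalSpace Z] [T2Space Z] [ChartedSpace (Euc n) Z]
    [IsManifold (𝓡 n) ∞ Z] {P a : Z → EvenForms n} (hPd : ∀ x, InDeg 4 (P x))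
    (hP : IsExact (n := n) (Z := Z) 4 (fun x v => evalForm 4 v (P x))) (ha : SmoothClosed a) :
    IsExact (n := n) (Z := Z) n (fun x v => evalForm n v (P x * a x)) := by
  rcases n with _ | m
  · intro x v
    have h0 : P x * a x = 0 := by
      rw [eq_zero_of_inDeg four_ne_zero rfl (hPd x), zero_mul]
    exact evalForm_of_eq_zero h0 v
  · exact isExact_mul hPd hP ha m

/-- The modularity statement for matrices of two-forms with the properties of curvatures. Its
function `t τ x v j` is the term of index `j` of the series `Q`. -/
theorem modular_of_curvFields
    {FT : Z → Matrix (Fin (4 * k)) (Fin (4 * k)) (EvenForms (4 * k))}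
    {Fξ : Z → Matrix (Fin 2) (Fin 2) (EvenForms (4 * k))}
    {FV : Z → Matrix (Fin (16 * l)) (Fin (16 * l)) (EvenForms (4 * k))}
    (hT : IsCurvField FT) (hξ : IsCurvField Fξ) (hV : IsCurvField FV)
    {t : UpperHalfPlane → Z → (Fin (4 * k) → Euc (4 * k)) → ℕ → ℂ}
    (ht : ∀ τ x v j, t τ x v j = evalForm (4 * k) v (PowerSeries.coeff j
      (qSeries (FT x) (Fξ x) (Fξ x 0 0 + Complex.I • Fξ x 1 0) (FV x))) * nome τ ^ j)
    {P : Z → EvenForms (4 * k)}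
    (hP : ∀ x, P x = -pontryagin (FT x) + 3 * pontryagin (Fξ x) + pontryagin (FV x)) :
    (∀ τ x v, Summable (t τ x v)) ∧
    ((∀ x, P x = 0) → ∀ (x : Z) (v : Fin (4 * k) → Euc (4 * k)),
        ∃ f : ModularForm 𝒮ℒ (4 * l + 2 * k : ℕ), ∀ τ, f τ = ∑' j, t τ x v j) ∧
    (IsExact (n := 4 * k) 4 (fun x v => evalForm 4 v (P x)) →
      ∃ (N : ℕ) (f : Fin N → ModularForm 𝒮ℒ (4 * l + 2 * k : ℕ))
        (η : Fin N → ∀ x : Z, TangentSpace (𝓡 (4 * k)) x [⋀^Fin (4 * k)]→L[ℝ] ℂ),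
        (∀ i, IsSmoothForm (η i)) ∧
        ∀ τ, IsExact (n := 4 * k) (4 * k)
          (fun x v => ∑' j, t τ x v j - ∑ i, f i τ * η i x v)) := by
  obtain ⟨M, hM, hnM⟩ := exists_nilradical_pow (4 * k)
  choose F hF using fun γ : Option (Fin 3 × Fin M) → Fin M => exists_modularForm_modCoef k l γ
  have hterm : ∀ τ x v j, t τ x v j = ∑ γ : Option (Fin 3 × Fin M) → Fin M,
      evalForm (4 * k) v (traceMon (FT x) (Fξ x) (FV x) γ) *
        (PowerSeries.coeff j (modCoef l γ) * nome τ ^ j) := by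
    intro τ x v j
    rw [ht, evalForm_coeff_qSeries hM hnM (hT.deg x) (hξ.deg x) (hV.deg x) (hT.nil x) (hξ.nil x)
      (hV.nil x) (hT.skew x) (hξ.skew x) (hV.skew x), Finset.sum_mul]
    exact Finset.sum_congr rfl fun γ _ => mul_assoc _ _ _
  -- the series converges, being a finite sum of constants times convergent series
  have hsum : ∀ τ x v, HasSum (t τ x v) (∑ γ : Option (Fin 3 × Fin M) → Fin M,
      evalForm (4 * k) v (traceMon (FT x) (Fξ x) (FV x) γ) * evAt (nome τ) (modCoef l γ)) := by
    intro τ x v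
    have h1 := hasSum_sum (s := Finset.univ) fun (γ : Option (Fin 3 × Fin M) → Fin M)
      (_ : γ ∈ Finset.univ) => (((isConv_modCoef l γ).summable (norm_nome_lt τ.im_pos)).hasSum).mul_left
        (evalForm (4 * k) v (traceMon (FT x) (Fξ x) (FV x) γ))
    exact h1.congr_fun (fun j => hterm τ x v j)
  -- the terms without the factor `-p₁(TZ) + 3 p₁(ξ) + p₁(V)` are modular; those of the wrong
  -- degree do not contribute
  have hmod : ∀ (τ : UpperHalfPlane) (x : Z) (v : Fin (4 * k) → Euc (4 * k))
      (γ : Option (Fin 3 × Fin M) → Fin M),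
      (γ none).val = 0 → evalForm (4 * k) v (traceMon (FT x) (Fξ x) (FV x) γ) *
        evAt (nome τ) (modCoef l γ) =
        evalForm (4 * k) v (traceMon (FT x) (Fξ x) (FV x) γ) * F γ τ := by
    intro τ x v γ h0
    by_cases hd : ∑ o, (γ o).val * formDeg o = 4 * k
    · rw [hF γ h0 hd]
    · rw [evalForm_eq_zero (inDeg_traceMon (hT.deg x) (hξ.deg x) (hV.deg x) γ) hd, zero_mul,
        zero_mul]
  refine ⟨fun τ x v => (hsum τ x v).summable, fun hP0 x v => ?_, fun hex => ?_⟩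
  · obtain ⟨G, hG⟩ := exists_modularForm_sum (Finset.univ.filter fun γ => (γ none).val = 0)
      (fun γ => evalForm (4 * k) v (traceMon (FT x) (Fξ x) (FV x) γ)) F
    refine ⟨G, fun τ => ?_⟩
    rw [hG, (hsum τ x v).tsum_eq, Finset.sum_filter]
    refine Finset.sum_congr rfl fun γ _ => ?_
    split_ifs with h0
    · exact (hmod τ x v γ h0).symm
    · rw [traceMon_eq_mul h0, ← hP x, hP0 x, zero_mul, evalForm_eq, map_zero, map_zero, zero_mul]
  · classical
    let S := {γ : Option (Fin 3 × Fin M) → Fin M // (γ none).val = 0}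
    let σ := Fintype.equivFin S
    refine ⟨Fintype.card S, fun i => F (σ.symm i).1,
      fun i => formField (4 * k) fun x => (traceMon (FT x) (Fξ x) (FV x) (σ.symm i).1).val,
      fun i => (smoothClosed_traceMon hT hξ hV _).isSmoothForm _, fun τ => ?_⟩
    -- the terms divisible by `-p₁(TZ) + 3 p₁(ξ) + p₁(V)`
    let a : Z → EvenForms (4 * k) := ∑ γ ∈ Finset.univ.filter
      (fun γ : Option (Fin 3 × Fin M) → Fin M => ¬(γ none).val = 0), evAt (nome τ) (modCoef l γ) •
        ((fun x => tracesOpt (FT x) (Fξ x) (FV x) M none) ^ ((γ none).val - 1) *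
          ∏ p, (fun x => tracesOpt (FT x) (Fξ x) (FV x) M (some p)) ^ (γ (some p)).val)
    have ha : SmoothClosed a := SmoothClosed.sum fun γ _ => SmoothClosed.const_smul _
      (((smoothClosed_tracesOpt hT hξ hV none).pow _).mul
        (SmoothClosed.prod fun p _ => (smoothClosed_tracesOpt hT hξ hV (some p)).pow _))
    have hmain : ∀ (x : Z) (v : Fin (4 * k) → Euc (4 * k)), ∑' j, t τ x v j -
        ∑ i, F (σ.symm i).1 τ * formField (4 * k)
          (fun x => (traceMon (FT x) (Fξ x) (FV x) (σ.symm i).1).val) x v =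
        evalForm (4 * k) v (P x * a x) := by
      intro x v
      have h1 : ∑ i, F (σ.symm i).1 τ * formField (4 * k)
          (fun x => (traceMon (FT x) (Fξ x) (FV x) (σ.symm i).1).val) x v =
          ∑ γ ∈ Finset.univ.filter
            (fun γ : Option (Fin 3 × Fin M) → Fin M => (γ none).val = 0),
            evalForm (4 * k) v (traceMon (FT x) (Fξ x) (FV x) γ) *
              evAt (nome τ) (modCoef l γ) := by
        rw [Equiv.sum_comp σ.symm (fun γ : S => F γ.1 τ * formField (4 * k)
          (fun x => (traceMon (FT x) (Fξ x) (FV x) γ.1).val) x v),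
          Finset.sum_subtype (p := fun γ : Option (Fin 3 × Fin M) → Fin M => (γ none).val = 0) _
            (fun γ => by simp)]
        refine Finset.sum_congr rfl fun γ _ => ?_
        rw [hmod τ x v γ.1 γ.2, mul_comm]
        rfl
      rw [(hsum τ x v).tsum_eq, h1, ← Finset.sum_filter_add_sum_filter_not Finset.univ
        (fun γ : Option (Fin 3 × Fin M) → Fin M => (γ none).val = 0), add_sub_cancel_left]
      have h2 : P x * a x = ∑ γ ∈ Finset.univ.filter
          (fun γ : Option (Fin 3 × Fin M) → Fin M => ¬(γ none).val = 0),
          evAt (nome τ) (modCoef l γ) • traceMon (FT x) (Fξ x) (FV x) γ := by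
        simp only [a, Finset.sum_apply, Finset.mul_sum]
        refine Finset.sum_congr rfl fun γ hγ => ?_
        rw [traceMon_eq_mul (Finset.mem_filter.mp hγ).2, ← hP x, Pi.smul_apply, mul_smul_comm]
        simp
      rw [h2, evalForm_sum]
      refine Finset.sum_congr rfl fun γ _ => ?_
      rw [evalForm_smul, mul_comm]
    have hPd : ∀ x, InDeg 4 (P x) := fun x => by
      rw [hP x]
      exact inDeg_anomaly (hT.deg x) (hξ.deg x) (hV.deg x)
    exact isExact_congr (isExact_mul_top hPd hex ha) hmain

variable {n : ℕ} {Z : Type*} [TopologicalSpace Z] [ChartedSpace (Euc n) Z] [IsManifold (𝓡 n) ∞ Z]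
  [Bundle.RiemannianBundle (fun x : Z => TangentSpace (𝓡 n) x)]
  {ξ : Z → Type*} [TopologicalSpace (Bundle.TotalSpace ℂ ξ)]
  [∀ x, NormedAddCommGroup (ξ x)] [∀ x, InnerProductSpace ℝ (ξ x)] [∀ x, Module ℂ (ξ x)]
  [FiberBundle ℂ ξ]

/-- A unit section `f` of a Hermitian line bundle gives the orthonormal frame `f, √-1 f` of the
underlying plane bundle. -/
lemma hermitian_frame (hξ : IsHermitianLine (n := n) ξ) (sc : SpinCStructure (n := n) Z ξ)
    (i : sc.ι) : IsOrthonormalFrameOn (n := n) ℂ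
      (![sc.f i, fun x => Complex.I • sc.f i x] : Fin 2 → ∀ x, ξ x) (sc.U i) where
  smooth a := by
    fin_cases a
    · exact sc.f_smooth i
    · exact hξ.smooth_I _ _ (sc.isOpen i) (sc.f_smooth i)
  orthonormal x hx := by
    have hn := sc.f_norm i x hx
    have hI : inner ℝ (sc.f i x) (Complex.I • sc.f i x) = (0 : ℝ) := by
      have h1 := hξ.inner_I x (sc.f i x) (Complex.I • sc.f i x)
      rw [smul_smul, Complex.I_mul_I, neg_one_smul, inner_neg_right, real_inner_comm] at h1
      linarith
    have hn' : ‖Complex.I • sc.f i x‖ = 1 := by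
      have h1 := hξ.inner_I x (sc.f i x) (sc.f i x)
      rw [real_inner_self_eq_norm_sq, real_inner_self_eq_norm_sq, hn] at h1
      exact (pow_eq_one_iff_of_nonneg (norm_nonneg _) two_ne_zero).mp (by rw [h1, one_pow])
    refine ⟨fun a => ?_, fun a b hab => ?_⟩
    · fin_cases a
      · exact hn
      · exact hn'
    · fin_cases a <;> fin_cases b
      · exact absurd rfl hab
      · exact hI
      · exact (real_inner_comm _ _).trans hI
      · exact absurd rfl hab

end Assembly

end CharForm

open CharForm in
theorem lemma2p2 (k l : ℕ)
    {Z : Type*} [TopologicalSpace Z] [T2Space Z] [SecondCountableTopology Z]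
    [ChartedSpace (Euc (4 * k)) Z] [IsManifold (𝓡 (4 * k)) ∞ Z]
    [Bundle.RiemannianBundle (fun x : Z => TangentSpace (𝓡 (4 * k)) x)]
    [IsContMDiffRiemannianBundle (𝓡 (4 * k)) ∞ (Euc (4 * k))
      (fun x : Z => TangentSpace (𝓡 (4 * k)) x)]
    {ξ : Z → Type*} [TopologicalSpace (Bundle.TotalSpace ℂ ξ)]
    [∀ x, NormedAddCommGroup (ξ x)] [∀ x, InnerProductSpace ℝ (ξ x)]
    [∀ x, Module ℂ (ξ x)] [∀ x, IsScalarTower ℝ ℂ (ξ x)]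
    [FiberBundle ℂ ξ] [VectorBundle ℝ ℂ ξ] [ContMDiffVectorBundle ∞ ℂ ξ (𝓡 (4 * k))]
    [IsContMDiffRiemannianBundle (𝓡 (4 * k)) ∞ ℂ ξ]
    (hξ : IsHermitianLine (n := 4 * k) ξ)
    {V : Z → Type*} [TopologicalSpace (Bundle.TotalSpace (Euc (16 * l)) V)]
    [∀ x, NormedAddCommGroup (V x)] [∀ x, InnerProductSpace ℝ (V x)]
    [FiberBundle (Euc (16 * l)) V] [VectorBundle ℝ (Euc (16 * l)) V]
    [ContMDiffVectorBundle ∞ (Euc (16 * l)) V (𝓡 (4 * k))]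
    [IsContMDiffRiemannianBundle (𝓡 (4 * k)) ∞ (Euc (16 * l)) V]
    (sc : SpinCStructure (n := 4 * k) Z ξ) (sp : SpinStructure (n := 4 * k) (16 * l) V)
    (covT : CovariantDerivative (𝓡 (4 * k)) (Euc (4 * k))
      (fun x : Z => TangentSpace (𝓡 (4 * k)) x))
    [CovariantDerivative.ContMDiffCovariantDerivative covT ∞] (hT : covT.IsMetricCompatible)
    (covξ : CovariantDerivative (𝓡 (4 * k)) ℂ ξ)
    [CovariantDerivative.ContMDiffCovariantDerivative covξ ∞] (hξm : covξ.IsMetricCompatible)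
    (hξc : IsComplexConnection covξ)
    (covV : CovariantDerivative (𝓡 (4 * k)) (Euc (16 * l)) V)
    [CovariantDerivative.ContMDiffCovariantDerivative covV ∞] (hV : covV.IsMetricCompatible) :
    (∀ τ x v, Summable (qTerm covT covξ covV sc sp τ x v)) ∧
    ((∀ x, anomaly covT covξ covV sc sp x = 0) →
      ∀ (x : Z) (v : Fin (4 * k) → TangentSpace (𝓡 (4 * k)) x),
        ∃ f : ModularForm 𝒮ℒ (4 * l + 2 * k : ℕ),
          ∀ τ, f τ = Q covT covξ covV sc sp τ x v) ∧
    (IsExact (n := 4 * k) 4 (fun x v => evalForm 4 v (anomaly covT covξ covV sc sp x)) →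
      ∃ (N : ℕ) (f : Fin N → ModularForm 𝒮ℒ (4 * l + 2 * k : ℕ))
        (η : Fin N → ∀ x : Z, TangentSpace (𝓡 (4 * k)) x [⋀^Fin (4 * k)]→L[ℝ] ℂ),
        (∀ i, IsSmoothForm (η i)) ∧
        ∀ τ, IsExact (n := 4 * k) (4 * k)
          (fun x v => Q covT covξ covV sc sp τ x v - ∑ i, f i τ * η i x v)) := by
  have cT : IsCurvField (tangentF covT sc) := by
    have : IsManifold (𝓡 (4 * k)) (∞ + 1) Z := inferInstanceAs (IsManifold (𝓡 (4 * k)) ∞ Z)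
    exact isCurvField_curvMatrix covT hT sc.frame sc.isOpen finrank_euclideanSpace_fin
      fun x => (sc.cover x).choose_spec
  have cV : IsCurvField (spinF covV sp) :=
    isCurvField_curvMatrix covV hV sp.frame sp.isOpen finrank_euclideanSpace_fin
      fun x => (sp.cover x).choose_spec
  have cξ : IsCurvField (planeF covξ sc) := by
    have := isCurvField_curvMatrix covξ hξm
      (f := fun i => ![sc.f i, fun x => Complex.I • sc.f i x]) (𝒰 := sc.U) (hermitian_frame hξ sc)
      sc.isOpen Complex.finrank_real_complex fun x => (sc.cover x).choose_spec
    convert! this using 1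
    funext x
    rw [planeF]
    congr 1
    funext a
    fin_cases a <;> rfl
  exact modular_of_curvFields cT cξ cV (fun τ x v j => rfl) fun x => rfl
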